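/- **Notation.** Let $N\ge 3$, $n=\lfloor N/2\rfloor$, and let $q=s^2$, $q^{1/2}:=s$, where $s\in\mathbb C^\times$ is not a root of unity. Indices run over $-n,\dots,n$, with $0$ left out for even $N$. Put $\rho=(n-\frac12,\dots,\frac12,0,-\frac12,\dots,\frac12-n)$ for odd $N$ and $\rho=(n-1,\dots,0,0,\dots,1-n)$ for even $N$, $k=q-q^{-1}$, $h=q^{1/2}-q^{-1/2}$, $\omega_i=q^{\rho_i}+q^{-\rho_i}$, $g_{ij}=g^{ij}=q^{-\rho_i}\delta_{i,-j}$. Let $\hat R$ be the braid matrix of $SO_q(N)$: with $E_{ij}$ the $N\times N$ matrix units, $$\hat R=q\sum_{i\ne0}E_{ii}\otimes E_{ii}+\sum_{i\ne\pm j\text{ or }i=j=0}E_{ij}\otimes E_{ji}+q^{-1}\sum_{i\neq0}E_{i,-i}\otimes E_{-i,i}+k\sum_{i<j}E_{ii}\otimes E_{jj}-k\sum_{i<j}q^{\rho_j-\rho_i}E_{i,-j}\otimes E_{-i,j},$$ and let $P_s,P_a,P_t$ be the projectors with $\hat R=qP_s-q^{-1}P_a+q^{1-N}P_t$, $P_s+P_a+P_t=1$,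 $(P_t)^{ij}_{kl}=(g^{sm}g_{sm})^{-1}g^{ij}g_{kl}$. Repeated indices are summed. Let $\mathcal A_N$ be the unital $\mathbb C$-algebra with generators $x^i$, $r_j^{\pm1}$ ($0\le j\le n$ for odd $N$, $1\le j\le n$ for even $N$), $\Lambda^{\pm1}$ and, for even $N$, $K^{\pm1}$, and relations $(P_a)^{ij}_{kl}x^kx^l=0$; $r_j^2=\sum_{|k|,|l|\le j}g_{kl}x^kx^l$; $r_ir_j=r_jr_i$; $r_0=x^0$ ($N$ odd); $x^ir_j=q^{e}r_jx^i$ with $e=0,1,-1$ for $|i|\le j$, $i<-j$, $i>j$; $x^i\Lambda=q\Lambda x^i$; $r_j\Lambda=q\Lambda r_j$; and, for even $N$, $Kx^{\pm1}=q^{\pm1}x^{\pm1}K$, $Kx^i=x^iK$ for $|i|>1$, $Kr_j=r_jK$, $K\Lambda=\Lambda K$. Let $\varepsilon=\pm1$ ($\varepsilon=1$: the calculus $(\Omega,d)$; $\varepsilon=-1$: the barred calculus $(\bar\Omega,\bar d)$; bars are omitted below). Let $\lambda_0=\gamma_0\Lambda^{\varepsilon}(x^0)^{-1}$ ($N$ odd),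 $\lambda_{\pm1}=\gamma_{\pm1}\Lambda^\varepsilon(x^{\pm1})^{-1}K^{\mp\varepsilon}$ ($N$ even), and $\lambda_a=\gamma_a\Lambda^\varepsilon r_{|a|}^{-1}r_{|a|-1}^{-1}x^{-a}$ otherwise, where the $\gamma_a\in\mathbb C$ are any constants with $\gamma_0=-\varepsilon q^{-\varepsilon/2}h^{-1}$; $\gamma_1\gamma_{-1}=-q^{-\varepsilon}h^{-2}$ ($N$ odd), $=k^{-2}$ ($N$ even); $\gamma_a\gamma_{-a}=-q^{-\varepsilon}k^{-2}\omega_a\omega_{a-1}$ for $a>1$. Let $\Omega^1$ be the $\mathcal A_N$-bimodule that is free as a left module on a frame $\theta^a$ with $f\theta^a=\theta^af$ for all $f\in\mathcal A_N$; put $df=[\lambda_a,f]\theta^a$, $\xi^i=dx^i$, $\theta=-\lambda_a\theta^a$. Let $\Omega^2$ be the quotient of $\Omega^1\otimes_{\mathcal A_N}\Omega^1$ by the sub-bimodule generated by all $(P_s)^{ij}_{kl}\xi^k\otimes\xi^l$ and $(P_t)^{ij}_{kl}\xi^k\otimes\xi^l$, and let $\pi$ be the projection. **Theorem.** 1. *(The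 calculus.)* $x^i\xi^j=((q\hat R)^{\varepsilon})^{ij}_{kl}\,\xi^kx^l$ and $\xi^i\Lambda=\Lambda\xi^i$; the $\xi^i$ form a left basis of $\Omega^1$; $\theta^a=\Lambda^{-2\varepsilon}g^{ab}[\lambda_b,x^j]g_{jl}\xi^l$; and $\theta=\varepsilon\,\omega_nq^{\varepsilon N/2}k^{-1}r_n^{-2}g_{ij}x^i\xi^j$. 2. *(Metric.)* Every bimodule map $g':\Omega^1\otimes_{\mathcal A_N}\Omega^1\to\mathcal A_N$ has $g'(\theta^a\otimes\theta^b)\in\mathbb C$. There is exactly one bimodule map $g$ with $g(\theta^a\otimes\theta^b)=g^{ab}$; it is non-degenerate, and $g(\xi^i\otimes\xi^j)=g^{ij}\Lambda^{2\varepsilon}$. 3. *(Flips and connections.)* Let $\delta=\pm1$ and $S=(q\hat R)^\delta=q^{2\delta}P_s-P_a+q^{(2-N)\delta}P_t$. There is a bimodule map $\sigma$ of $\Omega^1\otimes_{\mathcal A_N}\Omega^1$ with $\sigma(\theta^a\otimes\theta^b)=S^{ab}_{cd}\theta^c\otimes\theta^d$. It satisfies the braid relation, $\pi\circ(\sigma+1)=0$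 and $\sigma(\xi^i\otimes\xi^j)=S^{ij}_{hk}\xi^h\otimes\xi^k$. The map $D\xi=-\theta\otimes\xi+\sigma(\xi\otimes\theta)$ satisfies $D(f\xi)=df\otimes\xi+fD\xi$ and $D(\xi f)=\sigma(\xi\otimes df)+(D\xi)f$. There is exactly one additive $d:\Omega^1\to\Omega^2$ with $d(f\eta)=\pi(df\otimes\eta)+f\,d\eta$ and $d(df)=0$ for $f\in\mathcal A_N$, and the torsion vanishes: $d\xi=\pi(D\xi)$ for all $\xi\in\Omega^1$. 4. *(Metric compatibility up to a factor.)* $(\mathrm{id}\otimes g)\,\sigma_{12}\sigma_{23}(\xi\otimes\eta\otimes\zeta)=q^{2\delta}g(\xi\otimes\eta)\zeta$, i.e. $S^{ae}_{df}g^{fg}S^{cb}_{eg}=q^{2\delta}g^{ac}\delta^b_d$. There is exactly one additive $D_2$ with $D_2(\xi\otimes\eta)=D\xi\otimes\eta+\sigma_{12}(\xi\otimes D\eta)$, and $g_{23}\circ D_2=d\circ g+(q^{2\delta}-1)\,g(\cdot)\,\theta\ne d\circ g$. 5. *(Essential uniqueness.)* A bimodule map $g'$ that satisfies the condition in 4 for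 some factor $\kappa\in\mathbb C$ in place of $q^{2\delta}$ and for one of the two $\sigma$ is a complex multiple of $g$. If $C_s,C_t,\kappa\in\mathbb C$, $C_s\neq-1$, and the flip with matrix $S=C_sP_s-P_a+C_tP_t$ satisfies the condition in 4 for $g$ with the factor $\kappa$, then $S=(q\hat R)^{\delta}$ and $\kappa=q^{2\delta}$ for some $\delta=\pm1$. 6. *(Curvature.)* For both $\sigma$, $\mathrm{Curv}(\xi)=\pi_{12}D_2D\xi=0$ for all $\xi\in\Omega^1$. -/

import Mathlib

open scoped BigOperators

namespace QEuclid

/-! ## Indices, the braid matrix and its projectors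

`s` is a square root of the deformation parameter, `q = s ^ 2`, so that half-integer powers of `q`
are integer powers of `s`. -/

/-- The indices `-n, …, n`, where `n = ⌊N / 2⌋` and `0` is left out for even `N`. -/
abbrev Idx (N : ℕ) : Type :=
  ↥((Finset.Icc (-((N / 2 : ℕ) : ℤ)) ((N / 2 : ℕ) : ℤ)).filter fun i => i ≠ 0 ∨ Odd N)

/-- The indices of the radii `r_j`: `0 ≤ j ≤ n` for odd `N` and `1 ≤ j ≤ n` for even `N`. -/
abbrev RIdx (N : ℕ) : Type :=
  ↥((Finset.Icc (0 : ℤ) ((N / 2 : ℕ) : ℤ)).filter fun j => j ≠ 0 ∨ Odd N)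

/-- The index `-i`. -/
def negIdx {N : ℕ} (i : Idx N) : Idx N :=
  ⟨-(i : ℤ), by
    have h := i.2
    simp only [Finset.mem_filter, Finset.mem_Icc] at h ⊢
    refine ⟨⟨by omega, by omega⟩, ?_⟩
    rcases h.2 with h0 | h0
    · exact Or.inl (by omega)
    · exact Or.inr h0⟩

/-- `2 ρ_i`, where `ρ = (n - 1/2, …, 1/2, 0, -1/2, …, 1/2 - n)` for odd `N` and
`ρ = (n - 1, …, 0, 0, …, 1 - n)` for even `N` (listed for `i = -n, …, n`). -/
def twoRho (N : ℕ) (i : ℤ) : ℤ :=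
  if Odd N then -2 * i + i.sign else -2 * i + 2 * i.sign

/-- `ω_i = q^{ρ_i} + q^{-ρ_i}`. -/
noncomputable def omega (N : ℕ) (s : ℂ) (i : ℤ) : ℂ :=
  s ^ twoRho N i + s ^ (-twoRho N i)

/-- `k = q - q⁻¹`. -/
noncomputable def kConst (s : ℂ) : ℂ := s ^ 2 - (s ^ 2)⁻¹

/-- `h = q^{1/2} - q^{-1/2}`. -/
noncomputable def hConst (s : ℂ) : ℂ := s - s⁻¹

/-- The matrix `g_{ij} = g^{ij} = q^{-ρ_i} δ_{i,-j}`. -/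
noncomputable def gMat (N : ℕ) (s : ℂ) : Matrix (Idx N) (Idx N) ℂ :=
  Matrix.of fun i j => if (i : ℤ) = -(j : ℤ) then s ^ (-twoRho N i) else 0

/-- The braid matrix of `SO_q(N)`; the entry at `(a, b), (c, d)` is `R̂^{ab}_{cd}`. -/
noncomputable def rhat (N : ℕ) (s : ℂ) : Matrix (Idx N × Idx N) (Idx N × Idx N) ℂ :=
  Matrix.of fun u v =>
    let a : ℤ := u.1
    let b : ℤ := u.2
    let c : ℤ := v.1
    let d : ℤ := v.2
    (if a ≠ 0 ∧ b = a ∧ c = a ∧ d = a then s ^ 2 else 0)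
      + (if c = b ∧ d = a ∧ ((a ≠ b ∧ a ≠ -b) ∨ (a = 0 ∧ b = 0)) then 1 else 0)
      + (if a ≠ 0 ∧ b = -a ∧ c = -a ∧ d = a then (s ^ 2)⁻¹ else 0)
      + (if a < b ∧ c = a ∧ d = b then kConst s else 0)
      - (if a < d ∧ b = -a ∧ c = -d then kConst s * s ^ (twoRho N d - twoRho N a) else 0)

/-- The trace projector `(g^{sm} g_{sm})⁻¹ g^{ij} g_{kl}`. -/
noncomputable def projT (N : ℕ) (s : ℂ) : Matrix (Idx N × Idx N) (Idx N × Idx N) ℂ :=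
  Matrix.of fun u v =>
    (∑ i, ∑ j, gMat N s i j * gMat N s i j)⁻¹ * (gMat N s u.1 u.2 * gMat N s v.1 v.2)

/-- The antisymmetric projector: the solution `P_a` of
`R̂ = q P_s - q⁻¹ P_a + q^{1-N} P_t`, `P_s + P_a + P_t = 1`. -/
noncomputable def projA (N : ℕ) (s : ℂ) : Matrix (Idx N × Idx N) (Idx N × Idx N) ℂ :=
  (s ^ 2 + (s ^ 2)⁻¹)⁻¹ •
    ((s ^ 2) • (1 : Matrix (Idx N × Idx N) (Idx N × Idx N) ℂ) - rhat N s
      + (s ^ (2 - 2 * (N : ℤ)) - s ^ 2) • projT N s)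

/-- The symmetric trace-free projector. -/
noncomputable def projS (N : ℕ) (s : ℂ) : Matrix (Idx N × Idx N) (Idx N × Idx N) ℂ :=
  1 - projA N s - projT N s

/-! ## The algebra `A_N` by generators and relations -/

/-- Generators of the extended algebra of the quantum Euclidean space. -/
inductive QGen (N : ℕ) : Type
  | x (i : Idx N) : QGen N
  | r (j : RIdx N) : QGen N
  | rInv (j : RIdx N) : QGen N
  | lam : QGen N
  | lamInv : QGen N
  | K : QGen N
  | KInv : QGen N

/-- A generator as an element of the free algebra. -/
noncomputable def fr {N : ℕ} (u : QGen N) : FreeAlgebra ℂ (QGen N) := FreeAlgebra.ι ℂ u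

/-- The exponent `e` in `x^i r_j = q^e r_j x^i`. -/
def rExp (i j : ℤ) : ℤ := if |i| ≤ j then 0 else if i < 0 then 1 else -1

/-- The exponent `e` in `K x^i = q^e x^i K`. -/
def kExp (i : ℤ) : ℤ := if |i| = 1 then i else 0

open QGen in
/-- The defining relations of `A_N`. The generator `K` is present only for even `N`; this is
expressed by setting `K = 1` for odd `N`. For odd `N` the square root `r_0` of `r_0² = (x^0)²`
is `x^0`. -/
inductive QRel (N : ℕ) (s : ℂ) : FreeAlgebra ℂ (QGen N) → FreeAlgebra ℂ (QGen N) → Prop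
  | xx (i j : Idx N) :
      QRel N s (∑ k, ∑ l, projA N s (i, j) (k, l) • (fr (x k) * fr (x l))) 0
  | r_sq (j : RIdx N) :
      QRel N s (fr (r j) * fr (r j))
        (∑ k : Idx N, ∑ l : Idx N, if |(k : ℤ)| ≤ (j : ℤ) ∧ |(l : ℤ)| ≤ (j : ℤ)
          then gMat N s k l • (fr (x k) * fr (x l)) else 0)
  | r_zero (j : RIdx N) (i : Idx N) (hj : (j : ℤ) = 0) (hi : (i : ℤ) = 0) :
      QRel N s (fr (r j)) (fr (x i))
  | r_mul_inv (j : RIdx N) : QRel N s (fr (r j) * fr (rInv j)) 1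
  | r_inv_mul (j : RIdx N) : QRel N s (fr (rInv j) * fr (r j)) 1
  | r_comm (i j : RIdx N) : QRel N s (fr (r i) * fr (r j)) (fr (r j) * fr (r i))
  | x_r (i : Idx N) (j : RIdx N) :
      QRel N s (fr (x i) * fr (r j)) (s ^ (2 * rExp i j) • (fr (r j) * fr (x i)))
  | lam_mul_inv : QRel N s (fr lam * fr lamInv) 1
  | lam_inv_mul : QRel N s (fr lamInv * fr lam) 1
  | x_lam (i : Idx N) : QRel N s (fr (x i) * fr lam) (s ^ 2 • (fr lam * fr (x i)))
  | r_lam (j : RIdx N) : QRel N s (fr (r j) * fr lam) (s ^ 2 • (fr lam * fr (r j)))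
  | K_mul_inv : QRel N s (fr K * fr KInv) 1
  | K_inv_mul : QRel N s (fr KInv * fr K) 1
  | K_odd (hN : Odd N) : QRel N s (fr K) 1
  | K_x (hN : Even N) (i : Idx N) :
      QRel N s (fr K * fr (x i)) (s ^ (2 * kExp i) • (fr (x i) * fr K))
  | K_r (j : RIdx N) : QRel N s (fr K * fr (r j)) (fr (r j) * fr K)
  | K_lam : QRel N s (fr K * fr lam) (fr lam * fr K)

/-- The algebra `A_N`. -/
abbrev QAlg (N : ℕ) (s : ℂ) : Type := RingQuot (QRel N s)

/-- A generator as an element of `A_N`. -/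
noncomputable def gen (N : ℕ) (s : ℂ) (u : QGen N) : QAlg N s :=
  RingQuot.mkAlgHom ℂ (QRel N s) (fr u)

/-- The coordinate `x^i`. -/
noncomputable def xGen (N : ℕ) (s : ℂ) (i : Idx N) : QAlg N s := gen N s (QGen.x i)

/-- The dilatator `Λ`. -/
noncomputable def lamGen (N : ℕ) (s : ℂ) : QAlg N s := gen N s QGen.lam

/-- `r_j`, for `j` in the range of the radii (with value `0` for all other integers). -/
noncomputable def rGen (N : ℕ) (s : ℂ) (j : ℤ) : QAlg N s :=
  if h : j ∈ (Finset.Icc (0 : ℤ) ((N / 2 : ℕ) : ℤ)).filter fun j => j ≠ 0 ∨ Odd N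
  then gen N s (QGen.r ⟨j, h⟩) else 0

/-- `r_j⁻¹`, for `j` in the range of the radii (with value `0` for all other integers). -/
noncomputable def rInvGen (N : ℕ) (s : ℂ) (j : ℤ) : QAlg N s :=
  if h : j ∈ (Finset.Icc (0 : ℤ) ((N / 2 : ℕ) : ℤ)).filter fun j => j ≠ 0 ∨ Odd N
  then gen N s (QGen.rInv ⟨j, h⟩) else 0

/-- `Λ^ε` for a sign `ε`. -/
noncomputable def lamPow (N : ℕ) (s : ℂ) (ε : ℤˣ) : QAlg N s :=
  if ε = 1 then gen N s QGen.lam else gen N s QGen.lamInv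

/-! ## The elements `λ_a`

The sign `ε` selects the calculus: `ε = 1` for `(Ω, d)` and `ε = -1` for the barred one. -/

/-- The conditions on the normalization constants `γ_a` (`ε = 1`), `γ̄_a` (`ε = -1`). -/
structure IsNormalization (N : ℕ) (s : ℂ) (ε : ℤˣ) (γ : Idx N → ℂ) : Prop where
  zero : ∀ a : Idx N, (a : ℤ) = 0 → γ a = -((ε : ℤ) : ℂ) * s ^ (-(ε : ℤ)) * (hConst s)⁻¹
  one_odd : Odd N → ∀ a : Idx N, (a : ℤ) = 1 →
    γ a * γ (negIdx a) = -s ^ (-2 * (ε : ℤ)) * (hConst s ^ 2)⁻¹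
  one_even : Even N → ∀ a : Idx N, (a : ℤ) = 1 → γ a * γ (negIdx a) = (kConst s ^ 2)⁻¹
  gt_one : ∀ a : Idx N, 1 < (a : ℤ) →
    γ a * γ (negIdx a)
      = -s ^ (-2 * (ε : ℤ)) * (kConst s ^ 2)⁻¹ * omega N s a * omega N s ((a : ℤ) - 1)

/-- The elements `λ_a` (`ε = 1`), `λ̄_a` (`ε = -1`):
`γ_0 Λ^ε (x^0)⁻¹` for odd `N` and `a = 0`, `γ_{±1} Λ^ε (x^{±1})⁻¹ K^{∓ε}` for even `N` and
`a = ±1`, and `γ_a Λ^ε r_{|a|}⁻¹ r_{|a|-1}⁻¹ x^{-a}` otherwise. -/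
noncomputable def lamElt (N : ℕ) (s : ℂ) (ε : ℤˣ) (γ : Idx N → ℂ) (a : Idx N) : QAlg N s :=
  γ a • (lamPow N s ε *
    (if (a : ℤ) = 0 then Ring.inverse (xGen N s a)
     else if Even N ∧ |(a : ℤ)| = 1 then
       Ring.inverse (xGen N s a) *
         (if (ε : ℤ) * (a : ℤ) = 1 then gen N s QGen.KInv else gen N s QGen.K)
     else rInvGen N s |(a : ℤ)| * rInvGen N s (|(a : ℤ)| - 1) * xGen N s (negIdx a)))

/-! ## Forms over an algebra with a frame

Let `A` be an algebra and let `θ^a` (`a ∈ I`) be a frame: a left basis of the bimodule `Ω¹` of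
1-forms with `f θ^a = θ^a f` for all `f ∈ A`. The 1-form `∑ ξ_a θ^a` is the family `ξ : I → A` of
its components. The tensor powers of `Ω¹` over `A` are then free with bases `θ^a ⊗ θ^b` and
`θ^a ⊗ θ^b ⊗ θ^c`, which again commute with `A`, and their elements are families of components, too.
Left and right multiplication by `A` act on each component (the right one is the action of the
opposite ring). -/

section Frame

variable {I A : Type} [Fintype I] [DecidableEq I] [Ring A] [Algebra ℂ A]

/-- `Ω¹`. -/
abbrev Form (I A : Type) : Type := I → A

/-- `Ω¹ ⊗_A Ω¹`. -/
abbrev Form2 (I A : Type) : Type := I → I → A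

/-- `Ω¹ ⊗_A Ω¹ ⊗_A Ω¹`. -/
abbrev Form3 (I A : Type) : Type := I → I → I → A

/-- The frame element `θ^a`. -/
def frame (A : Type) [Ring A] (a : I) : Form I A := Pi.single a 1

/-- `ξ ⊗ η` for 1-forms. -/
def tens (ξ η : Form I A) : Form2 I A := fun a b => ξ a * η b

/-- `ζ ⊗ η` for `ζ ∈ Ω¹ ⊗ Ω¹` and a 1-form `η`. -/
def tensR (ζ : Form2 I A) (η : Form I A) : Form3 I A := fun a b c => ζ a b * η c

/-- `ξ ⊗ ζ` for a 1-form `ξ` and `ζ ∈ Ω¹ ⊗ Ω¹`. -/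
def tensL (ξ : Form I A) (ζ : Form2 I A) : Form3 I A := fun a b c => ξ a * ζ b c

/-- Homomorphisms of `A`-bimodules. -/
structure IsBimoduleMap (A : Type) [Ring A] {M M' : Type} [AddCommGroup M] [AddCommGroup M']
    [Module A M] [Module Aᵐᵒᵖ M] [Module A M'] [Module Aᵐᵒᵖ M'] (φ : M → M') : Prop where
  map_add : ∀ u v, φ (u + v) = φ u + φ v
  map_left : ∀ (f : A) u, φ (f • u) = f • φ u
  map_right : ∀ (f : A) u, φ (MulOpposite.op f • u) = MulOpposite.op f • φ u

/-- `σ₁₂ = σ ⊗ id`. -/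
def act12 (σ : Form2 I A → Form2 I A) (ζ : Form3 I A) : Form3 I A :=
  fun a b c => σ (fun a' b' => ζ a' b' c) a b

/-- `σ₂₃ = id ⊗ σ`. -/
def act23 (σ : Form2 I A → Form2 I A) (ζ : Form3 I A) : Form3 I A :=
  fun a b c => σ (ζ a) b c

/-- `g₂₃ = id ⊗ g`. -/
def contract23 (g : Form2 I A → A) (ζ : Form3 I A) : Form I A := fun a => g (ζ a)

/-- A metric: a non-degenerate bimodule map `Ω¹ ⊗_A Ω¹ → A`. -/
structure IsMetric (g : Form2 I A → A) : Prop where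
  bilinear : IsBimoduleMap A g
  nondeg_left : ∀ ξ : Form I A, (∀ η, g (tens ξ η) = 0) → ξ = 0
  nondeg_right : ∀ η : Form I A, (∀ ξ, g (tens ξ η) = 0) → η = 0

/-- Compatibility of a metric `g` and a flip `σ` up to the conformal factor `κ`:
`(id ⊗ g) σ₁₂ σ₂₃ (ξ ⊗ η ⊗ ζ) = κ g(ξ ⊗ η) ζ`, that is
`S^{ae}_{df} g^{fg} S^{cb}_{eg} = κ g^{ac} δ^b_d` for the components in the frame. -/
def CompatibleUpTo (κ : ℂ) (g : Form2 I A → A) (σ : Form2 I A → Form2 I A) : Prop :=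
  ∀ ξ η ζ : Form I A,
    contract23 g (act12 σ (act23 σ (tensR (tens ξ η) ζ))) = κ • (g (tens ξ η) • ζ)

/-- The flip `σ(θ^a ⊗ θ^b) = S^{ab}_{cd} θ^c ⊗ θ^d`, on all of `Ω¹ ⊗_A Ω¹`. -/
def IsFlipWith (S : Matrix (I × I) (I × I) ℂ) (σ : Form2 I A → Form2 I A) : Prop :=
  IsBimoduleMap A σ ∧ ∀ a b, σ (tens (frame A a) (frame A b)) =
    ∑ c, ∑ d, S (a, b) (c, d) • tens (frame A c) (frame A d)

/-- The differential `df = [λ_a, f] θ^a` of a function. -/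
def diff (lam : I → A) (f : A) : Form I A := fun a => lam a * f - f * lam a

/-- The Dirac operator `θ = -λ_a θ^a`. -/
def dirac (lam : I → A) : Form I A := fun a => -lam a

/-- The sub-bimodule of `Ω¹ ⊗_A Ω¹` generated by the elements `P^{ij}_{kl} ξ^k ⊗ ξ^l` for the two
matrices `P = P₁, P₂`. -/
def symForms (P₁ P₂ : Matrix (I × I) (I × I) ℂ) (ξ : I → Form I A) :
    Submodule A (Form2 I A) :=
  Submodule.span A
    {ω | ∃ P : Matrix (I × I) (I × I) ℂ, (P = P₁ ∨ P = P₂) ∧ ∃ (i j : I) (f : A),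
      ω = MulOpposite.op f • ∑ k, ∑ l, P (i, j) (k, l) • tens (ξ k) (ξ l)}

/-- The exterior differential `Ω¹ → Ω²`, for `Ω² = Ω¹ ⊗_A Ω¹ / J`: Leibniz rule and `d² = 0`. -/
structure IsExteriorDiff (lam : I → A) (J : Submodule A (Form2 I A))
    (d₁ : Form I A → Form2 I A ⧸ J) : Prop where
  map_add : ∀ ξ η, d₁ (ξ + η) = d₁ ξ + d₁ η
  leibniz : ∀ (f : A) (η : Form I A), d₁ (f • η) = J.mkQ (tens (diff lam f) η) + f • d₁ η
  d_d : ∀ f : A, d₁ (diff lam f) = 0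

/-- A covariant derivative for the flip `σ`: left and right Leibniz rule. -/
structure IsCovDeriv (lam : I → A) (σ : Form2 I A → Form2 I A) (D : Form I A → Form2 I A) :
    Prop where
  map_add : ∀ ξ η, D (ξ + η) = D ξ + D η
  left_leibniz : ∀ (f : A) (ξ : Form I A), D (f • ξ) = tens (diff lam f) ξ + f • D ξ
  right_leibniz : ∀ (f : A) (ξ : Form I A),
    D (MulOpposite.op f • ξ) = σ (tens ξ (diff lam f)) + MulOpposite.op f • D ξ

/-- `Dξ = -θ ⊗ ξ + σ(ξ ⊗ θ)`. -/
def covDeriv (lam : I → A) (σ : Form2 I A → Form2 I A) (ξ : Form I A) : Form2 I A :=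
  -tens (dirac lam) ξ + σ (tens ξ (dirac lam))

/-- The extension `D₂` of `D` to `Ω¹ ⊗_A Ω¹`: `D₂(ξ ⊗ η) = Dξ ⊗ η + σ₁₂(ξ ⊗ Dη)`. -/
structure IsSecondCovDeriv (σ : Form2 I A → Form2 I A) (D : Form I A → Form2 I A)
    (D₂ : Form2 I A → Form3 I A) : Prop where
  map_add : ∀ u v, D₂ (u + v) = D₂ u + D₂ v
  map_tens : ∀ ξ η, D₂ (tens ξ η) = tensR (D ξ) η + act12 σ (tensL ξ (D η))

/-- `π₁₂ = π ⊗ id : Ω¹ ⊗_A Ω¹ ⊗_A Ω¹ → Ω² ⊗_A Ω¹`, for `Ω² = Ω¹ ⊗_A Ω¹ / J`; the element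
`∑ ω_c ⊗ θ^c` of `Ω² ⊗_A Ω¹` is the family of its components `ω_c ∈ Ω²`. -/
def wedge12 (J : Submodule A (Form2 I A)) (ζ : Form3 I A) : I → Form2 I A ⧸ J :=
  fun c => J.mkQ fun a b => ζ a b c

end Frame

/-! ## The calculi over `A_N` -/

/-- The 1-forms `ξ^i = d x^i` (`ε = 1`), `ξ̄^i = d̄ x^i` (`ε = -1`). -/
noncomputable def xi (N : ℕ) (s : ℂ) (ε : ℤˣ) (γ : Idx N → ℂ) (i : Idx N) :
    Form (Idx N) (QAlg N s) :=
  diff (lamElt N s ε γ) (xGen N s i)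

/-- The relations of the 2-forms: the sub-bimodule generated by `P_s ξξ` and `P_t ξξ`. -/
noncomputable def rel2 (N : ℕ) (s : ℂ) (ε : ℤˣ) (γ : Idx N → ℂ) :
    Submodule (QAlg N s) (Form2 (Idx N) (QAlg N s)) :=
  symForms (projS N s) (projT N s) (xi N s ε γ)

end QEuclid

namespace QEuclid

/-! ## Indices -/

section Indices

variable {N : ℕ}

/-! The components of ξ^i in the frame are the commutators e^i_a = [λ_a, x^i]. The theorem rests on
the exchange relations between x^i, λ_a and e^i_a. Once these are known, metric, flips and
connections are matrix algebra with R̂.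

Telescoping. On an opposite pair (i, -i) the matrix R̂ acts through partial sums over the indices
below -i. The relations P_a x x = 0, together with the definition of the radii, amount to two facts:
x^i and x^j q-commute for i ≠ ±j, and (1 - q²) q^{-ρ_i} x^i x^{-i} is a difference V_{i+1} - V_i,
where each V_j is a multiple of one squared radius (`step_of_projA` and, conversely,
`QD.projA_x_x`). The structure `QD` records this explicit form, so that one computation applies to
several realizations. Up to a constant λ_a is Λ times two inverse radii times x^{-a}. Hence e^i_a
vanishes for i < a, is invertible for i = a, and for i > a equals (1 - q²) λ_a x^i, except that it
vanishes for even N, a = -1, i = 1. The partial sums in R̂ therefore collapse, and x e = q R̂ e x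
follows (`QD.x_e`).

Symmetries. Replacing q by q⁻¹ and i by -i turns R̂ into its inverse (`rhat_flip`, `QD.flip`) and
exchanges the two calculi. More importantly, the λ_{-i} satisfy the relations of the coordinates for
q⁻¹, with multiples of Λ r_j⁻¹ as radii; the conditions on the γ_a make the coefficients match
(`QD.dual`). In this dual realization the λ's are again multiples of the x's, so the results for x
hold for λ at no extra cost: λ e = q⁻¹ R̂⁻¹ e λ (`QD.lam_e`) and P_a λ λ = 0 (`QD.projA_l_l`).

Consequences. Writing one factor of e e as λ x - x λ and moving x and λ through the other gives R̂ e
e = e e R̂ (`QD.rll`), the orthogonality relations of e with value Λ² g (`QD.sum_g_E_E`,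
`QD.sum_E_g_E`) and the formula for θ (`QD.l_eq`). Moving x through e e in two ways gives the
Yang–Baxter equation itself (`QD.yangBaxter`), since the triangular matrix e can be cancelled.
`IsCalculus` collects these relations for both signs ε.

Metric. As θ^a ⊗ θ^b commutes with the algebra, a bimodule map has central components, and the
center is ℂ (`exists_algebraMap_of_commute`): gradings by conjugation remove the coordinates and Λ,
which leaves Laurent polynomials in the radii and K, and a representation by weighted translations
leaves only the constants. The same representation shows that the algebra is not zero.

Flips and connections. Both matrices (q R̂)^{±1} are -1 on the range of P_a, a form in the kernel of
P_a is zero in Ω² (`IsCalculus.mem_symForms`), and P_a λ λ = 0 says that P_a kills θ ⊗ θ. As df =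
-[θ, f], the torsion vanishes for these reasons alone; for the curvature P_a also has to pass
through two flips, which is the braid relation (`projA_braid`). Metric compatibility is the crossing
relation `rhat_crossing`. For x R̂ + y + z g g it becomes three scalar equations (`compat_iff`), and
their solutions with C_s ≠ -1 are the two flips. Uniqueness of the metric is a Schur type argument
with the entries of R̂ (`eq_smul_one_of_slice`). -/

@[simp] theorem coe_negIdx (i : Idx N) : ((negIdx i : Idx N) : ℤ) = -(i : ℤ) := rfl

@[simp] theorem negIdx_negIdx (i : Idx N) : negIdx (negIdx i) = i :=
  Subtype.ext (by simp)

theorem idx_ext_iff {i j : Idx N} : i = j ↔ (i : ℤ) = (j : ℤ) := Subtype.ext_iff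

theorem idx_mem (i : Idx N) :
    -((N / 2 : ℕ) : ℤ) ≤ (i : ℤ) ∧ (i : ℤ) ≤ ((N / 2 : ℕ) : ℤ) ∧ ((i : ℤ) ≠ 0 ∨ Odd N) := by
  have h := i.2
  simp only [Finset.mem_filter, Finset.mem_Icc] at h
  exact ⟨h.1.1, h.1.2, h.2⟩

/-- An integer in the range as an index. -/
def mkIdx (m : ℤ) (h₁ : -((N / 2 : ℕ) : ℤ) ≤ m) (h₂ : m ≤ ((N / 2 : ℕ) : ℤ)) (h₃ : m ≠ 0 ∨ Odd N) :
    Idx N :=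
  ⟨m, by simp only [Finset.mem_filter, Finset.mem_Icc]; exact ⟨⟨h₁, h₂⟩, h₃⟩⟩

/-- Negation of indices as an equivalence. -/
def negEquiv (N : ℕ) : Idx N ≃ Idx N where
  toFun := negIdx
  invFun := negIdx
  left_inv := negIdx_negIdx
  right_inv := negIdx_negIdx

theorem sum_negIdx {M : Type*} [AddCommMonoid M] (f : Idx N → M) :
    ∑ i, f (negIdx i) = ∑ i, f i := (negEquiv N).sum_comp f

theorem negIdx_inj {i j : Idx N} : negIdx i = negIdx j ↔ i = j := (negEquiv N).apply_eq_iff_eq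

theorem twoRho_neg (N : ℕ) (i : ℤ) : twoRho N (-i) = -twoRho N i := by
  unfold twoRho
  rw [Int.sign_neg]
  split_ifs <;> ring

theorem twoRho_zero (N : ℕ) : twoRho N 0 = 0 := by
  unfold twoRho; simp

theorem twoRho_pos {i : ℤ} (hi : 0 < i) :
    twoRho N i = if Odd N then -2 * i + 1 else -2 * i + 2 := by
  unfold twoRho; rw [Int.sign_eq_one_of_pos hi]; simp

/-- Partial sums over the indices below `j` of a function with a primitive. -/
theorem sum_idx_lt {M : Type*} [AddCommGroup M] (f : Idx N → M) (Φ : ℤ → M)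
    (hstep : ∀ i : Idx N, Φ ((i : ℤ) + 1) = Φ i + f i)
    (hgap : ¬ Odd N → Φ 1 = Φ 0) (j : ℤ) (h₁ : -((N / 2 : ℕ) : ℤ) ≤ j)
    (h₂ : j ≤ ((N / 2 : ℕ) : ℤ) + 1) :
    ∑ l : Idx N, (if (l : ℤ) < j then f l else 0) = Φ j - Φ (-((N / 2 : ℕ) : ℤ)) := by
  induction j, h₁ using Int.leInduction with
  | base =>
    rw [sub_self]
    refine Finset.sum_eq_zero fun l _ => if_neg ?_
    have := idx_mem l
    omega
  | succ j h ih =>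
    specialize ih (by omega)
    by_cases hj : j ≠ 0 ∨ Odd N
    · set J : Idx N := mkIdx j h (by omega) hj
      have hJ : (J : ℤ) = j := rfl
      have : ∀ l : Idx N, (if (l : ℤ) < j + 1 then f l else 0)
          = (if (l : ℤ) < j then f l else 0) + (if l = J then f l else 0) := by
        intro l
        have hl : l = J ↔ (l : ℤ) = j := idx_ext_iff
        by_cases h1 : (l : ℤ) < j
        · rw [if_pos h1, if_pos (by omega), if_neg (by rw [hl]; omega), add_zero]
        · by_cases h2 : (l : ℤ) = j
          · rw [if_neg h1, if_pos (by omega), if_pos (hl.2 h2), zero_add]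
          · rw [if_neg h1, if_neg (by omega), if_neg (by rwa [hl]), zero_add]
      simp only [this, Finset.sum_add_distrib, ih, Finset.sum_ite_eq', Finset.mem_univ, if_true]
      have := hstep J
      rw [hJ] at this
      rw [this]; abel
    -- For even N the index 0 is missing, so the sums below 0 and below 1 agree; `hgap` says the
    -- same of the primitive.
    · push Not at hj
      obtain ⟨rfl, hN⟩ := hj
      have : ∀ l : Idx N, (if (l : ℤ) < 0 + 1 then f l else 0) = if (l : ℤ) < 0 then f l else 0 := by
        intro l
        have := (idx_mem l).2.2
        have h0 : (l : ℤ) ≠ 0 := this.resolve_right (by simpa using hN)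
        by_cases h1 : (l : ℤ) < 0
        · rw [if_pos h1, if_pos (by omega)]
        · rw [if_neg h1, if_neg (by omega)]
      simp only [this, ih]
      rw [zero_add, hgap (by simpa using hN)]

end Indices

/-! ## Scalars -/

section Scalars

variable {s : ℂ}

/-- `s` is neither zero nor a root of unity. -/
structure Generic (s : ℂ) : Prop where
  ne_zero : s ≠ 0
  pow_ne : ∀ m : ℕ, 0 < m → s ^ m ≠ 1

theorem Generic.zpow_ne_one (hs : Generic s) {m : ℤ} (hm : m ≠ 0) : s ^ m ≠ 1 := by
  rcases lt_or_gt_of_ne hm with h | h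
  · intro h1
    have := hs.pow_ne (-m).toNat (by omega)
    apply this
    rw [← zpow_natCast, Int.toNat_of_nonneg (by omega), zpow_neg, h1, inv_one]
  · intro h1
    have := hs.pow_ne m.toNat (by omega)
    apply this
    rw [← zpow_natCast, Int.toNat_of_nonneg (by omega), h1]

theorem Generic.zpow_ne (hs : Generic s) {m k : ℤ} (h : m ≠ k) : s ^ m ≠ s ^ k := by
  intro h1
  apply hs.zpow_ne_one (m := m - k) (by omega)
  rw [zpow_sub₀ hs.ne_zero, h1, div_self (zpow_ne_zero _ hs.ne_zero)]

theorem Generic.inv (hs : Generic s) : Generic s⁻¹ :=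
  ⟨inv_ne_zero hs.ne_zero, fun m hm h => hs.pow_ne m hm (by simpa using h)⟩

/-- Otherwise `s ^ m = -1`, and squaring makes `s` a root of unity. Most denominators below are of
this form up to a power of `s`. -/
theorem Generic.one_add_zpow (hs : Generic s) (m : ℤ) : 1 + s ^ m ≠ 0 := by
  intro h
  have h1 : s ^ m = -1 := by linear_combination h
  by_cases hm : m = 0
  · subst hm
    rw [zpow_zero] at h1
    norm_num at h1
  · apply hs.zpow_ne_one (m := m * 2) (by omega)
    rw [zpow_mul, h1]
    norm_num

theorem Generic.kConst_ne (hs : Generic s) : kConst s ≠ 0 := by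
  unfold kConst
  intro h
  have h0 := hs.ne_zero
  apply hs.pow_ne 4 (by norm_num)
  field_simp at h
  linear_combination h

theorem Generic.hConst_ne (hs : Generic s) : hConst s ≠ 0 := by
  unfold hConst
  intro h
  have h0 := hs.ne_zero
  apply hs.pow_ne 2 (by norm_num)
  field_simp at h
  linear_combination h

theorem Generic.omega_ne (hs : Generic s) (N : ℕ) (i : ℤ) : omega N s i ≠ 0 := by
  unfold omega
  have h : s ^ twoRho N i + s ^ (-twoRho N i) = s ^ (-twoRho N i) * (1 + s ^ (2 * twoRho N i)) := by
    rw [mul_add, ← zpow_add₀ hs.ne_zero]; ring_nf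
  rw [h]
  exact mul_ne_zero (zpow_ne_zero _ hs.ne_zero) (hs.one_add_zpow _)

end Scalars

/-! ## The action of the braid matrix -/

section RAction

variable {N : ℕ} (s : ℂ)

theorem rhat_apply (i j k l : Idx N) (a b c d : ℤ) (ha : (i : ℤ) = a) (hb : (j : ℤ) = b)
    (hc : (k : ℤ) = c) (hd : (l : ℤ) = d) :
    rhat N s (i, j) (k, l) =
      (if a ≠ 0 ∧ b = a ∧ c = a ∧ d = a then s ^ 2 else 0)
      + (if c = b ∧ d = a ∧ ((a ≠ b ∧ a ≠ -b) ∨ (a = 0 ∧ b = 0)) then 1 else 0)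
      + (if a ≠ 0 ∧ b = -a ∧ c = -a ∧ d = a then (s ^ 2)⁻¹ else 0)
      + (if a < b ∧ c = a ∧ d = b then kConst s else 0)
      - (if a < d ∧ b = -a ∧ c = -d then kConst s * s ^ (twoRho N d - twoRho N a) else 0) := by
  subst ha hb hc hd; rfl

theorem rhat_apply_ne (i j k l : Idx N) (h : (j : ℤ) ≠ -(i : ℤ)) :
    rhat N s (i, j) (k, l) =
      (if k = j ∧ l = i then (if i = j then s ^ 2 else 1) else 0)
        + (if k = i ∧ l = j then (if (i : ℤ) < j then kConst s else 0) else 0) := by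
  rw [rhat_apply s i j k l _ _ _ _ rfl rfl rfl rfl]
  simp only [idx_ext_iff]
  rw [if_neg (c := ((i : ℤ) ≠ 0 ∧ (j : ℤ) = -i ∧ _)) (by tauto),
    if_neg (c := ((i : ℤ) < l ∧ (j : ℤ) = -i ∧ _)) (by tauto)]
  by_cases h1 : (k : ℤ) = j ∧ (l : ℤ) = i
  · rw [if_pos h1]
    by_cases h2 : (i : ℤ) = j
    · rw [if_pos h2, if_pos (by omega), if_neg (by omega), if_neg (by omega)]
      split_ifs <;> first | omega | simp
    · rw [if_neg h2, if_neg (by omega), if_pos (by omega), if_neg (by omega)]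
      split_ifs <;> first | omega | simp
  · rw [if_neg h1, if_neg (by omega), if_neg (by omega)]
    split_ifs <;> first | omega | simp

/-- The entry of `R̂` at `(i, -i), (-i, i)`, for `(i, -i) ≠ (-i, i)`, and at `(0, 0), (0, 0)`. -/
noncomputable def zConst (s : ℂ) (i : ℤ) : ℂ := if i = 0 then 1 else (s ^ 2)⁻¹

/-- R̂ preserves the span of the opposite pairs. `zConst` merges the entry q⁻¹ of the third sum in
R̂ with the entry 1 of the second at the index 0, so that 0 needs no separate formula. -/
theorem rhat_apply_neg (i k l : Idx N) :
    rhat N s (i, negIdx i) (k, l) =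
      (if l = negIdx k then
        (if k = negIdx i then zConst s i else 0) + (if k = i ∧ (i : ℤ) < 0 then kConst s else 0)
          - (if (k : ℤ) < -i then kConst s * s ^ (-twoRho N k - twoRho N i) else 0) else 0) := by
  simp only [idx_ext_iff, coe_negIdx, zConst]
  by_cases h : (l : ℤ) = -k
  · rw [rhat_apply s i (negIdx i) k l _ _ _ _ rfl (coe_negIdx i) rfl h, if_pos h]
    rw [if_neg (c := ((i : ℤ) ≠ 0 ∧ -(i : ℤ) = i ∧ _)) (by omega)]
    simp only [twoRho_neg, neg_neg, true_and, and_true]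
    by_cases hk : (k : ℤ) = -i <;> by_cases hi : (i : ℤ) = 0 <;> by_cases hki : (k : ℤ) = i <;>
      by_cases hlt : (k : ℤ) < -i <;> by_cases hi0 : (i : ℤ) < 0 <;>
      first
      | omega
      | (simp [hk, hi, hki, hlt, hi0] <;> split_ifs <;> first | omega | simp)
      | (split_ifs <;> first | omega | simp)
  · rw [rhat_apply s i (negIdx i) k l _ _ _ _ rfl (coe_negIdx i) rfl rfl, if_neg h,
      if_neg (by omega), if_neg (by omega), if_neg (by omega), if_neg (by omega),
      if_neg (by omega)]
    simp

/-- On opposite pairs the exponent -ρ_k - ρ_i and the condition k < -i are symmetric in i and k; all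
other blocks are symmetric of size at most two. -/
theorem rhat_symm (u v : Idx N × Idx N) : rhat N s u v = rhat N s v u := by
  obtain ⟨i, j⟩ := u
  obtain ⟨k, l⟩ := v
  by_cases h : j = negIdx i
  · subst h
    rw [rhat_apply_neg]
    by_cases h' : l = negIdx k
    · subst h'
      rw [rhat_apply_neg, if_pos rfl, if_pos rfl]
      have h1 : (if k = negIdx i then zConst s i else 0) = if i = negIdx k then zConst s k else 0 := by
        by_cases hk : k = negIdx i
        · subst hk; simp [zConst]
        · rw [if_neg hk, if_neg (fun h => hk (by rw [h, negIdx_negIdx]))]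
      have h2 : (if k = i ∧ (i : ℤ) < 0 then kConst s else 0)
          = if i = k ∧ (k : ℤ) < 0 then kConst s else 0 := by
        by_cases hk : k = i
        · subst hk; rfl
        · rw [if_neg (fun h => hk h.1), if_neg (fun h => hk h.1.symm)]
      rw [h1, h2, show -twoRho N (k : ℤ) - twoRho N i = -twoRho N i - twoRho N k by ring]
      congr 1
      exact if_congr (by omega) rfl rfl
    · rw [if_neg h', rhat_apply_ne _ _ _ _ _ (by rw [idx_ext_iff] at h'; simpa using h')]
      rw [if_neg, if_neg, add_zero]
      · rintro ⟨rfl, rfl⟩; exact h' rfl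
      · rintro ⟨h1, rfl⟩; exact h' (by rw [h1, negIdx_negIdx])
  · rw [rhat_apply_ne _ _ _ _ _ (by rw [idx_ext_iff] at h; simpa using h)]
    by_cases h' : l = negIdx k
    · subst h'
      rw [rhat_apply_neg, if_neg h, if_neg, if_neg, add_zero]
      · rintro ⟨rfl, h2⟩; exact h h2.symm
      · rintro ⟨rfl, h2⟩; exact h (by rw [← h2, negIdx_negIdx])
    · rw [rhat_apply_ne _ _ _ _ _ (by rw [idx_ext_iff] at h'; simpa using h')]
      congr 1
      · by_cases hc : k = j ∧ l = i
        · obtain ⟨rfl, rfl⟩ := hc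
          simp [eq_comm]
        · rw [if_neg hc, if_neg (by tauto)]
      · by_cases hc : k = i ∧ l = j
        · obtain ⟨rfl, rfl⟩ := hc
          simp
        · rw [if_neg hc, if_neg (by tauto)]

variable {M : Type*} [AddCommGroup M] [Module ℂ M]

theorem rhat_sum_ne (F : Idx N → Idx N → M) (i j : Idx N) (h : (j : ℤ) ≠ -(i : ℤ)) :
    ∑ k, ∑ l, rhat N s (i, j) (k, l) • F k l =
      (if i = j then s ^ 2 else 1 : ℂ) • F j i + (if (i : ℤ) < j then kConst s else 0) • F i j := by
  simp only [rhat_apply_ne s i j _ _ h, add_smul, Finset.sum_add_distrib, ite_and]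
  congr 1
  · rw [Finset.sum_eq_single j, Finset.sum_eq_single i]
    · simp
    · intro b _ hb; simp [hb]
    · simp
    · intro b _ hb; simp [hb]
    · simp
  · rw [Finset.sum_eq_single i, Finset.sum_eq_single j]
    · simp
    · intro b _ hb; simp [hb]
    · simp
    · intro b _ hb; simp [hb]
    · simp

/-- This is how R̂ is used on opposite pairs: its last term is a partial sum, which telescopes by
`sum_idx_lt` whenever q^{-ρ_l} F_{l,-l} has a primitive. -/
theorem rhat_sum_neg (F : Idx N → Idx N → M) (i : Idx N) :
    ∑ k, ∑ l, rhat N s (i, negIdx i) (k, l) • F k l =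
      zConst s i • F (negIdx i) i + (if (i : ℤ) < 0 then kConst s else 0) • F i (negIdx i)
        - (kConst s * s ^ (-twoRho N i)) •
          ∑ l : Idx N, (if (l : ℤ) < -i then s ^ (-twoRho N l) • F l (negIdx l) else 0) := by
  have h1 : ∀ k : Idx N, ∑ l, rhat N s (i, negIdx i) (k, l) • F k l
      = (if k = negIdx i then zConst s i • F k (negIdx k) else 0)
        + (if k = i then (if (i : ℤ) < 0 then kConst s else 0) • F k (negIdx k) else 0)
        - (kConst s * s ^ (-twoRho N i)) •
          (if (k : ℤ) < -i then s ^ (-twoRho N k) • F k (negIdx k) else 0) := by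
    intro k
    rw [Finset.sum_eq_single (negIdx k)]
    · rw [rhat_apply_neg, if_pos rfl, sub_smul, add_smul]
      congr 1
      · congr 1
        · split_ifs <;> simp
        · by_cases hk : k = i
          · simp [hk]
          · simp [hk]
      · split_ifs
        · rw [smul_smul]
          congr 1
          by_cases hs : s = 0
          · subst hs; simp [kConst]
          · rw [sub_eq_add_neg, zpow_add₀ hs]; ring
        · simp
    · intro l _ hl
      rw [rhat_apply_neg, if_neg hl, zero_smul]
    · simp
  simp only [h1, Finset.sum_sub_distrib, Finset.sum_add_distrib, Finset.sum_ite_eq',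
    Finset.mem_univ, if_true, negIdx_negIdx, ← Finset.smul_sum]

end RAction

end QEuclid

namespace QEuclid

/-! ## Relations of the braid matrix -/

section RMatrix

variable {N : ℕ} {s : ℂ}

theorem gMat_apply (s : ℂ) (i j : Idx N) :
    gMat N s i j = if j = negIdx i then s ^ (-twoRho N i) else 0 := by
  simp only [gMat, Matrix.of_apply, idx_ext_iff, coe_negIdx]
  exact if_congr (by omega) rfl rfl

theorem gMat_neg (s : ℂ) (i : Idx N) : gMat N s i (negIdx i) = s ^ (-twoRho N i) := by
  rw [gMat_apply, if_pos rfl]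

theorem gMat_neg' (s : ℂ) (i : Idx N) : gMat N s (negIdx i) i = s ^ (twoRho N i) := by
  rw [gMat_apply, negIdx_negIdx, if_pos rfl, coe_negIdx, twoRho_neg, neg_neg]

theorem sum_gMat {M : Type*} [AddCommGroup M] [Module ℂ M] (s : ℂ) (F : Idx N → Idx N → M) :
    ∑ i : Idx N, ∑ j, gMat N s i j • F i j = ∑ i : Idx N, s ^ (-twoRho N i) • F i (negIdx i) := by
  refine Finset.sum_congr rfl fun i _ => ?_
  rw [Finset.sum_eq_single (negIdx i), gMat_neg]
  · intro b _ hb; rw [gMat_apply, if_neg hb, zero_smul]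
  · simp

/-- `q^{1-N}`. -/
noncomputable def muConst (N : ℕ) (s : ℂ) : ℂ := s ^ (2 - 2 * (N : ℤ))

/-- `g^{sm} g_{sm}`. -/
noncomputable def gTrace (N : ℕ) (s : ℂ) : ℂ := ∑ i, ∑ j, gMat N s i j * gMat N s i j

/-- The matrix `g^{ij} g_{kl}`. -/
noncomputable def gg (N : ℕ) (s : ℂ) : Matrix (Idx N × Idx N) (Idx N × Idx N) ℂ :=
  Matrix.of fun u v => gMat N s u.1 u.2 * gMat N s v.1 v.2

/-- The indefinite sum of `k q^{-2 ρ_l}`. -/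
noncomputable def rhoPrim (N : ℕ) (s : ℂ) (j : ℤ) : ℂ :=
  if Odd N then (if j ≤ 0 then s ^ (4 * j) else s ^ (4 * j - 4) + kConst s)
  else (if j ≤ 0 then s ^ (4 * j + 2) else s ^ (4 * j - 6) + kConst s)

theorem rhoPrim_step (hs : s ≠ 0) (i : Idx N) :
    rhoPrim N s ((i : ℤ) + 1) = rhoPrim N s i + kConst s * s ^ (-2 * twoRho N i) := by
  have hi := (idx_mem i).2.2
  rcases lt_trichotomy (i : ℤ) 0 with h | h | h
  · have h1 : twoRho N (i : ℤ) = if Odd N then -2 * (i : ℤ) - 1 else -2 * (i : ℤ) - 2 := by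
      rw [← neg_neg (i : ℤ), twoRho_neg, twoRho_pos (by omega)]
      split_ifs <;> ring
    unfold rhoPrim kConst
    rw [if_pos (show (i : ℤ) ≤ 0 by omega), if_pos (show (i : ℤ) ≤ 0 by omega),
      if_pos (show (i : ℤ) + 1 ≤ 0 by omega), if_pos (show (i : ℤ) + 1 ≤ 0 by omega), h1]
    split_ifs
    · rw [show 4 * ((i : ℤ) + 1) = 4 * i + 2 + 2 by ring,
        show -2 * (-2 * (i : ℤ) - 1) = 4 * i + 2 by ring]
      simp only [zpow_add₀ hs]
      field_simp
      norm_cast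
      ring
    · rw [show 4 * ((i : ℤ) + 1) + 2 = 4 * i + 4 + 2 by ring,
        show -2 * (-2 * (i : ℤ) - 2) = 4 * i + 4 by ring]
      simp only [zpow_add₀ hs]
      field_simp
      norm_cast
      ring
  · have hN : Odd N := hi.resolve_left (by simp [h])
    unfold rhoPrim
    simp [h, hN, twoRho_zero]
  · unfold rhoPrim kConst
    rw [if_neg (show ¬ (i : ℤ) ≤ 0 by omega), if_neg (show ¬ (i : ℤ) ≤ 0 by omega),
      if_neg (show ¬ (i : ℤ) + 1 ≤ 0 by omega), if_neg (show ¬ (i : ℤ) + 1 ≤ 0 by omega),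
      twoRho_pos h]
    split_ifs
    · rw [show 4 * ((i : ℤ) + 1) - 4 = 4 * i - 2 + 2 by ring,
        show -2 * (-2 * (i : ℤ) + 1) = 4 * i - 2 by ring,
        show 4 * (i : ℤ) - 4 = 4 * i - 2 + (-2) by ring]
      simp only [zpow_add₀ hs]
      field_simp
      norm_cast
      ring
    · rw [show 4 * ((i : ℤ) + 1) - 6 = 4 * i - 4 + 2 by ring,
        show -2 * (-2 * (i : ℤ) + 2) = 4 * i - 4 by ring,
        show 4 * (i : ℤ) - 6 = 4 * i - 4 + (-2) by ring]
      simp only [zpow_add₀ hs]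
      field_simp
      norm_cast
      ring

/-- The constant k added on the positive side is responsible for this: q = q⁻¹ + k. -/
theorem rhoPrim_gap (hN : ¬ Odd N) : rhoPrim N s 1 = rhoPrim N s 0 := by
  unfold rhoPrim kConst
  simp only [if_neg hN]
  norm_num

theorem rhoPrim_start : rhoPrim N s (-((N / 2 : ℕ) : ℤ)) = muConst N s := by
  unfold rhoPrim muConst
  rw [if_pos (show -((N / 2 : ℕ) : ℤ) ≤ 0 by omega), if_pos (show -((N / 2 : ℕ) : ℤ) ≤ 0 by omega)]
  split_ifs with h
  · obtain ⟨m, rfl⟩ := h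
    congr 1; omega
  · rw [Nat.not_odd_iff_even] at h
    obtain ⟨m, rfl⟩ := h
    congr 1; omega

/-- The primitive is rewritten with the entries of R̂, so that partial sums cancel against the first
two terms of `rhat_sum_neg`. -/
theorem rhoPrim_idx (hs : s ≠ 0) (j : Idx N) :
    rhoPrim N s j = zConst s j * s ^ (-2 * twoRho N j) + if 0 < (j : ℤ) then kConst s else 0 := by
  have hj := (idx_mem j).2.2
  rcases lt_trichotomy (j : ℤ) 0 with h | h | h
  · have h1 : twoRho N (j : ℤ) = if Odd N then -2 * (j : ℤ) - 1 else -2 * (j : ℤ) - 2 := by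
      rw [← neg_neg (j : ℤ), twoRho_neg, twoRho_pos (by omega)]
      split_ifs <;> ring
    unfold rhoPrim zConst
    rw [if_pos (show (j : ℤ) ≤ 0 by omega), if_pos (show (j : ℤ) ≤ 0 by omega), h1,
      if_neg (show ¬ (j : ℤ) = 0 by omega), if_neg (show ¬ 0 < (j : ℤ) by omega), add_zero]
    rw [← zpow_natCast, ← zpow_neg, ← zpow_add₀ hs]
    split_ifs <;> (congr 1; push_cast; ring)
  · have hN : Odd N := hj.resolve_left (by simp [h])
    unfold rhoPrim zConst
    simp [h, hN, twoRho_zero]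
  · unfold rhoPrim zConst
    rw [if_neg (show ¬ (j : ℤ) ≤ 0 by omega), if_neg (show ¬ (j : ℤ) ≤ 0 by omega), twoRho_pos h,
      if_neg (show ¬ (j : ℤ) = 0 by omega), if_pos h]
    rw [← zpow_natCast, ← zpow_neg, ← zpow_add₀ hs]
    split_ifs <;> (congr 2; push_cast; ring)

/-- The partial sums of `k q^{-2 ρ_l}`. -/
theorem sum_rho_lt (hs : s ≠ 0) (J : Idx N) (j : ℤ) (hJ : (J : ℤ) = j) :
    kConst s * ∑ l : Idx N, (if (l : ℤ) < j then s ^ (-2 * twoRho N l) else 0) =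
      zConst s j * s ^ (-2 * twoRho N j) - muConst N s + if 0 < j then kConst s else 0 := by
  have h := sum_idx_lt (fun i : Idx N => kConst s * s ^ (-2 * twoRho N i)) (rhoPrim N s)
    (rhoPrim_step hs) rhoPrim_gap j (hJ ▸ (idx_mem J).1)
    (by have := (idx_mem J).2.1; omega)
  rw [rhoPrim_start, ← hJ, rhoPrim_idx hs, hJ] at h
  rw [Finset.mul_sum]
  simp only [mul_ite, mul_zero]
  rw [h]; ring

theorem gTrace_eq_sum (hs : s ≠ 0) : gTrace N s = ∑ i : Idx N, s ^ (-2 * twoRho N i) := by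
  unfold gTrace
  simp only [← smul_eq_mul]
  rw [sum_gMat s (fun i j => gMat N s i j)]
  refine Finset.sum_congr rfl fun i _ => ?_
  rw [gMat_neg, smul_eq_mul]
  rw [← zpow_add₀ hs]; ring_nf

/-- The sum of k q^{-2ρ_l} over all indices: its primitive runs from μ = q^{1-N} to μ⁻¹ + k. -/
theorem k_mul_gTrace (hN : 2 ≤ N) (hs : s ≠ 0) :
    kConst s * gTrace N s = kConst s + (muConst N s)⁻¹ - muConst N s := by
  have h := sum_idx_lt (fun i : Idx N => kConst s * s ^ (-2 * twoRho N i)) (rhoPrim N s)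
    (rhoPrim_step hs) rhoPrim_gap (((N / 2 : ℕ) : ℤ) + 1) (by omega) (by omega)
  have h2 : ∀ l : Idx N, (if (l : ℤ) < ((N / 2 : ℕ) : ℤ) + 1 then kConst s * s ^ (-2 * twoRho N l)
      else 0) = kConst s * s ^ (-2 * twoRho N l) := fun l =>
    if_pos (by have := (idx_mem l).2.1; omega)
  simp only [h2] at h
  rw [gTrace_eq_sum hs, Finset.mul_sum, h, rhoPrim_start]
  congr 1
  unfold rhoPrim muConst
  rw [if_neg (show ¬ ((N / 2 : ℕ) : ℤ) + 1 ≤ 0 by omega),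
    if_neg (show ¬ ((N / 2 : ℕ) : ℤ) + 1 ≤ 0 by omega), ← zpow_neg]
  split_ifs with h
  · obtain ⟨m, rfl⟩ := h
    rw [add_comm]
    congr 2; omega
  · rw [Nat.not_odd_iff_even] at h
    obtain ⟨m, rfl⟩ := h
    rw [add_comm]
    congr 2; omega

/-- `R̂ g = q^{1-N} g`. -/
theorem rhat_g (hs : s ≠ 0) (i j : Idx N) :
    ∑ k, ∑ l, rhat N s (i, j) (k, l) * gMat N s k l = muConst N s * gMat N s i j := by
  simp only [← smul_eq_mul]
  by_cases h : j = negIdx i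
  · subst h
    rw [rhat_sum_neg s (fun k l => gMat N s k l)]
    have h1 : ∀ l : Idx N, (if (l : ℤ) < -(i : ℤ) then s ^ (-twoRho N l) • gMat N s l (negIdx l)
        else 0) = if (l : ℤ) < -(i : ℤ) then s ^ (-2 * twoRho N l) else 0 := by
      intro l
      rw [gMat_neg, smul_eq_mul, ← zpow_add₀ hs]
      congr 2; ring
    simp only [h1]
    simp only [gMat_neg, gMat_neg', smul_eq_mul]
    have h2 := sum_rho_lt hs (negIdx i) _ (coe_negIdx i)
    rw [twoRho_neg] at h2
    have h3 : zConst s (-(i : ℤ)) = zConst s i := by simp [zConst]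
    rw [h3, show -2 * -twoRho N (i : ℤ) = twoRho N i + twoRho N i by ring, zpow_add₀ hs] at h2
    have h4 : (if 0 < -(i : ℤ) then kConst s else 0) = if (i : ℤ) < 0 then kConst s else 0 :=
      if_congr (by omega) rfl rfl
    rw [h4] at h2
    rw [mul_right_comm, h2, zpow_neg]
    have := zpow_ne_zero (twoRho N i) hs
    field_simp
    ring
  · have h' : (j : ℤ) ≠ -(i : ℤ) := by rw [idx_ext_iff] at h; simpa using h
    rw [rhat_sum_ne s (fun k l => gMat N s k l) _ _ h', gMat_apply, gMat_apply, if_neg h,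
      if_neg (fun h1 : i = negIdx j => h (by rw [h1, negIdx_negIdx]))]
    simp

/-- A partial sum down a column of the block of opposite pairs, as it occurs in the square of R̂.
The last term of R̂ restricts l to l < -c in addition to l < j, so the remaining sum of q^{-2ρ_l}
ends at the smaller bound; hence the two cases. -/
theorem sum_lt_rhat_neg (hs : s ≠ 0) (J c : Idx N) (j : ℤ) (hJ : (J : ℤ) = j) :
    kConst s * ∑ l : Idx N, (if (l : ℤ) < j then
        s ^ (-twoRho N l) * rhat N s (l, negIdx l) (c, negIdx c) else 0) =
      (if -(c : ℤ) < j then kConst s * zConst s c * s ^ twoRho N c else 0)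
      + (if (c : ℤ) < j ∧ (c : ℤ) < 0 then kConst s * kConst s * s ^ (-twoRho N c) else 0)
      - kConst s * s ^ (-twoRho N c) * (if -(c : ℤ) < j then
          zConst s c * s ^ (2 * twoRho N c) - muConst N s + (if (c : ℤ) < 0 then kConst s else 0)
        else
          zConst s j * s ^ (-2 * twoRho N j) - muConst N s
            + if 0 < j then kConst s else 0) := by
  have h1 : ∀ l : Idx N, (if (l : ℤ) < j then
        s ^ (-twoRho N l) * rhat N s (l, negIdx l) (c, negIdx c) else 0)
      = (if l = negIdx c then (if -(c : ℤ) < j then zConst s c * s ^ twoRho N c else 0) else 0)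
        + (if l = c then (if (c : ℤ) < j ∧ (c : ℤ) < 0 then kConst s * s ^ (-twoRho N c) else 0)
            else 0)
        - s ^ (-twoRho N c) * (kConst s *
          (if (l : ℤ) < (if -(c : ℤ) < j then -(c : ℤ) else j)
            then s ^ (-2 * twoRho N l) else 0)) := by
    intro l
    rw [rhat_apply_neg, if_pos rfl]
    by_cases hl : (l : ℤ) < j
    · rw [if_pos hl, mul_sub, mul_add]
      congr 1
      · congr 1
        · by_cases hlc : l = negIdx c
          · subst hlc
            rw [coe_negIdx] at hl
            rw [if_pos (by simp), if_pos rfl, if_pos hl, coe_negIdx, twoRho_neg, neg_neg]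
            simp [zConst, mul_comm]
          · rw [if_neg hlc, if_neg (fun h => hlc (by rw [h, negIdx_negIdx])), mul_zero]
        · by_cases hlc : l = c
          · subst hlc
            by_cases h0 : (l : ℤ) < 0
            · simp [h0, hl, mul_comm]
            · simp [h0]
          · rw [if_neg hlc, if_neg (fun h => hlc h.1.symm), mul_zero]
      · by_cases hcl : (c : ℤ) < -(l : ℤ)
        · rw [if_pos hcl, if_pos (by split_ifs <;> omega),
            sub_eq_add_neg, zpow_add₀ hs, show -2 * twoRho N (l : ℤ) = -twoRho N l + -twoRho N l by ring,
            zpow_add₀ hs]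
          ring
        · rw [if_neg hcl, if_neg (by rw [if_pos (by omega)]; omega)]
          simp
    · rw [if_neg hl, if_neg (show ¬ (l : ℤ) < (if -(c : ℤ) < j then -(c : ℤ) else j) by
        split_ifs <;> omega)]
      have e1 : (if l = negIdx c then (if -(c : ℤ) < j then zConst s c * s ^ twoRho N c else 0)
          else 0) = (0 : ℂ) := by
        by_cases hlc : l = negIdx c
        · subst hlc
          rw [coe_negIdx] at hl
          rw [if_pos rfl, if_neg hl]
        · rw [if_neg hlc]
      have e2 : (if l = c then (if (c : ℤ) < j ∧ (c : ℤ) < 0 then kConst s * s ^ (-twoRho N c)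
          else 0) else 0) = (0 : ℂ) := by
        by_cases hlc : l = c
        · subst hlc
          rw [if_pos rfl, if_neg (fun h => hl h.1)]
        · rw [if_neg hlc]
      rw [e1, e2]; simp
  simp only [h1, Finset.sum_sub_distrib, Finset.sum_add_distrib, Finset.sum_ite_eq',
    Finset.mem_univ, if_true, ← Finset.mul_sum]
  have h3 : zConst s (-(c : ℤ)) = zConst s c := by simp [zConst]
  by_cases hc : -(c : ℤ) < j
  · simp only [if_pos hc, sum_rho_lt hs (negIdx c) _ (coe_negIdx c), twoRho_neg, h3]
    rw [show (-2 * -twoRho N (c : ℤ)) = 2 * twoRho N c by ring]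
    have h4 : (if 0 < -(c : ℤ) then kConst s else 0) = if (c : ℤ) < 0 then kConst s else 0 :=
      if_congr (by omega) rfl rfl
    rw [h4]
    split_ifs <;> ring
  · simp only [if_neg hc, sum_rho_lt hs J _ hJ]
    split_ifs <;> ring

end RMatrix

end QEuclid

/-! ### The quadratic relation of the braid matrix -/

namespace QEuclid

section RMatrix

variable {N : ℕ} {s : ℂ}

theorem rhat_neg_neg (s : ℂ) (i c : Idx N) :
    rhat N s (i, negIdx i) (c, negIdx c) =
      (if (c : ℤ) = -i then zConst s i else 0)
        + (if (c : ℤ) = i ∧ (i : ℤ) < 0 then kConst s else 0)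
        - (if (c : ℤ) < -i then kConst s * s ^ (-twoRho N c - twoRho N i) else 0) := by
  rw [rhat_apply_neg, if_pos rfl]
  simp only [idx_ext_iff, coe_negIdx]

theorem rhat_mul_apply (M : Matrix (Idx N × Idx N) (Idx N × Idx N) ℂ) (i j : Idx N)
    (v : Idx N × Idx N) :
    (rhat N s * M) (i, j) v = ∑ k, ∑ l, rhat N s (i, j) (k, l) • M (k, l) v := by
  rw [Matrix.mul_apply, Fintype.sum_prod_type]
  rfl

/-- The quadratic relation of `R̂` modulo the trace part. -/
theorem rhat_sq (hs : s ≠ 0) :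
    rhat N s * rhat N s = kConst s • rhat N s + 1 - (kConst s * muConst N s) • gg N s := by
  ext ⟨i, j⟩ ⟨c, d⟩
  have hR : ∀ u v, (kConst s • rhat N s + 1 - (kConst s * muConst N s) • gg N s) u v =
      kConst s * rhat N s u v + (if u = v then 1 else 0)
        - kConst s * muConst N s * (gMat N s u.1 u.2 * gMat N s v.1 v.2) := fun u v => by
    simp only [Matrix.sub_apply, Matrix.add_apply, Matrix.smul_apply, smul_eq_mul, gg,
      Matrix.of_apply, Matrix.one_apply]
  rw [rhat_mul_apply, hR]
  simp only [Prod.mk.injEq]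
  by_cases hj : j = negIdx i
  · subst hj
    rw [rhat_sum_neg s (fun k l => rhat N s (k, l) (c, d))]
    by_cases hd : d = negIdx c
    · subst hd
      simp only [smul_eq_mul]
      rw [mul_right_comm, sum_lt_rhat_neg hs (negIdx i) c _ (coe_negIdx i)]
      have e1 : rhat N s (negIdx i, i) (c, negIdx c) =
          (if (c : ℤ) = i then zConst s i else 0)
        + (if (c : ℤ) = -i ∧ -(i : ℤ) < 0 then kConst s else 0)
        - (if (c : ℤ) < i then kConst s * s ^ (-twoRho N c + twoRho N i) else 0) := by
        have := rhat_neg_neg s (negIdx i) c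
        rw [negIdx_negIdx] at this
        rw [this]
        simp only [coe_negIdx, neg_neg, twoRho_neg, sub_neg_eq_add]
        simp [zConst]
      have e2 : (i = c ∧ negIdx i = negIdx c) = ((c : ℤ) = i) := by
        rw [negIdx_inj, and_self, idx_ext_iff]; exact propext eq_comm
      have e3 : zConst s (-(i : ℤ)) = zConst s i := by simp [zConst]
      rw [rhat_neg_neg, e1, gMat_neg, gMat_neg]
      simp only [e2, e3, twoRho_neg]
      have hk : kConst s = s ^ 2 - (s ^ 2)⁻¹ := rfl
      have hz : zConst s (i : ℤ) = if (i : ℤ) = 0 then 1 else (s ^ 2)⁻¹ := rfl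
      have hzc : zConst s (c : ℤ) = if (c : ℤ) = 0 then 1 else (s ^ 2)⁻¹ := rfl
      have hu0 : (i : ℤ) = 0 → s ^ twoRho N (i : ℤ) = 1 := by
        intro h; rw [h, twoRho_zero, zpow_zero]
      have hci : (c : ℤ) = i → s ^ twoRho N (c : ℤ) = s ^ twoRho N (i : ℤ) := by
        intro h; rw [h]
      have hci' : (c : ℤ) = -i → s ^ twoRho N (c : ℤ) = (s ^ twoRho N (i : ℤ))⁻¹ := by
        intro h; rw [h, twoRho_neg, zpow_neg]
      simp only [show ∀ x y : ℤ, -x - y = -x + -y from fun x y => by ring,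
        show ∀ x : ℤ, 2 * x = x + x from fun x => by ring,
        show ∀ x : ℤ, -2 * -x = x + x from fun x => by ring, zpow_add₀ hs, zpow_neg]
      have hu := zpow_ne_zero (twoRho N (i : ℤ)) hs
      have hv := zpow_ne_zero (twoRho N (c : ℤ)) hs
      -- Now u = q^{ρ_i} and v = q^{ρ_c} are free nonzero variables, related only if c = ±i and
      -- fixed only if the index is 0. Each relative position of i, -i, c and 0 leaves a rational
      -- identity.
      generalize s ^ twoRho N (i : ℤ) = u at *
      generalize s ^ twoRho N (c : ℤ) = v at *
      generalize muConst N s = μ at *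
      generalize (i : ℤ) = a at *
      generalize (c : ℤ) = b at *
      clear e1 e2 e3
      rcases lt_trichotomy a 0 with ha | ha | ha <;> rcases lt_trichotomy b a with hb | hb | hb <;>
        rcases lt_trichotomy b (-a) with hc | hc | hc <;> first
        | omega
        | (by_cases hb0 : b < 0 <;> by_cases hb1 : b = 0 <;> first
           | omega
           | (simp (disch := omega) only [if_pos, if_neg] at hz hzc ⊢
              try simp (disch := omega) only [hci, hci']
              try simp (disch := omega) only [hu0]
              simp only [hz, hzc, hk]
              field_simp
              ring))
    · have h1 : ∀ k : Idx N, rhat N s (k, negIdx k) (c, d) = 0 := fun k => by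
        rw [rhat_apply_neg, if_neg hd]
      have h2 : rhat N s (negIdx i, i) (c, d) = 0 := by
        have := h1 (negIdx i)
        rwa [negIdx_negIdx] at this
      simp only [h1, h2]
      rw [gMat_apply s c d, if_neg hd, if_neg (c := _ ∧ _)]
      · simp
      · exact fun h => hd (h.1 ▸ h.2.symm)
  · have hj' : (j : ℤ) ≠ -(i : ℤ) := by rw [idx_ext_iff] at hj; simpa using hj
    rw [rhat_sum_ne s (fun k l => rhat N s (k, l) (c, d)) _ _ hj', gMat_apply s i j, if_neg hj,
      rhat_apply_ne s j i _ _ (fun h => hj' (by omega)), rhat_apply_ne s i j _ _ hj']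
    -- Off the opposite pairs R̂ is of Hecke type: R̂² = k R̂ + 1 on blocks of size one and two.
    have hk : s ^ 2 * s ^ 2 = kConst s * s ^ 2 + 1 := by unfold kConst; field_simp; ring
    by_cases h : i = j
    · subst h
      by_cases h1 : c = i ∧ d = i
      · simp [h1, hk]
      · rw [if_neg (c := i = c ∧ _) (fun h => h1 ⟨h.1.symm, h.2.symm⟩)]
        simp [h1]
    · have e1 : (i = c ∧ j = d) = (c = i ∧ d = j) := by simp only [eq_comm]
      simp only [e1]
      rcases lt_trichotomy (i : ℤ) j with hlt | hlt | hlt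
      · simp only [if_neg h, if_neg (Ne.symm h), if_pos hlt, if_neg (not_lt_of_gt hlt)]
        simp only [smul_eq_mul, ite_self]
        split_ifs <;> ring
      · exact absurd (idx_ext_iff.2 hlt) h
      · simp only [if_neg h, if_neg (Ne.symm h), if_pos hlt, if_neg (not_lt_of_gt hlt)]
        simp only [smul_eq_mul, ite_self]
        split_ifs <;> ring

end RMatrix

end QEuclid

/-! ### Inverse, reflection symmetry and crossing -/

namespace QEuclid

section RMatrix

variable {N : ℕ} {s : ℂ}

/-- The inverse braid matrix. -/
noncomputable def rhatInv (N : ℕ) (s : ℂ) : Matrix (Idx N × Idx N) (Idx N × Idx N) ℂ :=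
  rhat N s - kConst s • 1 + kConst s • gg N s

theorem muConst_ne (hs : s ≠ 0) : muConst N s ≠ 0 := zpow_ne_zero _ hs

theorem rhat_mul_gg (hs : s ≠ 0) : rhat N s * gg N s = muConst N s • gg N s := by
  ext ⟨i, j⟩ v
  have h : ∀ k l, rhat N s (i, j) (k, l) • gg N s (k, l) v
      = rhat N s (i, j) (k, l) * gMat N s k l * gMat N s v.1 v.2 := fun k l => by
    simp only [gg, Matrix.of_apply, smul_eq_mul, mul_assoc]
  rw [rhat_mul_apply]
  simp only [h, ← Finset.sum_mul, rhat_g hs]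
  simp only [gg, Matrix.of_apply, Matrix.smul_apply, smul_eq_mul, mul_assoc]

theorem rhat_transpose : (rhat N s).transpose = rhat N s := by
  ext u v
  exact rhat_symm s v u

theorem gg_transpose : (gg N s).transpose = gg N s := by
  ext u v
  simp only [gg, Matrix.transpose_apply, Matrix.of_apply, mul_comm]

theorem gg_mul_rhat (hs : s ≠ 0) : gg N s * rhat N s = muConst N s • gg N s := by
  have h := congrArg Matrix.transpose (rhat_mul_gg (N := N) hs)
  rwa [Matrix.transpose_mul, rhat_transpose, gg_transpose, Matrix.transpose_smul,
    gg_transpose] at h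

theorem gg_mul_gg : gg N s * gg N s = gTrace N s • gg N s := by
  ext u v
  rw [Matrix.mul_apply, Fintype.sum_prod_type]
  simp only [gg, Matrix.of_apply, Matrix.smul_apply, smul_eq_mul, gTrace, Finset.sum_mul]
  refine Finset.sum_congr rfl fun i _ => Finset.sum_congr rfl fun j _ => by ring

/-- By the quadratic relation R̂ (R̂ - k) is 1 - k μ g g, and R̂ g = μ g repairs the defect. -/
theorem rhat_mul_rhatInv (hs : s ≠ 0) : rhat N s * rhatInv N s = 1 := by
  unfold rhatInv
  rw [mul_add, mul_sub, mul_smul_comm, mul_smul_comm, mul_one, rhat_sq hs, rhat_mul_gg hs]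
  module

theorem rhatInv_mul_rhat (hs : s ≠ 0) : rhatInv N s * rhat N s = 1 := by
  unfold rhatInv
  rw [add_mul, sub_mul, smul_mul_assoc, smul_mul_assoc, one_mul, rhat_sq hs, gg_mul_rhat hs]
  module

theorem kConst_inv (s : ℂ) : kConst s⁻¹ = -kConst s := by
  unfold kConst; rw [inv_pow, inv_inv]; ring

theorem gMat_flip (s : ℂ) (i j : Idx N) : gMat N s⁻¹ (negIdx i) (negIdx j) = gMat N s i j := by
  rw [gMat_apply, gMat_apply]
  simp only [negIdx_inj, coe_negIdx, twoRho_neg, neg_neg, inv_zpow, zpow_neg]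

theorem rhatInv_apply (s : ℂ) (i j k l : Idx N) : rhatInv N s (i, j) (k, l) =
    rhat N s (i, j) (k, l) - kConst s * (if i = k ∧ j = l then 1 else 0)
      + kConst s * (gMat N s i j * gMat N s k l) := by
  simp only [rhatInv, gg, Matrix.sub_apply, Matrix.add_apply, Matrix.smul_apply, smul_eq_mul,
    Matrix.of_apply, Matrix.one_apply, Prod.mk.injEq]

/-- Inverting q changes the sign of k, and the reflection i ↦ -i reverses the order of the indices;
together they invert R̂. This symmetry yields the barred calculus from the unbarred one and
relations for the λ_a from those for the x^i. -/
theorem rhat_flip (hs : s ≠ 0) (i j k l : Idx N) :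
    rhat N s⁻¹ (negIdx i, negIdx j) (negIdx k, negIdx l) = rhatInv N s (i, j) (k, l) := by
  rw [rhatInv_apply]
  by_cases hj : j = negIdx i
  · subst hj
    rw [rhat_apply_neg, rhat_apply_neg]
    by_cases hl : l = negIdx k
    · subst hl
      rw [if_pos rfl, if_pos rfl, gMat_neg, gMat_neg]
      simp only [idx_ext_iff, coe_negIdx, twoRho_neg, neg_neg, kConst_inv, inv_zpow, zpow_neg,
        sub_neg_eq_add, show ∀ x y : ℤ, -x - y = -x + -y from fun x y => by ring,
        zpow_add₀ hs, zpow_add₀ (inv_ne_zero hs)]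
      have hz : zConst s⁻¹ (-(i : ℤ)) = if (i : ℤ) = 0 then 1 else s ^ 2 := by simp [zConst]
      have hz' : zConst s (i : ℤ) = if (i : ℤ) = 0 then 1 else (s ^ 2)⁻¹ := rfl
      have hki : (k : ℤ) = -i → s ^ twoRho N (k : ℤ) = (s ^ twoRho N (i : ℤ))⁻¹ := by
        intro h; rw [h, twoRho_neg, zpow_neg]
      have hu := zpow_ne_zero (twoRho N (i : ℤ)) hs
      have hv := zpow_ne_zero (twoRho N (k : ℤ)) hs
      have hk : kConst s = s ^ 2 - (s ^ 2)⁻¹ := rfl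
      generalize s ^ twoRho N (i : ℤ) = u at *
      generalize s ^ twoRho N (k : ℤ) = v at *
      generalize (i : ℤ) = a at *
      generalize (k : ℤ) = b at *
      rcases lt_trichotomy a 0 with ha | ha | ha <;> rcases lt_trichotomy b a with hb | hb | hb <;>
        rcases lt_trichotomy b (-a) with hc | hc | hc <;> first
        | omega
        | (simp (disch := omega) only [if_pos, if_neg] at hz hz' ⊢
           try simp (disch := omega) only [hki]
           simp only [hz, hz', hk]
           field_simp
           ring)
    · rw [if_neg hl, if_neg (by rwa [negIdx_inj]), if_neg (c := _ ∧ _), gMat_apply s k l, if_neg hl]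
      · ring
      · exact fun h => hl (h.1 ▸ h.2.symm)
  · have hj' : (j : ℤ) ≠ -(i : ℤ) := by rw [idx_ext_iff] at hj; simpa using hj
    rw [gMat_apply s i j, if_neg hj, rhat_apply_ne s i j _ _ hj',
      rhat_apply_ne s⁻¹ (negIdx i) (negIdx j) _ _ (by simp only [coe_negIdx]; omega)]
    simp only [negIdx_inj, coe_negIdx, kConst_inv]
    have hk : kConst s = s ^ 2 - (s ^ 2)⁻¹ := rfl
    have e : (i = k ∧ j = l) = (k = i ∧ l = j) := by simp only [eq_comm]
    simp only [e]
    rcases lt_trichotomy (i : ℤ) j with hlt | hlt | hlt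
    · have h : i ≠ j := fun h => by rw [h] at hlt; exact lt_irrefl _ hlt
      simp (disch := omega) only [if_pos, if_neg, h, if_false]
      split_ifs <;> ring
    · obtain rfl : i = j := idx_ext_iff.2 hlt
      simp only [lt_irrefl, if_false, if_true, hk]
      split_ifs <;> ring
    · have h : i ≠ j := fun h => by rw [h] at hlt; exact lt_irrefl _ hlt
      simp (disch := omega) only [if_pos, if_neg, h, if_false]
      split_ifs <;> ring

/-- The crossing relation between `R̂`, its inverse and the metric. -/
theorem rhat_crossing (hs : s ≠ 0) (a b c f : Idx N) :
    rhat N s (a, b) (f, negIdx c) * gMat N s (negIdx c) c =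
      gMat N s a (negIdx a) * rhatInv N s (b, c) (negIdx a, f) := by
  rw [rhatInv_apply, gMat_neg, gMat_neg']
  have hk : kConst s = s ^ 2 - (s ^ 2)⁻¹ := rfl
  -- The two sides involve entries of R̂ at (a, b) and at (b, c), so the cases are whether these
  -- pairs are opposite. If both are, only f = c contributes.
  by_cases hb : b = negIdx a
  · subst hb
    rw [rhat_apply_neg]
    simp only [negIdx_inj]
    by_cases hca : c = a
    · subst hca
      have h1 := rhat_apply_neg s (negIdx c) (negIdx c) f
      rw [negIdx_negIdx] at h1
      rw [h1, gMat_neg']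
      by_cases hf : f = c
      · subst hf
        rw [gMat_neg']
        have hu := zpow_ne_zero (twoRho N (f : ℤ)) hs
        have hz : zConst s (f : ℤ) = if (f : ℤ) = 0 then 1 else (s ^ 2)⁻¹ := rfl
        have hz' : zConst s (-(f : ℤ)) = if (f : ℤ) = 0 then 1 else (s ^ 2)⁻¹ := by simp [zConst]
        have h0 : (f : ℤ) = 0 → s ^ twoRho N (f : ℤ) = 1 := by
          intro h; rw [h, twoRho_zero, zpow_zero]
        simp only [idx_ext_iff, coe_negIdx, if_true, true_and, and_true, twoRho_neg,
          sub_eq_add_neg, zpow_add₀ hs, zpow_neg, neg_neg,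
          hz, hz']
        generalize s ^ twoRho N (f : ℤ) = u at *
        generalize (f : ℤ) = x at *
        rcases lt_trichotomy x 0 with h | h | h
        · simp (disch := omega) only [if_pos, if_neg]
          field_simp
          ring
        · simp (disch := omega) only [if_pos, if_neg, h0]
          field_simp
          ring
        · simp (disch := omega) only [if_pos, if_neg]
          field_simp
          ring
      · have hg : gMat N s (negIdx c) f = 0 := by
          rw [gMat_apply, negIdx_negIdx, if_neg hf]
        simp [hf, Ne.symm hf, hg]
    · have hg : gMat N s (negIdx a) c = 0 := by
        rw [gMat_apply, negIdx_negIdx, if_neg hca]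
      rw [hg, rhat_apply_ne s (negIdx a) c _ _ (by rw [idx_ext_iff] at hca; simpa using hca)]
      by_cases hf : c = f
      · subst hf
        have hz : zConst s (a : ℤ) = if (a : ℤ) = 0 then 1 else (s ^ 2)⁻¹ := rfl
        have hac : (c : ℤ) = -a → s ^ twoRho N (c : ℤ) = (s ^ twoRho N (a : ℤ))⁻¹ := by
          intro h; rw [h, twoRho_neg, zpow_neg]
        simp only [idx_ext_iff, if_true, and_true, hz, zero_mul] at hca ⊢
        obtain ⟨w, hw⟩ : ∃ w : ℤ, w = ((negIdx a : Idx N) : ℤ) := ⟨_, rfl⟩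
        have hwa : w = -(a : ℤ) := hw
        simp only [← hw]
        clear hw
        simp only [show ∀ x y : ℤ, -x - y = -x + -y from fun x y => by ring, zpow_add₀ hs, zpow_neg]
        have hu := zpow_ne_zero (twoRho N (a : ℤ)) hs
        have hv := zpow_ne_zero (twoRho N (c : ℤ)) hs
        generalize s ^ twoRho N (a : ℤ) = u at *
        generalize s ^ twoRho N (c : ℤ) = v at *
        generalize (a : ℤ) = x at *
        generalize (c : ℤ) = y at *
        rcases lt_trichotomy y (-x) with h | h | h
        · simp (disch := omega) only [if_pos, if_neg]
          field_simp
          ring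
        · have hx : x ≠ 0 := by omega
          simp (disch := omega) only [if_pos, if_neg, hac]
          simp only [hk]
          field_simp
          ring
        · simp (disch := omega) only [if_pos, if_neg]
          field_simp
          ring
      · have h1 : ¬ (negIdx a = c ∧ f = negIdx a) := fun h => hf (by rw [h.2, h.1])
        simp [h1, hf, Ne.symm hf]
  · have hb' : (b : ℤ) ≠ -(a : ℤ) := by rw [idx_ext_iff] at hb; simpa using hb
    rw [rhat_apply_ne s a b _ _ hb']
    by_cases hc : c = negIdx b
    · subst hc
      rw [rhat_apply_neg, gMat_neg, gMat_apply s (negIdx a) f]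
      simp only [negIdx_inj, coe_negIdx, twoRho_neg, negIdx_negIdx]
      by_cases hf : f = a
      · subst hf
        have hz : zConst s (b : ℤ) = if (b : ℤ) = 0 then 1 else (s ^ 2)⁻¹ := rfl
        have hab : (f : ℤ) = b → s ^ twoRho N (b : ℤ) = (s ^ twoRho N (f : ℤ)) := by
          intro h; rw [h]
        have e1 : (b = negIdx f) = False := by simp [hb]
        simp only [idx_ext_iff, coe_negIdx, hz] at hb ⊢
        simp only [if_true, and_true, sub_eq_add_neg, zpow_add₀ hs, zpow_neg]
        have hu := zpow_ne_zero (twoRho N (f : ℤ)) hs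
        have hv := zpow_ne_zero (twoRho N (b : ℤ)) hs
        generalize s ^ twoRho N (f : ℤ) = u at *
        generalize s ^ twoRho N (b : ℤ) = v at *
        generalize (f : ℤ) = x at *
        generalize (b : ℤ) = y at *
        rcases lt_trichotomy x y with h | h | h <;>
        · simp (disch := omega) only [if_pos, if_neg]
          try simp (disch := omega) only [hab]
          simp only [hk]
          field_simp
          try ring
      · have h1 : ¬ (f = b ∧ b = a) := fun h => hf (h.1.trans h.2)
        have h2 : ¬ (b = negIdx a ∧ negIdx b = f) := fun h => hb h.1
        simp [h1, h2, hf]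
    · rw [gMat_apply s b c, if_neg hc,
        rhat_apply_ne s b c _ _ (by rw [idx_ext_iff] at hc; simpa using hc)]
      have h2 : ¬ (b = negIdx a ∧ c = f) := fun h => hb h.1
      have h3 : ¬ (f = a ∧ negIdx c = b) := fun h => hc (by rw [← h.2, negIdx_negIdx])
      have h4 : ¬ (negIdx a = b ∧ f = c) := fun h => hb h.1.symm
      simp only [if_neg h2, if_neg h3, if_neg h4]
      by_cases h5 : f = b ∧ negIdx c = a
      · obtain ⟨rfl, rfl⟩ := h5
        have h6 : f ≠ c := by rintro rfl; exact hb (by simp)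
        have h7 : negIdx c ≠ f := fun h => hc (by rw [← h, negIdx_negIdx])
        simp [h6, h7, twoRho_neg]
      · rw [if_neg h5, if_neg (c := _ ∧ f = b)]
        · ring
        · exact fun h => h5 ⟨h.2, by rw [← h.1, negIdx_negIdx]⟩

end RMatrix

end QEuclid

/-! ### Spectral decomposition of the braid matrix -/

namespace QEuclid

section Projectors

variable {N : ℕ} {s : ℂ}

/-- The factorization shows that the trace vanishes only if q^{1-N} is q or -q⁻¹, which is
impossible for generic `s`. -/
theorem k_mul_gTrace_eq (hN : 3 ≤ N) (hs : s ≠ 0) :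
    kConst s * gTrace N s = (s ^ 2 - muConst N s) * (1 + (s ^ 2)⁻¹ * (muConst N s)⁻¹) := by
  rw [k_mul_gTrace (by omega) hs, kConst]
  have := muConst_ne (N := N) hs
  field_simp
  ring

theorem sq_sub_mu_ne (hN : 3 ≤ N) (hs : Generic s) : s ^ 2 - muConst N s ≠ 0 := by
  intro h
  apply hs.zpow_ne (m := 2) (k := 2 - 2 * (N : ℤ)) (by omega)
  rw [muConst] at h
  exact_mod_cast sub_eq_zero.1 h

theorem one_add_mu_ne (hs : Generic s) : 1 + (s ^ 2)⁻¹ * (muConst N s)⁻¹ ≠ 0 := by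
  have h : (s ^ 2)⁻¹ * (muConst N s)⁻¹ = s ^ (-2 - (2 - 2 * (N : ℤ))) := by
    rw [zpow_sub₀ hs.ne_zero, muConst, div_eq_mul_inv]
    congr 1
  rw [h]
  exact hs.one_add_zpow _

theorem gTrace_ne (hN : 3 ≤ N) (hs : Generic s) : gTrace N s ≠ 0 := by
  have h := k_mul_gTrace_eq hN hs.ne_zero
  intro h0
  rw [h0, mul_zero] at h
  exact mul_ne_zero (sq_sub_mu_ne hN hs) (one_add_mu_ne hs) h.symm

/-- The trace is 2 only if q^{1-N} is q⁻¹ or -q. The number 2 minus the trace is a factor of the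
equation that determines the compatible flips (`eq_qrhat_zpow_of_compat`). -/
theorem gTrace_ne_two (hN : 3 ≤ N) (hs : Generic s) : gTrace N s ≠ 2 := by
  intro h0
  have h := k_mul_gTrace (N := N) (by omega) hs.ne_zero
  have h1 : ((muConst N s)⁻¹ - s ^ 2) * (1 + (s ^ 2)⁻¹ * muConst N s) = 0 := by
    have hk : kConst s = s ^ 2 - (s ^ 2)⁻¹ := rfl
    rw [h0, hk] at h
    have := muConst_ne (N := N) hs.ne_zero
    have := hs.ne_zero
    field_simp at h ⊢
    linear_combination -h
  rcases mul_eq_zero.1 h1 with h2 | h2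
  · apply hs.zpow_ne (m := 2) (k := -(2 - 2 * (N : ℤ))) (by omega)
    rw [zpow_neg, ← muConst]
    exact_mod_cast (sub_eq_zero.1 h2).symm
  · have h : (s ^ 2)⁻¹ * (muConst N s) = s ^ (-2 + (2 - 2 * (N : ℤ))) := by
      rw [zpow_add₀ hs.ne_zero, muConst]
      congr 1
    rw [h] at h2
    exact hs.one_add_zpow _ h2

theorem sq_add_ne (hs : Generic s) : s ^ 2 + (s ^ 2)⁻¹ ≠ 0 := by
  have h := hs.one_add_zpow 4
  have h0 := hs.ne_zero
  intro h1
  apply h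
  field_simp at h1
  norm_cast
  linear_combination h1

theorem projT_eq : projT N s = (gTrace N s)⁻¹ • gg N s := by
  ext u v
  simp only [projT, gg, gTrace, Matrix.of_apply, Matrix.smul_apply, smul_eq_mul]

theorem projA_eq : projA N s = (s ^ 2 + (s ^ 2)⁻¹)⁻¹ •
    ((s ^ 2) • (1 : Matrix (Idx N × Idx N) (Idx N × Idx N) ℂ) - rhat N s
      + (muConst N s - s ^ 2) • projT N s) := rfl

theorem gg_eq (hN : 3 ≤ N) (hs : Generic s) : gg N s = gTrace N s • projT N s := by
  rw [projT_eq, smul_smul, mul_inv_cancel₀ (gTrace_ne hN hs), one_smul]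

theorem rhat_mul_projT (hs : s ≠ 0) : rhat N s * projT N s = muConst N s • projT N s := by
  rw [projT_eq, mul_smul_comm, rhat_mul_gg hs, smul_comm]

theorem projT_mul_rhat (hs : s ≠ 0) : projT N s * rhat N s = muConst N s • projT N s := by
  rw [projT_eq, smul_mul_assoc, gg_mul_rhat hs, smul_comm]

theorem projT_mul_projT (hN : 3 ≤ N) (hs : Generic s) : projT N s * projT N s = projT N s := by
  have := gTrace_ne hN hs
  rw [projT_eq, smul_mul_assoc, mul_smul_comm, gg_mul_gg, smul_smul, smul_smul]
  congr 1
  field_simp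

theorem rhat_sq' (hN : 3 ≤ N) (hs : Generic s) : rhat N s * rhat N s = kConst s • rhat N s + 1
    - (muConst N s * (kConst s + (muConst N s)⁻¹ - muConst N s)) • projT N s := by
  rw [rhat_sq hs.ne_zero, gg_eq hN hs, smul_smul, ← k_mul_gTrace (by omega) hs.ne_zero]
  congr 2
  ring

theorem projT_mul_projA (hN : 3 ≤ N) (hs : Generic s) : projT N s * projA N s = 0 := by
  rw [projA_eq, mul_smul_comm, mul_add, mul_sub, mul_smul_comm, mul_smul_comm, mul_one,
    projT_mul_projT hN hs, projT_mul_rhat hs.ne_zero]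
  module

/-- P_a is a combination of R̂, 1 and the trace part, and the quadratic relation makes R̂ P_a such a
combination again. Idempotence of P_a then follows by inserting the eigenvalue into its definition.
-/
theorem rhat_mul_projA (hN : 3 ≤ N) (hs : Generic s) :
    rhat N s * projA N s = -(s ^ 2)⁻¹ • projA N s := by
  rw [projA_eq, mul_smul_comm, mul_add, mul_sub, mul_smul_comm, mul_smul_comm, mul_one,
    rhat_mul_projT hs.ne_zero, rhat_sq' hN hs, smul_comm (-(s ^ 2)⁻¹)]
  congr 1
  have h0 := hs.ne_zero
  have := muConst_ne (N := N) hs.ne_zero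
  unfold kConst
  match_scalars <;> field_simp <;> ring

theorem projA_mul_projA (hN : 3 ≤ N) (hs : Generic s) : projA N s * projA N s = projA N s := by
  conv_lhs => lhs; rw [projA_eq]
  rw [smul_mul_assoc, add_mul, sub_mul, smul_mul_assoc, smul_mul_assoc, one_mul,
    rhat_mul_projA hN hs, projT_mul_projA hN hs, smul_zero, add_zero, ← sub_smul, smul_smul,
    sub_neg_eq_add, inv_mul_cancel₀ (sq_add_ne hs), one_smul]

theorem rhat_eq (hs : Generic s) : rhat N s =
    s ^ 2 • projS N s - (s ^ 2)⁻¹ • projA N s + muConst N s • projT N s := by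
  have h : (s ^ 2 + (s ^ 2)⁻¹) • projA N s = (s ^ 2) • (1 : Matrix _ _ ℂ) - rhat N s
      + (muConst N s - s ^ 2) • projT N s := by
    rw [projA_eq, smul_smul, mul_inv_cancel₀ (sq_add_ne hs), one_smul]
  have h2 : rhat N s = (s ^ 2) • (1 : Matrix _ _ ℂ) - (s ^ 2 + (s ^ 2)⁻¹) • projA N s
      + (muConst N s - s ^ 2) • projT N s := by rw [h]; abel
  rw [h2, projS]
  module

theorem rhatInv_eq (hN : 3 ≤ N) (hs : Generic s) : rhatInv N s =
    (s ^ 2)⁻¹ • projS N s - s ^ 2 • projA N s + (muConst N s)⁻¹ • projT N s := by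
  have h : rhatInv N s = rhat N s - kConst s • 1
      + (kConst s + (muConst N s)⁻¹ - muConst N s) • projT N s := by
    rw [rhatInv, gg_eq hN hs, smul_smul, k_mul_gTrace (by omega) hs.ne_zero]
  rw [h, rhat_eq hs, projS, kConst]
  module

/-- The matrices `(q R̂)^{±1}`. -/
theorem qrhat_zpow_one : (s ^ 2 • rhat N s) ^ (((1 : ℤˣ) : ℤ)) = s ^ 2 • rhat N s := by
  rw [Units.val_one, zpow_one]

theorem qrhat_zpow_neg_one (hs : s ≠ 0) :
    (s ^ 2 • rhat N s) ^ (((-1 : ℤˣ) : ℤ)) = (s ^ 2)⁻¹ • rhatInv N s := by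
  rw [Units.val_neg, Units.val_one, zpow_neg_one]
  apply Matrix.inv_eq_right_inv
  rw [smul_mul_assoc, mul_smul_comm, smul_smul, rhat_mul_rhatInv hs,
    mul_inv_cancel₀ (pow_ne_zero 2 hs), one_smul]

theorem qrhat_zpow_mul (hs : s ≠ 0) (δ : ℤˣ) :
    (s ^ 2 • rhat N s) ^ (δ : ℤ) * (s ^ 2 • rhat N s) ^ ((-δ : ℤˣ) : ℤ) = 1 := by
  rcases Int.units_eq_one_or δ with rfl | rfl
  · rw [qrhat_zpow_neg_one hs, qrhat_zpow_one, smul_mul_assoc, mul_smul_comm, smul_smul,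
      rhat_mul_rhatInv hs, mul_inv_cancel₀ (pow_ne_zero 2 hs), one_smul]
  · rw [neg_neg, qrhat_zpow_neg_one hs, qrhat_zpow_one, smul_mul_assoc, mul_smul_comm, smul_smul,
      rhatInv_mul_rhat hs, inv_mul_cancel₀ (pow_ne_zero 2 hs), one_smul]

theorem qrhat_zpow_eq (hN : 3 ≤ N) (hs : Generic s) (δ : ℤˣ) :
    (s ^ 2 • rhat N s) ^ (δ : ℤ) = s ^ (4 * (δ : ℤ)) • projS N s - projA N s
      + s ^ ((4 - 2 * (N : ℤ)) * (δ : ℤ)) • projT N s := by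
  have h0 := hs.ne_zero
  have hμ : s ^ (4 - 2 * (N : ℤ)) = s ^ 2 * muConst N s := by
    rw [muConst, show (4 - 2 * (N : ℤ)) = 2 + (2 - 2 * N) by ring, zpow_add₀ h0]
    norm_cast
  rcases Int.units_eq_one_or δ with rfl | rfl
  · rw [qrhat_zpow_one, rhat_eq hs, Units.val_one, mul_one, mul_one, hμ]
    have : s ^ (4 : ℤ) = s ^ 4 := by norm_cast
    rw [this]
    match_scalars <;> field_simp
  · rw [qrhat_zpow_neg_one h0, rhatInv_eq hN hs, Units.val_neg, Units.val_one, mul_neg_one,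
      mul_neg_one, zpow_neg, zpow_neg, hμ]
    have : s ^ (4 : ℤ) = s ^ 4 := by norm_cast
    rw [this]
    have := muConst_ne (N := N) h0
    match_scalars <;> field_simp

theorem qrhat_zpow_symm (hs : s ≠ 0) (δ : ℤˣ) (u v : Idx N × Idx N) :
    ((s ^ 2 • rhat N s) ^ (δ : ℤ)) u v = ((s ^ 2 • rhat N s) ^ (δ : ℤ)) v u := by
  rcases Int.units_eq_one_or δ with rfl | rfl
  · rw [qrhat_zpow_one, Matrix.smul_apply, Matrix.smul_apply, rhat_symm]
  · rw [qrhat_zpow_neg_one hs, Matrix.smul_apply, Matrix.smul_apply]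
    obtain ⟨i, j⟩ := u
    obtain ⟨k, l⟩ := v
    rw [rhatInv_apply, rhatInv_apply, rhat_symm, mul_comm (gMat N s i j)]
    simp only [eq_comm]

/-- The eigenvalue -1 is its own inverse, which is why both flips agree with the relations of the
2-forms. -/
theorem qrhat_zpow_mul_projA (hN : 3 ≤ N) (hs : Generic s) (δ : ℤˣ) :
    (s ^ 2 • rhat N s) ^ (δ : ℤ) * projA N s = -projA N s := by
  rw [qrhat_zpow_eq hN hs, projS, add_mul, sub_mul, smul_mul_assoc, smul_mul_assoc, sub_mul, sub_mul,
    one_mul, projA_mul_projA hN hs, projT_mul_projA hN hs]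
  module

theorem projA_symm (u v : Idx N × Idx N) : projA N s u v = projA N s v u := by
  have h : (projA N s).transpose = projA N s := by
    rw [projA_eq, projT_eq]
    simp only [Matrix.transpose_smul, Matrix.transpose_add, Matrix.transpose_sub,
      Matrix.transpose_one, rhat_transpose, gg_transpose]
  exact congrFun (congrFun h v) u

end Projectors

end QEuclid

namespace QEuclid

/-! ## `q`-commuting elements -/

section QComm

variable {A : Type*} [Ring A] [Algebra ℂ A] {s : ℂ} {m n : ℤ} {a b c a' b' : A}

/-- `a b = s ^ m b a`. -/
def QComm (s : ℂ) (m : ℤ) (a b : A) : Prop := a * b = s ^ m • (b * a)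

theorem QComm.eq (h : QComm s m a b) : a * b = s ^ m • (b * a) := h

theorem QComm.congr (h : QComm s m a b) (e : m = n) : QComm s n a b := e ▸ h

theorem QComm.of_commute (h : a * b = b * a) : QComm s 0 a b := by
  rw [QComm, zpow_zero, one_smul, h]

theorem QComm.commute (h : QComm s m a b) (hm : m = 0) : a * b = b * a := by
  rw [h.eq, hm, zpow_zero, one_smul]

theorem QComm.refl : QComm s 0 a a := QComm.of_commute rfl

theorem QComm.mul_right (hs : s ≠ 0) (h₁ : QComm s m a b) (h₂ : QComm s n a c) :
    QComm s (m + n) a (b * c) := by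
  rw [QComm, ← mul_assoc, h₁.eq, smul_mul_assoc, mul_assoc, h₂.eq, mul_smul_comm, smul_smul,
    zpow_add₀ hs, mul_assoc]

theorem QComm.mul_left (hs : s ≠ 0) (h₁ : QComm s m a c) (h₂ : QComm s n b c) :
    QComm s (m + n) (a * b) c := by
  rw [QComm, mul_assoc, h₂.eq, mul_smul_comm, ← mul_assoc, h₁.eq, smul_mul_assoc, smul_smul,
    zpow_add₀ hs, mul_assoc, mul_comm (s ^ m)]

theorem QComm.smul_left (h : QComm s m a b) (k : ℂ) : QComm s m (k • a) b := by
  rw [QComm, smul_mul_assoc, h.eq, mul_smul_comm, smul_comm]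

theorem QComm.smul_right (h : QComm s m a b) (k : ℂ) : QComm s m a (k • b) := by
  rw [QComm, smul_mul_assoc, mul_smul_comm, h.eq, smul_comm]

theorem QComm.symm (hs : s ≠ 0) (h : QComm s m a b) : QComm s (-m) b a := by
  rw [QComm, h.eq, smul_smul, ← zpow_add₀ hs, neg_add_cancel, zpow_zero, one_smul]

theorem QComm.inv_right (hs : s ≠ 0) (h : QComm s m a b) (h₁ : b * b' = 1) (h₂ : b' * b = 1) :
    QComm s (-m) a b' := by
  have : b' * (a * b) * b' = s ^ m • (b' * (b * a) * b') := by
    rw [h.eq, mul_smul_comm, smul_mul_assoc]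
  rw [mul_assoc, mul_assoc a, h₁, mul_one, ← mul_assoc b', h₂, one_mul] at this
  rw [QComm, this, smul_smul, ← zpow_add₀ hs, neg_add_cancel, zpow_zero, one_smul]

theorem QComm.inv_left (hs : s ≠ 0) (h : QComm s m a b) (h₁ : a * a' = 1) (h₂ : a' * a = 1) :
    QComm s (-m) a' b := by
  have := ((h.symm hs).inv_right hs h₁ h₂).symm hs
  exact this.congr (by ring)

/-- For the realizations `QD.flip` and `QD.dual`, whose parameter is `s⁻¹`. -/
theorem QComm.invert (h : QComm s m a b) : QComm s⁻¹ (-m) a b := by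
  rw [QComm, h.eq, inv_zpow, zpow_neg, inv_inv]

end QComm

/-! ## Realizations of the relations of `A_N` -/

section Realization

variable {N : ℕ}

/-- The range of the indices of the radii. -/
def InR (N : ℕ) (j : ℤ) : Prop := 0 ≤ j ∧ j ≤ ((N / 2 : ℕ) : ℤ) ∧ (j ≠ 0 ∨ Odd N)

/-- `2 (2 ρ_{m+1} + 2)`. -/
def kap (N : ℕ) (m : ℤ) : ℤ := if Odd N then -4 * m + 2 else -4 * m + 4

theorem kap_eq {i : ℤ} (hi : 1 ≤ i) : kap N i = 2 * twoRho N i := by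
  rw [kap, twoRho_pos (by omega)]; split_ifs <;> ring

theorem kap_sub_one {i : ℤ} (hi : 1 ≤ i) : kap N (i - 1) = 2 * twoRho N i + 4 := by
  rw [kap, twoRho_pos (by omega)]; split_ifs <;> ring

/-- The coefficient in `q^{-ρ_i} [x^{-i}, x^i] = p_{i-1} r_{i-1}^2`. -/
noncomputable def pC (N : ℕ) (s : ℂ) (m : ℤ) : ℂ := (1 - s ^ 4) / (1 + s ^ kap N m)

section
variable {A : Type*} [Ring A] [Algebra ℂ A]

/-- `∑_{|k|, |l| ≤ j} g_{kl} x^k x^l`. -/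
noncomputable def rsq (N : ℕ) (r : ℤ → A) (j : ℤ) : A :=
  open Classical in if j = 0 ∧ ¬ Odd N then 0 else r j * r j

/-- The elements whose successive differences are `(1 - q^2) q^{-ρ_i} x^i x^{-i}`. -/
noncomputable def vfun (N : ℕ) (s : ℂ) (r : ℤ → A) (j : ℤ) : A :=
  if 1 ≤ j then pC N s (j - 1) • rsq N r (j - 1)
  else -((s ^ kap N (-j) * pC N s (-j)) • rsq N r (-j))

/-- Elements of an algebra that satisfy the relations of the generators of `A_N`, with the relations
between `x^i` and `x^{-i}` in explicit form. -/
structure QD (N : ℕ) (s : ℂ) (A : Type*) [Ring A] [Algebra ℂ A] where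
  x : Idx N → A
  r : ℤ → A
  ri : ℤ → A
  Lam : A
  Lami : A
  K : A
  Ki : A
  r_ri : ∀ j, InR N j → r j * ri j = 1
  ri_r : ∀ j, InR N j → ri j * r j = 1
  Lam_Lami : Lam * Lami = 1
  Lami_Lam : Lami * Lam = 1
  K_Ki : K * Ki = 1
  Ki_K : Ki * K = 1
  r_comm : ∀ i j, InR N i → InR N j → r i * r j = r j * r i
  x_x : ∀ i j : Idx N, (i : ℤ) < j → (i : ℤ) ≠ -j → QComm s 2 (x i) (x j)
  x_r : ∀ (i : Idx N) (j : ℤ), InR N j → QComm s (2 * rExp i j) (x i) (r j)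
  x_lam : ∀ i, QComm s 2 (x i) Lam
  r_lam : ∀ j, InR N j → QComm s 2 (r j) Lam
  K_r : ∀ j, InR N j → K * r j = r j * K
  K_lam : K * Lam = Lam * K
  K_x : ¬ Odd N → ∀ i : Idx N, QComm s (2 * kExp i) K (x i)
  x_zero : ∀ i : Idx N, (i : ℤ) = 0 → x i = r 0
  step : ∀ i : Idx N, ((1 - s ^ 4) * s ^ (-twoRho N i)) • (x i * x (negIdx i)) =
    vfun N s r ((i : ℤ) + 1) - vfun N s r i

end

namespace QD

variable {s : ℂ} {A : Type*} [Ring A] [Algebra ℂ A] (𝔇 : QD N s A)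

/-- The elements `V_i`. -/
noncomputable def V (j : ℤ) : A := vfun N s 𝔇.r j

theorem V_of_pos {j : ℤ} (h : 1 ≤ j) : 𝔇.V j = pC N s (j - 1) • rsq N 𝔇.r (j - 1) := if_pos h

theorem V_of_nonpos {j : ℤ} (h : j ≤ 0) :
    𝔇.V j = -((s ^ kap N (-j) * pC N s (-j)) • rsq N 𝔇.r (-j)) := if_neg (by omega)

theorem V_step (i : Idx N) : ((1 - s ^ 4) * s ^ (-twoRho N i)) • (𝔇.x i * 𝔇.x (negIdx i)) =
    𝔇.V ((i : ℤ) + 1) - 𝔇.V i := 𝔇.step i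

theorem one_sub_ne (hs : Generic s) : 1 - s ^ 4 ≠ 0 := fun h =>
  hs.pow_ne 4 (by norm_num) (by linear_combination -h)

/-- Opposite coordinates multiply into the algebra of the commuting radii; there all their relations
become scalar identities. -/
theorem mul_eq (hs : Generic s) (i : Idx N) : 𝔇.x i * 𝔇.x (negIdx i) =
    ((1 - s ^ 4)⁻¹ * s ^ twoRho N i) • (𝔇.V ((i : ℤ) + 1) - 𝔇.V i) := by
  rw [← 𝔇.V_step, smul_smul]
  have h1 := one_sub_ne hs
  have h2 := zpow_ne_zero (twoRho N i) hs.ne_zero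
  rw [zpow_neg]
  field_simp
  rw [one_smul]

theorem neg_mul_eq (hs : Generic s) (i : Idx N) : 𝔇.x (negIdx i) * 𝔇.x i =
    ((1 - s ^ 4)⁻¹ * s ^ (-twoRho N i)) • (𝔇.V (-(i : ℤ) + 1) - 𝔇.V (-(i : ℤ))) := by
  have := 𝔇.mul_eq hs (negIdx i)
  rwa [negIdx_negIdx, coe_negIdx, twoRho_neg] at this

/-- `V_i` in terms of the commutator of `x^{-i}` and `x^i`. -/
theorem V_pos (hs : Generic s) (i : Idx N) (hi : 1 ≤ (i : ℤ)) : 𝔇.V i =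
    s ^ (-twoRho N i) • (𝔇.x (negIdx i) * 𝔇.x i - 𝔇.x i * 𝔇.x (negIdx i)) := by
  rw [𝔇.mul_eq hs, 𝔇.neg_mul_eq hs, 𝔇.V_of_pos hi, 𝔇.V_of_pos (j := i + 1) (by omega),
    𝔇.V_of_nonpos (j := -i) (by omega), 𝔇.V_of_nonpos (j := -i + 1) (by omega)]
  simp only [neg_neg, add_sub_cancel_right, show -(-(i : ℤ) + 1) = i - 1 by ring, pC,
    kap_eq hi, kap_sub_one hi]
  have h1 := hs.one_add_zpow (2 * twoRho N i)
  have h2 := hs.one_add_zpow (2 * twoRho N i + 4)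
  have h3 := one_sub_ne hs
  have h5 : s ^ (2 * twoRho N (i : ℤ)) = s ^ twoRho N (i : ℤ) * s ^ twoRho N (i : ℤ) := by
    rw [← zpow_add₀ hs.ne_zero]; ring_nf
  have h6 : s ^ (2 * twoRho N (i : ℤ) + 4) = s ^ twoRho N (i : ℤ) * s ^ twoRho N (i : ℤ) * s ^ 4 := by
    rw [zpow_add₀ hs.ne_zero, h5]; norm_cast
  have hu := zpow_ne_zero (twoRho N (i : ℤ)) hs.ne_zero
  rw [h5] at h1 ⊢
  rw [h6] at h2 ⊢
  rw [zpow_neg]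
  generalize s ^ twoRho N (i : ℤ) = u at *
  match_scalars <;> field_simp <;> ring

/-- The commutator in `V_pos` eliminates the larger radius r_i; the factor q² here eliminates
r_{i-1} and leaves a multiple of r_i². -/
theorem V_neg (hs : Generic s) (i : Idx N) (hi : 1 ≤ (i : ℤ)) : 𝔇.V (-(i : ℤ)) =
    s ^ twoRho N i • (s ^ 4 • (𝔇.x i * 𝔇.x (negIdx i)) - 𝔇.x (negIdx i) * 𝔇.x i) := by
  rw [𝔇.mul_eq hs, 𝔇.neg_mul_eq hs, 𝔇.V_of_pos hi, 𝔇.V_of_pos (j := i + 1) (by omega),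
    𝔇.V_of_nonpos (j := -i) (by omega), 𝔇.V_of_nonpos (j := -i + 1) (by omega)]
  simp only [neg_neg, add_sub_cancel_right, show -(-(i : ℤ) + 1) = i - 1 by ring, pC,
    kap_eq hi, kap_sub_one hi]
  have h1 := hs.one_add_zpow (2 * twoRho N i)
  have h2 := hs.one_add_zpow (2 * twoRho N i + 4)
  have h3 := one_sub_ne hs
  have h5 : s ^ (2 * twoRho N (i : ℤ)) = s ^ twoRho N (i : ℤ) * s ^ twoRho N (i : ℤ) := by
    rw [← zpow_add₀ hs.ne_zero]; ring_nf
  have h6 : s ^ (2 * twoRho N (i : ℤ) + 4) = s ^ twoRho N (i : ℤ) * s ^ twoRho N (i : ℤ) * s ^ 4 := by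
    rw [zpow_add₀ hs.ne_zero, h5]; norm_cast
  have hu := zpow_ne_zero (twoRho N (i : ℤ)) hs.ne_zero
  rw [h5] at h1 ⊢
  rw [h6] at h2 ⊢
  rw [zpow_neg]
  generalize s ^ twoRho N (i : ℤ) = u at *
  match_scalars <;> field_simp <;> ring

/-- For even N there is no r_0 and `rsq` is 0 at 0. This is the gap condition of `sum_idx_lt`. -/
theorem V_zero_even (hN : ¬ Odd N) : 𝔇.V 0 = 0 ∧ 𝔇.V 1 = 0 := by
  rw [𝔇.V_of_nonpos le_rfl, 𝔇.V_of_pos le_rfl]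
  simp [rsq, hN]

theorem odd_of_zero {i : Idx N} (hi : (i : ℤ) = 0) : Odd N :=
  (idx_mem i).2.2.resolve_left (by simp [hi])

theorem V_zero (hs : Generic s) (i : Idx N) (hi : (i : ℤ) = 0) :
    𝔇.V 0 = (s ^ 4 - s ^ 2) • (𝔇.x i * 𝔇.x i) ∧ 𝔇.V 1 = (1 - s ^ 2) • (𝔇.x i * 𝔇.x i) := by
  have hN := odd_of_zero hi
  rw [𝔇.V_of_nonpos le_rfl, 𝔇.V_of_pos le_rfl, 𝔇.x_zero i hi]
  simp only [rsq, hN, not_true, and_false, if_false, pC, kap, if_true, neg_zero, sub_self]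
  have h := hs.one_add_zpow 2
  norm_num at h ⊢
  norm_cast at h ⊢
  constructor
  · rw [← neg_smul]
    congr 1
    field_simp
    ring
  · congr 1
    field_simp
    ring

end QD

end Realization

end QEuclid

/-! ### The elements λ_a and their commutators with the coordinates -/

namespace QEuclid

namespace QD

variable {N : ℕ} {s : ℂ} {A : Type*} [Ring A] [Algebra ℂ A] (𝔇 : QD N s A)

/-- The exceptional case `N` even and `|a| = 1`. -/
def Exc (N : ℕ) (a : ℤ) : Prop := ¬ Odd N ∧ (a = 1 ∨ a = -1)

theorem inR_abs (a : Idx N) : InR N |(a : ℤ)| := by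
  obtain ⟨h1, h2, h3⟩ := idx_mem a
  exact ⟨abs_nonneg _, abs_le.2 ⟨h1, h2⟩, h3.imp_left (by simp)⟩

theorem inR_abs_sub {a : Idx N} (h : (a : ℤ) ≠ 0) (he : ¬ Exc N a) : InR N (|(a : ℤ)| - 1) := by
  obtain ⟨h1, h2, h3⟩ := idx_mem a
  have := abs_le.2 ⟨h1, h2⟩
  have := Int.one_le_abs h
  refine ⟨by omega, by omega, ?_⟩
  by_contra! hc
  apply he
  refine ⟨by simpa using hc.2, ?_⟩
  rcases abs_choice (a : ℤ) with h | h <;> omega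

theorem inR_one (he : ∃ a : Idx N, Exc N a) : InR N 1 := by
  obtain ⟨a, he⟩ := he
  obtain ⟨h1, h2, h3⟩ := idx_mem a
  refine ⟨by norm_num, ?_, by norm_num⟩
  rcases he.2 with h | h <;> omega

open Classical in
/-- The second radius in `λ_a`, and its analogue in the exceptional cases. -/
noncomputable def rp (a : ℤ) : A :=
  if a = 0 then 𝔇.r 0
  else if Exc N a then (if a = 1 then 𝔇.r 1 * 𝔇.K else 𝔇.r 1 * 𝔇.Ki) else 𝔇.r (|a| - 1)

open Classical in
/-- The inverse of `rp`. -/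
noncomputable def rpi (a : ℤ) : A :=
  if a = 0 then 𝔇.ri 0
  else if Exc N a then (if a = 1 then 𝔇.Ki * 𝔇.ri 1 else 𝔇.K * 𝔇.ri 1) else 𝔇.ri (|a| - 1)

open Classical in
/-- The exponent in the commutation of `x^h` and `rp a`. -/
noncomputable def rpExp (N : ℕ) (h a : ℤ) : ℤ :=
  if a = 0 then rExp h 0 else if Exc N a then (if a = 1 then rExp h 0 else rExp h 1 + kExp h)
  else rExp h (|a| - 1)

/-- For even N the inverse of x^{±1} is 2 r_1⁻² x^{∓1}, so (x^{±1})⁻¹ K^{∓1} is a multiple of r_1⁻¹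
(r_1 K^{±1})⁻¹ x^{∓1}. With r_1 K^{±1} in the place of the second radius one formula covers all λ_a.
-/
theorem rp_mul_rpi (a : Idx N) : 𝔇.rp a * 𝔇.rpi a = 1 ∧ 𝔇.rpi a * 𝔇.rp a = 1 := by
  unfold rp rpi
  by_cases h0 : (a : ℤ) = 0
  · have := inR_abs a
    rw [h0, abs_zero] at this
    rw [if_pos h0, if_pos h0]
    exact ⟨𝔇.r_ri _ this, 𝔇.ri_r _ this⟩
  · rw [if_neg h0, if_neg h0]
    by_cases he : Exc N a
    · rw [if_pos he, if_pos he]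
      have h1 := inR_one ⟨a, he⟩
      have e1 := 𝔇.r_ri _ h1
      have e2 := 𝔇.ri_r _ h1
      split_ifs
      · constructor
        · rw [mul_assoc, ← mul_assoc 𝔇.K, 𝔇.K_Ki, one_mul, e1]
        · rw [mul_assoc, ← mul_assoc (𝔇.ri 1), e2, one_mul, 𝔇.Ki_K]
      · constructor
        · rw [mul_assoc, ← mul_assoc 𝔇.Ki, 𝔇.Ki_K, one_mul, e1]
        · rw [mul_assoc, ← mul_assoc (𝔇.ri 1), e2, one_mul, 𝔇.K_Ki]
    · rw [if_neg he, if_neg he]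
      exact ⟨𝔇.r_ri _ (inR_abs_sub h0 he), 𝔇.ri_r _ (inR_abs_sub h0 he)⟩

theorem x_rp (hs : s ≠ 0) (h a : Idx N) : QComm s (2 * rpExp N h a) (𝔇.x h) (𝔇.rp a) := by
  unfold rp rpExp
  by_cases h0 : (a : ℤ) = 0
  · have := inR_abs a
    rw [h0, abs_zero] at this
    rw [if_pos h0, if_pos h0]
    exact 𝔇.x_r _ _ this
  · rw [if_neg h0, if_neg h0]
    by_cases he : Exc N a
    · rw [if_pos he, if_pos he]
      have h1 := inR_one ⟨a, he⟩
      have hh := (idx_mem h).2.2.resolve_right he.1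
      have hK := (𝔇.K_x he.1 h).symm hs
      split_ifs with h2
      · refine ((𝔇.x_r h 1 h1).mul_right hs hK).congr ?_
        unfold rExp kExp
        have := abs_cases (h : ℤ)
        split_ifs <;> omega
      · refine ((𝔇.x_r h 1 h1).mul_right hs (hK.inv_right hs 𝔇.K_Ki 𝔇.Ki_K)).congr ?_
        ring
    · rw [if_neg he, if_neg he]
      exact 𝔇.x_r _ _ (inR_abs_sub h0 he)

theorem r_rp (hs : s ≠ 0) (j : ℤ) (hj : InR N j) (a : Idx N) : 𝔇.r j * 𝔇.rp a = 𝔇.rp a * 𝔇.r j := by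
  have hK : QComm s 0 (𝔇.r j) 𝔇.K := QComm.of_commute (𝔇.K_r j hj).symm
  unfold rp
  by_cases h0 : (a : ℤ) = 0
  · have := inR_abs a
    rw [h0, abs_zero] at this
    rw [if_pos h0]
    exact 𝔇.r_comm _ _ hj this
  · rw [if_neg h0]
    by_cases he : Exc N a
    · rw [if_pos he]
      have h1 : QComm s 0 (𝔇.r j) (𝔇.r 1) := QComm.of_commute (𝔇.r_comm _ _ hj (inR_one ⟨a, he⟩))
      split_ifs
      · exact (h1.mul_right hs hK).commute rfl
      · exact (h1.mul_right hs (hK.inv_right hs 𝔇.K_Ki 𝔇.Ki_K)).commute (by ring)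
    · rw [if_neg he]
      exact 𝔇.r_comm _ _ hj (inR_abs_sub h0 he)

theorem rp_lam (hs : s ≠ 0) (a : Idx N) : QComm s 2 (𝔇.rp a) 𝔇.Lam := by
  have hK : QComm s 0 𝔇.K 𝔇.Lam := QComm.of_commute 𝔇.K_lam
  unfold rp
  by_cases h0 : (a : ℤ) = 0
  · have := inR_abs a
    rw [h0, abs_zero] at this
    rw [if_pos h0]
    exact 𝔇.r_lam _ this
  · rw [if_neg h0]
    by_cases he : Exc N a
    · rw [if_pos he]
      have h1 := 𝔇.r_lam _ (inR_one ⟨a, he⟩)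
      split_ifs
      · exact (h1.mul_left hs hK).congr rfl
      · exact (h1.mul_left hs (hK.inv_left hs 𝔇.K_Ki 𝔇.Ki_K)).congr rfl
    · rw [if_neg he]
      exact 𝔇.r_lam _ (inR_abs_sub h0 he)

/-- `Λ` times the inverse radii in `λ_a`. -/
noncomputable def W (a : Idx N) : A := 𝔇.Lam * (𝔇.ri |(a : ℤ)| * 𝔇.rpi a)

/-- The elements `λ_a`, without their normalization. -/
noncomputable def lam (a : Idx N) : A := 𝔇.W a * 𝔇.x (negIdx a)

theorem x_W (hs : s ≠ 0) (h a : Idx N) :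
    QComm s (2 - 2 * rExp h |(a : ℤ)| - 2 * rpExp N h a) (𝔇.x h) (𝔇.W a) :=
  ((𝔇.x_lam h).mul_right hs
    (((𝔇.x_r h _ (inR_abs a)).inv_right hs (𝔇.r_ri _ (inR_abs a)) (𝔇.ri_r _ (inR_abs a))).mul_right
      hs ((𝔇.x_rp hs h a).inv_right hs (𝔇.rp_mul_rpi a).1 (𝔇.rp_mul_rpi a).2))).congr (by ring)

/-- The exponent in the commutation of `x^h` and `x^j`, for `h ≠ -j`. -/
noncomputable def xExp (h j : ℤ) : ℤ := if h = j then 0 else if h < j then 2 else -2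

theorem x_xExp (hs : s ≠ 0) (h j : Idx N) (hj : (h : ℤ) ≠ -j) :
    QComm s (xExp h j) (𝔇.x h) (𝔇.x j) := by
  unfold xExp
  rcases lt_trichotomy (h : ℤ) j with h1 | h1 | h1
  · rw [if_neg (by omega), if_pos h1]
    exact 𝔇.x_x _ _ h1 hj
  · rw [if_pos h1, idx_ext_iff.2 h1]
    exact QComm.refl
  · rw [if_neg (by omega), if_neg (by omega)]
    exact (𝔇.x_x _ _ h1 (by omega)).symm hs

open Classical in
/-- The least index above which `[λ_a, x^i] = (1 - q^2) λ_a x^i`. -/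
noncomputable def thr (N : ℕ) (a : ℤ) : ℤ := if Exc N a ∧ a = -1 then 2 else a + 1

theorem idx_ne_zero_of_exc {a : ℤ} (he : Exc N a) (i : Idx N) : (i : ℤ) ≠ 0 :=
  (idx_mem i).2.2.resolve_right he.1

/-- The weights of Λ, of the inverse radii and of x^{-a} under x^h either cancel or add up to q². So
[λ_a, x^h] is 0 below the threshold and (1 - q²) λ_a x^h from there on, which makes the matrix of
commutators triangular. -/
theorem x_lam_of_ne (hs : s ≠ 0) (h a : Idx N) (hne : (h : ℤ) ≠ a) :
    QComm s (if thr N a ≤ h then 4 else 0) (𝔇.x h) (𝔇.lam a) := by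
  refine ((𝔇.x_W hs h a).mul_right hs (𝔇.x_xExp hs h (negIdx a) (by simpa using hne))).congr ?_
  have ha := abs_cases (a : ℤ)
  have hh := abs_cases (h : ℤ)
  unfold rExp rpExp xExp thr rExp kExp
  rw [coe_negIdx]
  by_cases he : Exc N a
  · have h0 := idx_ne_zero_of_exc he h
    have h1 := he.2
    simp only [he, true_and, if_true]
    split_ifs <;> omega
  · simp only [he, false_and, if_false]
    split_ifs <;> omega

/-- `x^{-a} x^a - q^e x^a x^{-a}`, such that `[λ_a, x^a] = W_a U_a`. -/
noncomputable def U (a : Idx N) : A := 𝔇.x (negIdx a) * 𝔇.x a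
  - s ^ (2 - 2 * rpExp N a a) • (𝔇.x a * 𝔇.x (negIdx a))

theorem rExp_self (a : ℤ) : rExp a |a| = 0 := by simp [rExp]

theorem lam_comm_self (hs : s ≠ 0) (a : Idx N) :
    𝔇.lam a * 𝔇.x a - 𝔇.x a * 𝔇.lam a = 𝔇.W a * 𝔇.U a := by
  have h := 𝔇.x_W hs a a
  rw [rExp_self] at h
  unfold lam U
  rw [← mul_assoc (𝔇.x a), h.eq, mul_sub, mul_assoc, smul_mul_assoc, mul_smul_comm, mul_assoc,
    show (2 - 2 * 0 - 2 * rpExp N a a) = 2 - 2 * rpExp N a a by ring]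

open Classical in
/-- The exponent in `V_m = q^{-ρ_a} s^e U_a`. -/
noncomputable def uExp (N : ℕ) (a : ℤ) : ℤ := if a < 0 ∧ ¬ Exc N a then 4 else 0

/-- U_a is a q-commutator of the kind met in `V_pos` and `V_neg`, hence one V instead of a
difference of two. This makes [λ_a, x^a] invertible, and it gives the telescoping sums of [λ_a, x^l]
x^{-l} their starting value. -/
theorem V_thr (hs : Generic s) (a : Idx N) :
    𝔇.V (thr N a) = (s ^ (-twoRho N a) * s ^ uExp N a) • 𝔇.U a := by
  have hstep := 𝔇.V_step a
  unfold thr uExp U rpExp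
  by_cases he : Exc N a
  · have hN := he.1
    have ht : twoRho N 1 = 0 := by rw [twoRho_pos one_pos, if_neg hN]; norm_num
    simp only [he, true_and, if_true, not_true, and_false, if_false, zpow_zero, mul_one]
    rcases he.2 with h | h
    · rw [if_neg (by omega), if_neg (by omega), if_pos h]
      have h1 := 𝔇.V_pos hs a (by omega)
      rw [h, (𝔇.V_zero_even hN).2, ht, neg_zero, zpow_zero, one_smul] at h1
      rw [h, (𝔇.V_zero_even hN).2, ht, neg_zero, zpow_zero, mul_one, sub_zero] at hstep
      rw [h, ht, neg_zero, zpow_zero, one_smul, ← hstep, ← sub_eq_zero.1 h1.symm]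
      simp [rExp, sub_smul]
    · have hb : ((negIdx a : Idx N) : ℤ) = 1 := by rw [coe_negIdx, h]; rfl
      have h1 := 𝔇.V_pos hs (negIdx a) (by omega)
      have hstep := 𝔇.V_step (negIdx a)
      rw [negIdx_negIdx, hb, (𝔇.V_zero_even hN).2, ht, neg_zero, zpow_zero, one_smul] at h1
      rw [negIdx_negIdx, hb, (𝔇.V_zero_even hN).2, ht, neg_zero, zpow_zero, mul_one, sub_zero]
        at hstep
      rw [if_pos h, if_neg (by omega), if_neg (by omega), h, twoRho_neg, ht, neg_zero, neg_zero,
        zpow_zero, one_smul, show (2 : ℤ) = 1 + 1 from rfl, ← hstep, ← sub_eq_zero.1 h1.symm]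
      simp [rExp, kExp, sub_smul]
  · simp only [he, false_and, if_false, not_false_iff, and_true]
    rw [sub_eq_iff_eq_add.1 hstep.symm]
    have ha := abs_cases (a : ℤ)
    have e4 : s ^ (4 : ℤ) = s ^ 4 := by norm_cast
    rcases lt_trichotomy (a : ℤ) 0 with h | h | h
    · have h1 := 𝔇.V_neg hs (negIdx a) (by simp only [coe_negIdx]; omega)
      rw [negIdx_negIdx, coe_negIdx, neg_neg, twoRho_neg] at h1
      have e : rExp a (|(a : ℤ)| - 1) = 1 := by unfold rExp; split_ifs <;> omega
      rw [h1, if_pos h, if_neg (by omega), e, e4]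
      norm_num
      module
    · have h1 := (𝔇.V_zero hs a h).1
      have e : rExp 0 0 = 0 := rfl
      have hn : negIdx a = a := by rw [idx_ext_iff, coe_negIdx, h]; rfl
      rw [h, twoRho_zero, h1, if_neg (by omega), if_pos rfl, hn, e]
      norm_num
      norm_cast
      module
    · have h1 := 𝔇.V_pos hs a (by omega)
      have e : rExp a (|(a : ℤ)| - 1) = -1 := by unfold rExp; split_ifs <;> omega
      rw [h1, if_neg (by omega), if_neg (by omega), e]
      norm_num
      module

open Classical in
/-- The radius in `[λ_a, x^a]`. -/
noncomputable def uIdx (N : ℕ) (a : ℤ) : ℤ := if a < 0 ∧ ¬ Exc N a then |a| - 1 else |a|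

theorem inR_uIdx (a : Idx N) : InR N (uIdx N a) := by
  unfold uIdx
  split_ifs with h
  · exact inR_abs_sub (by omega) h.2
  · exact inR_abs a

theorem U_eq (hs : Generic s) (a : Idx N) :
    ∃ c : ℂ, c ≠ 0 ∧ 𝔇.U a = c • (𝔇.r (uIdx N a) * 𝔇.r (uIdx N a)) := by
  have hp : ∀ m, pC N s m ≠ 0 := fun m => div_ne_zero (one_sub_ne hs) (hs.one_add_zpow _)
  have h0 : s ^ (-twoRho N a) * s ^ uExp N a ≠ 0 :=
    mul_ne_zero (zpow_ne_zero _ hs.ne_zero) (zpow_ne_zero _ hs.ne_zero)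
  have h1 : 𝔇.U a = (s ^ (-twoRho N a) * s ^ uExp N a)⁻¹ • 𝔇.V (thr N a) := by
    rw [𝔇.V_thr hs, smul_smul, inv_mul_cancel₀ h0, one_smul]
  have h2 : rsq N 𝔇.r (uIdx N a) = 𝔇.r (uIdx N a) * 𝔇.r (uIdx N a) := by
    have := (inR_uIdx a).2.2
    exact if_neg (by tauto)
  have h3 : ∃ c : ℂ, c ≠ 0 ∧ 𝔇.V (thr N a) = c • rsq N 𝔇.r (uIdx N a) := by
    have ha := abs_cases (a : ℤ)
    by_cases h : 1 ≤ thr N a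
    · refine ⟨pC N s (thr N a - 1), hp _, (𝔇.V_of_pos h).trans ?_⟩
      have : thr N a - 1 = uIdx N a := by
        unfold thr uIdx at *
        by_cases he : Exc N a
        · have := he.2
          simp only [he, true_and, not_true, and_false, if_false] at *
          split_ifs at * <;> omega
        · simp only [he, false_and, not_false_iff, and_true, if_false] at *
          split_ifs <;> omega
      rw [this]
    · refine ⟨-(s ^ kap N (-thr N a) * pC N s (-thr N a)),
        neg_ne_zero.2 (mul_ne_zero (zpow_ne_zero _ hs.ne_zero) (hp _)),
        (𝔇.V_of_nonpos (by omega)).trans ?_⟩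
      have : -thr N a = uIdx N a := by
        unfold thr uIdx at *
        by_cases he : Exc N a
        · have := he.2
          simp only [he, true_and, not_true, and_false, if_false] at *
          split_ifs at * <;> omega
        · simp only [he, false_and, not_false_iff, and_true, if_false] at *
          split_ifs <;> omega
      rw [this, neg_smul]
  obtain ⟨c, hc, h3⟩ := h3
  exact ⟨_, mul_ne_zero (inv_ne_zero h0) hc, by rw [h1, h3, smul_smul, h2]⟩

/-- `[λ_a, x^a]`. -/
noncomputable def D (a : Idx N) : A := 𝔇.W a * 𝔇.U a

/-- The exponents are those of q times the exchange entries q, 1, q⁻¹ of R̂. This is the case i = a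
of `x_e`. -/
theorem x_D (hs : Generic s) (h a : Idx N) :
    QComm s (if (h : ℤ) = a then (if (h : ℤ) = 0 then 2 else 4) else if (h : ℤ) = -a then 0 else 2)
      (𝔇.x h) (𝔇.D a) := by
  obtain ⟨c, -, hc⟩ := 𝔇.U_eq hs a
  have hr := 𝔇.x_r h _ (inR_uIdx a)
  unfold D
  rw [hc]
  refine ((𝔇.x_W hs.ne_zero h a).mul_right hs.ne_zero
    ((hr.mul_right hs.ne_zero hr).smul_right c)).congr ?_
  have ha := abs_cases (a : ℤ)
  have hh := abs_cases (h : ℤ)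
  unfold rpExp uIdx
  by_cases he : Exc N a
  · have h0 := idx_ne_zero_of_exc he h
    have h1 := he.2
    have h2 := abs_cases (1 : ℤ)
    simp only [he, not_true, and_false, if_true, if_false]
    have h3 : |(-1 : ℤ)| = 1 := rfl
    rcases h1 with h1 | h1 <;> simp only [h1, rExp, kExp, h3, abs_one] <;> split_ifs <;> first | omega | contradiction
  · simp only [he, not_false_iff, and_true, if_false]
    rcases lt_trichotomy (a : ℤ) 0 with h1 | h1 | h1
    · simp (disch := omega) only [if_pos, if_neg, rExp]
      split_ifs <;> omega
    · simp (disch := omega) only [if_pos, if_neg, rExp, h1, abs_zero]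
      split_ifs <;> omega
    · simp (disch := omega) only [if_pos, if_neg, rExp]
      split_ifs <;> omega

theorem U_x (hs : Generic s) (a : Idx N) :
    QComm s (uExp N a) (𝔇.U a) (𝔇.x (negIdx a)) := by
  obtain ⟨c, -, hc⟩ := 𝔇.U_eq hs a
  have hr := 𝔇.x_r (negIdx a) _ (inR_uIdx a)
  rw [hc]
  refine ((hr.mul_right hs.ne_zero hr).symm hs.ne_zero).congr ?_ |>.smul_left c
  have ha := abs_cases (a : ℤ)
  have hh := abs_cases (-a : ℤ)
  unfold uIdx rExp uExp
  rw [coe_negIdx]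
  split_ifs <;> omega

/-- `q^{-ρ_a} [λ_a, x^a] x^{-a} = λ_a V_m`. -/
theorem D_mul_x (hs : Generic s) (a : Idx N) :
    s ^ (-twoRho N a) • (𝔇.D a * 𝔇.x (negIdx a)) = 𝔇.lam a * 𝔇.V (thr N a) := by
  rw [𝔇.V_thr hs, D, lam, mul_assoc, (𝔇.U_x hs a).eq]
  simp only [mul_smul_comm, smul_smul, mul_assoc]

theorem isUnit_D (hs : Generic s) (a : Idx N) : IsUnit (𝔇.D a) := by
  obtain ⟨c, hc0, hc⟩ := 𝔇.U_eq hs a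
  have hr : ∀ j, InR N j → IsUnit (𝔇.r j) := fun j hj =>
    ⟨⟨_, _, 𝔇.r_ri j hj, 𝔇.ri_r j hj⟩, rfl⟩
  have hri : ∀ j, InR N j → IsUnit (𝔇.ri j) := fun j hj =>
    ⟨⟨_, _, 𝔇.ri_r j hj, 𝔇.r_ri j hj⟩, rfl⟩
  have h1 : IsUnit (𝔇.rpi a) := ⟨⟨_, _, (𝔇.rp_mul_rpi a).2, (𝔇.rp_mul_rpi a).1⟩, rfl⟩
  have h2 : IsUnit 𝔇.Lam := ⟨⟨_, _, 𝔇.Lam_Lami, 𝔇.Lami_Lam⟩, rfl⟩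
  unfold D W
  rw [hc, mul_smul_comm]
  have := (h2.mul ((hri _ (inR_abs a)).mul h1)).mul ((hr _ (inR_uIdx a)).mul (hr _ (inR_uIdx a)))
  have h3 : IsUnit (algebraMap ℂ A c) := (IsUnit.mk0 c hc0).map (algebraMap ℂ A)
  rw [Algebra.smul_def]
  exact h3.mul this

end QD

end QEuclid

/-! ### Exchange relations of coordinates and commutators -/

namespace QEuclid

namespace QD

variable {N : ℕ} {s : ℂ} {A : Type*} [Ring A] [Algebra ℂ A] (𝔇 : QD N s A)

/-- `[λ_a, x^i]`. -/
noncomputable def e (a i : Idx N) : A := 𝔇.lam a * 𝔇.x i - 𝔇.x i * 𝔇.lam a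

theorem e_self (hs : Generic s) (a : Idx N) : 𝔇.e a a = 𝔇.D a := 𝔇.lam_comm_self hs.ne_zero a

theorem lt_thr (a : ℤ) : a < thr N a := by
  unfold thr; split_ifs with h <;> omega

theorem e_of_thr_le (hs : Generic s) {a i : Idx N} (h : thr N a ≤ i) :
    𝔇.e a i = (1 - s ^ 4) • (𝔇.lam a * 𝔇.x i) := by
  have h1 := lt_thr (N := N) a
  have h2 := (𝔇.x_lam_of_ne hs.ne_zero i a (by omega)).eq
  rw [if_pos h] at h2
  rw [e, h2, sub_smul, one_smul]
  norm_cast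

theorem e_of_lt_thr (hs : Generic s) {a i : Idx N} (h : (i : ℤ) < thr N a) (hne : (i : ℤ) ≠ a) :
    𝔇.e a i = 0 := by
  have h2 := (𝔇.x_lam_of_ne hs.ne_zero i a hne).eq
  rw [if_neg (by omega), zpow_zero, one_smul] at h2
  rw [e, h2, sub_self]

theorem e_of_lt (hs : Generic s) {a i : Idx N} (h : (i : ℤ) < a) : 𝔇.e a i = 0 :=
  𝔇.e_of_lt_thr hs (h.trans (lt_thr _)) h.ne

/-- An index between `a` and the threshold. -/
theorem eq_of_lt_thr {a i : Idx N} (h : (a : ℤ) < i) (h' : (i : ℤ) < thr N a) :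
    ¬ Odd N ∧ (a : ℤ) = -1 ∧ (i : ℤ) = 1 ∧ thr N a = 2 := by
  unfold thr at *
  split_ifs at * with he
  · have := idx_ne_zero_of_exc he.1 i
    exact ⟨he.1.1, he.2, by omega, rfl⟩
  · omega

/-- The partial sums `∑_{l < j} q^{-ρ_l} [λ_a, x^l] x^{-l}`. -/
noncomputable def psum (a : Idx N) (j : ℤ) : A :=
  if j ≤ a then 0 else 𝔇.lam a * 𝔇.V (max j (thr N a))

/-- The summand is zero for l < a, the term l = a is λ_a V at the threshold (`D_mul_x`), and every
term from the threshold on is λ_a (V_{l+1} - V_l). -/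
theorem sum_e_mul (hs : Generic s) (a : Idx N) (j : ℤ) (h₁ : -((N / 2 : ℕ) : ℤ) ≤ j)
    (h₂ : j ≤ ((N / 2 : ℕ) : ℤ) + 1) :
    ∑ l : Idx N, (if (l : ℤ) < j then s ^ (-twoRho N l) • (𝔇.e a l * 𝔇.x (negIdx l)) else 0) =
      𝔇.psum a j := by
  have hlt := lt_thr (N := N) (a : ℤ)
  rw [sum_idx_lt _ (𝔇.psum a) _ _ j h₁ h₂]
  · rw [psum, psum, if_pos (idx_mem a).1, sub_zero]
  · intro i
    unfold psum
    rcases lt_trichotomy (i : ℤ) a with h | h | h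
    · rw [if_pos (by omega), if_pos (by omega), 𝔇.e_of_lt hs h, zero_mul, smul_zero, zero_add]
    · obtain rfl := idx_ext_iff.2 h
      rw [if_neg (by omega), if_pos le_rfl, zero_add, 𝔇.e_self hs, 𝔇.D_mul_x hs,
        max_eq_right (by omega)]
    · rw [if_neg (by omega), if_neg (by omega)]
      rcases lt_or_ge (i : ℤ) (thr N a) with h' | h'
      · rw [𝔇.e_of_lt_thr hs h' h.ne', zero_mul, smul_zero, add_zero, max_eq_right (by omega),
          max_eq_right (by omega)]
      · rw [𝔇.e_of_thr_le hs h', max_eq_left (by omega), max_eq_left (by omega),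
          smul_mul_assoc, smul_smul, mul_assoc, mul_comm (s ^ _), ← mul_smul_comm, 𝔇.V_step,
          ← mul_add, add_sub_cancel]
  · intro hN
    unfold psum
    have h0 : (a : ℤ) ≠ 0 := (idx_mem a).2.2.resolve_right hN
    have h1 : (a : ℤ) < -1 → thr N a < 0 := fun h => by unfold thr; split_ifs <;> omega
    have h2 : (a : ℤ) = -1 → thr N a = 2 := fun h => by
      unfold thr; rw [if_pos ⟨⟨hN, Or.inr h⟩, h⟩]
    rcases lt_trichotomy (a : ℤ) (-1) with h | h | h
    · rw [if_neg (by omega), if_neg (by omega), max_eq_left (by have := h1 h; omega),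
        max_eq_left (by have := h1 h; omega), (𝔇.V_zero_even hN).1, (𝔇.V_zero_even hN).2]
    -- For a = -1 the threshold 2 exceeds both bounds 0 and 1, so the missing index is not seen.
    · rw [if_neg (by omega), if_neg (by omega), h2 h]; norm_num
    · rw [if_pos (by omega), if_pos (by omega)]

/-- The commutation relations of the `x^h` and the `[λ_a, x^i]`. -/
theorem x_e (hs : Generic s) (a h i : Idx N) : 𝔇.x h * 𝔇.e a i =
    s ^ 2 • ∑ k, ∑ l, rhat N s (h, i) (k, l) • (𝔇.e a k * 𝔇.x l) := by
  have hs0 := hs.ne_zero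
  have hlt := lt_thr (N := N) (a : ℤ)
  have z4 : s ^ (4 : ℤ) = s ^ 4 := by norm_cast
  have z2 : s ^ (2 : ℤ) = s ^ 2 := by norm_cast
  -- The one coordinate that does not q-commute with λ_a is moved past it at the cost of [λ_a, x^a].
  have hxl : ∀ y : A, 𝔇.x a * (𝔇.lam a * y) = 𝔇.lam a * (𝔇.x a * y) - 𝔇.D a * y := fun y => by
    rw [← 𝔇.e_self hs, e, sub_mul]; simp only [mul_assoc, sub_sub_cancel]
  -- On opposite pairs the partial sum in R̂ is λ_a V. Where V is taken at -h, `V_pos`, `V_neg` or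
  -- `V_zero` expresses it by the products of x^h and x^{-h}; apart from terms with [λ_a, x^a], both
  -- sides become λ_a times such products.
  by_cases hi : (i : ℤ) = -h
  · obtain rfl : i = negIdx h := idx_ext_iff.2 hi
    have hb := idx_mem (negIdx h)
    rw [rhat_sum_neg s (fun k l => 𝔇.e a k * 𝔇.x l), 𝔇.sum_e_mul hs a _ (by simpa using hb.1)
      (by have := hb.2.1; rw [hi] at this; omega), ← hi]
    have ht : twoRho N (h : ℤ) = - twoRho N ((negIdx h : Idx N) : ℤ) := by
      rw [hi, twoRho_neg, neg_neg]
    unfold psum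
    rcases lt_trichotomy ((negIdx h : Idx N) : ℤ) a with h1 | h1 | h1
    · rw [if_pos h1.le, 𝔇.e_of_lt hs h1]
      split_ifs with h2
      · rw [𝔇.e_of_lt hs (show (h : ℤ) < a by omega)]; simp
      · simp
    · have h1' := idx_ext_iff.2 h1
      rw [if_pos h1.le, h1', 𝔇.e_self hs, (𝔇.x_D hs h a).eq]
      by_cases h0 : (h : ℤ) = 0
      · simp (disch := omega) only [zConst, if_pos, if_neg]
        simp [z2]
      · have : (if (h : ℤ) < 0 then kConst s else 0) • (𝔇.e a h * 𝔇.x a) = 0 := by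
          split_ifs
          · rw [𝔇.e_of_lt hs (by omega), zero_mul, smul_zero]
          · rw [zero_smul]
        rw [this]
        simp (disch := omega) only [zConst, if_pos, if_neg]
        rw [smul_zero, sub_zero, add_zero, smul_smul, mul_inv_cancel₀ (pow_ne_zero 2 hs0),
          zpow_zero]
    · rw [if_neg (show ¬ ((negIdx h : Idx N) : ℤ) ≤ a by omega)]
      rcases lt_or_ge ((negIdx h : Idx N) : ℤ) (thr N a) with h' | h'
      -- Only even N, a = -1 and i = 1 occurs here, where the commutator vanishes although i > a.
      · obtain ⟨hN, ha, h2, h3⟩ := eq_of_lt_thr h1 h'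
        obtain rfl : h = a := idx_ext_iff.2 (by omega)
        have h4 := 𝔇.D_mul_x hs h
        rw [𝔇.e_of_lt_thr hs h' h1.ne']
        simp (disch := omega) only [if_pos, if_neg]
        rw [max_eq_right (by omega), ← h4, 𝔇.e_self hs, smul_smul, mul_assoc, ha, twoRho_neg, twoRho_pos one_pos, if_neg hN]
        simp
      · rw [max_eq_left h', 𝔇.e_of_thr_le hs h']
        have hk : kConst s = s ^ 2 - (s ^ 2)⁻¹ := rfl
        rcases lt_trichotomy (h : ℤ) 0 with h0 | h0 | h0
        · have hV := 𝔇.V_pos hs (negIdx h) (by omega)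
          rw [negIdx_negIdx] at hV
          rw [hV]
          simp (disch := omega) only [zConst, if_pos, if_neg]
          rw [ht, neg_neg, zpow_neg]
          have hu := zpow_ne_zero (twoRho N ((negIdx h : Idx N) : ℤ)) hs0
          generalize s ^ twoRho N ((negIdx h : Idx N) : ℤ) = u at *
          by_cases ha : (h : ℤ) = a
          · obtain rfl := idx_ext_iff.2 ha
            rw [mul_smul_comm, hxl, 𝔇.e_self hs, hk]
            simp only [mul_smul_comm, mul_sub, smul_mul_assoc, mul_assoc]
            match_scalars <;> field_simp <;> ring
          · have hx := (𝔇.x_lam_of_ne hs0 h a ha).eq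
            rw [mul_smul_comm, ← mul_assoc, hx, smul_mul_assoc, hk]
            rcases lt_or_ge (h : ℤ) (thr N a) with h2 | h2
            · rw [if_neg (by omega), 𝔇.e_of_lt_thr hs h2 ha]
              simp only [mul_smul_comm, mul_sub, smul_mul_assoc, mul_assoc, zero_mul, smul_zero,
                zpow_zero]
              match_scalars <;> field_simp <;> ring
            · rw [if_pos h2, 𝔇.e_of_thr_le hs h2, z4]
              simp only [mul_smul_comm, mul_sub, smul_mul_assoc, mul_assoc]
              match_scalars <;> field_simp <;> ring
        · have hn : negIdx h = h := idx_ext_iff.2 (by omega)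
          rw [hn, h0, (𝔇.V_zero hs h h0).1, twoRho_zero]
          simp (disch := omega) only [zConst, if_neg, if_true]
          have hx := (𝔇.x_lam_of_ne hs0 h a (by omega)).eq
          rw [hn] at h'
          rw [if_pos h', z4] at hx
          rw [mul_smul_comm, ← mul_assoc, hx, hk]
          simp only [mul_smul_comm, mul_sub, smul_mul_assoc, mul_assoc, zero_smul, neg_zero,
            zpow_zero]
          match_scalars
          field_simp
          ring
        · have hV := 𝔇.V_neg hs h (by omega)
          have hx := (𝔇.x_lam_of_ne hs0 h a (by omega)).eq
          have : thr N a ≤ h := by omega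
          rw [if_pos this, z4] at hx
          rw [hi, hV]
          simp (disch := omega) only [zConst, if_pos, if_neg]
          rw [zpow_neg, mul_smul_comm, ← mul_assoc, hx, hk]
          have hu := zpow_ne_zero (twoRho N (h : ℤ)) hs0
          generalize s ^ twoRho N (h : ℤ) = u at *
          simp only [mul_smul_comm, mul_sub, smul_mul_assoc, mul_assoc, zero_smul]
          match_scalars <;> field_simp <;> ring
  · rw [rhat_sum_ne s (fun k l => 𝔇.e a k * 𝔇.x l) h i hi]
    simp only [idx_ext_iff]
    rcases lt_trichotomy (i : ℤ) a with h1 | h1 | h1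
    · rw [𝔇.e_of_lt hs h1]
      split_ifs with h2 h3 h3
      · omega
      · simp
      · rw [𝔇.e_of_lt hs (show (h : ℤ) < a by omega)]; simp
      · simp
    · obtain rfl := idx_ext_iff.2 h1
      rw [𝔇.e_self hs, (𝔇.x_D hs h i).eq]
      have : (if (h : ℤ) < i then kConst s else 0) • (𝔇.e i h * 𝔇.x i) = 0 := by
        split_ifs with h2
        · rw [𝔇.e_of_lt hs h2, zero_mul, smul_zero]
        · rw [zero_smul]
      rw [this, add_zero, smul_smul]
      congr 1
      rw [← z2]
      split_ifs <;> first | omega | (rw [← zpow_add₀ hs0]; norm_num) | simp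
    · rcases lt_or_ge (i : ℤ) (thr N a) with h' | h'
      · obtain ⟨hN, ha, h2, h3⟩ := eq_of_lt_thr h1 h'
        rw [𝔇.e_of_lt_thr hs h' h1.ne']
        split_ifs with h2 h3 h3
        · omega
        · simp
        · rw [𝔇.e_of_lt hs (show (h : ℤ) < a by
            have := (idx_mem h).2.2.resolve_right hN; omega)]; simp
        · simp
      · have hk : kConst s = s ^ 2 - (s ^ 2)⁻¹ := rfl
        rw [𝔇.e_of_thr_le hs h', mul_smul_comm, hk]
        have hxx := (𝔇.x_xExp hs0 h i (by omega)).eq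
        unfold xExp at hxx
        by_cases ha : (h : ℤ) = a
        · obtain rfl := idx_ext_iff.2 ha
          rw [hxl, 𝔇.e_self hs, if_neg h1.ne, if_pos h1]
          rw [if_neg h1.ne, if_pos h1, z2] at hxx
          rw [hxx]
          simp only [mul_smul_comm, smul_mul_assoc, mul_assoc]
          match_scalars <;> field_simp <;> ring
        · have hx := (𝔇.x_lam_of_ne hs0 h a ha).eq
          rw [← mul_assoc, hx, smul_mul_assoc, mul_assoc, hxx]
          rcases lt_trichotomy (h : ℤ) i with h2 | h2 | h2
          · rw [if_neg h2.ne, if_neg h2.ne, if_pos h2, if_pos h2, z2]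
            rw [if_neg h2.ne, if_pos h2, z2] at hxx
            rcases lt_or_ge (h : ℤ) (thr N a) with h3 | h3
            · rw [if_neg (by omega), 𝔇.e_of_lt_thr hs h3 ha]
              simp only [mul_smul_comm, smul_mul_assoc, mul_assoc, zero_mul, smul_zero,
                zpow_zero]
              module
            · rw [if_pos h3, 𝔇.e_of_thr_le hs h3, z4]
              simp only [mul_smul_comm, smul_mul_assoc, mul_assoc, hxx]
              match_scalars
              field_simp
              ring
          · simp (disch := omega) only [if_pos, if_neg]
            rw [z4, zpow_zero]
            simp only [mul_smul_comm, smul_mul_assoc, mul_assoc, zero_smul]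
            module
          · simp (disch := omega) only [if_pos, if_neg]
            rw [z4, zpow_neg, z2]
            simp only [mul_smul_comm, smul_mul_assoc, mul_assoc, zero_smul]
            match_scalars
            field_simp

/-- `∑ g_{jl} [λ_a, x^j] x^l = λ_a V_{n+1}`. -/
theorem sum_g_e_x (hs : Generic s) (a : Idx N) :
    ∑ j, ∑ l, gMat N s j l • (𝔇.e a j * 𝔇.x l) = 𝔇.lam a * 𝔇.V (((N / 2 : ℕ) : ℤ) + 1) := by
  have h := 𝔇.sum_e_mul hs a (((N / 2 : ℕ) : ℤ) + 1) (by omega) le_rfl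
  have ha := (idx_mem a).2.1
  rw [sum_gMat s (fun j l => 𝔇.e a j * 𝔇.x l)]
  have h2 : psum 𝔇 a (((N / 2 : ℕ) : ℤ) + 1) = 𝔇.lam a * 𝔇.V (((N / 2 : ℕ) : ℤ) + 1) := by
    unfold psum
    rw [if_neg (by omega)]
    rcases le_or_gt (thr N a) (((N / 2 : ℕ) : ℤ) + 1) with h3 | h3
    · rw [max_eq_left h3]
    · exfalso
      unfold thr at h3
      split_ifs at h3 with he
      · have := (idx_mem (negIdx a)).2.1
        rw [coe_negIdx] at this
        omega
      · omega
  rw [← h2, ← h]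
  refine Finset.sum_congr rfl fun l _ => ?_
  rw [if_pos (by have := (idx_mem l).2.1; omega)]

end QD

end QEuclid

/-! ### The reflection symmetry and the normalization constants -/

namespace QEuclid

theorem rExp_neg (i : ℤ) {j : ℤ} (hj : 0 ≤ j) : rExp (-i) j = -rExp i j := by
  have := abs_neg i
  have := abs_cases i
  unfold rExp
  split_ifs <;> omega

theorem kExp_neg (i : ℤ) : kExp (-i) = -kExp i := by
  unfold kExp; rw [abs_neg]; split_ifs <;> simp

theorem pC_inv {N : ℕ} {s : ℂ} (hs : Generic s) (m : ℤ) :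
    pC N s⁻¹ m = -(s ^ 4)⁻¹ * s ^ kap N m * pC N s m := by
  unfold pC
  have h1 := hs.one_add_zpow (kap N m)
  have h2 := zpow_ne_zero (kap N m) hs.ne_zero
  have h3 := hs.ne_zero
  rw [inv_zpow]
  generalize s ^ kap N m = u at *
  have h4 : u + 1 ≠ 0 := by rwa [add_comm]
  field_simp
  ring

namespace QD

variable {N : ℕ} {s : ℂ} {A : Type*} [Ring A] [Algebra ℂ A] (𝔇 : QD N s A)

/-- The symmetry `q ↦ q⁻¹`, `x^i ↦ x^{-i}`, `Λ ↦ Λ⁻¹`. -/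
noncomputable def flip (hs : Generic s) : QD N s⁻¹ A where
  x i := 𝔇.x (negIdx i)
  r := 𝔇.r
  ri := 𝔇.ri
  Lam := 𝔇.Lami
  Lami := 𝔇.Lam
  K := 𝔇.K
  Ki := 𝔇.Ki
  r_ri := 𝔇.r_ri
  ri_r := 𝔇.ri_r
  Lam_Lami := 𝔇.Lami_Lam
  Lami_Lam := 𝔇.Lam_Lami
  K_Ki := 𝔇.K_Ki
  Ki_K := 𝔇.Ki_K
  r_comm := 𝔇.r_comm
  x_x i j h h' := ((𝔇.x_x (negIdx j) (negIdx i) (by simpa using h)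
    (by simp only [coe_negIdx]; omega)).symm hs.ne_zero).invert.congr (by norm_num)
  x_r i j hj := (𝔇.x_r (negIdx i) j hj).invert.congr (by rw [coe_negIdx, rExp_neg _ hj.1]; ring)
  x_lam i := ((𝔇.x_lam (negIdx i)).inv_right hs.ne_zero 𝔇.Lam_Lami 𝔇.Lami_Lam).invert.congr
    (by norm_num)
  r_lam j hj := ((𝔇.r_lam j hj).inv_right hs.ne_zero 𝔇.Lam_Lami 𝔇.Lami_Lam).invert.congr
    (by norm_num)
  K_r := 𝔇.K_r
  K_lam := ((QComm.of_commute (s := s) 𝔇.K_lam).inv_right hs.ne_zero 𝔇.Lam_Lami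
    𝔇.Lami_Lam).commute (by norm_num)
  K_x hN i := (𝔇.K_x hN (negIdx i)).invert.congr (by rw [coe_negIdx, kExp_neg]; ring)
  x_zero i hi := 𝔇.x_zero (negIdx i) (by simp [hi])
  step i := by
    -- The radii are kept, and the reflection maps the step from i to i + 1 to the step from -i to
    -- -i + 1; hence the index 1 - j.
    have hV : ∀ j, vfun N s⁻¹ 𝔇.r j = (s ^ 4)⁻¹ • 𝔇.V (1 - j) := by
      intro j
      rcases lt_or_ge j 1 with h | h
      · rw [vfun, if_neg (by omega), 𝔇.V_of_pos (by omega), pC_inv hs,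
          show 1 - j - 1 = -j by ring, inv_zpow]
        have h2 := zpow_ne_zero (kap N (-j)) hs.ne_zero
        match_scalars
        field_simp
      · rw [vfun, if_pos h, 𝔇.V_of_nonpos (by omega), pC_inv hs,
          show -(1 - j) = j - 1 by ring]
        module
    have h := 𝔇.V_step (negIdx i)
    rw [negIdx_negIdx, coe_negIdx, twoRho_neg, neg_neg] at h
    rw [hV, hV, show (1 : ℤ) - (i + 1) = -i by ring, show (1 : ℤ) - i = -i + 1 by ring,
      ← smul_sub, ← neg_sub (𝔇.V (-(i : ℤ) + 1)), ← h, negIdx_negIdx, inv_zpow, zpow_neg, inv_inv]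
    have h3 := hs.ne_zero
    match_scalars
    field_simp
    ring

end QD

/-- The conditions on the normalization of the elements `lam a`. -/
structure NormConst (N : ℕ) (s : ℂ) (c : Idx N → ℂ) : Prop where
  zero : ∀ a : Idx N, (a : ℤ) = 0 → c a = -(s * hConst s)⁻¹
  one_odd : Odd N → ∀ a : Idx N, (a : ℤ) = 1 → c a * c (negIdx a) = -(s ^ 2 * hConst s ^ 2)⁻¹
  one_even : ¬ Odd N → ∀ a : Idx N, (a : ℤ) = 1 →
    c a * c (negIdx a) = 4 * (s ^ 4 * kConst s ^ 2)⁻¹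
  gt_one : ∀ a : Idx N, 1 < (a : ℤ) → c a * c (negIdx a) =
    -(s ^ 2 * kConst s ^ 2)⁻¹ * omega N s a * omega N s ((a : ℤ) - 1)

/-- The normalization of the radii of the dual realization. -/
noncomputable def cst (N : ℕ) (s : ℂ) (j : ℤ) : ℂ :=
  if j = 0 then -(s * hConst s)⁻¹ else (s * kConst s)⁻¹ * omega N s j

theorem cst_ne {N : ℕ} {s : ℂ} (hs : Generic s) (j : ℤ) : cst N s j ≠ 0 := by
  unfold cst
  split_ifs
  · exact neg_ne_zero.2 (inv_ne_zero (mul_ne_zero hs.ne_zero hs.hConst_ne))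
  · exact mul_ne_zero (inv_ne_zero (mul_ne_zero hs.ne_zero hs.kConst_ne)) (hs.omega_ne _ _)

theorem NormConst.ne_zero {N : ℕ} {s : ℂ} {c : Idx N → ℂ} (h : NormConst N s c) (hs : Generic s)
    (a : Idx N) : c a ≠ 0 := by
  have h1 := hs.hConst_ne
  have h2 := hs.kConst_ne
  have h3 := hs.ne_zero
  have key : ∀ b : Idx N, 0 < (b : ℤ) → c b * c (negIdx b) ≠ 0 := by
    intro b hb
    by_cases hb1 : (b : ℤ) = 1
    · by_cases hN : Odd N
      · rw [h.one_odd hN b hb1]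
        exact neg_ne_zero.2 (inv_ne_zero (by positivity))
      · rw [h.one_even hN b hb1]
        exact mul_ne_zero (by norm_num) (inv_ne_zero (by positivity))
    · rw [h.gt_one b (by omega)]
      exact mul_ne_zero (mul_ne_zero (neg_ne_zero.2 (inv_ne_zero (by positivity)))
        (hs.omega_ne _ _)) (hs.omega_ne _ _)
  rcases lt_trichotomy (a : ℤ) 0 with h0 | h0 | h0
  · have := right_ne_zero_of_mul (key (negIdx a) (by simpa using h0))
    rwa [negIdx_negIdx] at this
  · rw [h.zero a h0]
    exact neg_ne_zero.2 (inv_ne_zero (by positivity))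
  · exact left_ne_zero_of_mul (key a h0)

/-- The two identities behind the duality. -/
theorem NormConst.key {N : ℕ} {s : ℂ} {c : Idx N → ℂ} (h : NormConst N s c) (hs : Generic s)
    (a : Idx N) (ha : 0 < (a : ℤ)) (he : ¬ QD.Exc N a) :
    c a * c (negIdx a) * (s ^ (2 * twoRho N a) * pC N s (a - 1)) =
      s ^ 2 * (cst N s a ^ 2 * pC N s⁻¹ a) ∧
    c a * c (negIdx a) * (s ^ (2 * twoRho N a) * pC N s a) =
      s ^ 2 * (cst N s (a - 1) ^ 2 * pC N s⁻¹ (a - 1)) := by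
  rw [pC_inv hs, pC_inv hs]
  unfold pC cst
  rw [if_neg ha.ne', kap_eq (show 1 ≤ (a : ℤ) by omega), kap_sub_one (show 1 ≤ (a : ℤ) by omega)]
  have hs0 := hs.ne_zero
  have h1 := hs.one_add_zpow (2 * twoRho N a)
  have h2 := hs.one_add_zpow (2 * twoRho N a + 4)
  have h5 : s ^ (2 * twoRho N (a : ℤ)) = s ^ twoRho N (a : ℤ) * s ^ twoRho N (a : ℤ) := by
    rw [← zpow_add₀ hs.ne_zero]; ring_nf
  have h6 : s ^ (2 * twoRho N (a : ℤ) + 4) = s ^ twoRho N (a : ℤ) * s ^ twoRho N (a : ℤ) * s ^ 4 := by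
    rw [zpow_add₀ hs.ne_zero, h5]; norm_cast
  have hu := zpow_ne_zero (twoRho N (a : ℤ)) hs.ne_zero
  have hk := hs.kConst_ne
  -- For a = 1 the lower radius is r_0, normalized with h instead of k; the two are related by k = h
  -- (q^{1/2} + q^{-1/2}).
  by_cases h1a : (a : ℤ) = 1
  · have hN : Odd N := by
      by_contra hN
      exact he ⟨hN, Or.inl h1a⟩
    have ht : twoRho N 1 = -1 := by rw [twoRho_pos one_pos, if_pos hN]; norm_num
    rw [h.one_odd hN a h1a, if_pos (by omega)]
    have hh := hs.hConst_ne
    have hkh : kConst s = hConst s * (s + s⁻¹) := by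
      unfold kConst hConst; field_simp; ring
    have h7 : s ^ 2 + 1 ≠ 0 := by
      have := hs.one_add_zpow 2
      rw [add_comm]; exact_mod_cast this
    have e1 : s ^ (2 * twoRho N (a : ℤ)) = (s ^ 2)⁻¹ := by rw [h1a, ht]; rfl
    have e2 : s ^ (2 * twoRho N (a : ℤ) + 4) = s ^ 2 := by rw [h1a, ht]; rfl
    have e3 : omega N s a = s + s⁻¹ := by rw [h1a]; simp [omega, ht, add_comm]
    rw [e1, e2, e3, hkh]
    have h8 : s + s⁻¹ ≠ 0 := by
      have : s + s⁻¹ = (s ^ 2 + 1) * s⁻¹ := by field_simp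
      rw [this]; exact mul_ne_zero h7 (inv_ne_zero hs0)
    have h9 : 1 + s ^ 2 ≠ 0 := by rwa [add_comm]
    have h10 : 1 + (s ^ 2)⁻¹ ≠ 0 := by rwa [← e1]
    rw [show s + s⁻¹ = (s ^ 2 + 1) * s⁻¹ by field_simp,
      show 1 + (s ^ 2)⁻¹ = (s ^ 2 + 1) * (s ^ 2)⁻¹ by field_simp, add_comm 1 (s ^ 2)]
    generalize hConst s = H at *
    constructor <;> field_simp
  · have ht : twoRho N ((a : ℤ) - 1) = twoRho N a + 2 := by
      rw [twoRho_pos (by omega), twoRho_pos (by omega)]; split_ifs <;> ring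
    rw [h.gt_one a (by omega), if_neg (by omega)]
    unfold omega
    rw [ht, zpow_neg, zpow_neg, zpow_add₀ hs0]
    rw [h5] at h1 ⊢
    rw [h6] at h2 ⊢
    have e2 : s ^ (2 : ℤ) = s ^ 2 := by norm_cast
    rw [e2]
    generalize s ^ twoRho N (a : ℤ) = u at *
    generalize kConst s = k at *
    have h7 : u ^ 2 * s ^ 4 + 1 ≠ 0 := by rwa [add_comm, sq]
    have h9 : s ^ 4 * u ^ 2 + 1 ≠ 0 := by rwa [mul_comm]
    have h8 : u ^ 2 + 1 ≠ 0 := by rwa [add_comm, sq]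
    rw [show 1 + u * u = u ^ 2 + 1 by ring, show 1 + u * u * s ^ 4 = u ^ 2 * s ^ 4 + 1 by ring]
    constructor <;> field_simp

end QEuclid

/-! ### Commutation relations of the λ_a -/

namespace QEuclid

namespace QD

variable {N : ℕ} {s : ℂ} {A : Type*} [Ring A] [Algebra ℂ A] (𝔇 : QD N s A)

theorem ri_comm (hs : s ≠ 0) {i j : ℤ} (hi : InR N i) (hj : InR N j) :
    𝔇.ri i * 𝔇.ri j = 𝔇.ri j * 𝔇.ri i ∧ 𝔇.ri i * 𝔇.r j = 𝔇.r j * 𝔇.ri i := by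
  have h := (QComm.of_commute (s := s) (𝔇.r_comm i j hi hj)).inv_left hs (𝔇.r_ri i hi) (𝔇.ri_r i hi)
  exact ⟨(h.inv_right hs (𝔇.r_ri j hj) (𝔇.ri_r j hj)).commute (by norm_num),
    h.commute (by norm_num)⟩

theorem ri_lam (hs : s ≠ 0) {j : ℤ} (hj : InR N j) : QComm s (-2) (𝔇.ri j) 𝔇.Lam :=
  (𝔇.r_lam j hj).inv_left hs (𝔇.r_ri j hj) (𝔇.ri_r j hj)

theorem ri_rpi (hs : s ≠ 0) {j : ℤ} (hj : InR N j) (a : Idx N) :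
    𝔇.ri j * 𝔇.rpi a = 𝔇.rpi a * 𝔇.ri j :=
  (((QComm.of_commute (s := s) (𝔇.r_rp hs j hj a)).inv_left hs (𝔇.r_ri j hj)
    (𝔇.ri_r j hj)).inv_right hs (𝔇.rp_mul_rpi a).1 (𝔇.rp_mul_rpi a).2).commute (by norm_num)

theorem rpi_lam (hs : s ≠ 0) (a : Idx N) : QComm s (-2) (𝔇.rpi a) 𝔇.Lam :=
  (𝔇.rp_lam hs a).inv_left hs (𝔇.rp_mul_rpi a).1 (𝔇.rp_mul_rpi a).2

theorem rp_K (hs : s ≠ 0) (a : Idx N) : 𝔇.rp a * 𝔇.K = 𝔇.K * 𝔇.rp a := by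
  have hr : ∀ j, InR N j → QComm s 0 (𝔇.r j) 𝔇.K :=
    fun j hj => QComm.of_commute (𝔇.K_r j hj).symm
  have hK : QComm s 0 𝔇.K 𝔇.K := QComm.refl
  unfold rp
  by_cases h0 : (a : ℤ) = 0
  · have := inR_abs a
    rw [h0, abs_zero] at this
    rw [if_pos h0]
    exact (hr _ this).commute rfl
  · rw [if_neg h0]
    by_cases he : Exc N a
    · rw [if_pos he]
      have h1 := hr _ (inR_one ⟨a, he⟩)
      split_ifs
      · exact (h1.mul_left hs hK).commute (by norm_num)
      · exact (h1.mul_left hs (hK.inv_left hs 𝔇.K_Ki 𝔇.Ki_K)).commute (by norm_num)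
    · rw [if_neg he]
      exact (hr _ (inR_abs_sub h0 he)).commute rfl

theorem rp_rp (hs : s ≠ 0) (a b : Idx N) : 𝔇.rp a * 𝔇.rp b = 𝔇.rp b * 𝔇.rp a := by
  have hK : QComm s 0 (𝔇.rp a) 𝔇.K := QComm.of_commute (𝔇.rp_K hs a)
  have hr : ∀ j, InR N j → QComm s 0 (𝔇.rp a) (𝔇.r j) :=
    fun j hj => QComm.of_commute (𝔇.r_rp hs j hj a).symm
  nth_rewrite 2 3 [rp]
  by_cases h0 : (b : ℤ) = 0
  · have := inR_abs b
    rw [h0, abs_zero] at this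
    rw [if_pos h0]
    exact (hr _ this).commute rfl
  · rw [if_neg h0]
    by_cases he : Exc N b
    · rw [if_pos he]
      have h1 := hr _ (inR_one ⟨b, he⟩)
      split_ifs
      · exact (h1.mul_right hs hK).commute (by norm_num)
      · exact (h1.mul_right hs (hK.inv_right hs 𝔇.K_Ki 𝔇.Ki_K)).commute (by norm_num)
    · rw [if_neg he]
      exact (hr _ (inR_abs_sub h0 he)).commute rfl

theorem W_lam (hs : s ≠ 0) (a : Idx N) : QComm s (-4) (𝔇.W a) 𝔇.Lam :=
  ((QComm.refl (a := 𝔇.Lam)).mul_left hs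
    ((𝔇.ri_lam hs (inR_abs a)).mul_left hs (𝔇.rpi_lam hs a))).congr (by norm_num)

theorem W_ri (hs : s ≠ 0) (a : Idx N) {j : ℤ} (hj : InR N j) : QComm s 2 (𝔇.W a) (𝔇.ri j) :=
  (((𝔇.ri_lam hs hj).symm hs).mul_left hs
    ((QComm.of_commute (𝔇.ri_comm hs (inR_abs a) hj).1).mul_left hs
      (QComm.of_commute (𝔇.ri_rpi hs hj a).symm))).congr (by norm_num)

theorem W_K (hs : s ≠ 0) (a : Idx N) : QComm s 0 (𝔇.W a) 𝔇.K :=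
  ((QComm.of_commute 𝔇.K_lam.symm).mul_left hs
    (((QComm.of_commute (𝔇.K_r _ (inR_abs a)).symm).inv_left hs (𝔇.r_ri _ (inR_abs a))
      (𝔇.ri_r _ (inR_abs a))).mul_left hs ((QComm.of_commute (𝔇.rp_K hs a)).inv_left hs
        (𝔇.rp_mul_rpi a).1 (𝔇.rp_mul_rpi a).2))).congr (by norm_num)

theorem W_rpi (hs : s ≠ 0) (a b : Idx N) : QComm s 2 (𝔇.W a) (𝔇.rpi b) :=
  (((𝔇.rpi_lam hs b).symm hs).mul_left hs
    ((QComm.of_commute (𝔇.ri_rpi hs (inR_abs a) b)).mul_left hs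
      (((QComm.of_commute (𝔇.rp_rp hs a b)).inv_left hs (𝔇.rp_mul_rpi a).1
        (𝔇.rp_mul_rpi a).2).inv_right hs (𝔇.rp_mul_rpi b).1 (𝔇.rp_mul_rpi b).2))).congr
    (by norm_num)

theorem W_W (hs : s ≠ 0) (a b : Idx N) : QComm s 0 (𝔇.W a) (𝔇.W b) :=
  ((𝔇.W_lam hs a).mul_right hs ((𝔇.W_ri hs a (inR_abs b)).mul_right hs (𝔇.W_rpi hs a b))).congr
    (by norm_num)

theorem x_W_of_abs_ne (hs : s ≠ 0) (h a : Idx N) (hne : |(h : ℤ)| ≠ |(a : ℤ)|) :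
    QComm s (if |(h : ℤ)| < |(a : ℤ)| then 2 else if (h : ℤ) < 0 then -2 else 6)
      (𝔇.x h) (𝔇.W a) := by
  refine (𝔇.x_W hs h a).congr ?_
  unfold rpExp rExp
  by_cases he : Exc N a
  · have h0 := idx_ne_zero_of_exc he h
    have h1 : |(a : ℤ)| = 1 := by
      rcases he.2 with h | h <;> rw [h] <;> rfl
    have h2 := abs_pos.2 h0
    have h3 := abs_pos.1 (h1 ▸ one_pos)
    simp only [he, if_true, kExp, if_neg h3]
    split_ifs <;> omega
  · simp only [he, if_false]
    rcases eq_or_ne (a : ℤ) 0 with h0 | h0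
    · have h1 := abs_nonneg (h : ℤ)
      have h2 : |(a : ℤ)| = 0 := abs_eq_zero.2 h0
      simp (disch := omega) only [if_true, if_neg]
      split_ifs <;> omega
    · simp only [h0, if_false]
      split_ifs <;> omega

/-- `λ_a λ_b = q^{-1} λ_b λ_a`. -/
theorem lam_lam (hs : s ≠ 0) (a b : Idx N) (h : (b : ℤ) < a) (hne : (a : ℤ) ≠ -b) :
    QComm s (-2) (𝔇.lam a) (𝔇.lam b) := by
  have ha := abs_cases (a : ℤ)
  have hb := abs_cases (b : ℤ)
  have hab : |(a : ℤ)| ≠ |(b : ℤ)| := by omega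
  have h1 := (𝔇.x_W_of_abs_ne hs (negIdx b) a (by rw [coe_negIdx, abs_neg]; exact hab.symm)).symm hs
  have h2 := 𝔇.x_W_of_abs_ne hs (negIdx a) b (by rwa [coe_negIdx, abs_neg])
  have h3 := 𝔇.x_x (negIdx a) (negIdx b) (by simpa using h)
    (by simp only [coe_negIdx]; omega)
  refine (((𝔇.W_W hs a b).mul_right hs h1).mul_left hs (h2.mul_right hs h3)).congr ?_
  rw [coe_negIdx, coe_negIdx, abs_neg, abs_neg]
  split_ifs <;> omega

open Classical in
/-- The index of the second radius in `λ_a`. -/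
noncomputable def rIdx (N : ℕ) (a : ℤ) : ℤ := if a = 0 then 0 else if Exc N a then 1 else |a| - 1

theorem inR_rIdx (a : Idx N) : InR N (rIdx N a) := by
  unfold rIdx
  split_ifs with h0 he
  · have := inR_abs a
    rwa [h0, abs_zero] at this
  · exact inR_one ⟨a, he⟩
  · exact inR_abs_sub h0 he

theorem exc_neg {a : ℤ} : Exc N (-a) ↔ Exc N a := by
  unfold Exc
  refine and_congr_right fun _ => ?_
  omega

/-- In the exceptional case K and K⁻¹ cancel between λ_1 and λ_{-1}. -/
theorem rpi_neg_mul_rpi (hs : s ≠ 0) (a : Idx N) :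
    𝔇.rpi ((negIdx a : Idx N) : ℤ) * 𝔇.rpi a = 𝔇.ri (rIdx N a) * 𝔇.ri (rIdx N a) := by
  unfold rpi rIdx
  rw [coe_negIdx, abs_neg]
  by_cases h0 : (a : ℤ) = 0
  · simp only [h0, neg_zero, if_true]
  · rw [if_neg (by omega), if_neg h0, if_neg h0]
    by_cases he : Exc N a
    · rw [if_pos (exc_neg.2 he), if_pos he, if_pos he]
      have h1 := inR_one ⟨a, he⟩
      have h2 := (QComm.of_commute (s := s) (𝔇.K_r _ h1)).inv_right hs (𝔇.r_ri _ h1) (𝔇.ri_r _ h1)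
      have h3 := h2.commute (by norm_num)
      have h4 := (h2.inv_left hs 𝔇.K_Ki 𝔇.Ki_K).commute (by norm_num)
      rcases he.2 with h1 | h1
      · rw [if_neg (by omega), if_pos h1, h3, h4, mul_assoc, ← mul_assoc 𝔇.K, h3, mul_assoc,
          𝔇.K_Ki, mul_one]
      · rw [if_pos (by omega), if_neg (by omega), h3, h4, mul_assoc, ← mul_assoc 𝔇.Ki, h4,
          mul_assoc, 𝔇.Ki_K, mul_one]
    · rw [if_neg (exc_neg.not.2 he), if_neg he, if_neg he]

/-- The product is x^a x^{-a} divided by two squared radii, times Λ². Since x^a x^{-a} is a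
combination of these same squares, the quotient is a combination of their inverses, and the
telescoping relation reappears for the λ_a. -/
theorem lam_neg_mul_lam (hs : s ≠ 0) (a : Idx N) : 𝔇.lam (negIdx a) * 𝔇.lam a =
    s ^ (-2 - 2 * rpExp N a a) • (𝔇.Lam * 𝔇.Lam * (𝔇.ri |(a : ℤ)| * 𝔇.ri |(a : ℤ)|) *
      (𝔇.ri (rIdx N a) * 𝔇.ri (rIdx N a)) * (𝔇.x a * 𝔇.x (negIdx a))) := by
  have h1 := (𝔇.x_W hs a a).eq
  rw [rExp_self] at h1
  have h2 := ((𝔇.ri_lam hs (inR_abs a)).mul_left hs (𝔇.rpi_lam hs (negIdx a))).eq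
  have h3 := 𝔇.ri_rpi hs (inR_abs a) (negIdx a)
  have h4 : 𝔇.W (negIdx a) * 𝔇.W a = s ^ (-4 : ℤ) • (𝔇.Lam * 𝔇.Lam *
      (𝔇.ri |(a : ℤ)| * 𝔇.ri |(a : ℤ)|) * (𝔇.ri (rIdx N a) * 𝔇.ri (rIdx N a))) := by
    unfold W
    rw [show |((negIdx a : Idx N) : ℤ)| = |(a : ℤ)| by rw [coe_negIdx, abs_neg], mul_assoc,
      ← mul_assoc _ 𝔇.Lam, h2, ← rpi_neg_mul_rpi _ hs]
    simp only [mul_smul_comm, smul_mul_assoc, mul_assoc]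
    rw [← mul_assoc (𝔇.rpi (negIdx a)) (𝔇.ri _), ← h3]
    simp only [mul_assoc]
    rfl
  unfold lam
  rw [negIdx_negIdx, mul_assoc, ← mul_assoc (𝔇.x a), h1]
  simp only [smul_mul_assoc, mul_smul_comm]
  rw [mul_assoc (𝔇.W a), ← mul_assoc (𝔇.W (negIdx a)), h4, smul_mul_assoc, smul_smul,
    ← zpow_add₀ hs]
  congr 2
  ring

end QD

end QEuclid

/-! ### The duality between coordinates and λ_a -/

namespace QEuclid

namespace QD

variable {N : ℕ} {s : ℂ} {A : Type*} [Ring A] [Algebra ℂ A] (𝔇 : QD N s A)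

omit [Algebra ℂ A] in
theorem rsq_of_inR {j : ℤ} (hj : InR N j) (r : ℤ → A) : rsq N r j = r j * r j :=
  if_neg (by have := hj.2.2; tauto)

theorem ri_sq_mul_r_sq {j : ℤ} (hj : InR N j) : (𝔇.ri j * 𝔇.ri j) * (𝔇.r j * 𝔇.r j) = 1 := by
  rw [mul_assoc, ← mul_assoc (𝔇.ri j) (𝔇.r j), 𝔇.ri_r j hj, one_mul, 𝔇.ri_r j hj]

/-- `Λ² r_j^{-2}`. -/
noncomputable def T (j : ℤ) : A := 𝔇.Lam * 𝔇.Lam * (𝔇.ri j * 𝔇.ri j)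

theorem T_mul (hs : s ≠ 0) {i j : ℤ} (hi : InR N i) (hj : InR N j) :
    𝔇.T i * (𝔇.ri j * 𝔇.ri j) * (𝔇.r i * 𝔇.r i) = 𝔇.T j ∧
    𝔇.T i * (𝔇.ri j * 𝔇.ri j) * (𝔇.r j * 𝔇.r j) = 𝔇.T i := by
  have h : Commute (𝔇.ri j) (𝔇.r i) := (𝔇.ri_comm hs hj hi).2
  have h2 : Commute (𝔇.ri j * 𝔇.ri j) (𝔇.r i * 𝔇.r i) :=
    (h.mul_right h).mul_left (h.mul_right h)
  constructor
  · rw [mul_assoc, h2.eq, ← mul_assoc, T, mul_assoc (𝔇.Lam * 𝔇.Lam), 𝔇.ri_sq_mul_r_sq hi, mul_one, T]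
  · rw [mul_assoc, 𝔇.ri_sq_mul_r_sq hj, mul_one]

theorem lam_ri_sq (hs : s ≠ 0) {j : ℤ} (hj : InR N j) :
    (𝔇.Lam * 𝔇.ri j) * (𝔇.Lam * 𝔇.ri j) = s ^ (-2 : ℤ) • 𝔇.T j := by
  rw [mul_assoc, ← mul_assoc (𝔇.ri j), (𝔇.ri_lam hs hj).eq, smul_mul_assoc, mul_smul_comm, T]
  simp only [mul_assoc]

theorem rsq_dual (hs : s ≠ 0) {j : ℤ} (hj : InR N j) :
    rsq N (fun j => cst N s j • (𝔇.Lam * 𝔇.ri j)) j = (cst N s j ^ 2 * (s ^ 2)⁻¹) • 𝔇.T j := by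
  rw [rsq_of_inR hj]
  simp only [smul_mul_assoc, mul_smul_comm, smul_smul]
  rw [𝔇.lam_ri_sq hs hj, smul_smul, sq, zpow_neg]
  norm_cast

theorem vfun_add_one {m : ℤ} (hm : InR N m) (r : ℤ → A) :
    vfun N s r (m + 1) = pC N s m • (r m * r m) := by
  rw [vfun, if_pos (by have := hm.1; omega), add_sub_cancel_right, rsq_of_inR hm]

theorem vfun_neg {m : ℤ} (hm : InR N m) (r : ℤ → A) :
    vfun N s r (-m) = (-(s ^ kap N m * pC N s m)) • (r m * r m) := by
  rw [vfun, if_neg (by have := hm.1; omega), neg_neg, rsq_of_inR hm, neg_smul]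

theorem vfun_even (hN : ¬ Odd N) (r : ℤ → A) : vfun N s r 0 = 0 ∧ vfun N s r 1 = 0 := by
  have : rsq N r 0 = 0 := if_pos ⟨rfl, hN⟩
  constructor
  · rw [vfun, if_neg (by norm_num), neg_zero, this, smul_zero, neg_zero]
  · rw [vfun, if_pos le_rfl, sub_self, this, smul_zero]

/-- Cancelling the squared radii leaves combinations of Λ² r_m⁻² for the two radii of λ_i, with
their roles interchanged; `NormConst.key` equates the coefficients. For i = 0, and for even N with
|i| = 1, only one radius occurs and the normalization enters directly. -/
theorem step_dual {c : Idx N → ℂ} (hc : NormConst N s c) (hs : Generic s) (i : Idx N) :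
    ((1 - s⁻¹ ^ 4) * s⁻¹ ^ (-twoRho N i)) •
      ((c (negIdx i) • 𝔇.lam (negIdx i)) * (c i • 𝔇.lam i)) =
    vfun N s⁻¹ (fun j => cst N s j • (𝔇.Lam * 𝔇.ri j)) ((i : ℤ) + 1) -
      vfun N s⁻¹ (fun j => cst N s j • (𝔇.Lam * 𝔇.ri j)) i := by
  have hs0 := hs.ne_zero
  have h4 := one_sub_ne hs
  rw [smul_mul_assoc, mul_smul_comm, smul_smul (c _), 𝔇.lam_neg_mul_lam hs0, 𝔇.mul_eq hs,
    inv_zpow, zpow_neg, inv_inv]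
  have hm := inR_abs i
  have hm' := inR_rIdx i
  rw [show 𝔇.Lam * 𝔇.Lam * (𝔇.ri |(i : ℤ)| * 𝔇.ri |(i : ℤ)|) = 𝔇.T |(i : ℤ)| from rfl]
  have hT := 𝔇.T_mul hs0 hm hm'
  have hu := zpow_ne_zero (twoRho N (i : ℤ)) hs0
  have habs := abs_cases (i : ℤ)
  by_cases he : Exc N i
  · have hN := he.1
    have h1 : |(i : ℤ)| = 1 := by rcases he.2 with h | h <;> rw [h] <;> rfl
    have h0 : (i : ℤ) ≠ 0 := by omega
    have hr : rIdx N i = 1 := by rw [rIdx, if_neg h0, if_pos he]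
    have ht1 : twoRho N 1 = 0 := by rw [twoRho_pos one_pos, if_neg hN]; norm_num
    have ht : twoRho N i = 0 := by
      rcases he.2 with h | h <;> rw [h]
      · exact ht1
      · rw [twoRho_neg, ht1, neg_zero]
    have hk : kap N 1 = 0 := by rw [kap_eq le_rfl, ht1, mul_zero]
    have hP : c (negIdx i) * c i = 4 * (s ^ 4 * kConst s ^ 2)⁻¹ := by
      rcases he.2 with h | h
      · rw [mul_comm, hc.one_even hN i h]
      · have := hc.one_even hN (negIdx i) (by simp [h])
        rwa [negIdx_negIdx] at this
    have hc1 : cst N s 1 = 2 * (s * kConst s)⁻¹ := by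
      rw [cst, if_neg one_ne_zero, omega, ht1]; norm_num; ring
    have hp : pC N s 1 = (1 - s ^ 4) / 2 := by rw [pC, hk, zpow_zero]; norm_num
    have hp' : pC N s⁻¹ 1 = -(s ^ 4)⁻¹ * ((1 - s ^ 4) / 2) := by
      rw [pC_inv hs, hk, zpow_zero, hp, mul_one]
    have hT := hT.1
    have h1N := inR_one ⟨i, he⟩
    have hd := 𝔇.rsq_dual hs0 h1N
    rw [h1, hr] at hT ⊢
    rw [hP, ht]
    have hkc := hs.kConst_ne
    generalize kConst s = k at *
    rcases he.2 with h | h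
    · have e : rpExp N 1 1 = -1 := by
        rw [rpExp, if_neg (by norm_num), if_pos (by rwa [h] at he), if_pos rfl]; decide
      have hV := vfun_add_one (s := s) h1N 𝔇.r
      have hV' := vfun_add_one (s := s⁻¹) h1N (fun j => cst N s j • (𝔇.Lam * 𝔇.ri j))
      rw [h, V, V, hV, hV', (vfun_even hN _).2, (vfun_even hN _).2, sub_zero, sub_zero,
        ← rsq_of_inR h1N (fun j => cst N s j • (𝔇.Lam * 𝔇.ri j)), hd, mul_smul_comm, mul_smul_comm, hT,
        hc1, hp, hp', e]
      simp only [smul_smul]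
      congr 1
      norm_num
      field_simp
      try ring
    · have e : rpExp N (-1) (-1) = -1 := by
        rw [rpExp, if_neg (by norm_num), if_pos (by rwa [h] at he), if_neg (by norm_num)]; decide
      have hV := vfun_neg (s := s) h1N 𝔇.r
      have hV' := vfun_neg (s := s⁻¹) h1N (fun j => cst N s j • (𝔇.Lam * 𝔇.ri j))
      rw [h, V, V, hV, hV', show (-1 : ℤ) + 1 = 0 from rfl, (vfun_even hN _).1, (vfun_even hN _).1,
        zero_sub, zero_sub, ← neg_smul, ← neg_smul, neg_neg, neg_neg,
        ← rsq_of_inR h1N (fun j => cst N s j • (𝔇.Lam * 𝔇.ri j)), hd, mul_smul_comm, mul_smul_comm, hT,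
        hc1, hp, hp', e, hk]
      simp only [smul_smul]
      congr 1
      norm_num
      field_simp
      try ring
  · by_cases h0 : (i : ℤ) = 0
    · have hN := odd_of_zero h0
      have h1 : |(i : ℤ)| = 0 := abs_eq_zero.2 h0
      have hr : rIdx N i = 0 := by rw [rIdx, if_pos h0]
      have h0N : InR N 0 := h1 ▸ hm
      have hk : kap N 0 = 2 := by rw [kap, if_pos hN]; rfl
      have hp : pC N s 0 = 1 - s ^ 2 := by
        have := hs.one_add_zpow 2
        rw [pC, hk, div_eq_iff this]
        norm_cast
        ring
      have hp' : pC N s⁻¹ 0 = -(s ^ 2)⁻¹ * (1 - s ^ 2) := by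
        rw [pC_inv hs, hp, hk]
        norm_cast
        field_simp
      have e : rpExp N 0 0 = 0 := by rw [rpExp, if_pos rfl]; rfl
      have hn : negIdx i = i := idx_ext_iff.2 (by simp [h0])
      have hV := vfun_add_one (s := s) h0N 𝔇.r
      have hV' := vfun_add_one (s := s⁻¹) h0N (fun j => cst N s j • (𝔇.Lam * 𝔇.ri j))
      have hW := vfun_neg (s := s) h0N 𝔇.r
      have hW' := vfun_neg (s := s⁻¹) h0N (fun j => cst N s j • (𝔇.Lam * 𝔇.ri j))
      have hT := hT.1
      have hd := 𝔇.rsq_dual hs0 h0N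
      rw [h1, hr] at hT ⊢
      rw [neg_zero] at hW hW'
      rw [hn, hc.zero i h0, h0, V, V, hV, hV', hW, hW', twoRho_zero, zpow_zero,
        ← rsq_of_inR h0N (fun j => cst N s j • (𝔇.Lam * 𝔇.ri j)), hd, mul_smul_comm, mul_sub,
        mul_smul_comm, mul_smul_comm, hT, hp, hp', e, hk, cst, if_pos rfl]
      have hh := hs.hConst_ne
      generalize hConst s = H at *
      have z2 : s ^ (2 : ℤ) = s ^ 2 := by norm_cast
      rw [inv_zpow, z2]
      norm_num
      match_scalars
      field_simp
      try ring
    · have hr : rIdx N i = |(i : ℤ)| - 1 := by rw [rIdx, if_neg h0, if_neg he]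
      have hdm := 𝔇.rsq_dual hs0 hm
      have hdm' := 𝔇.rsq_dual hs0 hm'
      have hV := vfun_add_one (s := s) hm 𝔇.r
      have hV' := vfun_add_one (s := s⁻¹) hm (fun j => cst N s j • (𝔇.Lam * 𝔇.ri j))
      have hW := vfun_neg (s := s) hm 𝔇.r
      have hW' := vfun_neg (s := s⁻¹) hm (fun j => cst N s j • (𝔇.Lam * 𝔇.ri j))
      have iV := vfun_add_one (s := s) hm' 𝔇.r
      have iV' := vfun_add_one (s := s⁻¹) hm' (fun j => cst N s j • (𝔇.Lam * 𝔇.ri j))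
      have iW := vfun_neg (s := s) hm' 𝔇.r
      have iW' := vfun_neg (s := s⁻¹) hm' (fun j => cst N s j • (𝔇.Lam * 𝔇.ri j))
      rw [rsq_of_inR hm] at hdm
      rw [rsq_of_inR hm'] at hdm'
      rcases lt_or_gt_of_ne h0 with h | h
      · have ha : |(i : ℤ)| = -i := by omega
        obtain ⟨k1, k2⟩ := hc.key hs (negIdx i) (by simpa using h) (by rwa [coe_negIdx, exc_neg])
        have e : rpExp N i i = 1 := by
          rw [rpExp, if_neg h0, if_neg he, rExp]; split_ifs <;> omega
        have hkm := kap_eq (N := N) (i := -i) (by omega)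
        have hkm' := kap_sub_one (N := N) (i := -i) (by omega)
        rw [coe_negIdx, negIdx_negIdx] at k1 k2
        rw [hr, ha] at hT hdm' iW iW' ⊢
        rw [ha] at hdm hW hW'
        rw [neg_neg] at hW hW'
        rw [show -(-(i : ℤ) - 1) = i + 1 by ring] at iW iW'
        rw [hkm] at hW hW'
        rw [hkm'] at iW iW'
        rw [V, V, hW, hW', iW, iW', hdm, hdm', e, mul_smul_comm, mul_sub, mul_smul_comm,
          mul_smul_comm, hT.1, hT.2]
        rw [twoRho_neg] at *
        have h5 : s ^ (2 * -twoRho N (i : ℤ)) = (s ^ twoRho N (i : ℤ) * s ^ twoRho N (i : ℤ))⁻¹ := by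
          rw [← zpow_add₀ hs0, ← zpow_neg]; ring_nf
        have h6 : s ^ (2 * -twoRho N (i : ℤ) + 4) =
            (s ^ twoRho N (i : ℤ) * s ^ twoRho N (i : ℤ))⁻¹ * s ^ 4 := by
          rw [zpow_add₀ hs0, h5]; norm_cast
        rw [h5] at k1 k2
        rw [inv_zpow, inv_zpow, h5, h6]
        generalize s ^ twoRho N (i : ℤ) = u at *
        have e1 : pC N s⁻¹ (-i) * (cst N s (-i) ^ 2 * (s ^ 2)⁻¹) = (s ^ 4)⁻¹ *
          (c (negIdx i) * c i * ((u * u)⁻¹ * pC N s (-i - 1))) := by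
          rw [k1]; field_simp
        have e2 : pC N s⁻¹ (-i - 1) * (cst N s (-i - 1) ^ 2 * (s ^ 2)⁻¹) = (s ^ 4)⁻¹ *
          (c (negIdx i) * c i * ((u * u)⁻¹ * pC N s (-i))) := by
          rw [k2]; field_simp
        simp only [smul_smul, neg_mul, mul_assoc, neg_smul]
        rw [e1, e2]
        norm_num
        match_scalars <;> field_simp <;> ring
      · have ha : |(i : ℤ)| = i := by omega
        have hkey := hc.key hs i h he
        have e : rpExp N i i = -1 := by
          rw [rpExp, if_neg h0, if_neg he, rExp]; split_ifs <;> omega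
        have h5 : s ^ (2 * twoRho N (i : ℤ)) = s ^ twoRho N (i : ℤ) * s ^ twoRho N (i : ℤ) := by
          rw [← zpow_add₀ hs0]; ring_nf
        rw [hr, ha] at hT hdm' iV iV' ⊢
        rw [ha] at hdm hV hV'
        rw [h5] at hkey
        rw [sub_add_cancel] at iV iV'
        rw [V, V, hV, hV', iV, iV', hdm, hdm', e, mul_smul_comm, mul_sub, mul_smul_comm,
          mul_smul_comm, hT.1, hT.2]
        obtain ⟨k1, k2⟩ := hkey

        have e1 : pC N s⁻¹ i * (cst N s i ^ 2 * (s ^ 2)⁻¹) = (s ^ 4)⁻¹ * (c i * c (negIdx i) *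
          (s ^ twoRho N i * s ^ twoRho N i * pC N s (i - 1))) := by
          rw [k1]; field_simp
        have e2 : pC N s⁻¹ (i - 1) * (cst N s (i - 1) ^ 2 * (s ^ 2)⁻¹) = (s ^ 4)⁻¹ *
          (c i * c (negIdx i) * (s ^ twoRho N i * s ^ twoRho N i * pC N s i)) := by
          rw [k2]; field_simp
        rw [smul_smul (pC N s⁻¹ i), smul_smul (pC N s⁻¹ (i - 1)), e1, e2]
        generalize s ^ twoRho N (i : ℤ) = u at *
        norm_num
        match_scalars <;> field_simp <;> ring

/-- The duality that interchanges the `x^i` and the `λ_{-i}`. -/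
noncomputable def dual {c : Idx N → ℂ} (hc : NormConst N s c) (hs : Generic s) : QD N s⁻¹ A where
  x i := c (negIdx i) • 𝔇.lam (negIdx i)
  r j := cst N s j • (𝔇.Lam * 𝔇.ri j)
  ri j := (cst N s j)⁻¹ • (𝔇.r j * 𝔇.Lami)
  Lam := 𝔇.Lam
  Lami := 𝔇.Lami
  K := 𝔇.Ki
  Ki := 𝔇.K
  r_ri j hj := by
    rw [smul_mul_assoc, mul_smul_comm, smul_smul, mul_inv_cancel₀ (cst_ne hs j), one_smul,
      mul_assoc, ← mul_assoc (𝔇.ri j), 𝔇.ri_r j hj, one_mul, 𝔇.Lam_Lami]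
  ri_r j hj := by
    rw [smul_mul_assoc, mul_smul_comm, smul_smul, inv_mul_cancel₀ (cst_ne hs j), one_smul,
      mul_assoc, ← mul_assoc 𝔇.Lami, 𝔇.Lami_Lam, one_mul, 𝔇.r_ri j hj]
  Lam_Lami := 𝔇.Lam_Lami
  Lami_Lam := 𝔇.Lami_Lam
  K_Ki := 𝔇.Ki_K
  Ki_K := 𝔇.K_Ki
  r_comm i j hi hj := by
    have h1 := 𝔇.ri_lam hs.ne_zero hi
    have h2 := 𝔇.ri_lam hs.ne_zero hj
    have h3 : QComm s 0 (𝔇.ri i) (𝔇.ri j) := QComm.of_commute (𝔇.ri_comm hs.ne_zero hi hj).1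
    exact (((QComm.refl.mul_right hs.ne_zero (h2.symm hs.ne_zero)).mul_left hs.ne_zero
      (h1.mul_right hs.ne_zero h3)).smul_left (cst N s i)).smul_right (cst N s j) |>.commute
        (by norm_num)
  x_x i j h h' := (((𝔇.lam_lam hs.ne_zero (negIdx i) (negIdx j) (by simpa using h)
    (by simp only [coe_negIdx]; omega)).smul_left _).smul_right _).invert.congr (by norm_num)
  x_r i j hj := by
    have h1 := (𝔇.W_lam hs.ne_zero (negIdx i)).mul_right hs.ne_zero (𝔇.W_ri hs.ne_zero (negIdx i) hj)
    have h2 := (𝔇.x_lam i).mul_right hs.ne_zero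
      ((𝔇.x_r i j hj).inv_right hs.ne_zero (𝔇.r_ri j hj) (𝔇.ri_r j hj))
    rw [← negIdx_negIdx i] at h2
    refine (((h1.mul_left hs.ne_zero h2).smul_left _).smul_right _).invert.congr ?_
    rw [negIdx_negIdx]
    ring
  x_lam i := by
    have h2 := 𝔇.x_lam i
    rw [← negIdx_negIdx i] at h2
    exact (((𝔇.W_lam hs.ne_zero (negIdx i)).mul_left hs.ne_zero h2).smul_left _).invert.congr
      (by norm_num)
  r_lam j hj := ((QComm.refl.mul_left hs.ne_zero (𝔇.ri_lam hs.ne_zero hj)).smul_left _).invert.congr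
    (by norm_num)
  K_r j hj := by
    have h := ((QComm.of_commute (s := s) 𝔇.K_lam).mul_right hs.ne_zero
      ((QComm.of_commute (𝔇.K_r j hj)).inv_right hs.ne_zero (𝔇.r_ri j hj) (𝔇.ri_r j hj))).inv_left
        hs.ne_zero 𝔇.K_Ki 𝔇.Ki_K
    exact (h.smul_right _).commute (by norm_num)
  K_lam := ((QComm.of_commute (s := s) 𝔇.K_lam).inv_left hs.ne_zero 𝔇.K_Ki 𝔇.Ki_K).commute
    (by norm_num)
  K_x hN i := by
    have h2 := 𝔇.K_x hN i
    rw [← negIdx_negIdx i] at h2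
    refine ((((𝔇.W_K hs.ne_zero (negIdx i)).symm hs.ne_zero).mul_right hs.ne_zero h2).inv_left
      hs.ne_zero 𝔇.K_Ki 𝔇.Ki_K).smul_right _ |>.invert.congr ?_
    rw [negIdx_negIdx]
    ring
  x_zero i hi := by
    have hn : negIdx i = i := idx_ext_iff.2 (by simp [hi])
    have h0 := inR_abs i
    rw [hi, abs_zero] at h0
    rw [hn, hc.zero i hi, cst, if_pos rfl, lam, hn, W, rpi, if_pos hi, hi, abs_zero,
      𝔇.x_zero i hi, mul_assoc, mul_assoc, 𝔇.ri_r 0 h0, mul_one]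
  step i := by
    rw [negIdx_negIdx]
    exact 𝔇.step_dual hc hs i

theorem dual_rpi {c : Idx N → ℂ} (hc : NormConst N s c) (hs : Generic s) (a : Idx N) :
    ∃ k : ℂ, k ≠ 0 ∧ (𝔇.dual hc hs).rpi a * (𝔇.Lam * 𝔇.rpi a) = k • (1 : A) := by
  have key : ∃ k : ℂ, k ≠ 0 ∧ (𝔇.dual hc hs).rp a = k • (𝔇.Lam * 𝔇.rpi a) := by
    unfold rp rpi
    by_cases h0 : (a : ℤ) = 0
    · rw [if_pos h0, if_pos h0]
      exact ⟨_, cst_ne hs 0, rfl⟩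
    · rw [if_neg h0, if_neg h0]
      by_cases he : Exc N a
      · rw [if_pos he, if_pos he]
        have h1 := inR_one ⟨a, he⟩
        have h2 := (QComm.of_commute (s := s) (𝔇.K_r _ h1)).inv_right hs.ne_zero (𝔇.r_ri _ h1)
          (𝔇.ri_r _ h1)
        have h3 := h2.commute (by norm_num)
        have h4 := (h2.inv_left hs.ne_zero 𝔇.K_Ki 𝔇.Ki_K).commute (by norm_num)
        refine ⟨cst N s 1, cst_ne hs 1, ?_⟩
        split_ifs
        · rw [h4, ← mul_assoc, ← smul_mul_assoc]; rfl
        · rw [h3, ← mul_assoc, ← smul_mul_assoc]; rfl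
      · rw [if_neg he, if_neg he]
        exact ⟨_, cst_ne hs _, rfl⟩
  obtain ⟨k, hk, h⟩ := key
  refine ⟨k⁻¹, inv_ne_zero hk, ?_⟩
  have := ((𝔇.dual hc hs).rp_mul_rpi a).2
  rw [h, mul_smul_comm] at this
  rw [← this, smul_smul, inv_mul_cancel₀ hk, one_smul]

/-- The elements `λ_a` of the dual realization. -/
theorem dual_lam {c : Idx N → ℂ} (hc : NormConst N s c) (hs : Generic s) (a : Idx N) :
    ∃ k : ℂ, k ≠ 0 ∧ (𝔇.dual hc hs).lam a = k • 𝔇.x (negIdx a) := by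
  obtain ⟨k, hk, h⟩ := 𝔇.dual_rpi hc hs a
  have hm := inR_abs a
  refine ⟨c a * k * (cst N s |(a : ℤ)|)⁻¹ * s ^ (-2 : ℤ),
    mul_ne_zero (mul_ne_zero (mul_ne_zero (hc.ne_zero hs a) hk) (inv_ne_zero (cst_ne hs _)))
      (zpow_ne_zero _ hs.ne_zero), ?_⟩
  have h1 : (𝔇.dual hc hs).x (negIdx a) = c a • (𝔇.W a * 𝔇.x (negIdx a)) := by
    change c (negIdx (negIdx a)) • 𝔇.lam (negIdx (negIdx a)) = _
    rw [negIdx_negIdx, lam]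
  have h2 : (𝔇.dual hc hs).ri |(a : ℤ)| = (cst N s |(a : ℤ)|)⁻¹ • (𝔇.r |(a : ℤ)| * 𝔇.Lami) := rfl
  have h3 : (𝔇.dual hc hs).Lam = 𝔇.Lam := rfl
  have h4 := (((𝔇.ri_lam hs.ne_zero hm).symm hs.ne_zero).inv_left hs.ne_zero 𝔇.Lam_Lami
    𝔇.Lami_Lam).eq
  have h5 : (𝔇.dual hc hs).rpi a * 𝔇.W a = k • 𝔇.ri |(a : ℤ)| := by
    rw [W, 𝔇.ri_rpi hs.ne_zero hm, ← mul_assoc 𝔇.Lam, ← mul_assoc, h, smul_mul_assoc, one_mul]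
  have h6 : (𝔇.dual hc hs).ri |(a : ℤ)| * 𝔇.ri |(a : ℤ)| =
      ((cst N s |(a : ℤ)|)⁻¹ * s ^ (-2 : ℤ)) • 𝔇.Lami := by
    rw [h2, smul_mul_assoc, mul_assoc, h4, mul_smul_comm, ← mul_assoc, 𝔇.r_ri _ hm, one_mul,
      smul_smul]
    norm_num
  rw [lam, W, h1, h3, mul_smul_comm, mul_assoc, mul_assoc, ← mul_assoc (rpi _ _), h5]
  rw [smul_mul_assoc, mul_smul_comm, ← mul_assoc (ri _ _), h6, smul_mul_assoc, mul_smul_comm,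
    mul_smul_comm, ← mul_assoc, 𝔇.Lam_Lami, one_mul, smul_smul, smul_smul]
  congr 1
  ring

/-- The commutation relations of the `λ_h` and the `[λ_i, x^a]`. -/
theorem lam_e {c : Idx N → ℂ} (hc : NormConst N s c) (hs : Generic s) (a h i : Idx N) :
    (c h • 𝔇.lam h) * (c i • 𝔇.e i a) =
      (s ^ 2)⁻¹ • ∑ j, ∑ k, rhatInv N s (h, i) (j, k) • ((c j • 𝔇.e j a) * (c k • 𝔇.lam k)) := by
  obtain ⟨k, hk, hl⟩ := 𝔇.dual_lam hc hs (negIdx a)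
  have hx : ∀ b, (𝔇.dual hc hs).x b = c (negIdx b) • 𝔇.lam (negIdx b) := fun _ => rfl
  have he : ∀ b, (𝔇.dual hc hs).e (negIdx a) b = (-k) • (c (negIdx b) • 𝔇.e (negIdx b) a) := by
    intro b
    rw [e, hl, hx, negIdx_negIdx, e]
    simp only [smul_mul_assoc, mul_smul_comm, smul_sub]
    module
  -- In the dual the coordinates are λ's and the λ's are multiples of the x's, so its commutators
  -- are again [λ, x] up to a factor. The exchange relation at `s⁻¹` with reflected indices is the
  -- claim, by `rhat_flip`.
  have := (𝔇.dual hc hs).x_e hs.inv (negIdx a) (negIdx h) (negIdx i)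
  simp only [he, hx, negIdx_negIdx, mul_smul_comm (-k), smul_mul_assoc (-k)] at this
  rw [← sum_negIdx] at this
  simp_rw [← sum_negIdx (fun l => rhat N s⁻¹ (_, _) (_, l) • _)] at this
  simp only [rhat_flip hs.ne_zero, negIdx_negIdx, smul_comm _ (-k), ← Finset.smul_sum] at this
  have h2 := congrArg ((-k)⁻¹ • ·) this
  simp only [smul_smul, inv_mul_cancel₀ (neg_ne_zero.2 hk), one_smul] at h2
  rw [h2, inv_pow, inv_mul_cancel_left₀ (neg_ne_zero.2 hk)]

end QD

end QEuclid

/-! ### The relations P_a x x = 0 in a realization -/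

namespace QEuclid

variable {N : ℕ} {s : ℂ}

/-- The largest index. -/
abbrev top (N : ℕ) : ℤ := ((N / 2 : ℕ) : ℤ)

theorem inR_top (hN : 3 ≤ N) : InR N (top N) := ⟨Int.natCast_nonneg _, le_rfl, Or.inl (by unfold top; omega)⟩

theorem kap_top : kap N (top N) = 4 - 2 * (N : ℤ) := by
  unfold kap top
  split_ifs with h
  · obtain ⟨m, rfl⟩ := h
    rw [show (2 * m + 1) / 2 = m by omega]
    push_cast
    ring
  · rw [Nat.not_odd_iff_even] at h
    obtain ⟨m, rfl⟩ := h
    rw [show (m + m) / 2 = m by omega]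
    push_cast
    ring

theorem zpow_kap_top (hs : s ≠ 0) : s ^ kap N (top N) = s ^ 2 * muConst N s := by
  rw [kap_top, muConst, show (4 - 2 * (N : ℤ)) = 2 + (2 - 2 * N) by ring, zpow_add₀ hs]
  rfl

theorem one_add_sq_mu_ne (hs : Generic s) : 1 + s ^ 2 * muConst N s ≠ 0 := by
  rw [← zpow_kap_top hs.ne_zero]
  exact hs.one_add_zpow _

/-- Removes the trace from the coefficient of g g in P_a, which can then be compared with the
coefficient of r_n² in V_{-n}. -/
theorem mu_sub_div_gTrace (hN : 3 ≤ N) (hs : Generic s) : (muConst N s - s ^ 2) * (gTrace N s)⁻¹ =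
    -(kConst s * s ^ 2 * muConst N s) * (1 + s ^ 2 * muConst N s)⁻¹ := by
  have h := k_mul_gTrace_eq hN hs.ne_zero
  have h1 := gTrace_ne hN hs
  have h2 := one_add_sq_mu_ne (N := N) hs
  have h3 := muConst_ne (N := N) hs.ne_zero
  have h4 := hs.ne_zero
  generalize gTrace N s = c at *
  generalize muConst N s = m at *
  generalize kConst s = k at *
  field_simp at h ⊢
  linear_combination h

theorem projT_sum {M : Type*} [AddCommGroup M] [Module ℂ M] (F : Idx N → Idx N → M) (i j : Idx N) :
    ∑ k, ∑ l, projT N s (i, j) (k, l) • F k l =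
      ((gTrace N s)⁻¹ * gMat N s i j) • ∑ k, ∑ l, gMat N s k l • F k l := by
  rw [projT_eq]
  simp only [gg, Matrix.smul_apply, Matrix.of_apply, smul_eq_mul, Finset.smul_sum, smul_smul,
    mul_assoc]

theorem one_sum {M : Type*} [AddCommGroup M] [Module ℂ M] (F : Idx N → Idx N → M) (i j : Idx N) :
    ∑ k, ∑ l, (1 : Matrix (Idx N × Idx N) (Idx N × Idx N) ℂ) (i, j) (k, l) • F k l = F i j := by
  rw [Finset.sum_eq_single i, Finset.sum_eq_single j]
  · simp
  · intro b _ hb; simp [hb.symm]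
  · simp
  · intro b _ hb; simp [hb.symm]
  · simp

theorem projA_sum {M : Type*} [AddCommGroup M] [Module ℂ M] (F : Idx N → Idx N → M) (i j : Idx N) :
    ∑ k, ∑ l, projA N s (i, j) (k, l) • F k l =
      (s ^ 2 + (s ^ 2)⁻¹)⁻¹ • (s ^ 2 • F i j - ∑ k, ∑ l, rhat N s (i, j) (k, l) • F k l +
        ((muConst N s - s ^ 2) * (gTrace N s)⁻¹ * gMat N s i j) •
          ∑ k, ∑ l, gMat N s k l • F k l) := by
  rw [mul_assoc, mul_smul, ← projT_sum]
  nth_rewrite 1 [← one_sum F i j]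
  rw [projA_eq]
  simp only [Matrix.smul_apply, Matrix.add_apply, Matrix.sub_apply, smul_eq_mul, Finset.smul_sum,
    ← Finset.sum_sub_distrib, ← Finset.sum_add_distrib, smul_smul, ← sub_smul, ← add_smul]

namespace QD

variable {A : Type*} [Ring A] [Algebra ℂ A] (𝔇 : QD N s A)

theorem V_top (hN : 3 ≤ N) (hs : Generic s) :
    𝔇.V (top N + 1) = ((1 - s ^ 4) * (1 + s ^ 2 * muConst N s)⁻¹) • (𝔇.r (top N) * 𝔇.r (top N)) ∧
    𝔇.V (-top N) = (-(s ^ 2 * muConst N s * ((1 - s ^ 4) * (1 + s ^ 2 * muConst N s)⁻¹))) •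
      (𝔇.r (top N) * 𝔇.r (top N)) := by
  have h1 := vfun_add_one (s := s) (inR_top hN) 𝔇.r
  have h2 := vfun_neg (s := s) (inR_top hN) 𝔇.r
  rw [pC, zpow_kap_top hs.ne_zero, div_eq_mul_inv] at h1 h2
  exact ⟨h1, h2⟩

/-- `∑ g_{kl} x^k x^l = r_n^2`. -/
theorem sum_g_x_x (hN : 3 ≤ N) (hs : Generic s) :
    ∑ k, ∑ l, gMat N s k l • (𝔇.x k * 𝔇.x l) = 𝔇.r (top N) * 𝔇.r (top N) := by
  have h4 := one_sub_ne hs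
  have h := sum_idx_lt (fun i : Idx N => ((1 - s ^ 4) * s ^ (-twoRho N i)) •
    (𝔇.x i * 𝔇.x (negIdx i))) 𝔇.V (fun i => by rw [𝔇.V_step]; abel)
    (fun hN => by rw [(𝔇.V_zero_even hN).1, (𝔇.V_zero_even hN).2]) (top N + 1) (by unfold top; omega) le_rfl
  rw [(𝔇.V_top hN hs).1, (𝔇.V_top hN hs).2, ← sub_smul] at h
  rw [sum_gMat s (fun k l => 𝔇.x k * 𝔇.x l)]
  have h2 : (1 - s ^ 4) • ∑ i : Idx N, s ^ (-twoRho N i) • (𝔇.x i * 𝔇.x (negIdx i)) =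
      (1 - s ^ 4) • (𝔇.r (top N) * 𝔇.r (top N)) := by
    rw [Finset.smul_sum]
    refine Eq.trans (Finset.sum_congr rfl fun i _ => ?_) (h.trans ?_)
    · rw [if_pos (by have := (idx_mem i).2.1; unfold top; omega), smul_smul]
    · congr 1
      have := one_add_sq_mu_ne (N := N) hs
      field_simp
      ring
  have h3 := congrArg ((1 - s ^ 4)⁻¹ • ·) h2
  simpa only [smul_smul, inv_mul_cancel₀ h4, one_smul] using h3

/-- On opposite pairs the partial sum telescopes to V_{-i} - V_{-n}, and V_{-i} is the combination
that turns the remaining terms into q x^i x^{-i}. Only the lower end V_{-n} survives; it is a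
multiple of r_n² and belongs to the trace part. -/
theorem rhat_x_x (hs : Generic s) (i j : Idx N) :
    ∑ k, ∑ l, rhat N s (i, j) (k, l) • (𝔇.x k * 𝔇.x l) =
      s ^ 2 • (𝔇.x i * 𝔇.x j) - ((s ^ 2)⁻¹ * gMat N s i j) • 𝔇.V (-top N) := by
  have hs0 := hs.ne_zero
  have hk : kConst s = s ^ 2 - (s ^ 2)⁻¹ := rfl
  by_cases hj : j = negIdx i
  · subst hj
    have h := sum_idx_lt (fun i : Idx N => ((1 - s ^ 4) * s ^ (-twoRho N i)) •
      (𝔇.x i * 𝔇.x (negIdx i))) 𝔇.V (fun i => by rw [𝔇.V_step]; abel)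
      (fun hN => by rw [(𝔇.V_zero_even hN).1, (𝔇.V_zero_even hN).2]) (-i)
      (by have := (idx_mem (negIdx i)).1; simpa using this)
      (by have := (idx_mem (negIdx i)).2.1; rw [coe_negIdx] at this; omega)
    have h2 : (1 - s ^ 4) • ∑ l : Idx N, (if (l : ℤ) < -i then
        s ^ (-twoRho N l) • (𝔇.x l * 𝔇.x (negIdx l)) else 0) = 𝔇.V (-i) - 𝔇.V (-top N) := by
      rw [Finset.smul_sum, ← h]
      refine Finset.sum_congr rfl fun i _ => ?_
      split_ifs
      · rw [smul_smul]
      · rw [smul_zero]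
    rw [rhat_sum_neg s (fun k l => 𝔇.x k * 𝔇.x l), gMat_neg]
    generalize (∑ l : Idx N, (if (l : ℤ) < -i then
        s ^ (-twoRho N l) • (𝔇.x l * 𝔇.x (negIdx l)) else 0)) = S at *
    have h3 : (kConst s * s ^ (-twoRho N i)) • S =
        -((s ^ 2)⁻¹ * s ^ (-twoRho N i)) • (𝔇.V (-i) - 𝔇.V (-top N)) := by
      rw [← h2, smul_smul, hk]
      congr 1
      field_simp
      ring
    rw [h3]
    rcases lt_trichotomy (i : ℤ) 0 with h0 | h0 | h0
    · have hV := 𝔇.V_pos hs (negIdx i) (by simp only [coe_negIdx]; omega)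
      rw [negIdx_negIdx, coe_negIdx, twoRho_neg, neg_neg] at hV
      rw [hV, if_pos h0, hk, zpow_neg]
      have hu := zpow_ne_zero (twoRho N (i : ℤ)) hs0
      generalize s ^ twoRho N (i : ℤ) = u at *
      simp (disch := omega) only [zConst, if_neg]
      match_scalars <;> field_simp <;> ring
    · have hn : negIdx i = i := idx_ext_iff.2 (by simp [h0])
      rw [hn, h0, neg_zero, (𝔇.V_zero hs i h0).1, twoRho_zero]
      simp only [zConst, if_true, lt_irrefl, if_false, neg_zero, zpow_zero]
      match_scalars <;> field_simp <;> ring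
    · have hV := 𝔇.V_neg hs i (by omega)
      rw [hV, if_neg (by omega), zpow_neg]
      have hu := zpow_ne_zero (twoRho N (i : ℤ)) hs0
      generalize s ^ twoRho N (i : ℤ) = u at *
      simp (disch := omega) only [zConst, if_neg]
      match_scalars <;> field_simp <;> ring
  · have hj' : (j : ℤ) ≠ -i := fun h => hj (idx_ext_iff.2 h)
    rw [rhat_sum_ne s (fun k l => 𝔇.x k * 𝔇.x l) i j hj', gMat_apply, if_neg hj, mul_zero,
      zero_smul, sub_zero]
    rcases lt_trichotomy (i : ℤ) j with h | h | h
    · have := (𝔇.x_x i j h (by omega)).eq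
      rw [if_neg (by rintro rfl; exact lt_irrefl _ h), if_pos h, this, hk]
      match_scalars
      norm_cast
      field_simp
      ring
    · obtain rfl := idx_ext_iff.2 h
      rw [if_pos rfl, if_neg (lt_irrefl _), zero_smul, add_zero]
    · have := (𝔇.x_x j i h (by omega)).eq
      rw [if_neg (by rintro rfl; exact lt_irrefl _ h), if_neg (by omega), zero_smul, add_zero,
        one_smul, this]
      norm_cast

/-- `P_a x x = 0`. -/
theorem projA_x_x (hN : 3 ≤ N) (hs : Generic s) (i j : Idx N) :
    ∑ k, ∑ l, projA N s (i, j) (k, l) • (𝔇.x k * 𝔇.x l) = 0 := by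
  rw [projA_sum, 𝔇.rhat_x_x hs, 𝔇.sum_g_x_x hN hs, (𝔇.V_top hN hs).2, mu_sub_div_gTrace hN hs,
    kConst, smul_eq_zero]
  right
  have h1 := one_add_sq_mu_ne (N := N) hs
  have h2 := hs.ne_zero
  match_scalars <;> field_simp <;> ring

end QD

theorem gTrace_inv (s : ℂ) : gTrace N s⁻¹ = gTrace N s := by
  unfold gTrace
  rw [← sum_negIdx]
  refine Finset.sum_congr rfl fun i _ => ?_
  rw [← sum_negIdx]
  simp only [gMat_flip]

theorem projT_flip (s : ℂ) (i j k l : Idx N) :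
    projT N s⁻¹ (negIdx i, negIdx j) (negIdx k, negIdx l) = projT N s (i, j) (k, l) := by
  rw [projT_eq, projT_eq]
  simp only [Matrix.smul_apply, gg, Matrix.of_apply, gMat_flip, gTrace_inv]

theorem muConst_inv (s : ℂ) : muConst N s⁻¹ = (muConst N s)⁻¹ := by
  rw [muConst, inv_zpow, muConst]

/-- R̂ and its inverse have the same spectral projectors; the reflection exchanges the two matrices
and inverts the eigenvalues, so P_a stays fixed. -/
theorem projA_flip (hN : 3 ≤ N) (hs : Generic s) (i j k l : Idx N) :
    projA N s⁻¹ (negIdx i, negIdx j) (negIdx k, negIdx l) = projA N s (i, j) (k, l) := by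
  have h1 := congrFun (congrFun (rhatInv_eq hN hs) (i, j)) (k, l)
  have h2 := sq_add_ne hs
  rw [projA_eq]
  simp only [projS, Matrix.smul_apply, Matrix.add_apply, Matrix.sub_apply, rhat_flip hs.ne_zero,
    projT_flip, muConst_inv, smul_eq_mul] at h1 ⊢
  have h3 : (1 : Matrix (Idx N × Idx N) (Idx N × Idx N) ℂ) (negIdx i, negIdx j) (negIdx k, negIdx l)
      = (1 : Matrix (Idx N × Idx N) (Idx N × Idx N) ℂ) (i, j) (k, l) := by
    simp only [Matrix.one_apply, Prod.mk.injEq, negIdx_inj]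
  have h4 := hs.ne_zero
  rw [h1, h3, inv_pow, inv_inv, add_comm (s ^ 2)⁻¹, inv_mul_eq_iff_eq_mul₀ h2]
  field_simp
  ring

end QEuclid

/-! ### Exchange relations of two differentials -/

namespace QEuclid

variable {N : ℕ} {s : ℂ}

section Scalar

variable {I : Type*} [Fintype I] [DecidableEq I] {A : Type*} [Ring A] [Algebra ℂ A]

/-- A matrix of complex numbers as a matrix over the algebra `A`. -/
noncomputable abbrev sc (A : Type*) [Ring A] [Algebra ℂ A] (M : Matrix I I ℂ) : Matrix I I A :=
  (algebraMap ℂ A).mapMatrix M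

theorem sc_apply (M : Matrix I I ℂ) (i j : I) : sc A M i j = algebraMap ℂ A (M i j) := rfl

theorem sc_smul (c : ℂ) (M : Matrix I I ℂ) : sc A (c • M) = c • sc A M := by
  ext i j
  rw [Matrix.smul_apply, sc_apply, sc_apply, Matrix.smul_apply, smul_eq_mul, map_mul,
    Algebra.smul_def]

theorem sc_mul_apply {K : Type*} (M : Matrix I I ℂ) (X : Matrix I K A) (i : I) (j : K) :
    (sc A M * X) i j = ∑ k, M i k • X k j := by
  simp only [Matrix.mul_apply, sc_apply, Algebra.smul_def]

theorem mul_sc_apply {K : Type*} (M : Matrix I I ℂ) (X : Matrix K I A) (i : K) (j : I) :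
    (X * sc A M) i j = ∑ k, M k j • X i k := by
  simp only [Matrix.mul_apply, sc_apply, Algebra.smul_def, Algebra.commutes]

omit [DecidableEq I] in
theorem sum_pair {M : Type*} [AddCommMonoid M] (F : I × I → M) :
    ∑ u, F u = ∑ i, ∑ j, F (i, j) := Fintype.sum_prod_type F

end Scalar

theorem rhatInv_symm (u v : Idx N × Idx N) : rhatInv N s u v = rhatInv N s v u := by
  have h : (rhatInv N s).transpose = rhatInv N s := by
    unfold rhatInv
    simp only [Matrix.transpose_smul, Matrix.transpose_add, Matrix.transpose_sub,
      Matrix.transpose_one, rhat_transpose, gg_transpose]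
  exact congrFun (congrFun h v) u

theorem gMat_mul_gMat (hs : s ≠ 0) : gMat N s * gMat N s = 1 := by
  ext i j
  rw [Matrix.mul_apply, Finset.sum_eq_single (negIdx i)]
  · rw [gMat_neg, gMat_apply, negIdx_negIdx, coe_negIdx, twoRho_neg, neg_neg, Matrix.one_apply]
    by_cases h : j = i
    · rw [if_pos h, if_pos h.symm, ← zpow_add₀ hs, neg_add_cancel, zpow_zero]
    · rw [if_neg h, if_neg (Ne.symm h), mul_zero]
  · intro b _ hb
    rw [gMat_apply, if_neg hb, zero_mul]
  · simp

namespace QD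

variable {A : Type*} [Ring A] [Algebra ℂ A] (𝔇 : QD N s A) (c : Idx N → ℂ)

/-- The elements `λ_a`. -/
noncomputable def l (a : Idx N) : A := c a • 𝔇.lam a

/-- The components `[λ_a, x^i]` of the differentials of the coordinates. -/
noncomputable def E (i a : Idx N) : A := c a • 𝔇.e a i

theorem E_eq (i a : Idx N) : 𝔇.E c i a = 𝔇.l c a * 𝔇.x i - 𝔇.x i * 𝔇.l c a := by
  rw [E, e, l, smul_sub, smul_mul_assoc, mul_smul_comm]

theorem x_E (hs : Generic s) (h i a : Idx N) : 𝔇.x h * 𝔇.E c i a =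
    s ^ 2 • ∑ k, ∑ l, rhat N s (h, i) (k, l) • (𝔇.E c k a * 𝔇.x l) := by
  unfold E
  simp only [smul_mul_assoc, smul_comm _ (c a), ← Finset.smul_sum]
  rw [mul_smul_comm, 𝔇.x_e hs]

variable {c}

theorem l_E (hc : NormConst N s c) (hs : Generic s) (a h i : Idx N) : 𝔇.l c h * 𝔇.E c a i =
    (s ^ 2)⁻¹ • ∑ j, ∑ k, rhatInv N s (h, i) (j, k) • (𝔇.E c a j * 𝔇.l c k) :=
  𝔇.lam_e hc hs a h i

theorem E_l (hc : NormConst N s c) (hs : Generic s) (a h i : Idx N) : 𝔇.E c a h * 𝔇.l c i =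
    s ^ 2 • ∑ j, ∑ k, rhat N s (h, i) (j, k) • (𝔇.l c j * 𝔇.E c a k) := by
  have h0 := hs.ne_zero
  let P : Matrix (Idx N × Idx N) Unit A := Matrix.of fun u _ => 𝔇.l c u.1 * 𝔇.E c a u.2
  let Q : Matrix (Idx N × Idx N) Unit A := Matrix.of fun u _ => 𝔇.E c a u.1 * 𝔇.l c u.2
  have h1 : P = (s ^ 2)⁻¹ • (sc A (rhatInv N s) * Q) := by
    ext u v
    rw [Matrix.smul_apply, sc_mul_apply, sum_pair]
    exact 𝔇.l_E hc hs a u.1 u.2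
  have h2 : s ^ 2 • (sc A (rhat N s) * P) = Q := by
    rw [h1, Matrix.mul_smul, smul_smul, mul_inv_cancel₀ (pow_ne_zero 2 h0), one_smul,
      ← Matrix.mul_assoc, ← map_mul, rhat_mul_rhatInv h0, map_one, Matrix.one_mul]
  have h3 := congrFun (congrFun h2 (h, i)) ()
  rw [Matrix.smul_apply, sc_mul_apply, sum_pair] at h3
  exact h3.symm

/-- The matrix of the products of the components of two differentials. -/
noncomputable def EE (c : Idx N → ℂ) : Matrix (Idx N × Idx N) (Idx N × Idx N) A :=
  Matrix.of fun u v => 𝔇.E c u.1 v.1 * 𝔇.E c u.2 v.2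

/-- Write the first factor of e e as λ x - x λ. Moving x and λ through the second factor produces q
R̂ on the left and q⁻¹ R̂⁻¹ on the right, for either order of the two, and e (λ x - x λ) is left
over. Hence e e = R̂ (e e) R̂⁻¹. -/
theorem rll (hc : NormConst N s c) (hs : Generic s) :
    sc A (rhat N s) * 𝔇.EE c = 𝔇.EE c * sc A (rhat N s) := by
  have h0 := hs.ne_zero
  have h2 := pow_ne_zero 2 h0
  let X : Matrix (Idx N × Idx N) (Idx N × Idx N) A :=
    Matrix.of fun u v => 𝔇.l c v.1 * (𝔇.x u.1 * 𝔇.E c u.2 v.2)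
  let Y : Matrix (Idx N × Idx N) (Idx N × Idx N) A :=
    Matrix.of fun u v => 𝔇.x u.1 * (𝔇.l c v.1 * 𝔇.E c u.2 v.2)
  let Z : Matrix (Idx N × Idx N) (Idx N × Idx N) A :=
    Matrix.of fun u v => 𝔇.l c v.1 * 𝔇.E c u.1 v.2 * 𝔇.x u.2
  let Z' : Matrix (Idx N × Idx N) (Idx N × Idx N) A :=
    Matrix.of fun u v => 𝔇.x u.1 * 𝔇.E c u.2 v.1 * 𝔇.l c v.2
  let X' : Matrix (Idx N × Idx N) (Idx N × Idx N) A :=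
    Matrix.of fun u v => 𝔇.E c u.1 v.1 * 𝔇.l c v.2 * 𝔇.x u.2
  let Y' : Matrix (Idx N × Idx N) (Idx N × Idx N) A :=
    Matrix.of fun u v => 𝔇.E c u.1 v.1 * 𝔇.x u.2 * 𝔇.l c v.2
  have e1 : X = s ^ 2 • (sc A (rhat N s) * Z) := by
    ext u v
    rw [Matrix.smul_apply, sc_mul_apply, sum_pair]
    change 𝔇.l c v.1 * (𝔇.x u.1 * 𝔇.E c u.2 v.2) = s ^ 2 • ∑ k, ∑ l, rhat N s (u.1, u.2) (k, l) •
      (𝔇.l c v.1 * 𝔇.E c k v.2 * 𝔇.x l)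
    rw [𝔇.x_E c hs, mul_smul_comm, Finset.mul_sum]
    simp only [Finset.mul_sum, mul_smul_comm, mul_assoc]
  have e2 : Z = (s ^ 2)⁻¹ • (X' * sc A (rhatInv N s)) := by
    ext u v
    rw [Matrix.smul_apply, mul_sc_apply, sum_pair]
    change 𝔇.l c v.1 * 𝔇.E c u.1 v.2 * 𝔇.x u.2 = (s ^ 2)⁻¹ • ∑ k, ∑ l,
      rhatInv N s (k, l) (v.1, v.2) • (𝔇.E c u.1 k * 𝔇.l c l * 𝔇.x u.2)
    rw [𝔇.l_E hc hs, smul_mul_assoc, Finset.sum_mul]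
    simp only [Finset.sum_mul, smul_mul_assoc, rhatInv_symm _ (v.1, v.2)]
  have e3 : Y = (s ^ 2)⁻¹ • (Z' * sc A (rhatInv N s)) := by
    ext u v
    rw [Matrix.smul_apply, mul_sc_apply, sum_pair]
    change 𝔇.x u.1 * (𝔇.l c v.1 * 𝔇.E c u.2 v.2) = (s ^ 2)⁻¹ • ∑ k, ∑ l,
      rhatInv N s (k, l) (v.1, v.2) • (𝔇.x u.1 * 𝔇.E c u.2 k * 𝔇.l c l)
    rw [𝔇.l_E hc hs, mul_smul_comm, Finset.mul_sum]
    simp only [Finset.mul_sum, mul_smul_comm, rhatInv_symm _ (v.1, v.2), mul_assoc]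
  have e4 : Z' = s ^ 2 • (sc A (rhat N s) * Y') := by
    ext u v
    rw [Matrix.smul_apply, sc_mul_apply, sum_pair]
    change 𝔇.x u.1 * 𝔇.E c u.2 v.1 * 𝔇.l c v.2 = s ^ 2 • ∑ k, ∑ l,
      rhat N s (u.1, u.2) (k, l) • (𝔇.E c k v.1 * 𝔇.x l * 𝔇.l c v.2)
    rw [𝔇.x_E c hs, smul_mul_assoc, Finset.sum_mul]
    simp only [Finset.sum_mul, smul_mul_assoc]
  have e5 : X - Y = 𝔇.EE c := by
    ext u v
    simp only [X, Y, EE, Matrix.sub_apply, Matrix.of_apply, ← mul_assoc, ← sub_mul]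
    rw [𝔇.E_eq c u.1 v.1]
  have e6 : X' - Y' = 𝔇.EE c := by
    ext u v
    simp only [X', Y', EE, Matrix.sub_apply, Matrix.of_apply, mul_assoc, ← mul_sub]
    rw [𝔇.E_eq c u.2 v.2]
  have e7 : 𝔇.EE c = sc A (rhat N s) * (𝔇.EE c * sc A (rhatInv N s)) := by
    calc 𝔇.EE c = X - Y := e5.symm
      _ = sc A (rhat N s) * ((X' - Y') * sc A (rhatInv N s)) := by
        rw [e1, e2, e3, e4, sub_mul, mul_sub, Matrix.mul_smul, Matrix.smul_mul, smul_smul,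
          smul_smul, mul_inv_cancel₀ h2, inv_mul_cancel₀ h2, one_smul, one_smul, Matrix.mul_assoc]
      _ = _ := by rw [e6]
  conv_rhs => rw [e7]
  rw [Matrix.mul_assoc, Matrix.mul_assoc, ← map_mul, rhatInv_mul_rhat h0, map_one, Matrix.mul_one]

theorem E_of_lt (hs : Generic s) {i a : Idx N} (h : (i : ℤ) < a) : 𝔇.E c i a = 0 := by
  rw [E, 𝔇.e_of_lt hs h, smul_zero]

theorem isUnit_E (hc : NormConst N s c) (hs : Generic s) (a : Idx N) : IsUnit (𝔇.E c a a) := by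
  rw [E, 𝔇.e_self hs, Algebra.smul_def]
  exact ((IsUnit.mk0 _ (hc.ne_zero hs a)).map (algebraMap ℂ A)).mul (𝔇.isUnit_D hs a)

/-- A row vector that is annihilated by the triangular matrix `E` vanishes. -/
theorem eq_zero_of_sum_mul_E (hc : NormConst N s c) (hs : Generic s) (C : Idx N → A)
    (h : ∀ a, ∑ k, C k * 𝔇.E c k a = 0) : C = 0 := by
  classical
  by_contra hne
  obtain ⟨k, hk⟩ := Function.ne_iff.1 hne
  -- Let b be the largest index with `C b ≠ 0`. In column b the rows k < b vanish by triangularity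
  -- and the terms with k > b by the choice of b, which leaves `C b` times a unit.
  obtain ⟨b, hb, hmax⟩ := (Finset.univ.filter fun k : Idx N => C k ≠ 0).exists_max_image id
    ⟨k, by simpa using hk⟩
  rw [Finset.mem_filter] at hb
  have h1 := h b
  rw [Finset.sum_eq_single b] at h1
  · exact hb.2 ((𝔇.isUnit_E hc hs b).mul_left_eq_zero.1 h1)
  · intro j _ hj
    rcases lt_or_ge (j : ℤ) b with h2 | h2
    · rw [𝔇.E_of_lt hs h2, mul_zero]
    · by_contra h3
      have h4 : C j ≠ 0 := fun h5 => h3 (by rw [h5, zero_mul])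
      have h5 : (j : ℤ) ≤ b := hmax j (by simpa using h4)
      exact hj (idx_ext_iff.2 (le_antisymm h5 h2))
  · simp

theorem eq_zero_of_sum_E_mul (hc : NormConst N s c) (hs : Generic s) (C : Idx N → A)
    (h : ∀ a, ∑ k, 𝔇.E c k a * C k = 0) : C = 0 := by
  classical
  by_contra hne
  obtain ⟨k, hk⟩ := Function.ne_iff.1 hne
  obtain ⟨b, hb, hmax⟩ := (Finset.univ.filter fun k : Idx N => C k ≠ 0).exists_max_image id
    ⟨k, by simpa using hk⟩
  rw [Finset.mem_filter] at hb
  have h1 := h b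
  rw [Finset.sum_eq_single b] at h1
  · exact hb.2 ((𝔇.isUnit_E hc hs b).mul_right_eq_zero.1 h1)
  · intro j _ hj
    rcases lt_or_ge (j : ℤ) b with h2 | h2
    · rw [𝔇.E_of_lt hs h2, zero_mul]
    · by_contra h3
      have h4 : C j ≠ 0 := fun h5 => h3 (by rw [h5, mul_zero])
      have h5 : (j : ℤ) ≤ b := hmax j (by simpa using h4)
      exact hj (idx_ext_iff.2 (le_antisymm h5 h2))
  · simp

theorem dual_x_negIdx (hc : NormConst N s c) (hs : Generic s) (i : Idx N) :
    (𝔇.dual hc hs).x (negIdx i) = 𝔇.l c i := by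
  change c (negIdx (negIdx i)) • 𝔇.lam (negIdx (negIdx i)) = _
  rw [negIdx_negIdx, l]

/-- `P_a λ λ = 0`. -/
theorem projA_l_l (hN : 3 ≤ N) (hc : NormConst N s c) (hs : Generic s) (i j : Idx N) :
    ∑ k, ∑ l, projA N s (i, j) (k, l) • (𝔇.l c k * 𝔇.l c l) = 0 := by
  -- The λ's are the reflected coordinates of the dual, and the reflection fixes P_a.
  have h := (𝔇.dual hc hs).projA_x_x hN hs.inv (negIdx i) (negIdx j)
  rw [← sum_negIdx] at h
  rw [← h]
  refine Finset.sum_congr rfl fun k _ => Eq.trans (Finset.sum_congr rfl fun l _ => ?_)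
    (sum_negIdx _)
  rw [projA_flip hN hs, dual_x_negIdx, dual_x_negIdx]

/-- `∑ g_{kl} λ_k λ_l` as a multiple of `Λ² r_n^{-2}`. -/
theorem sum_g_l_l (hN : 3 ≤ N) (hc : NormConst N s c) (hs : Generic s) :
    ∑ k, ∑ l, gMat N s k l • (𝔇.l c k * 𝔇.l c l) =
      (cst N s (top N) ^ 2 * (s ^ 2)⁻¹) • 𝔇.T (top N) := by
  have h := (𝔇.dual hc hs).sum_g_x_x hN hs.inv
  rw [← 𝔇.rsq_dual hs.ne_zero (inR_top hN), rsq_of_inR (inR_top hN)]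
  refine Eq.trans ?_ h
  refine Eq.trans (Finset.sum_congr rfl fun k _ => ?_) (sum_negIdx _)
  refine Eq.trans (Finset.sum_congr rfl fun l _ => ?_) (sum_negIdx _)
  rw [← gMat_flip, dual_x_negIdx, dual_x_negIdx]

end QD

end QEuclid

/-! ### Orthogonality of the commutators and the Dirac operator -/

namespace QEuclid

variable {N : ℕ} {s : ℂ}

theorem twoRho_top (hN : 3 ≤ N) : twoRho N (top N) = 2 - N := by
  have h1 := kap_eq (N := N) (i := top N) (by unfold top; omega)
  rw [kap_top] at h1
  linarith

theorem omega_top_sq (hN : 3 ≤ N) (hs : s ≠ 0) :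
    omega N s (top N) ^ 2 * (s ^ 2 * muConst N s) = (1 + s ^ 2 * muConst N s) ^ 2 := by
  have h1 : s ^ 2 * muConst N s = s ^ twoRho N (top N) * s ^ twoRho N (top N) := by
    rw [twoRho_top hN, muConst, ← zpow_add₀ hs, ← zpow_natCast, ← zpow_add₀ hs]
    congr 1
    push_cast
    ring
  rw [h1, omega, zpow_neg]
  have := zpow_ne_zero (twoRho N (top N)) hs
  field_simp
  ring

theorem omega_top_mul (hN : 3 ≤ N) (hs : s ≠ 0) :
    omega N s (top N) * s ^ (N : ℤ) = s ^ 2 + (muConst N s)⁻¹ := by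
  rw [omega, twoRho_top hN, muConst, add_mul, ← zpow_add₀ hs, ← zpow_add₀ hs, ← zpow_neg,
    ← zpow_natCast s 2]
  congr 2 <;> push_cast <;> ring

theorem sum_sum_sum_sum_comm {I M : Type*} [Fintype I] [AddCommMonoid M] (F : I → I → I → I → M) :
    ∑ i, ∑ j, ∑ k, ∑ l, F i j k l = ∑ k, ∑ l, ∑ i, ∑ j, F i j k l := by
  calc ∑ i, ∑ j, ∑ k, ∑ l, F i j k l = ∑ i, ∑ k, ∑ j, ∑ l, F i j k l :=
        Finset.sum_congr rfl fun i _ => Finset.sum_comm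
    _ = ∑ k, ∑ i, ∑ j, ∑ l, F i j k l := Finset.sum_comm
    _ = ∑ k, ∑ i, ∑ l, ∑ j, F i j k l :=
        Finset.sum_congr rfl fun k _ => Finset.sum_congr rfl fun i _ => Finset.sum_comm
    _ = _ := Finset.sum_congr rfl fun k _ => Finset.sum_comm

namespace QD

variable {A : Type*} [Ring A] [Algebra ℂ A] (𝔇 : QD N s A) {c : Idx N → ℂ}

theorem x_r_top (hN : 3 ≤ N) (i : Idx N) : QComm s 0 (𝔇.x i) (𝔇.r (top N)) :=
  (𝔇.x_r i _ (inR_top hN)).congr (by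
    rw [rExp, if_pos (abs_le.2 (idx_mem i |>.imp_right And.left))]
    rfl)

theorem l_r_top (hN : 3 ≤ N) (hs : s ≠ 0) (a : Idx N) : QComm s (-2) (𝔇.l c a) (𝔇.r (top N)) :=
  (((((𝔇.W_ri hs a (inR_top hN)).inv_right hs (𝔇.ri_r _ (inR_top hN)) (𝔇.r_ri _ (inR_top hN))).mul_left
    hs (𝔇.x_r_top hN (negIdx a)))).congr (by norm_num)).smul_left _

theorem l_Lam (hs : s ≠ 0) (a : Idx N) : QComm s (-2) (𝔇.l c a) 𝔇.Lam :=
  (((𝔇.W_lam hs a).mul_left hs (𝔇.x_lam (negIdx a))).congr (by norm_num)).smul_left _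

theorem QComm_sub {m : ℤ} {a b d : A} (h₁ : QComm s m a d) (h₂ : QComm s m b d) :
    QComm s m (a - b) d := by
  rw [QComm, sub_mul, mul_sub, h₁.eq, h₂.eq, smul_sub]

theorem E_Lam (hs : s ≠ 0) (i a : Idx N) : QComm s 0 (𝔇.E c i a) 𝔇.Lam := by
  rw [E_eq]
  exact QComm_sub (((𝔇.l_Lam hs a).mul_left hs (𝔇.x_lam i)).congr (by norm_num))
    (((𝔇.x_lam i).mul_left hs (𝔇.l_Lam hs a)).congr (by norm_num))

theorem sum_g_E_x (hs : Generic s) (a : Idx N) :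
    ∑ j, ∑ l, gMat N s j l • (𝔇.E c j a * 𝔇.x l) = 𝔇.l c a * 𝔇.V (top N + 1) := by
  unfold E l
  simp only [smul_mul_assoc, smul_comm _ (c a), ← Finset.smul_sum]
  rw [𝔇.sum_g_e_x hs]

theorem V_l (hN : 3 ≤ N) (hs : Generic s) (a : Idx N) :
    𝔇.V (top N + 1) * 𝔇.l c a = s ^ 4 • (𝔇.l c a * 𝔇.V (top N + 1)) := by
  have h0 := hs.ne_zero
  have h := ((𝔇.l_r_top (c := c) hN h0 a).mul_right h0 (𝔇.l_r_top hN h0 a)).symm h0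
  have h2 := h.eq
  norm_num at h2
  norm_cast at h2
  rw [(𝔇.V_top hN hs).1, smul_mul_assoc, h2, mul_smul_comm, smul_comm]

/-- `g_{jl} e^j_b e^l_a = g_{ba} Λ^2`. -/
theorem sum_g_E_E (hN : 3 ≤ N) (hc : NormConst N s c) (hs : Generic s) (b a : Idx N) :
    ∑ j, ∑ l, gMat N s j l • (𝔇.E c j b * 𝔇.E c l a) = gMat N s b a • (𝔇.Lam * 𝔇.Lam) := by
  have h0 := hs.ne_zero
  -- The second factor is written as λ x - x λ. In the first term R̂ moves e to the right of λ,
  -- after which g e x contracts to λ V; in the second term g e x stands there already.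
  have h1 : ∑ j, ∑ l, gMat N s j l • (𝔇.E c j b * 𝔇.E c l a) =
      s ^ 2 • ((∑ d, ∑ f, rhat N s (b, a) (d, f) • (𝔇.l c d * 𝔇.l c f)) * 𝔇.V (top N + 1)) -
        s ^ 4 • (𝔇.l c b * 𝔇.l c a * 𝔇.V (top N + 1)) := by
    have e1 : ∑ j, ∑ l, gMat N s j l • (𝔇.E c j b * 𝔇.l c a * 𝔇.x l) =
        s ^ 2 • ((∑ d, ∑ f, rhat N s (b, a) (d, f) • (𝔇.l c d * 𝔇.l c f)) * 𝔇.V (top N + 1)) := by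
      have : ∀ j l, gMat N s j l • (𝔇.E c j b * 𝔇.l c a * 𝔇.x l) = s ^ 2 • ∑ d, ∑ f,
          rhat N s (b, a) (d, f) • (𝔇.l c d * (gMat N s j l • (𝔇.E c j f * 𝔇.x l))) := by
        intro j l
        rw [𝔇.E_l hc hs, smul_mul_assoc, smul_comm]
        simp only [Finset.sum_mul, Finset.smul_sum, smul_mul_assoc, mul_smul_comm, mul_assoc,
          smul_comm (gMat N s j l)]
      simp only [this, ← Finset.smul_sum]
      rw [sum_sum_sum_sum_comm, Finset.sum_mul]
      congr 1
      refine Finset.sum_congr rfl fun d _ => ?_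
      rw [Finset.sum_mul]
      refine Finset.sum_congr rfl fun f _ => ?_
      rw [smul_mul_assoc, mul_assoc, ← 𝔇.sum_g_E_x hs]
      simp only [← Finset.smul_sum, ← Finset.mul_sum]
    have e2 : ∑ j, ∑ l, gMat N s j l • (𝔇.E c j b * (𝔇.x l * 𝔇.l c a)) =
        s ^ 4 • (𝔇.l c b * 𝔇.l c a * 𝔇.V (top N + 1)) := by
      have := congrArg (· * 𝔇.l c a) (𝔇.sum_g_E_x (c := c) hs b)
      simp only [Finset.sum_mul, smul_mul_assoc, mul_assoc] at this
      rw [this, 𝔇.V_l hN hs, mul_smul_comm, mul_assoc]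
    rw [← e1, ← e2]
    simp only [← Finset.sum_sub_distrib, ← smul_sub]
    refine Finset.sum_congr rfl fun j _ => Finset.sum_congr rfl fun l _ => ?_
    rw [𝔇.E_eq c l a, mul_sub, mul_assoc]
  rw [h1]
  have h2 := 𝔇.projA_l_l hN hc hs b a
  rw [projA_sum, smul_eq_zero_iff_right (inv_ne_zero (sq_add_ne hs))] at h2
  -- P_a λ λ = 0 evaluates R̂ λ λ. The terms λ_b λ_a cancel, and a multiple of g_{kl} λ_k λ_l
  -- remains; it is proportional to Λ² r_n⁻², and V supplies the r_n².
  have h3 : ∑ d, ∑ f, rhat N s (b, a) (d, f) • (𝔇.l c d * 𝔇.l c f) =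
      s ^ 2 • (𝔇.l c b * 𝔇.l c a) + ((muConst N s - s ^ 2) * (gTrace N s)⁻¹ * gMat N s b a) •
          ∑ k, ∑ l, gMat N s k l • (𝔇.l c k * 𝔇.l c l) := by
    rw [sub_add_eq_add_sub, sub_eq_zero] at h2
    exact h2.symm
  rw [h3, 𝔇.sum_g_l_l hN hc hs, mu_sub_div_gTrace hN hs, (𝔇.V_top hN hs).1]
  have h4 : 𝔇.T (top N) * (𝔇.r (top N) * 𝔇.r (top N)) = 𝔇.Lam * 𝔇.Lam := by
    rw [T, mul_assoc, 𝔇.ri_sq_mul_r_sq (inR_top hN), mul_one]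
  simp only [add_mul, smul_mul_assoc, mul_smul_comm, h4, smul_add, smul_smul]
  have h5 := omega_top_sq hN h0
  have h6 := one_add_sq_mu_ne (N := N) hs
  have h7 : cst N s (top N) = (s * kConst s)⁻¹ * omega N s (top N) := if_neg (by unfold top; omega)
  have h8 := hs.kConst_ne
  have h9 : 1 - s ^ 4 = - (s ^ 2 * kConst s) := by
    rw [kConst]; field_simp; ring
  have h10 : s ^ 2 * (-(kConst s * s ^ 2 * muConst N s) * (1 + s ^ 2 * muConst N s)⁻¹ * gMat N s b a *
      (cst N s (top N) ^ 2 * (s ^ 2)⁻¹) * ((1 - s ^ 4) * (1 + s ^ 2 * muConst N s)⁻¹)) =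
      gMat N s b a := by
    rw [h7, h9]
    field_simp
    linear_combination gMat N s b a * h5
  conv_rhs => rw [← h10]
  module

/-- The same for the upper indices. -/
theorem sum_E_g_E (hN : 3 ≤ N) (hc : NormConst N s c) (hs : Generic s) (i j : Idx N) :
    ∑ b, ∑ a, gMat N s b a • (𝔇.E c i b * 𝔇.E c j a) = gMat N s i j • (𝔇.Lam * 𝔇.Lam) := by
  let M : Matrix (Idx N) (Idx N) A := Matrix.of fun i a => 𝔇.E c i a
  let G : Matrix (Idx N) (Idx N) A := sc A (gMat N s)
  have hG : G * G = 1 := by rw [← map_mul, gMat_mul_gMat hs.ne_zero, map_one]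
  let Y := 𝔇.Lam * 𝔇.Lam
  have hMY : ∀ i a, M i a * Y = Y * M i a := fun i a =>
    ((𝔇.E_Lam hs.ne_zero i a).mul_right hs.ne_zero (𝔇.E_Lam hs.ne_zero i a)).commute rfl
  have h1 : M.transpose * G * M = Matrix.of fun b a => gMat N s b a • Y := by
    ext b a
    rw [Matrix.of_apply, ← 𝔇.sum_g_E_E hN hc hs b a, Matrix.mul_apply, Finset.sum_comm]
    refine Finset.sum_congr rfl fun l _ => ?_
    rw [mul_sc_apply, Finset.sum_mul]
    simp only [smul_mul_assoc]
    rfl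
  have h2 : G * (Matrix.of fun b a => gMat N s b a • Y) = Matrix.diagonal fun _ => Y := by
    ext b a
    rw [sc_mul_apply, Matrix.diagonal_apply]
    simp only [Matrix.of_apply, smul_smul, ← Finset.sum_smul, ← Matrix.mul_apply]
    rw [gMat_mul_gMat hs.ne_zero, Matrix.one_apply, ite_smul, one_smul, zero_smul]
  -- As Λ² commutes with the entries of M, the lower relation gives (M G Mᵗ G - Λ²) M = 0, and the
  -- triangular M can be cancelled on the right.
  have h3 : (M * G * M.transpose * G) = Matrix.diagonal fun _ => Y := by
    have h4 : M * G * M.transpose * G * M = (Matrix.diagonal fun _ => Y) * M := by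
      rw [Matrix.mul_assoc, Matrix.mul_assoc, ← Matrix.mul_assoc M.transpose, h1,
        Matrix.mul_assoc, h2]
      ext i a
      rw [Matrix.mul_diagonal, Matrix.diagonal_mul, hMY]
    rw [← sub_eq_zero, ← sub_mul] at h4
    rw [← sub_eq_zero]
    generalize M * G * M.transpose * G - (Matrix.diagonal fun _ => Y) = Z at h4
    ext i k
    exact congrFun (𝔇.eq_zero_of_sum_mul_E hc hs (Z i) fun a => congrFun (congrFun h4 i) a) k
  have h5 : (M * G * M.transpose * G * G) i j = ((Matrix.diagonal fun _ => Y : Matrix (Idx N) (Idx N) A) * G) i j := by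
    rw [h3]
  rw [Matrix.mul_assoc, hG, Matrix.mul_one, Matrix.diagonal_mul, Matrix.mul_apply] at h5
  rw [Algebra.smul_def, Algebra.commutes]
  refine Eq.trans ?_ h5
  rw [Finset.sum_comm]
  refine Finset.sum_congr rfl fun a _ => ?_
  rw [mul_sc_apply, Finset.sum_mul]
  simp only [smul_mul_assoc]
  rfl

/-- The Dirac operator. -/
theorem l_eq (hN : 3 ≤ N) (hs : Generic s) (a : Idx N) : -𝔇.l c a =
    (omega N s (top N) * s ^ (N : ℤ) * (kConst s)⁻¹) • (𝔇.ri (top N) * 𝔇.ri (top N) *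
      ∑ i, ∑ j, gMat N s i j • (𝔇.x i * 𝔇.E c j a)) := by
  have h0 := hs.ne_zero
  -- Since g is an eigenvector of R̂, the exchange relation turns g x e into a multiple of g e x = λ
  -- V.
  have h1 : ∑ i, ∑ j, gMat N s i j • (𝔇.x i * 𝔇.E c j a) =
      (s ^ 2 * muConst N s) • (𝔇.l c a * 𝔇.V (top N + 1)) := by
    simp only [𝔇.x_E c hs, ← 𝔇.sum_g_E_x hs, Finset.smul_sum, smul_smul]
    rw [sum_sum_sum_sum_comm]
    refine Finset.sum_congr rfl fun k _ => Finset.sum_congr rfl fun l _ => ?_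
    simp only [← Finset.sum_smul]
    congr 1
    rw [mul_assoc, ← rhat_g h0 k l]
    simp only [Finset.mul_sum]
    refine Finset.sum_congr rfl fun i _ => Finset.sum_congr rfl fun j _ => ?_
    rw [rhat_symm s (k, l) (i, j)]
    ring
  have h2 : 𝔇.l c a * 𝔇.V (top N + 1) = ((s ^ 4)⁻¹ * ((1 - s ^ 4) * (1 + s ^ 2 * muConst N s)⁻¹)) •
      (𝔇.r (top N) * 𝔇.r (top N) * 𝔇.l c a) := by
    have := 𝔇.V_l (c := c) hN hs a
    rw [mul_smul, ← smul_mul_assoc, ← (𝔇.V_top hN hs).1, this, smul_smul,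
      inv_mul_cancel₀ (pow_ne_zero 4 h0), one_smul]
  rw [h1, h2, omega_top_mul hN h0]
  simp only [mul_smul_comm, smul_smul]
  rw [← mul_assoc (𝔇.ri _ * _), 𝔇.ri_sq_mul_r_sq (inR_top hN), one_mul, ← neg_one_smul ℂ]
  congr 1
  have h3 := one_add_sq_mu_ne (N := N) hs
  have h4 := muConst_ne (N := N) h0
  have h5 := hs.kConst_ne
  have h6 : 1 - s ^ 4 = - (s ^ 2 * kConst s) := by
    rw [kConst]; field_simp; ring
  rw [h6]
  field_simp
  ring

end QD

end QEuclid

/-! ### The Yang–Baxter equation -/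

namespace QEuclid

variable {N : ℕ} {s : ℂ}

section Legs

variable {I : Type*} [Fintype I] [DecidableEq I]

/-- The matrix `M ⊗ 1` on triples of indices. -/
def leg12 (M : Matrix (I × I) (I × I) ℂ) : Matrix (I × I × I) (I × I × I) ℂ :=
  (Matrix.kroneckerMap (· * ·) M (1 : Matrix I I ℂ)).submatrix (Equiv.prodAssoc I I I).symm
    (Equiv.prodAssoc I I I).symm

/-- The matrix `1 ⊗ M` on triples of indices. -/
def leg23 (M : Matrix (I × I) (I × I) ℂ) : Matrix (I × I × I) (I × I × I) ℂ :=
  Matrix.kroneckerMap (· * ·) (1 : Matrix I I ℂ) M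

theorem leg12_mul (M M' : Matrix (I × I) (I × I) ℂ) : leg12 (M * M') = leg12 M * leg12 M' := by
  unfold leg12
  rw [Matrix.submatrix_mul_equiv, ← Matrix.mul_kronecker_mul, one_mul]

theorem leg23_mul (M M' : Matrix (I × I) (I × I) ℂ) : leg23 (M * M') = leg23 M * leg23 M' := by
  unfold leg23
  rw [← Matrix.mul_kronecker_mul, one_mul]

theorem leg12_one : leg12 (1 : Matrix (I × I) (I × I) ℂ) = 1 := by
  unfold leg12
  rw [Matrix.kroneckerMap_one_one _ (by simp) (by simp) (by simp), Matrix.submatrix_one_equiv]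

theorem leg23_one : leg23 (1 : Matrix (I × I) (I × I) ℂ) = 1 :=
  Matrix.kroneckerMap_one_one _ (by simp) (by simp) (by simp)

theorem leg12_add (M M' : Matrix (I × I) (I × I) ℂ) : leg12 (M + M') = leg12 M + leg12 M' := by
  unfold leg12
  rw [Matrix.add_kronecker]; rfl

theorem leg23_add (M M' : Matrix (I × I) (I × I) ℂ) : leg23 (M + M') = leg23 M + leg23 M' := by
  unfold leg23
  rw [Matrix.kronecker_add]

theorem leg12_smul (c : ℂ) (M : Matrix (I × I) (I × I) ℂ) : leg12 (c • M) = c • leg12 M := by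
  unfold leg12
  rw [Matrix.smul_kronecker]; rfl

theorem leg23_smul (c : ℂ) (M : Matrix (I × I) (I × I) ℂ) : leg23 (c • M) = c • leg23 M := by
  unfold leg23
  rw [Matrix.kronecker_smul]

variable {V : Type*} [AddCommGroup V] [Module ℂ V]

theorem leg12_sum (M : Matrix (I × I) (I × I) ℂ) (F : I × I × I → V) (i j k : I) :
    ∑ v, leg12 M (i, j, k) v • F v = ∑ p, ∑ q, M (i, j) (p, q) • F (p, q, k) := by
  rw [Fintype.sum_prod_type]
  refine Finset.sum_congr rfl fun p _ => ?_
  rw [Fintype.sum_prod_type]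
  refine Finset.sum_congr rfl fun q _ => ?_
  rw [Finset.sum_eq_single k]
  · simp [leg12]
  · intro r _ hr
    simp [leg12, Matrix.one_apply_ne hr.symm]
  · simp

theorem leg23_sum (M : Matrix (I × I) (I × I) ℂ) (F : I × I × I → V) (i j k : I) :
    ∑ v, leg23 M (i, j, k) v • F v = ∑ p, ∑ q, M (j, k) (p, q) • F (i, p, q) := by
  rw [Fintype.sum_prod_type, Finset.sum_eq_single i]
  · rw [Fintype.sum_prod_type]
    simp [leg23]
  · intro r _ hr
    simp [leg23, Matrix.one_apply_ne hr.symm]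
  · simp

end Legs

namespace QD

variable {A : Type*} [Ring A] [Algebra ℂ A] (𝔇 : QD N s A) {c : Idx N → ℂ}

/-- Commuting a linear relation between the coordinates with λ_a gives the same relation between the
rows of the triangular matrix of commutators. -/
theorem eq_zero_of_sum_x [Nontrivial A] (hc : NormConst N s c) (hs : Generic s) (z : Idx N → ℂ)
    (h : ∑ r, z r • 𝔇.x r = 0) : z = 0 := by
  have h1 : (fun r => algebraMap ℂ A (z r)) = 0 := by
    refine 𝔇.eq_zero_of_sum_mul_E hc hs _ fun a => ?_
    have h2 : 𝔇.l c a * (∑ r, z r • 𝔇.x r) - (∑ r, z r • 𝔇.x r) * 𝔇.l c a = 0 := by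
      rw [h, mul_zero, zero_mul, sub_zero]
    rw [Finset.mul_sum, Finset.sum_mul, ← Finset.sum_sub_distrib] at h2
    rw [← h2]
    refine Finset.sum_congr rfl fun r _ => ?_
    rw [← Algebra.smul_def, E_eq, smul_sub, mul_smul_comm, smul_mul_assoc]
  ext r
  exact (map_eq_zero_iff _ (FaithfulSMul.algebraMap_injective ℂ A)).1 (congrFun h1 r)

/-- The Yang–Baxter equation. -/
theorem yangBaxter [Nontrivial A] (𝔇 : QD N s A) (hc : NormConst N s c) (hs : Generic s) :
    leg12 (rhat N s) * leg23 (rhat N s) * leg12 (rhat N s) =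
      leg23 (rhat N s) * leg12 (rhat N s) * leg23 (rhat N s) := by
  have h0 := hs.ne_zero
  let J := Idx N × Idx N × Idx N
  let X : Matrix J (Idx N × Idx N) A :=
    Matrix.of fun u v => 𝔇.x u.1 * (𝔇.E c u.2.1 v.1 * 𝔇.E c u.2.2 v.2)
  let X' : Matrix J (Idx N × Idx N) A :=
    Matrix.of fun u v => 𝔇.E c u.1 v.1 * (𝔇.x u.2.1 * 𝔇.E c u.2.2 v.2)
  let W : Matrix J (Idx N × Idx N) A :=
    Matrix.of fun u v => 𝔇.E c u.1 v.1 * (𝔇.E c u.2.1 v.2 * 𝔇.x u.2.2)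
  let R := sc A (rhat N s)
  have e1 : X = s ^ 2 • (sc A (leg12 (rhat N s)) * X') := by
    ext ⟨i, j, k⟩ v
    rw [Matrix.smul_apply, sc_mul_apply, leg12_sum]
    simp only [X, X', Matrix.of_apply]
    rw [← mul_assoc, 𝔇.x_E c hs, smul_mul_assoc, Finset.sum_mul]
    simp only [Finset.sum_mul, smul_mul_assoc, mul_assoc]
  have e2 : X' = s ^ 2 • (sc A (leg23 (rhat N s)) * W) := by
    ext ⟨i, j, k⟩ v
    rw [Matrix.smul_apply, sc_mul_apply, leg23_sum]
    simp only [X', W, Matrix.of_apply]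
    rw [𝔇.x_E c hs, mul_smul_comm, Finset.mul_sum]
    simp only [Finset.mul_sum, mul_smul_comm]
  have hr : ∀ j k a b : Idx N, ∑ p, ∑ q, rhat N s (p, q) (a, b) • (𝔇.E c j p * 𝔇.E c k q) =
      ∑ p, ∑ q, rhat N s (j, k) (p, q) • (𝔇.E c p a * 𝔇.E c q b) := fun j k a b => by
    have := congrFun (congrFun (𝔇.rll hc hs) (j, k)) (a, b)
    rw [sc_mul_apply, mul_sc_apply, sum_pair, sum_pair] at this
    exact this.symm
  have e3 : X * R = sc A (leg23 (rhat N s)) * X := by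
    ext ⟨i, j, k⟩ ⟨a, b⟩
    rw [mul_sc_apply, sc_mul_apply, leg23_sum, sum_pair]
    have := congrArg (𝔇.x i * ·) (hr j k a b)
    simp only [Finset.mul_sum, mul_smul_comm] at this
    exact this
  have e4 : W * R = sc A (leg12 (rhat N s)) * W := by
    ext ⟨i, j, k⟩ ⟨a, b⟩
    rw [mul_sc_apply, sc_mul_apply, leg12_sum, sum_pair]
    have := congrArg (· * 𝔇.x k) (hr i j a b)
    simp only [Finset.sum_mul, smul_mul_assoc, mul_assoc] at this
    exact this
  -- Moving x through two differentials produces R̂₁₂ R̂₂₃. As R̂ commutes with e e, applying it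
  -- before or after the move gives R̂₂₃ R̂₁₂ R̂₂₃ W = R̂₁₂ R̂₂₃ R̂₁₂ W.
  have e5 : X = s ^ 4 • (sc A (leg12 (rhat N s)) * (sc A (leg23 (rhat N s)) * W)) := by
    rw [e1, e2, Matrix.mul_smul, smul_smul]
    congr 1
    ring
  have e6 : sc A (leg12 (rhat N s) * leg23 (rhat N s) * leg12 (rhat N s) -
      leg23 (rhat N s) * leg12 (rhat N s) * leg23 (rhat N s)) * W = 0 := by
    rw [e5, Matrix.mul_smul, Matrix.smul_mul, Matrix.mul_assoc, Matrix.mul_assoc, e4] at e3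
    have e7 := smul_right_injective (Matrix J (Idx N × Idx N) A) (pow_ne_zero 4 h0) e3
    simp only [map_sub]
    rw [Matrix.sub_mul, sub_eq_zero]
    simp only [map_mul, Matrix.mul_assoc]
    exact e7
  rw [← sub_eq_zero]
  generalize leg12 (rhat N s) * leg23 (rhat N s) * leg12 (rhat N s) -
      leg23 (rhat N s) * leg12 (rhat N s) * leg23 (rhat N s) = Z at e6 ⊢
  ext u ⟨p, q, r⟩
  -- The factors of W = e e x are cancelled one by one: twice by triangularity, then by the linear
  -- independence of the coordinates.
  have h1 : ∀ a b, ∑ p, 𝔇.E c p a * ∑ q, 𝔇.E c q b * ∑ r, Z u (p, q, r) • 𝔇.x r = 0 := by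
    intro a b
    have := congrFun (congrFun e6 u) (a, b)
    rw [sc_mul_apply, Fintype.sum_prod_type] at this
    refine Eq.trans (Finset.sum_congr rfl fun p _ => ?_) this
    rw [Fintype.sum_prod_type, Finset.mul_sum]
    refine Finset.sum_congr rfl fun q _ => ?_
    simp only [Finset.mul_sum, mul_smul_comm, W, Matrix.of_apply]
  have h2 : ∀ b p, ∑ q, 𝔇.E c q b * ∑ r, Z u (p, q, r) • 𝔇.x r = 0 := fun b p =>
    congrFun (𝔇.eq_zero_of_sum_E_mul hc hs _ fun a => h1 a b) p
  have h3 : ∀ p q, ∑ r, Z u (p, q, r) • 𝔇.x r = 0 := fun p q =>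
    congrFun (𝔇.eq_zero_of_sum_E_mul hc hs _ fun b => h2 b p) q
  exact congrFun (𝔇.eq_zero_of_sum_x hc hs _ (h3 p q)) r

end QD

end QEuclid

/-! ### From the defining relations to the telescoping form -/

namespace QEuclid

variable {N : ℕ} {s : ℂ}

section FromProjA

variable {A : Type*} [Ring A] [Algebra ℂ A] {x : Idx N → A} {r : ℤ → A}

theorem x_x_of_projA (hs : Generic s)
    (hx : ∀ i j, ∑ k, ∑ l, projA N s (i, j) (k, l) • (x k * x l) = 0) (i j : Idx N)
    (hij : (i : ℤ) < j) (hne : (i : ℤ) ≠ -j) : QComm s 2 (x i) (x j) := by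
  have h := hx i j
  have h0 := hs.ne_zero
  have e1 : ¬ j = negIdx i := fun h => hne (by rw [h, coe_negIdx, neg_neg])
  have e2 : ¬ i = j := fun h => hij.ne (by rw [h])
  rw [projA_sum, smul_eq_zero_iff_right (inv_ne_zero (sq_add_ne hs)),
    rhat_sum_ne s (fun k l => x k * x l) i j (by omega), gMat_apply, if_neg e1, if_neg e2,
    if_pos hij, mul_zero, zero_smul, add_zero, one_smul, kConst, sub_eq_zero] at h
  have h1 : x j * x i = (s ^ 2)⁻¹ • (x i * x j) := by
    rw [← sub_eq_iff_eq_add] at h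
    rw [← h]
    module
  rw [QComm, h1, smul_smul]
  norm_cast
  rw [mul_inv_cancel₀ (pow_ne_zero 2 h0), one_smul]

theorem sum_idx_lt_add_one {M : Type*} [AddCommMonoid M] (f : Idx N → M) (i : Idx N) :
    ∑ l : Idx N, (if (l : ℤ) < (i : ℤ) + 1 then f l else 0) =
      (∑ l : Idx N, if (l : ℤ) < i then f l else 0) + f i := by
  rw [← Finset.add_sum_erase _ _ (Finset.mem_univ i), if_pos (by omega),
    ← Finset.add_sum_erase _ (fun l : Idx N => if (l : ℤ) < i then f l else 0) (Finset.mem_univ i),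
    if_neg (lt_irrefl _), zero_add, add_comm]
  congr 1
  refine Finset.sum_congr rfl fun l hl => ?_
  have h := Finset.ne_of_mem_erase hl
  rw [Ne, idx_ext_iff] at h
  exact if_congr (by omega) rfl rfl

theorem sum_abs_le_sub {M : Type*} [AddCommGroup M] (f : Idx N → M) (i : Idx N) (hi : 0 < (i : ℤ)) :
    ∑ l : Idx N, (if |(l : ℤ)| ≤ (i : ℤ) - 1 then f l else 0) =
      (∑ l : Idx N, if |(l : ℤ)| ≤ i then f l else 0) - f i - f (negIdx i) := by
  have hne : negIdx i ≠ i := by rw [Ne, idx_ext_iff, coe_negIdx]; omega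
  have hm : negIdx i ∈ Finset.univ.erase i := Finset.mem_erase.2 ⟨hne, Finset.mem_univ _⟩
  rw [← Finset.add_sum_erase _ _ (Finset.mem_univ i), ← Finset.add_sum_erase _ _ hm,
    ← Finset.add_sum_erase _ (fun l : Idx N => if |(l : ℤ)| ≤ i then f l else 0)
      (Finset.mem_univ i), ← Finset.add_sum_erase _ (fun l : Idx N => if |(l : ℤ)| ≤ i then f l else 0)
      hm, coe_negIdx, abs_neg, abs_of_pos hi, if_neg (by omega), if_neg (by omega), if_pos le_rfl,
      if_pos le_rfl, zero_add, zero_add]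
  have : ∑ l ∈ (Finset.univ.erase i).erase (negIdx i), (if |(l : ℤ)| ≤ (i : ℤ) - 1 then f l else 0) =
      ∑ l ∈ (Finset.univ.erase i).erase (negIdx i), (if |(l : ℤ)| ≤ (i : ℤ) then f l else 0) := by
    refine Finset.sum_congr rfl fun l hl => ?_
    rw [Finset.mem_erase, Finset.mem_erase] at hl
    simp only [Ne, idx_ext_iff, coe_negIdx] at hl
    refine if_congr ?_ rfl rfl
    rw [abs_le, abs_le]
    omega
  rw [this]
  abel

/-- Let Φ_j be V_{-n} plus the partial sums of (1 - q²) q^{-ρ_l} x^l x^{-l}; the claim amounts to Φ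
= V. The relation P_a x x = 0 at (i, -i) expresses Φ_{-i} by the two products of x^i and x^{-i}. The
ends are known, and these relations determine Φ inwards, one opposite pair at a time. -/
theorem step_of_projA (hN : 3 ≤ N) (hs : Generic s)
    (hx : ∀ i j, ∑ k, ∑ l, projA N s (i, j) (k, l) • (x k * x l) = 0)
    (hr : ∀ m, 0 ≤ m → m ≤ top N → rsq N r m =
      ∑ l : Idx N, if |(l : ℤ)| ≤ m then s ^ (-twoRho N l) • (x l * x (negIdx l)) else 0)
    (i : Idx N) : ((1 - s ^ 4) * s ^ (-twoRho N i)) • (x i * x (negIdx i)) =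
      vfun N s r ((i : ℤ) + 1) - vfun N s r i := by
  have h0 := hs.ne_zero
  have h4 := QD.one_sub_ne hs
  have htd : top N = ((N / 2 : ℕ) : ℤ) := rfl
  set y : Idx N → A := fun l => s ^ (-twoRho N l) • (x l * x (negIdx l)) with hy
  set S : ℤ → A := fun j => ∑ l : Idx N, if (l : ℤ) < j then y l else 0 with hS
  set Φ : ℤ → A := fun j => vfun N s r (-top N) + (1 - s ^ 4) • S j with hΦ
  have hΦs : ∀ i : Idx N, Φ ((i : ℤ) + 1) = Φ i + (1 - s ^ 4) • y i := fun i => by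
    simp only [hΦ, hS, sum_idx_lt_add_one, smul_add, add_assoc]
  have hbot : vfun N s r (-top N) = -((s ^ 2 * muConst N s * pC N s (top N)) • rsq N r (top N)) := by
    rw [vfun, if_neg (by unfold top; omega), neg_neg, zpow_kap_top h0]
  have htop : Φ (top N + 1) = vfun N s r (top N + 1) := by
    have h1 : S (top N + 1) = rsq N r (top N) := by
      rw [hr _ (by unfold top; omega) le_rfl]
      refine Finset.sum_congr rfl fun l _ => if_congr ?_ rfl rfl
      have := idx_mem l
      rw [abs_le]; unfold top; omega
    have h2 := one_add_sq_mu_ne (N := N) hs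
    simp only [hΦ]
    rw [h1, hbot, vfun, if_pos (by unfold top; omega), add_sub_cancel_right, pC, zpow_kap_top h0]
    match_scalars
    field_simp
    ring
  -- the relations between `x^i` and `x^{-i}`
  have hrel : ∀ i : Idx N, s ^ 2 • ((s ^ 2 - (if (i : ℤ) < 0 then kConst s else 0)) •
      (s ^ (2 * twoRho N i) • y i) - zConst s i • y (negIdx i)) = Φ (negIdx i) := by
    intro i
    have h := hx i (negIdx i)
    rw [projA_sum, smul_eq_zero_iff_right (inv_ne_zero (sq_add_ne hs)), rhat_sum_neg, gMat_neg,
      mu_sub_div_gTrace hN hs, sum_gMat s (fun k l => x k * x l)] at h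
    have e1 : ∑ l : Idx N, s ^ (-twoRho N l) • (x l * x (negIdx l)) = rsq N r (top N) := by
      rw [hr _ (by unfold top; omega) le_rfl]
      refine Finset.sum_congr rfl fun l _ => (if_pos ?_).symm
      exact abs_le.2 ⟨(idx_mem l).1, (idx_mem l).2.1⟩
    have e2 : x i * x (negIdx i) = s ^ twoRho N i • y i := by
      simp only [hy]
      rw [smul_smul, ← zpow_add₀ h0, add_neg_cancel, zpow_zero, one_smul]
    have e3 : x (negIdx i) * x i = s ^ (-twoRho N i) • y (negIdx i) := by
      simp only [hy, coe_negIdx, twoRho_neg, neg_neg, negIdx_negIdx]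
      rw [smul_smul, ← zpow_add₀ h0, neg_add_cancel, zpow_zero, one_smul]
    have e4 : ∑ l : Idx N, (if (l : ℤ) < -i then s ^ (-twoRho N l) • (x l * x (negIdx l)) else 0) =
      S (negIdx i) := rfl
    rw [e1, e2, e3, e4] at h
    have h' := congrArg ((s ^ twoRho N i * s ^ 2) • ·) h
    simp only [smul_zero] at h'
    simp only [hΦ]
    rw [hbot, pC, zpow_kap_top h0, ← sub_eq_zero, ← h', show 2 * twoRho N i = twoRho N i + twoRho N i
      by ring, zpow_add₀ h0, zpow_neg]
    have h5 := one_add_sq_mu_ne (N := N) hs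
    have h6 := zpow_ne_zero (twoRho N i) h0
    have hk : kConst s = s ^ 2 - (s ^ 2)⁻¹ := rfl
    generalize s ^ twoRho N i = u at *
    generalize zConst s i = z
    by_cases hi : (i : ℤ) < 0
    · simp only [if_pos hi]
      rw [hk]
      match_scalars <;> field_simp <;> ring
    · simp only [if_neg hi]
      rw [hk]
      match_scalars <;> field_simp <;> ring
  -- With m = n - d, the value Φ_{-m} = V_{-m} gives r_m² in terms of the pair ±m, and subtracting
  -- this pair from r_m² gives r_{m-1}². The relations at ±m then identify Φ_m and Φ_{-m+1}.
  have hdesc : ∀ d : ℕ, (d : ℤ) ≤ top N → Φ (top N - d + 1) = vfun N s r (top N - d + 1) ∧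
      Φ (-(top N - d)) = vfun N s r (-(top N - d)) := by
    intro d
    induction d with
    | zero =>
      intro _
      rw [Nat.cast_zero, sub_zero]
      refine ⟨htop, ?_⟩
      have : S (-top N) = 0 := Finset.sum_eq_zero fun l _ => if_neg (by
        have := idx_mem l; unfold top; omega)
      simp only [hΦ]
      rw [this, smul_zero, add_zero]
    | succ d ih =>
      intro hd
      push_cast at hd
      obtain ⟨ih1, ih2⟩ := ih (by omega)
      obtain ⟨m, hm⟩ : ∃ m : Idx N, (m : ℤ) = top N - d :=
        ⟨mkIdx (top N - d) (by omega) (by omega) (Or.inl (by omega)), rfl⟩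
      rw [← hm] at ih1 ih2
      have hm1 : 1 ≤ (m : ℤ) := by omega
      rw [show top N - ((d + 1 : ℕ) : ℤ) = m - 1 by rw [hm]; push_cast; ring, sub_add_cancel,
        show -((m : ℤ) - 1) = -m + 1 by ring]
      have hA := hrel (negIdx m)
      have hB := hrel m
      have hstep1 := hΦs m
      have hstep2 := hΦs (negIdx m)
      simp only [negIdx_negIdx, coe_negIdx, zConst, show ¬ ((m : ℤ) < 0) by omega,
        show -(m : ℤ) < 0 by omega, show (m : ℤ) ≠ 0 by omega, show -(m : ℤ) ≠ 0 by omega, if_true,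
        if_false, twoRho_neg, mul_neg] at hA hB hstep2
      have hL := sum_abs_le_sub y m (by omega)
      have hr1 := hr m (by omega) (idx_mem m).2.1
      have hr2 := hr (m - 1) (by omega) (by have := (idx_mem m).2.1; omega)
      rw [← hr1, ← hr2] at hL
      rw [vfun, if_neg (by omega), neg_neg, ← hB] at ih2
      rw [vfun, if_pos hm1, vfun, if_neg (by omega), show -(-(m : ℤ) + 1) = m - 1 by ring, hL]
      rw [← hA, hstep2, ← hB]
      unfold pC at ih2 ⊢
      rw [kap_sub_one hm1]
      rw [kap_eq hm1] at ih2
      have h5 : s ^ (2 * twoRho N m + 4) = s ^ (2 * twoRho N m) * s ^ 4 := by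
        rw [zpow_add₀ h0]; norm_cast
      have h6 := hs.one_add_zpow (2 * twoRho N m)
      have h7 := hs.one_add_zpow (2 * twoRho N m + 4)
      have h8 := zpow_ne_zero (2 * twoRho N m) h0
      rw [h5] at h7 ⊢
      rw [zpow_neg]
      have hk : kConst s = s ^ 2 - (s ^ 2)⁻¹ := rfl
      rw [hk]
      generalize s ^ (2 * twoRho N m) = u at *
      have h9 : rsq N r m = -((1 + u) * (u * (1 - s ^ 4))⁻¹) •
          (s ^ 2 • ((s ^ 2 - 0) • u • y m - (s ^ 2)⁻¹ • y (negIdx m))) := by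
        rw [ih2]
        match_scalars
        field_simp
      rw [h9]
      have h10 : 1 + s ^ 4 * u ≠ 0 := by rwa [mul_comm]
      constructor <;> match_scalars <;> field_simp <;> ring
  have hmain : ∀ j : ℤ, -top N ≤ j → j ≤ top N + 1 → Φ j = vfun N s r j := by
    intro j h1 h2
    rcases le_or_gt j 0 with h | h
    · have := (hdesc (top N + j).toNat (by rw [Int.toNat_of_nonneg (by omega)]; omega)).2
      rwa [Int.toNat_of_nonneg (by omega), show -(top N - (top N + j)) = j by ring] at this
    · have := (hdesc (top N - j + 1).toNat (by rw [Int.toNat_of_nonneg (by omega)]; omega)).1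
      rwa [Int.toNat_of_nonneg (by omega), show top N - (top N - j + 1) + 1 = j by ring] at this
  have := idx_mem i
  rw [← hmain _ (by unfold top; omega) (by unfold top; omega),
    ← hmain _ (by unfold top; omega) (by unfold top; omega), hΦs, add_sub_cancel_left, mul_smul]

end FromProjA

end QEuclid

/-! ### The generators of A_N as a realization -/

namespace QEuclid

variable {N : ℕ} {s : ℂ}

section Generators

theorem gen_rel {u v : FreeAlgebra ℂ (QGen N)} (h : QRel N s u v) :
    RingQuot.mkAlgHom ℂ (QRel N s) u = RingQuot.mkAlgHom ℂ (QRel N s) v :=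
  RingQuot.mkAlgHom_rel ℂ h

theorem inR_iff {j : ℤ} : InR N j ↔
    j ∈ (Finset.Icc (0 : ℤ) ((N / 2 : ℕ) : ℤ)).filter fun j => j ≠ 0 ∨ Odd N := by
  simp only [InR, Finset.mem_filter, Finset.mem_Icc, and_assoc]

theorem rGen_eq {j : ℤ} (h : InR N j) : rGen N s j = gen N s (QGen.r ⟨j, inR_iff.1 h⟩) :=
  dif_pos _

theorem rInvGen_eq {j : ℤ} (h : InR N j) : rInvGen N s j = gen N s (QGen.rInv ⟨j, inR_iff.1 h⟩) :=
  dif_pos _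

theorem projA_xGen (i j : Idx N) :
    ∑ k, ∑ l, projA N s (i, j) (k, l) • (xGen N s k * xGen N s l) = 0 := by
  have h := gen_rel (QRel.xx (s := s) i j)
  simp only [map_sum, map_smul, map_mul, map_zero] at h
  exact h

/-- For even N and m = 0 there is no radius and the sum is empty, in agreement with the value of
`rsq`. -/
theorem rsq_rGen {m : ℤ} (h0 : 0 ≤ m) (h1 : m ≤ top N) : rsq N (rGen N s) m =
    ∑ l : Idx N, if |(l : ℤ)| ≤ m then
      s ^ (-twoRho N l) • (xGen N s l * xGen N s (negIdx l)) else 0 := by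
  by_cases hm : m = 0 ∧ ¬ Odd N
  · rw [rsq, if_pos hm]
    refine (Finset.sum_eq_zero fun l _ => if_neg ?_).symm
    have h2 := (idx_mem l).2.2.resolve_right hm.2
    rw [hm.1, abs_le]
    omega
  · have hR : InR N m := ⟨h0, h1, by tauto⟩
    have h := gen_rel (QRel.r_sq (s := s) ⟨m, inR_iff.1 hR⟩)
    simp only [map_sum, map_mul] at h
    rw [QD.rsq_of_inR hR, rGen_eq hR]
    refine h.trans (Finset.sum_congr rfl fun k _ => ?_)
    rw [Finset.sum_eq_single (negIdx k)]
    · simp only [coe_negIdx, abs_neg, and_self]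
      split_ifs
      · rw [map_smul, map_mul, gMat_neg]; rfl
      · rw [map_zero]
    · intro b _ hb
      rw [gMat_apply, if_neg hb, zero_smul, ite_self, map_zero]
    · simp

/-- The generators of `A_N`. -/
noncomputable def qd (hN : 3 ≤ N) (hs : Generic s) : QD N s (QAlg N s) where
  x := xGen N s
  r := rGen N s
  ri := rInvGen N s
  Lam := gen N s QGen.lam
  Lami := gen N s QGen.lamInv
  K := gen N s QGen.K
  Ki := gen N s QGen.KInv
  r_ri j hj := by
    rw [rGen_eq hj, rInvGen_eq hj]
    have h := gen_rel (QRel.r_mul_inv (s := s) ⟨j, inR_iff.1 hj⟩)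
    rwa [map_mul, map_one] at h
  ri_r j hj := by
    rw [rGen_eq hj, rInvGen_eq hj]
    have h := gen_rel (QRel.r_inv_mul (s := s) ⟨j, inR_iff.1 hj⟩)
    rwa [map_mul, map_one] at h
  Lam_Lami := by
    have h := gen_rel (QRel.lam_mul_inv (N := N) (s := s))
    rwa [map_mul, map_one] at h
  Lami_Lam := by
    have h := gen_rel (QRel.lam_inv_mul (N := N) (s := s))
    rwa [map_mul, map_one] at h
  K_Ki := by
    have h := gen_rel (QRel.K_mul_inv (N := N) (s := s))
    rwa [map_mul, map_one] at h
  Ki_K := by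
    have h := gen_rel (QRel.K_inv_mul (N := N) (s := s))
    rwa [map_mul, map_one] at h
  r_comm i j hi hj := by
    rw [rGen_eq hi, rGen_eq hj]
    have h := gen_rel (QRel.r_comm (s := s) ⟨i, inR_iff.1 hi⟩ ⟨j, inR_iff.1 hj⟩)
    rwa [map_mul, map_mul] at h
  x_x := x_x_of_projA hs projA_xGen
  x_r i j hj := by
    rw [rGen_eq hj]
    have h := gen_rel (QRel.x_r (s := s) i ⟨j, inR_iff.1 hj⟩)
    rwa [map_mul, map_smul, map_mul] at h
  x_lam i := by
    have h := gen_rel (QRel.x_lam (s := s) i)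
    rw [map_mul, map_smul, map_mul] at h
    exact h
  r_lam j hj := by
    rw [rGen_eq hj]
    have h := gen_rel (QRel.r_lam (s := s) ⟨j, inR_iff.1 hj⟩)
    rw [map_mul, map_smul, map_mul] at h
    exact h
  K_r j hj := by
    rw [rGen_eq hj]
    have h := gen_rel (QRel.K_r (s := s) ⟨j, inR_iff.1 hj⟩)
    rwa [map_mul, map_mul] at h
  K_lam := by
    have h := gen_rel (QRel.K_lam (N := N) (s := s))
    rwa [map_mul, map_mul] at h
  K_x ho i := by
    have h := gen_rel (QRel.K_x (s := s) (Nat.not_odd_iff_even.1 ho) i)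
    rwa [map_mul, map_smul, map_mul] at h
  x_zero i hi := by
    have h0 : InR N 0 := ⟨le_rfl, Int.natCast_nonneg _, Or.inr (QD.odd_of_zero hi)⟩
    rw [rGen_eq h0]
    exact (gen_rel (QRel.r_zero (s := s) ⟨0, inR_iff.1 h0⟩ i rfl hi)).symm
  step := step_of_projA hN hs projA_xGen fun _ h0 h1 => rsq_rGen h0 h1

end Generators

namespace QD

variable {A : Type*} [Ring A] [Algebra ℂ A] (𝔇 : QD N s A)

theorem lam_zero {a : Idx N} (ha : (a : ℤ) = 0) :
    𝔇.lam a = 𝔇.Lam * Ring.inverse (𝔇.x a) := by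
  have h0 : InR N 0 := ⟨le_rfl, Int.natCast_nonneg _, Or.inr (odd_of_zero ha)⟩
  have h1 : Ring.inverse (𝔇.x a) = 𝔇.ri 0 := by
    rw [𝔇.x_zero a ha]
    exact Ring.inverse_unit ⟨_, _, 𝔇.r_ri 0 h0, 𝔇.ri_r 0 h0⟩
  rw [h1, lam, W, rpi, ha, if_pos rfl, abs_zero, 𝔇.x_zero (negIdx a) (by simp [ha])]
  simp only [mul_assoc]
  rw [𝔇.ri_r 0 h0, mul_one]

/-- For even N the telescoping relation gives x^1 x^{-1} = x^{-1} x^1 = r_1²/2, so x^{±1} has the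
inverse 2 r_1⁻² x^{∓1}. This 2, and the q⁻¹ from moving K past the coordinate, explain the factor in
`normC` and the 4 in `NormConst`. -/
theorem lam_of_exc (hs : Generic s) {a : Idx N} (he : Exc N a) :
    𝔇.Lam * (Ring.inverse (𝔇.x a) * (if (a : ℤ) = 1 then 𝔇.Ki else 𝔇.K)) =
      (2 * (s ^ 2)⁻¹) • 𝔇.lam a := by
  have h0 := hs.ne_zero
  have h1 := inR_one ⟨a, he⟩
  have hN := he.1
  have ha1 : |(a : ℤ)| = 1 := by rcases he.2 with h | h <;> rw [h] <;> rfl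
  have ht : twoRho N 1 = 0 := by rw [twoRho_pos one_pos, if_neg hN]; norm_num
  have hk : kap N 1 = 0 := by rw [kap, if_neg hN]; norm_num
  have h4 := one_sub_ne hs
  have hxr : ∀ b : Idx N, |(b : ℤ)| = 1 → QComm s 0 (𝔇.x b) (𝔇.r 1) := fun b hb =>
    (𝔇.x_r b 1 h1).congr (by rw [rExp, if_pos hb.le, mul_zero])
  have hx : ∀ b : Idx N, |(b : ℤ)| = 1 →
      𝔇.x b * 𝔇.x (negIdx b) = (2 : ℂ)⁻¹ • (𝔇.r 1 * 𝔇.r 1) := by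
    have e1 : 𝔇.V 2 = ((1 - s ^ 4) * 2⁻¹) • (𝔇.r 1 * 𝔇.r 1) := by
      have := vfun_add_one (s := s) h1 𝔇.r
      rw [pC, hk, zpow_zero] at this
      refine this.trans ?_
      norm_num [div_eq_mul_inv]
    have e2 : 𝔇.V (-1) = -((1 - s ^ 4) * 2⁻¹) • (𝔇.r 1 * 𝔇.r 1) := by
      have := vfun_neg (s := s) h1 𝔇.r
      rw [pC, hk, zpow_zero] at this
      refine this.trans ?_
      norm_num [div_eq_mul_inv]
    intro b hb
    have h := 𝔇.V_step b
    rcases eq_or_eq_neg_of_abs_eq hb with hb | hb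
    · rw [hb, ht, (𝔇.V_zero_even hN).2, sub_zero, neg_zero, zpow_zero, mul_one, one_add_one_eq_two,
        e1, mul_smul] at h
      exact smul_right_injective A h4 h
    · rw [hb, twoRho_neg, ht, neg_add_cancel, (𝔇.V_zero_even hN).1, zero_sub, neg_zero, neg_zero,
        zpow_zero, mul_one, e2, neg_smul, neg_neg, mul_smul] at h
      exact smul_right_injective A h4 h
  have hm1 : |((negIdx a : Idx N) : ℤ)| = 1 := by rw [coe_negIdx, abs_neg, ha1]
  have hri : ∀ b : Idx N, |(b : ℤ)| = 1 → 𝔇.x b * 𝔇.ri 1 = 𝔇.ri 1 * 𝔇.x b := fun b hb =>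
    ((hxr b hb).inv_right h0 (𝔇.r_ri 1 h1) (𝔇.ri_r 1 h1)).commute neg_zero
  have h2 := hx (negIdx a) hm1
  rw [negIdx_negIdx] at h2
  have hrr := 𝔇.ri_sq_mul_r_sq h1
  have hinv : Ring.inverse (𝔇.x a) = (2 : ℂ) • (𝔇.ri 1 * 𝔇.ri 1 * 𝔇.x (negIdx a)) := by
    refine Ring.inverse_unit ⟨𝔇.x a, (2 : ℂ) • (𝔇.ri 1 * 𝔇.ri 1 * 𝔇.x (negIdx a)), ?_, ?_⟩
    · rw [mul_smul_comm, ← mul_assoc, ← mul_assoc, hri a ha1, mul_assoc (𝔇.ri 1), hri a ha1,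
        mul_assoc, mul_assoc, hx a ha1, mul_smul_comm, mul_smul_comm, ← mul_assoc, hrr, smul_smul]
      norm_num
    · rw [smul_mul_assoc, mul_assoc, h2, mul_smul_comm, hrr, smul_smul]
      norm_num
  have hKr : 𝔇.K * 𝔇.ri 1 = 𝔇.ri 1 * 𝔇.K :=
    ((QComm.of_commute (s := s) (𝔇.K_r 1 h1)).inv_right h0 (𝔇.r_ri 1 h1) (𝔇.ri_r 1 h1)).commute
      neg_zero
  have hKx := 𝔇.K_x hN (negIdx a)
  have key : ∀ k, 𝔇.ri 1 * k = k * 𝔇.ri 1 → QComm s (-2) (𝔇.x (negIdx a)) k →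
      𝔇.Lam * ((2 : ℂ) • (𝔇.ri 1 * 𝔇.ri 1 * 𝔇.x (negIdx a)) * k) =
        (2 * (s ^ 2)⁻¹) • (𝔇.Lam * (𝔇.ri 1 * (k * 𝔇.ri 1)) * 𝔇.x (negIdx a)) := by
    intro k hk1 hk2
    rw [smul_mul_assoc, mul_assoc (𝔇.ri 1 * 𝔇.ri 1), hk2.eq, ← hk1, mul_smul_comm, mul_smul_comm,
      mul_smul_comm, smul_smul, zpow_neg]
    simp only [mul_assoc]
    norm_cast
  rw [hinv, lam, W, ha1]
  rcases he.2 with hb | hb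
  · have h3 : 𝔇.rpi a = 𝔇.Ki * 𝔇.ri 1 := by
      rw [hb] at he ⊢
      rw [rpi, if_neg one_ne_zero, if_pos he, if_pos rfl]
    rw [h3, if_pos hb]
    rw [coe_negIdx, hb] at hKx
    refine key _ ?_ (((hKx.symm h0).inv_right h0 𝔇.K_Ki 𝔇.Ki_K).congr (by decide))
    exact ((QComm.of_commute (s := s) hKr).inv_left h0 𝔇.K_Ki 𝔇.Ki_K).commute neg_zero |>.symm
  · have h3 : 𝔇.rpi a = 𝔇.K * 𝔇.ri 1 := by
      rw [hb] at he ⊢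
      rw [rpi, if_neg (show ¬ (-1 : ℤ) = 0 by norm_num), if_pos he,
        if_neg (show ¬ (-1 : ℤ) = 1 by norm_num)]
    rw [h3, if_neg (show ¬ (a : ℤ) = 1 by omega)]
    rw [coe_negIdx, hb] at hKx
    exact key _ hKr.symm ((hKx.symm h0).congr (by decide))

theorem lam_of_ne (a : Idx N) (ha : (a : ℤ) ≠ 0) (he : ¬ Exc N a) :
    𝔇.lam a = 𝔇.Lam * (𝔇.ri |(a : ℤ)| * 𝔇.ri (|(a : ℤ)| - 1) * 𝔇.x (negIdx a)) := by
  rw [lam, W, rpi, if_neg ha, if_neg he, mul_assoc]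

end QD

end QEuclid

/-! ### The two calculi -/

namespace QEuclid

variable {N : ℕ} {s : ℂ}

section

variable {A : Type*} [Ring A] [Algebra ℂ A]

/-- The commutators `[λ_a, x^i]`. -/
def com (x l : Idx N → A) (i a : Idx N) : A := l a * x i - x i * l a

/-- The matrix of the products of two commutators. -/
def com2 (x l : Idx N → A) : Matrix (Idx N × Idx N) (Idx N × Idx N) A :=
  Matrix.of fun u v => com x l u.1 v.1 * com x l u.2 v.2

/-- The relations between coordinates `x^i` and elements `λ_a` on which the calculus labelled by `ε`
is based. -/
structure IsCalculus (N : ℕ) (s : ℂ) (ε : ℤˣ) (x l : Idx N → A) (L Li rr : A) : Prop where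
  x_com : ∀ h i a, x h * com x l i a = ∑ k, ∑ m, ((s ^ 2 • rhat N s) ^ (ε : ℤ)) (h, i) (k, m) •
    (com x l k a * x m)
  com_L : ∀ i a, com x l i a * L = L * com x l i a
  L_Li : L * Li = 1
  Li_L : Li * L = 1
  l_l : ∀ i j, ∑ k, ∑ m, projA N s (i, j) (k, m) • (l k * l m) = 0
  rll : sc A (rhat N s) * com2 x l = com2 x l * sc A (rhat N s)
  sum_upper : ∀ a b, ∑ i, ∑ j, gMat N s i j • (com x l i a * com x l j b) = gMat N s a b • (L * L)
  sum_lower : ∀ i j, ∑ a, ∑ b, gMat N s a b • (com x l i a * com x l j b) = gMat N s i j • (L * L)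
  dirac : ∀ a, -l a = (((ε : ℤ) : ℂ) * omega N s (top N) * s ^ ((ε : ℤ) * (N : ℤ)) *
    (kConst s)⁻¹) • (rr * ∑ i, ∑ j, gMat N s i j • (x i * com x l j a))

namespace QD

theorem com_eq (𝔇 : QD N s A) (c : Idx N → ℂ) : com 𝔇.x (𝔇.l c) = 𝔇.E c := by
  ext i a
  rw [com, 𝔇.E_eq]

theorem isCalculus (𝔇 : QD N s A) {c : Idx N → ℂ} (hN : 3 ≤ N) (hs : Generic s)
    (hc : NormConst N s c) : IsCalculus N s 1 𝔇.x (𝔇.l c) 𝔇.Lam 𝔇.Lami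
      (𝔇.ri (top N) * 𝔇.ri (top N)) where
  x_com h i a := by
    rw [com_eq, 𝔇.x_E c hs, qrhat_zpow_one]
    simp only [Finset.smul_sum, Matrix.smul_apply, smul_smul, smul_eq_mul]
  com_L i a := by
    rw [com_eq]
    exact (𝔇.E_Lam hs.ne_zero i a).commute rfl
  L_Li := 𝔇.Lam_Lami
  Li_L := 𝔇.Lami_Lam
  l_l := 𝔇.projA_l_l hN hc hs
  rll := by
    have : com2 𝔇.x (𝔇.l c) = 𝔇.EE c := by
      ext u v
      simp only [com2, com_eq, EE]
    rw [this]
    exact 𝔇.rll hc hs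
  sum_upper a b := by
    rw [com_eq]
    exact 𝔇.sum_g_E_E hN hc hs a b
  sum_lower i j := by
    rw [com_eq]
    exact 𝔇.sum_E_g_E hN hc hs i j
  dirac a := by
    rw [com_eq, 𝔇.l_eq hN hs, Units.val_one, Int.cast_one, one_mul, one_mul]

end QD

theorem sum_sum_negIdx {M : Type*} [AddCommMonoid M] (F : Idx N → Idx N → M) :
    ∑ k, ∑ l, F (negIdx k) (negIdx l) = ∑ k, ∑ l, F k l :=
  (Finset.sum_congr rfl fun _ _ => sum_negIdx _).trans (sum_negIdx fun k => ∑ l, F k l)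

theorem omega_inv (s : ℂ) (i : ℤ) : omega N s⁻¹ i = omega N s i := by
  rw [omega, omega, inv_zpow, inv_zpow, ← zpow_neg, ← zpow_neg, neg_neg, add_comm]

/-- The symmetry `q ↦ q⁻¹`, `i ↦ -i` exchanges the two calculi. -/
theorem IsCalculus.flip (hN : 3 ≤ N) (hs : Generic s) {x l : Idx N → A} {L Li rr : A}
    (h : IsCalculus N s⁻¹ 1 x l L Li rr) :
    IsCalculus N s (-1) (fun i => x (negIdx i)) (fun i => l (negIdx i)) L Li rr := by
  have h0 := hs.ne_zero
  have hcom : ∀ i a, com (fun i => x (negIdx i)) (fun i => l (negIdx i)) i a =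
      com x l (negIdx i) (negIdx a) := fun _ _ => rfl
  refine ⟨fun h' i a => ?_, fun i a => h.com_L _ _, h.L_Li, h.Li_L, fun i j => ?_, ?_,
    fun a b => ?_, fun i j => ?_, fun a => ?_⟩
  · rw [hcom, h.x_com, qrhat_zpow_one, qrhat_zpow_neg_one h0, ← sum_sum_negIdx]
    simp only [Matrix.smul_apply, rhat_flip h0, inv_pow, hcom]
  · refine Eq.trans ?_ (h.l_l (negIdx i) (negIdx j))
    rw [← sum_sum_negIdx (fun k m => projA N s⁻¹ (negIdx i, negIdx j) (k, m) • (l k * l m))]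
    simp only [projA_flip hN hs]
  · let C := com2 (fun i => x (negIdx i)) (fun i => l (negIdx i))
    have h1 : sc A (rhatInv N s) * C = C * sc A (rhatInv N s) := by
      ext ⟨i, j⟩ ⟨a, b⟩
      have h2 := congrFun (congrFun h.rll (negIdx i, negIdx j)) (negIdx a, negIdx b)
      rw [sc_mul_apply, mul_sc_apply, sum_pair, sum_pair] at h2
      rw [← sum_sum_negIdx] at h2
      rw [← sum_sum_negIdx (fun k m => rhat N s⁻¹ (k, m) (negIdx a, negIdx b) •
        com2 x l (negIdx i, negIdx j) (k, m))] at h2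
      rw [sc_mul_apply, mul_sc_apply, sum_pair, sum_pair]
      simp only [rhat_flip h0] at h2
      exact h2
    -- The reflection gives commutation with the inverse of R̂, which is equivalent to commutation
    -- with R̂.
    calc sc A (rhat N s) * C = sc A (rhat N s) * (C * sc A (rhatInv N s)) * sc A (rhat N s) := by
          rw [Matrix.mul_assoc, Matrix.mul_assoc, ← map_mul, rhatInv_mul_rhat h0, map_one,
            Matrix.mul_one]
      _ = _ := by
        rw [← h1, ← Matrix.mul_assoc, ← map_mul, rhat_mul_rhatInv h0, map_one, Matrix.one_mul]
  · rw [← gMat_flip, ← h.sum_upper]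
    refine Eq.trans ?_ (sum_sum_negIdx _)
    simp only [gMat_flip, hcom]
  · rw [← gMat_flip, ← h.sum_lower]
    refine Eq.trans ?_ (sum_sum_negIdx _)
    simp only [gMat_flip, hcom]
  · have h1 := h.dirac (negIdx a)
    rw [← sum_sum_negIdx, omega_inv, kConst_inv] at h1
    simp only [gMat_flip, Units.val_one, one_mul, Int.cast_one, inv_neg] at h1
    rw [h1]
    simp only [Units.val_neg, Units.val_one, Int.cast_neg, Int.cast_one, inv_zpow, zpow_neg,
      neg_mul, one_mul, mul_neg, neg_smul, hcom]

end

/-- The normalization of the elements `lam a` that belongs to the constants `γ_a`. -/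
noncomputable def normC (s : ℂ) (γ : Idx N → ℂ) (a : Idx N) : ℂ :=
  open Classical in if QD.Exc N a then 2 * (s ^ 2)⁻¹ * γ a else γ a

theorem normConst_one {γ : Idx N → ℂ} (hγ : IsNormalization N s 1 γ) : NormConst N s (normC s γ) := by
  have hne : ∀ a : Idx N, ¬ QD.Exc N a → normC s γ a = γ a := fun a ha => if_neg ha
  refine ⟨fun a ha => ?_, fun ho a ha => ?_, fun he a ha => ?_, fun a ha => ?_⟩
  · rw [hne a (by rw [ha]; exact fun h => by have := h.2; omega), hγ.zero a ha]
    rw [Units.val_one, zpow_neg_one, mul_inv]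
    push_cast
    ring
  · rw [hne a fun h => h.1 ho, hne _ fun h => h.1 ho, hγ.one_odd ho a ha]
    rw [Units.val_one, mul_inv, mul_one, zpow_neg, neg_mul]
    rfl
  · have h1 : QD.Exc N a := ⟨he, Or.inl ha⟩
    have h2 : QD.Exc N (negIdx a : Idx N) := ⟨he, Or.inr (by rw [coe_negIdx, ha])⟩
    have h3 := hγ.one_even (Nat.not_odd_iff_even.1 he) a ha
    rw [normC, if_pos h1, normC, if_pos h2]
    have : 2 * (s ^ 2)⁻¹ * γ a * (2 * (s ^ 2)⁻¹ * γ (negIdx a)) =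
      4 * ((s ^ 2)⁻¹ * (s ^ 2)⁻¹) * (γ a * γ (negIdx a)) := by ring
    rw [this, h3, ← mul_inv, mul_assoc, ← mul_inv]
    ring_nf
  · have h1 : ¬ QD.Exc N a := fun h => by have := h.2; omega
    have h2 : ¬ QD.Exc N (negIdx a : Idx N) := fun h => by
      have := h.2; rw [coe_negIdx] at this; omega
    rw [hne a h1, hne _ h2, hγ.gt_one a ha]
    rw [Units.val_one, mul_inv, mul_one, zpow_neg]
    norm_cast
    ring

/-- Under q ↦ q⁻¹ the constants h and k change sign and ω_i does not change, so the barred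
conditions become the unbarred ones for the reflected constants. -/
theorem isNormalization_flip {γ : Idx N → ℂ} (hγ : IsNormalization N s (-1) γ) :
    IsNormalization N s⁻¹ 1 fun a => γ (negIdx a) := by
  have hh : hConst s⁻¹ = -hConst s := by rw [hConst, hConst, inv_inv]; ring
  refine ⟨fun a ha => ?_, fun ho a ha => ?_, fun he a ha => ?_, fun a ha => ?_⟩
  · rw [hγ.zero _ (by rw [coe_negIdx, ha, neg_zero]), hh]
    simp
  · rw [mul_comm, negIdx_negIdx, hγ.one_odd ho a ha, hh]
    simp
  · rw [mul_comm, negIdx_negIdx, hγ.one_even he a ha, kConst_inv, neg_sq]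
  · rw [mul_comm, negIdx_negIdx, hγ.gt_one a ha, kConst_inv, neg_sq, omega_inv, omega_inv]
    simp

namespace QD

variable {A : Type*} [Ring A] [Algebra ℂ A]

theorem l_normC (𝔇 : QD N s A) (hs : Generic s) (γ : Idx N → ℂ) (a : Idx N) :
    𝔇.l (normC s γ) a = γ a • (𝔇.Lam * (if (a : ℤ) = 0 then Ring.inverse (𝔇.x a)
      else if Even N ∧ |(a : ℤ)| = 1 then
        Ring.inverse (𝔇.x a) * (if (a : ℤ) = 1 then 𝔇.Ki else 𝔇.K)
      else 𝔇.ri |(a : ℤ)| * 𝔇.ri (|(a : ℤ)| - 1) * 𝔇.x (negIdx a))) := by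
  have he : QD.Exc N a ↔ Even N ∧ |(a : ℤ)| = 1 := by
    rw [Exc, Nat.not_odd_iff_even, abs_eq zero_le_one]
  by_cases h0 : (a : ℤ) = 0
  · rw [if_pos h0, l, 𝔇.lam_zero h0, normC, if_neg]
    rw [he, h0]
    simp
  · rw [if_neg h0]
    by_cases h1 : Exc N a
    · rw [if_pos (he.1 h1), 𝔇.lam_of_exc hs h1, l, normC, if_pos h1, smul_smul, mul_comm]
    · rw [if_neg (fun h => h1 (he.2 h)), ← 𝔇.lam_of_ne a h0 h1, l, normC, if_neg h1]

end QD

theorem lamPow_one : lamPow N s 1 = gen N s QGen.lam := if_pos rfl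

theorem lamPow_neg_one : lamPow N s (-1) = gen N s QGen.lamInv := if_neg (by decide)

/-- The elements `λ_a` define a calculus. -/
theorem isCalculus_lamElt (hN : 3 ≤ N) (hs : Generic s) (ε : ℤˣ) {γ : Idx N → ℂ}
    (hγ : IsNormalization N s ε γ) : IsCalculus N s ε (xGen N s) (lamElt N s ε γ) (lamPow N s ε)
      (lamPow N s (-ε)) (rInvGen N s (top N) * rInvGen N s (top N)) := by
  rcases Int.units_eq_one_or ε with rfl | rfl
  · have h := (qd hN hs).isCalculus hN hs (normConst_one hγ)
    have h1 : (qd hN hs).l (normC s γ) = lamElt N s 1 γ := by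
      ext a
      rw [(qd hN hs).l_normC hs, lamElt, lamPow_one, Units.val_one, one_mul]
      rfl
    rw [h1] at h
    rw [lamPow_one, lamPow_neg_one]
    exact h
  -- The barred calculus is the unbarred one of the reflected generators at `s⁻¹`, whose dilatator
  -- is Λ⁻¹, with the indices reflected back.
  · have h := (((qd hN hs).flip hs).isCalculus hN hs.inv
      (normConst_one (isNormalization_flip hγ))).flip hN hs
    have h1 : (fun a => ((qd hN hs).flip hs).l (normC s⁻¹ fun a => γ (negIdx a)) (negIdx a)) =
        lamElt N s (-1) γ := by
      ext a
      rw [((qd hN hs).flip hs).l_normC hs.inv, lamElt, lamPow_neg_one]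
      have hx : ∀ b, ((qd hN hs).flip hs).x b = xGen N s (negIdx b) := fun _ => rfl
      simp only [hx, negIdx_negIdx, coe_negIdx, abs_neg, neg_eq_zero, Units.val_neg, Units.val_one,
        neg_mul, one_mul]
      rfl
    have h2 : (fun i => ((qd hN hs).flip hs).x (negIdx i)) = xGen N s := by
      ext i
      exact congrArg (xGen N s) (negIdx_negIdx i)
    rw [h1, h2] at h
    rw [lamPow_neg_one, neg_neg, lamPow_one]
    exact h

end QEuclid

namespace QEuclid

variable {N : ℕ} {s : ℂ}

/-! ## A representation of `A_N` -/

section Weighted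

/-- The weighted translation `f ↦ (t ↦ φ t * f (t + v))` of functions on `ℤ → ℤ`. -/
def wt (φ : (ℤ → ℤ) → ℂ) (v : ℤ → ℤ) : Module.End ℂ ((ℤ → ℤ) → ℂ) where
  toFun f t := φ t * f (t + v)
  map_add' f g := by ext t; simp [mul_add]
  map_smul' c f := by ext t; simp; ring

variable {φ ψ : (ℤ → ℤ) → ℂ} {v w : ℤ → ℤ}

theorem wt_apply (f : (ℤ → ℤ) → ℂ) (t : ℤ → ℤ) : wt φ v f t = φ t * f (t + v) := rfl

theorem wt_mul : wt φ v * wt ψ w = wt (fun t => φ t * ψ (t + v)) (v + w) := by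
  ext f t
  simp only [Module.End.mul_apply, wt_apply, mul_assoc, add_assoc]

theorem wt_mul_eq_one (h : ∀ t, φ t * ψ (t + v) = 1) (hv : v + w = 0) : wt φ v * wt ψ w = 1 := by
  ext f t
  simp only [Module.End.mul_apply, wt_apply, ← mul_assoc, h, add_assoc, hv, add_zero, one_mul,
    Module.End.one_apply]

theorem wt_smul (c : ℂ) : c • wt φ v = wt (fun t => c * φ t) v := by
  ext f t
  simp only [LinearMap.smul_apply, Pi.smul_apply, smul_eq_mul, wt_apply, mul_assoc]

theorem wt_sub : wt φ v - wt ψ v = wt (fun t => φ t - ψ t) v := by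
  ext f t
  simp only [LinearMap.sub_apply, Pi.sub_apply, wt_apply, sub_mul]

theorem wt_qComm {m : ℤ} (h : ∀ t, φ t * ψ (t + v) = s ^ m * (ψ t * φ (t + w))) :
    QComm s m (wt φ v) (wt ψ w) := by
  rw [QComm, wt_mul, wt_mul, wt_smul, add_comm w]
  congr 1
  ext t
  exact h t

theorem wt_qComm_of_hom {a b m : ℤ} (hs : s ≠ 0) (h₁ : ∀ t, ψ (t + v) = s ^ a * ψ t)
    (h₂ : ∀ t, φ (t + w) = s ^ b * φ t) (hm : a = m + b) : QComm s m (wt φ v) (wt ψ w) :=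
  wt_qComm fun t => by rw [h₁, h₂, hm, zpow_add₀ hs]; ring

end Weighted

/-- The coefficient of `x^{-m} x^m` in the representation. -/
noncomputable def repY (N : ℕ) (s : ℂ) (m : ℤ) (t : ℤ → ℤ) : ℂ :=
  s ^ twoRho N m * (1 - s ^ 4)⁻¹ * (pC N s m * s ^ (4 * t m) -
    (if m = 1 ∧ ¬ Odd N then 0 else pC N s (m - 1) * s ^ (4 * t (m - 1) + 4)))

/-- The weight of `x^i`. -/
noncomputable def repPhi (N : ℕ) (s : ℂ) (i : ℤ) (t : ℤ → ℤ) : ℂ :=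
  if 0 ≤ i then s ^ (2 * t i) else s ^ (-(2 * t (-i))) * repY N s (-i) t

open Classical in
/-- The translation of `x^i`. -/
noncomputable def repV (N : ℕ) (i j : ℤ) : ℤ :=
  if j < |i| ∧ (Odd N ∨ j ≠ 0 ∨ |i| = 1) then -i.sign else 0

open Classical in
/-- The translation of `Λ`. -/
noncomputable def repW (N : ℕ) (j : ℤ) : ℤ := if Odd N ∨ j ≠ 0 then -1 else 0

/-- The weight of x^i depends only on t_{|i|} and, for i < 0, on t_{|i|-1} as far as this belongs to
a radius; it scales by q^d if these are translated by d. The q-commutation relations between the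
x^i, and between x^i and Λ, reduce to this homogeneity. -/
theorem repPhi_add (hs : s ≠ 0) (i : ℤ) (t v : ℤ → ℤ) (d : ℤ) (h₁ : v |i| = d)
    (h₂ : i < 0 → (|i| = 1 ∧ ¬ Odd N) ∨ v (|i| - 1) = d) :
    repPhi N s i (t + v) = s ^ (2 * d) * repPhi N s i t := by
  unfold repPhi
  split_ifs with hi
  · rw [abs_of_nonneg hi] at h₁
    rw [Pi.add_apply, h₁, ← zpow_add₀ hs]
    congr 1
    ring
  · rw [abs_of_neg (by omega)] at h₁ h₂
    unfold repY
    have e : s ^ (-(2 * (t + v) (-i))) = s ^ (-(2 * t (-i))) * s ^ (-(2 * d)) := by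
      rw [Pi.add_apply, h₁, ← zpow_add₀ hs]
      congr 1
      ring
    have e1 : s ^ (4 * (t + v) (-i)) = s ^ (4 * t (-i)) * s ^ (4 * d) := by
      rw [Pi.add_apply, h₁, ← zpow_add₀ hs]
      congr 1
      ring
    have e3 : s ^ (-(2 * d)) * s ^ (4 * d) = s ^ (2 * d) := by
      rw [← zpow_add₀ hs]
      congr 1
      ring
    rw [e, e1, ← e3]
    split_ifs with h
    · ring
    · have h3 := (h₂ (by omega)).resolve_left h
      have e2 : s ^ (4 * (t + v) (-i - 1) + 4) = s ^ (4 * t (-i - 1) + 4) * s ^ (4 * d) := by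
        rw [Pi.add_apply, h3, ← zpow_add₀ hs]
        congr 1
        ring
      rw [e2]
      ring

theorem repPhi_add_repV (hs : s ≠ 0) (i j : Idx N) (h : |(i : ℤ)| ≠ |(j : ℤ)|) (t : ℤ → ℤ) :
    repPhi N s i (t + repV N j) = s ^ (2 * (if |(i : ℤ)| < |(j : ℤ)| then -(j : ℤ).sign else 0)) *
      repPhi N s i t := by
  have hi := (idx_mem i).2.2
  have hj := abs_nonneg (j : ℤ)
  refine repPhi_add hs i t _ _ ?_ ?_
  · unfold repV
    refine if_congr ⟨fun h => h.1, fun h1 => ⟨h1, ?_⟩⟩ rfl rfl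
    rw [← Int.natAbs_pos] at hi
    rcases hi with h2 | h2
    · right; left; rw [Ne, abs_eq_zero]; omega
    · exact Or.inl h2
  · intro h0
    by_cases hc : |(i : ℤ)| = 1 ∧ ¬ Odd N
    · exact Or.inl hc
    · right
      have h4 : |(i : ℤ)| - 1 < |(j : ℤ)| ↔ |(i : ℤ)| < |(j : ℤ)| := by omega
      unfold repV
      refine if_congr ⟨fun h => h4.1 h.1, fun h1 => ⟨h4.2 h1, ?_⟩⟩ rfl rfl
      by_cases ho : Odd N
      · exact Or.inl ho
      · right; left
        intro h5
        exact hc ⟨by omega, ho⟩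

theorem repPhi_add_repW (hs : s ≠ 0) (i : Idx N) (t : ℤ → ℤ) :
    repPhi N s i (t + repW N) = s ^ (-2 : ℤ) * repPhi N s i t := by
  have hi := (idx_mem i).2.2
  refine repPhi_add hs i t _ (-1) ?_ ?_
  · unfold repW
    rw [if_pos]
    rw [Ne, abs_eq_zero]
    tauto
  · intro h0
    by_cases hc : |(i : ℤ)| = 1 ∧ ¬ Odd N
    · exact Or.inl hc
    · right
      unfold repW
      rw [if_pos]
      by_cases ho : Odd N
      · exact Or.inl ho
      · right
        intro h5
        exact hc ⟨by omega, ho⟩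

theorem repV_apply (i j : ℤ) (hj : InR N j) : repV N i j = rExp i j := by
  unfold repV rExp
  have h := abs_cases i
  have h1 := hj.1
  have h2 : Odd N ∨ j ≠ 0 ∨ |i| = 1 := by have := hj.2.2; tauto
  simp only [h2, and_true]
  rcases lt_trichotomy i 0 with h0 | h0 | h0
  · rw [Int.sign_eq_neg_one_of_neg h0]
    split_ifs <;> omega
  · rw [h0]; simp [h1]
  · rw [Int.sign_eq_one_of_pos h0]
    split_ifs <;> omega

theorem repV_neg (i : ℤ) : repV N (-i) = -repV N i := by
  ext j
  rw [Pi.neg_apply]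
  unfold repV
  rw [abs_neg, Int.sign_neg]
  split_ifs <;> simp

theorem wt_congr {φ ψ : (ℤ → ℤ) → ℂ} {v w : ℤ → ℤ} (h₁ : ∀ t, φ t = ψ t) (h₂ : v = w) :
    wt φ v = wt ψ w := by rw [funext h₁, h₂]

/-- The radii of the representation. -/
noncomputable def repR (s : ℂ) (j : ℤ) : Module.End ℂ ((ℤ → ℤ) → ℂ) := wt (fun t => s ^ (2 * t j)) 0

theorem rsq_repR (hs : s ≠ 0) (m : ℤ) : rsq N (repR s) m =
    open Classical in wt (fun t => if m = 0 ∧ ¬ Odd N then 0 else s ^ (4 * t m)) 0 := by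
  unfold rsq repR
  split_ifs with h
  · ext f t
    simp [wt_apply]
  · rw [wt_mul, add_zero]
    refine wt_congr (fun t => ?_) rfl
    rw [add_zero, ← zpow_add₀ hs]
    congr 1
    ring

theorem repV_self (i : ℤ) : repV N i |i| = 0 := by
  unfold repV
  simp

/-- `repY` is the value that the telescoping relation demands for x^{-i} x^i. Then x^i x^{-i} is the
same function after the translation of x^i, which moves t_{i-1} and fixes t_i. -/
theorem vfun_repR (hs : Generic s) {i : ℤ} (hi : 1 ≤ i) : vfun N s (repR s) (i + 1) - vfun N s (repR s) i =
      wt (fun t => (1 - s ^ 4)  * s ^ (-twoRho N i) * repY N s i (t + repV N i)) 0 ∧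
    vfun N s (repR s) (-i + 1) - vfun N s (repR s) (-i) =
      wt (fun t => (1 - s ^ 4)  * s ^ twoRho N i * repY N s i t) 0 := by
  have h0 := hs.ne_zero
  have h4 := QD.one_sub_ne hs
  have hu := zpow_ne_zero (twoRho N i) h0
  have e1 : vfun N s (repR s) (i + 1) = pC N s i • rsq N (repR s) i := by
    rw [vfun, if_pos (by omega), add_sub_cancel_right]
  have e2 : vfun N s (repR s) i = pC N s (i - 1) • rsq N (repR s) (i - 1) := by
    rw [vfun, if_pos (by omega)]
  have e3 : vfun N s (repR s) (-i + 1) =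
      -(s ^ kap N (i - 1) * pC N s (i - 1)) • rsq N (repR s) (i - 1) := by
    rw [vfun, if_neg (by omega), show -(-i + 1) = i - 1 by ring]
    exact (neg_smul _ _).symm
  have e4 : vfun N s (repR s) (-i) = -(s ^ kap N i * pC N s i) • rsq N (repR s) i := by
    rw [vfun, if_neg (by omega), neg_neg]
    exact (neg_smul _ _).symm
  have hi1 : ¬ (i = 0 ∧ ¬ Odd N) := fun h => by omega
  have hi2 : (i - 1 = 0 ∧ ¬ Odd N) ↔ (i = 1 ∧ ¬ Odd N) := and_congr_left fun _ => by omega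
  have e5 : s ^ (2 * twoRho N i + 4) = s ^ twoRho N i * s ^ twoRho N i * s ^ 4 := by
    rw [zpow_add₀ h0, two_mul, zpow_add₀ h0]; norm_cast
  have e6 : s ^ (2 * twoRho N i) = s ^ twoRho N i * s ^ twoRho N i := by
    rw [two_mul, zpow_add₀ h0]
  have e7 : ∀ m : ℤ, s ^ (m + 4) = s ^ m * s ^ 4 := fun m => by
    rw [zpow_add₀ h0]; norm_cast
  rw [e1, e2, e3, e4, rsq_repR h0, rsq_repR h0, wt_smul, wt_smul, wt_smul, wt_smul, wt_sub, wt_sub]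
  constructor
  · refine wt_congr (fun t => ?_) rfl
    simp only [if_neg hi1, hi2]
    unfold repY
    have h5 : repV N i i = 0 := by
      have := repV_self (N := N) i
      rwa [abs_of_nonneg (by omega)] at this
    rw [Pi.add_apply, h5, add_zero, zpow_neg]
    split_ifs with h
    · field_simp
      ring
    · have h6 : repV N i (i - 1) = -1 := by
        unfold repV
        rw [if_pos, Int.sign_eq_one_of_pos (by omega)]
        rw [abs_of_nonneg (by omega)]
        refine ⟨by omega, ?_⟩
        by_contra h7
        exact h ⟨by omega, by tauto⟩
      rw [Pi.add_apply, h6, show 4 * (t (i - 1) + -1) + 4 = 4 * t (i - 1) by ring]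
      field_simp
  · refine wt_congr (fun t => ?_) rfl
    simp only [if_neg hi1, hi2]
    unfold repY
    rw [kap_eq hi, kap_sub_one hi, e5, e6, e7]
    split_ifs with h
    · field_simp
      ring
    · field_simp
      ring

/-- The representation of the generators of `A_N` by weighted translations. -/
noncomputable def repQD (hs : Generic s) : QD N s (Module.End ℂ ((ℤ → ℤ) → ℂ)) where
  x i := wt (repPhi N s i) (repV N i)
  r := repR s
  ri j := wt (fun t => s ^ (-(2 * t j))) 0
  Lam := wt 1 (repW N)
  Lami := wt 1 (-repW N)
  -- For even N there is no r_0; its coordinate t_0 carries K instead and is translated only by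
  -- x^{±1}.
  K := open Classical in wt (fun t => if Odd N then 1 else s ^ (2 * t 0)) 0
  Ki := open Classical in wt (fun t => if Odd N then 1 else s ^ (-(2 * t 0))) 0
  r_ri j _ := wt_mul_eq_one (fun t => by
    rw [add_zero, ← zpow_add₀ hs.ne_zero, add_neg_cancel, zpow_zero]) (add_zero _)
  ri_r j _ := wt_mul_eq_one (fun t => by
    rw [add_zero, ← zpow_add₀ hs.ne_zero, neg_add_cancel, zpow_zero]) (add_zero _)
  Lam_Lami := wt_mul_eq_one (fun t => mul_one _) (add_neg_cancel _)
  Lami_Lam := wt_mul_eq_one (fun t => mul_one _) (neg_add_cancel _)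
  K_Ki := wt_mul_eq_one (fun t => by
    rw [add_zero]
    split_ifs
    · rw [one_mul]
    · rw [← zpow_add₀ hs.ne_zero, add_neg_cancel, zpow_zero]) (add_zero _)
  Ki_K := wt_mul_eq_one (fun t => by
    rw [add_zero]
    split_ifs
    · rw [one_mul]
    · rw [← zpow_add₀ hs.ne_zero, neg_add_cancel, zpow_zero]) (add_zero _)
  r_comm i j _ _ := (wt_qComm (s := s) (m := 0) fun t => by
    rw [add_zero, zpow_zero]; ring).commute rfl
  x_x i j hij hne := by
    have h1 : |(i : ℤ)| ≠ |(j : ℤ)| := by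
      rw [Ne, abs_eq_abs]
      omega
    refine wt_qComm_of_hom hs.ne_zero (repPhi_add_repV hs.ne_zero j i h1.symm)
      (repPhi_add_repV hs.ne_zero i j h1) ?_
    have h2 := abs_cases (i : ℤ)
    have h3 := abs_cases (j : ℤ)
    rcases lt_or_gt_of_ne h1 with h | h
    · rw [if_pos h, if_neg h.not_gt, Int.sign_eq_one_of_pos (by omega)]
      rfl
    · rw [if_pos h, if_neg h.not_gt, Int.sign_eq_neg_one_of_neg (by omega)]
      rfl
  x_r i j hj := wt_qComm_of_hom (a := 2 * rExp i j) (b := 0) hs.ne_zero (fun t => by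
      rw [Pi.add_apply, repV_apply _ _ hj, ← zpow_add₀ hs.ne_zero]
      congr 1
      ring) (fun t => by rw [add_zero, zpow_zero, one_mul]) (by ring)
  x_lam i := wt_qComm_of_hom (a := 0) (b := -2) hs.ne_zero (fun t => by
    rw [zpow_zero, one_mul]; rfl) (repPhi_add_repW hs.ne_zero i) (by norm_num)
  r_lam j hj := wt_qComm_of_hom (a := 0) (b := -2) hs.ne_zero (fun t => by
    rw [zpow_zero, one_mul]; rfl) (fun t => by
      have : repW N j = -1 := if_pos (by have := hj.2.2; tauto)
      rw [Pi.add_apply, this, ← zpow_add₀ hs.ne_zero]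
      congr 1
      ring) (by norm_num)
  K_r j _ := (wt_qComm (s := s) (m := 0) fun t => by
    rw [add_zero, zpow_zero]; ring).commute rfl
  K_lam := (wt_qComm (s := s) (m := 0) fun t => by
    rw [zpow_zero, one_mul, Pi.one_apply, Pi.one_apply, mul_one, one_mul]
    split_ifs with ho
    · rfl
    · have : repW N 0 = 0 := if_neg (by tauto)
      rw [Pi.add_apply, this, add_zero]).commute rfl
  K_x ho i := wt_qComm_of_hom (a := 0) (b := -(2 * kExp i)) hs.ne_zero (fun t => by
      rw [add_zero, zpow_zero, one_mul]) (fun t => by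
      rw [if_neg ho, if_neg ho, Pi.add_apply, ← zpow_add₀ hs.ne_zero]
      congr 1
      have : repV N i 0 = -kExp i := by
        unfold repV kExp
        simp only [ho, false_or, ne_eq, not_true]
        split_ifs with h1 h2 h2
        · rcases eq_or_eq_neg_of_abs_eq h2 with h | h <;> rw [h] <;> rfl
        · omega
        · omega
        · rfl
      rw [this]
      ring) (by ring)
  x_zero i hi := by
    refine wt_congr (fun t => ?_) ?_
    · rw [hi, repPhi, if_pos le_rfl]
    · ext j
      unfold repV
      rw [hi, Int.sign_zero, neg_zero, ite_self]
      rfl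
  step i := by
    have h0 := hs.ne_zero
    rw [wt_mul, coe_negIdx, repV_neg, add_neg_cancel, wt_smul]
    rcases lt_trichotomy (i : ℤ) 0 with h | h | h
    · have h1 := (vfun_repR (N := N) hs (i := -i) (by omega)).2
      rw [neg_neg] at h1
      rw [h1]
      refine wt_congr (fun t => ?_) rfl
      have h2 := repV_self (N := N) i
      rw [abs_of_neg h] at h2
      rw [repPhi, if_neg (by omega), repPhi, if_pos (by omega), Pi.add_apply, h2, add_zero,
        twoRho_neg, zpow_neg s (2 * _)]
      have := zpow_ne_zero (2 * t (-i)) h0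
      field_simp
    · have ho := QD.odd_of_zero h
      have h1 : rsq N (repR s) 0 = wt (fun t => s ^ (4 * t 0)) 0 := by
        rw [rsq_repR h0]
        exact wt_congr (fun t => if_neg fun h => h.2 ho) rfl
      have h2 := hs.one_add_zpow 2
      have h3 : kap N 0 = 2 := by rw [kap, if_pos ho]; rfl
      have h6 : vfun N s (repR s) 0 = wt (fun t => -(s ^ kap N 0 * pC N s 0) * s ^ (4 * t 0)) 0 := by
        rw [vfun, if_neg (by norm_num), neg_zero, h1, ← wt_smul]
        exact (neg_smul _ _).symm
      rw [h, h6, vfun, if_pos (by norm_num), zero_add, sub_self, h1, wt_smul, wt_sub]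
      refine wt_congr (fun t => ?_) rfl
      have h4 : repV N 0 0 = 0 := repV_self 0
      have h5 : s ^ (4 * t 0) = s ^ (2 * t 0) * s ^ (2 * t 0) := by
        rw [← zpow_add₀ h0]
        congr 1
        ring
      have h7 : ∀ u, repPhi N s 0 u = s ^ (2 * u 0) := fun u => if_pos le_rfl
      have h8 : s ^ (2 : ℤ) = s ^ 2 := by norm_cast
      rw [h8] at h2
      rw [neg_zero, h7, h7, Pi.add_apply, h4, add_zero, twoRho_zero, neg_zero,
        zpow_zero, pC, h3, h5, h8]
      field_simp
      ring
    · rw [(vfun_repR (N := N) hs (i := i) (by omega)).1]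
      refine wt_congr (fun t => ?_) rfl
      have h2 := repV_self (N := N) i
      rw [abs_of_pos h] at h2
      have := zpow_ne_zero (2 * t i) h0
      rw [repPhi, if_pos (by omega), repPhi, if_neg (by omega), neg_neg, Pi.add_apply, h2, add_zero,
        zpow_neg s (2 * _)]
      field_simp

end QEuclid

/-! ### Homomorphisms from A_N -/

namespace QEuclid

variable {N : ℕ} {s : ℂ}

namespace QD

variable {A : Type*} [Ring A] [Algebra ℂ A] (𝔇 : QD N s A)

/-- `∑_{|k| ≤ j} q^{-ρ_k} x^k x^{-k} = r_j^2`. -/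
theorem sum_abs_le (hs : Generic s) {j : ℤ} (hj : InR N j) :
    ∑ l : Idx N, (if |(l : ℤ)| ≤ j then s ^ (-twoRho N l) • (𝔇.x l * 𝔇.x (negIdx l)) else 0) =
      𝔇.r j * 𝔇.r j := by
  have h4 := one_sub_ne hs
  have h0 := hj.1
  have hj2 := hj.2.1
  have hsum := fun m h₁ h₂ => sum_idx_lt (fun i : Idx N => ((1 - s ^ 4) * s ^ (-twoRho N i)) •
    (𝔇.x i * 𝔇.x (negIdx i))) 𝔇.V (fun i => by rw [𝔇.V_step]; abel)
    (fun hN => by rw [(𝔇.V_zero_even hN).1, (𝔇.V_zero_even hN).2]) m h₁ h₂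
  have h1 := hsum (j + 1) (by omega) (by omega)
  have h2 := hsum (-j) (by omega) (by omega)
  have h3 : (1 - s ^ 4) • ∑ l : Idx N, (if |(l : ℤ)| ≤ j then
      s ^ (-twoRho N l) • (𝔇.x l * 𝔇.x (negIdx l)) else 0) = 𝔇.V (j + 1) - 𝔇.V (-j) := by
    rw [← sub_sub_sub_cancel_right _ _ (𝔇.V (-((N / 2 : ℕ) : ℤ))), ← h1, ← h2,
      ← Finset.sum_sub_distrib, Finset.smul_sum]
    refine Finset.sum_congr rfl fun l _ => ?_
    have := abs_le (a := (l : ℤ)) (b := j)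
    by_cases h5 : |(l : ℤ)| ≤ j
    · rw [if_pos h5, if_pos (by omega), if_neg (by omega), sub_zero, smul_smul]
    · rw [if_neg h5, smul_zero]
      by_cases h6 : (l : ℤ) < -j
      · rw [if_pos h6, if_pos (by omega), sub_self]
      · rw [if_neg h6, if_neg (by omega), sub_self]
  have h5 : 𝔇.V (j + 1) - 𝔇.V (-j) = (1 - s ^ 4) • (𝔇.r j * 𝔇.r j) := by
    have e1 : 𝔇.V (j + 1) = _ := vfun_add_one hj 𝔇.r
    have e2 : 𝔇.V (-j) = _ := vfun_neg hj 𝔇.r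
    rw [e1, e2, ← sub_smul]
    congr 1
    have h6 := hs.one_add_zpow (kap N j)
    rw [pC]
    field_simp
    ring
  exact smul_right_injective A h4 (h3.trans h5)

/-- The images of the generators. -/
def genMap : QGen N → A
  | .x i => 𝔇.x i
  | .r j => 𝔇.r j
  | .rInv j => 𝔇.ri j
  | .lam => 𝔇.Lam
  | .lamInv => 𝔇.Lami
  | .K => 𝔇.K
  | .KInv => 𝔇.Ki

/-- The converse of `qd`: the explicit relations of a realization imply the defining ones, except
for K = 1 with odd N, which `QD` does not contain. -/
theorem genMap_rel (hN : 3 ≤ N) (hs : Generic s) (hK : Odd N → 𝔇.K = 1)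
    {u v : FreeAlgebra ℂ (QGen N)} (h : QRel N s u v) :
    FreeAlgebra.lift ℂ 𝔇.genMap u = FreeAlgebra.lift ℂ 𝔇.genMap v := by
  induction h with
  | xx i j =>
    simp only [map_sum, map_smul, map_mul, map_zero, fr, FreeAlgebra.lift_ι_apply, genMap]
    exact 𝔇.projA_x_x hN hs i j
  | r_sq j =>
    have hj := inR_iff.2 j.2
    simp only [map_sum, map_mul, fr, FreeAlgebra.lift_ι_apply, genMap]
    rw [← 𝔇.sum_abs_le hs hj]
    refine Finset.sum_congr rfl fun k _ => ?_
    rw [Finset.sum_eq_single (negIdx k)]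
    · simp only [coe_negIdx, abs_neg, and_self]
      split_ifs
      · rw [map_smul, map_mul, gMat_neg, FreeAlgebra.lift_ι_apply, FreeAlgebra.lift_ι_apply]
        rfl
      · rw [map_zero]
    · intro b _ hb
      rw [gMat_apply, if_neg hb, zero_smul, ite_self, map_zero]
    · simp
  | r_zero j i hj hi =>
    simp only [fr, FreeAlgebra.lift_ι_apply, genMap]
    rw [𝔇.x_zero i hi, hj]
  | r_mul_inv j =>
    simp only [map_mul, map_one, fr, FreeAlgebra.lift_ι_apply, genMap]
    exact 𝔇.r_ri _ (inR_iff.2 j.2)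
  | r_inv_mul j =>
    simp only [map_mul, map_one, fr, FreeAlgebra.lift_ι_apply, genMap]
    exact 𝔇.ri_r _ (inR_iff.2 j.2)
  | r_comm i j =>
    simp only [map_mul, fr, FreeAlgebra.lift_ι_apply, genMap]
    exact 𝔇.r_comm _ _ (inR_iff.2 i.2) (inR_iff.2 j.2)
  | x_r i j =>
    simp only [map_mul, map_smul, fr, FreeAlgebra.lift_ι_apply, genMap]
    exact 𝔇.x_r i _ (inR_iff.2 j.2)
  | lam_mul_inv =>
    simp only [map_mul, map_one, fr, FreeAlgebra.lift_ι_apply, genMap]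
    exact 𝔇.Lam_Lami
  | lam_inv_mul =>
    simp only [map_mul, map_one, fr, FreeAlgebra.lift_ι_apply, genMap]
    exact 𝔇.Lami_Lam
  | x_lam i =>
    simp only [map_mul, map_smul, fr, FreeAlgebra.lift_ι_apply, genMap]
    exact 𝔇.x_lam i
  | r_lam j =>
    simp only [map_mul, map_smul, fr, FreeAlgebra.lift_ι_apply, genMap]
    exact 𝔇.r_lam _ (inR_iff.2 j.2)
  | K_mul_inv =>
    simp only [map_mul, map_one, fr, FreeAlgebra.lift_ι_apply, genMap]
    exact 𝔇.K_Ki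
  | K_inv_mul =>
    simp only [map_mul, map_one, fr, FreeAlgebra.lift_ι_apply, genMap]
    exact 𝔇.Ki_K
  | K_odd h =>
    simp only [map_one, fr, FreeAlgebra.lift_ι_apply, genMap]
    exact hK h
  | K_x h i =>
    simp only [map_mul, map_smul, fr, FreeAlgebra.lift_ι_apply, genMap]
    exact 𝔇.K_x (Nat.not_odd_iff_even.2 h) i
  | K_r j =>
    simp only [map_mul, fr, FreeAlgebra.lift_ι_apply, genMap]
    exact 𝔇.K_r _ (inR_iff.2 j.2)
  | K_lam =>
    simp only [map_mul, fr, FreeAlgebra.lift_ι_apply, genMap]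
    exact 𝔇.K_lam

/-- The homomorphism from `A_N` that is determined by the images of the generators. -/
noncomputable def lift (hN : 3 ≤ N) (hs : Generic s) (hK : Odd N → 𝔇.K = 1) : QAlg N s →ₐ[ℂ] A :=
  RingQuot.liftAlgHom ℂ ⟨FreeAlgebra.lift ℂ 𝔇.genMap, fun _ _ h => 𝔇.genMap_rel hN hs hK h⟩

theorem lift_gen (hN : 3 ≤ N) (hs : Generic s) (hK : Odd N → 𝔇.K = 1) (u : QGen N) :
    𝔇.lift hN hs hK (gen N s u) = 𝔇.genMap u := by
  rw [lift, gen, RingQuot.liftAlgHom_mkAlgHom_apply, fr, FreeAlgebra.lift_ι_apply]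

end QD

theorem repQD_K (hs : Generic s) (ho : Odd N) : (repQD (N := N) hs).K = 1 := by
  ext f t
  simp [repQD, wt_apply, ho]

/-- The representation of `A_N` on functions. -/
noncomputable def rep (hN : 3 ≤ N) (hs : Generic s) :
    QAlg N s →ₐ[ℂ] Module.End ℂ ((ℤ → ℤ) → ℂ) := (repQD hs).lift hN hs (repQD_K hs)

theorem nontrivial_QAlg (hN : 3 ≤ N) (hs : Generic s) : Nontrivial (QAlg N s) := by
  have h : Nontrivial (Module.End ℂ ((ℤ → ℤ) → ℂ)) := inferInstance
  exact (rep hN hs).toRingHom.domain_nontrivial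

/-! ## Commutants -/

section Commutant

variable {A : Type*} [Ring A] [Algebra ℂ A]

theorem adjoin_le_of_mul_mem (G : Set A) (S : Submodule ℂ A) (h1 : (1 : A) ∈ S)
    (hG : ∀ g ∈ G, ∀ z ∈ S, g * z ∈ S) {a : A} (ha : a ∈ Algebra.adjoin ℂ G) : a ∈ S := by
  have key : ∀ z ∈ S, a * z ∈ S := by
    induction ha using Algebra.adjoin_induction with
    | mem g hg => exact hG g hg
    | algebraMap r =>
      intro z hz
      rw [← Algebra.smul_def]
      exact S.smul_mem _ hz
    | add x y _ _ hx hy =>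
      intro z hz
      rw [add_mul]
      exact S.add_mem (hx z hz) (hy z hz)
    | mul x y _ _ hx hy =>
      intro z hz
      rw [mul_assoc]
      exact hx _ (hy z hz)
  simpa using key 1 h1

/-- The commutant of a unit `g` in an algebra that is generated by a subalgebra `C` of elements that
commute with `g` and by two elements `u`, `v` of opposite weights. -/
theorem mem_of_commute (hs : Generic s) (G : Set A) {u v g gi : A} {m : ℤ} (hm : m ≠ 0)
    (hu : ∀ c ∈ G, ∃ k, QComm s k u c) (hv : ∀ c ∈ G, ∃ k, QComm s k v c)
    (huv : u * v ∈ Algebra.adjoin ℂ G) (hvu : v * u ∈ Algebra.adjoin ℂ G)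
    (hg : ∀ c ∈ G, g * c = c * g) (hgi' : g * gi = 1)
    (hgu : QComm s m g u) (hgv : QComm s (-m) g v)
    {z : A} (hz : z ∈ Algebra.adjoin ℂ (G ∪ {u, v})) (hgz : g * z = z * g) :
    z ∈ Algebra.adjoin ℂ G := by
  have h0 := hs.ne_zero
  set C := Algebra.adjoin ℂ G with hC
  have hmove : ∀ w : A, (∀ c ∈ G, ∃ k, QComm s k w c) → ∀ c ∈ C, ∃ c' ∈ C, w * c = c' * w := by
    intro w hw c hc
    induction hc using Algebra.adjoin_induction with
    | mem c hc =>
      obtain ⟨k, hk⟩ := hw c hc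
      exact ⟨s ^ k • c, C.smul_mem (Algebra.subset_adjoin hc) _, by rw [hk.eq, smul_mul_assoc]⟩
    | algebraMap r => exact ⟨_, C.algebraMap_mem r, (Algebra.commutes r w).symm⟩
    | add x y _ _ hx hy =>
      obtain ⟨x', hx', ex⟩ := hx
      obtain ⟨y', hy', ey⟩ := hy
      exact ⟨x' + y', C.add_mem hx' hy', by rw [mul_add, add_mul, ex, ey]⟩
    | mul x y _ _ hx hy =>
      obtain ⟨x', hx', ex⟩ := hx
      obtain ⟨y', hy', ey⟩ := hy
      exact ⟨x' * y', C.mul_mem hx' hy', by rw [← mul_assoc, ex, mul_assoc, ey, mul_assoc]⟩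
  have hgC : ∀ c ∈ C, g * c = c * g := by
    intro c hc
    have : c ∈ Subalgebra.centralizer ℂ {g} := by
      refine Algebra.adjoin_le (fun x hx => ?_) hc
      simp only [SetLike.mem_coe, Subalgebra.mem_centralizer_iff, Set.mem_singleton_iff, forall_eq]
      exact hg x hx
    simpa [Subalgebra.mem_centralizer_iff] using this
  -- Under conjugation by g the monomials c u^j and c v^j are eigenvectors, and for j > 0 the
  -- eigenvalue is a nontrivial power of `s`. They span everything, and the independence of
  -- eigenspaces leaves only the part in C for an element that commutes with g.
  let T : Module.End ℂ A := LinearMap.mulRight ℂ gi ∘ₗ LinearMap.mulLeft ℂ g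
  have hT : ∀ a, T a = g * a * gi := fun a => rfl
  have hpow : ∀ {w : A} {k : ℤ}, QComm s k g w → ∀ j : ℕ, QComm s (k * j) g (w ^ j) := by
    intro w k hw j
    induction j with
    | zero => rw [pow_zero, Nat.cast_zero, mul_zero]; exact QComm.of_commute (by rw [mul_one, one_mul])
    | succ j ih =>
      rw [pow_succ]
      exact (ih.mul_right h0 hw).congr (by push_cast; ring)
  have hTw : ∀ {w : A} {k : ℤ}, QComm s k g w → ∀ c ∈ C, ∀ j : ℕ,
      c * w ^ j ∈ T.eigenspace (s ^ (k * j)) := by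
    intro w k hw c hc j
    rw [Module.End.mem_eigenspace_iff, hT, ← mul_assoc, hgC c hc, mul_assoc c, (hpow hw j).eq,
      mul_smul_comm, smul_mul_assoc, mul_assoc, mul_assoc, hgi', mul_one]
  let P : Submodule ℂ A := Subalgebra.toSubmodule C ⊔ ⨆ μ ≠ (1 : ℂ), T.eigenspace μ
  let S : Submodule ℂ A := Submodule.span ℂ
    ({a | ∃ c ∈ C, ∃ j : ℕ, a = c * u ^ j} ∪ {a | ∃ c ∈ C, ∃ j : ℕ, a = c * v ^ j})
  have hSP : S ≤ P := by
    refine Submodule.span_le.2 ?_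
    have aux : ∀ {w : A} {k : ℤ}, k ≠ 0 → QComm s k g w → ∀ c ∈ C, ∀ j : ℕ, c * w ^ j ∈ P := by
      intro w k hk hw c hc j
      rcases Nat.eq_zero_or_pos j with rfl | hj
      · rw [pow_zero, mul_one]
        exact Submodule.mem_sup_left hc
      · refine Submodule.mem_sup_right (Submodule.mem_iSup_of_mem (s ^ (k * j))
          (Submodule.mem_iSup_of_mem ?_ (hTw hw c hc j)))
        exact hs.zpow_ne_one (mul_ne_zero hk (by exact_mod_cast hj.ne'))
    rintro a (⟨c, hc, j, rfl⟩ | ⟨c, hc, j, rfl⟩)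
    · exact aux hm hgu c hc j
    · exact aux (neg_ne_zero.2 hm) hgv c hc j
  have hone : (1 : A) ∈ S := Submodule.subset_span (Or.inl ⟨1, C.one_mem, 0, by simp⟩)
  -- Normal ordering: a new factor u or v moves through c, and u v and v u lie in C, so mixed
  -- monomials do not occur.
  have hzS : z ∈ S := by
    refine adjoin_le_of_mul_mem _ S hone ?_ hz
    intro y hy a ha
    induction ha using Submodule.span_induction with
    | zero => rw [mul_zero]; exact S.zero_mem
    | add a b _ _ ha hb => rw [mul_add]; exact S.add_mem ha hb
    | smul r a _ ha => rw [mul_smul_comm]; exact S.smul_mem _ ha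
    | mem a ha =>
      refine Submodule.subset_span ?_
      rcases hy with hy | rfl | hy
      · have hyC : y ∈ C := Algebra.subset_adjoin hy
        rcases ha with ⟨c, hc, j, rfl⟩ | ⟨c, hc, j, rfl⟩
        · exact Or.inl ⟨y * c, C.mul_mem hyC hc, j, by rw [mul_assoc]⟩
        · exact Or.inr ⟨y * c, C.mul_mem hyC hc, j, by rw [mul_assoc]⟩
      · rcases ha with ⟨c, hc, j, rfl⟩ | ⟨c, hc, j, rfl⟩ <;> obtain ⟨c', hc', e⟩ := hmove y hu c hc
        · exact Or.inl ⟨c', hc', j + 1, by rw [← mul_assoc, e, mul_assoc, ← pow_succ']⟩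
        · rcases j with _ | j
          · exact Or.inl ⟨c', hc', 1, by rw [pow_zero, mul_one, e, pow_one]⟩
          · exact Or.inr ⟨c' * (y * v), C.mul_mem hc' huv, j, by
              rw [← mul_assoc, e, pow_succ']; simp only [mul_assoc]⟩
      · obtain rfl : y = v := hy
        rcases ha with ⟨c, hc, j, rfl⟩ | ⟨c, hc, j, rfl⟩ <;> obtain ⟨c', hc', e⟩ := hmove y hv c hc
        · rcases j with _ | j
          · exact Or.inr ⟨c', hc', 1, by rw [pow_zero, mul_one, e, pow_one]⟩
          · exact Or.inl ⟨c' * (y * u), C.mul_mem hc' hvu, j, by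
              rw [← mul_assoc, e, pow_succ']; simp only [mul_assoc]⟩
        · exact Or.inr ⟨c', hc', j + 1, by rw [← mul_assoc, e, mul_assoc, ← pow_succ']⟩
  obtain ⟨c, hc, e, he, rfl⟩ := Submodule.mem_sup.1 (hSP hzS)
  have hT1 : ∀ a, g * a = a * g → a ∈ T.eigenspace 1 := fun a ha => by
    rw [Module.End.mem_eigenspace_iff, hT, ha, mul_assoc, hgi', mul_one, one_smul]
  have he1 : e ∈ T.eigenspace 1 := by
    have := (T.eigenspace 1).sub_mem (hT1 _ hgz) (hT1 c (hgC c hc))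
    rwa [add_sub_cancel_left] at this
  have hd := (Module.End.eigenspaces_iSupIndep T) 1
  have he0 : e = 0 := Submodule.disjoint_def.1 hd e he1 he
  rw [he0, add_zero]
  exact hc

end Commutant

end QEuclid

/-! ### Central elements lie in the algebra of the radii and K -/

namespace QEuclid

variable {N : ℕ} {s : ℂ}

namespace QD

variable {A : Type*} [Ring A] [Algebra ℂ A] (𝔇 : QD N s A)

/-- The generators `r_j`, `K` and their inverses. -/
def torus : Set A :=
  {a | (∃ j, InR N j ∧ (a = 𝔇.r j ∨ a = 𝔇.ri j)) ∨ a = 𝔇.K ∨ a = 𝔇.Ki}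

/-- The generators up to the coordinates `x^{±i}`. -/
def upTo (i : ℤ) : Set A :=
  {a | a ∈ 𝔇.torus ∪ {𝔇.Lam, 𝔇.Lami} ∨ ∃ k : Idx N, (k : ℤ) ≠ 0 ∧ |(k : ℤ)| ≤ i ∧ a = 𝔇.x k}

theorem qComm_torus (hs : s ≠ 0) {y : A} (hr : ∀ j, InR N j → ∃ m, QComm s m y (𝔇.r j))
    (hK : ∃ m, QComm s m y 𝔇.K) : ∀ c ∈ 𝔇.torus, ∃ m, QComm s m y c := by
  rintro c (⟨j, hj, rfl | rfl⟩ | rfl | rfl)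
  · exact hr j hj
  · obtain ⟨m, hm⟩ := hr j hj
    exact ⟨_, hm.inv_right hs (𝔇.r_ri j hj) (𝔇.ri_r j hj)⟩
  · exact hK
  · obtain ⟨m, hm⟩ := hK
    exact ⟨_, hm.inv_right hs 𝔇.K_Ki 𝔇.Ki_K⟩

theorem commute_torus (hs : s ≠ 0) {y : A} (hr : ∀ j, InR N j → y * 𝔇.r j = 𝔇.r j * y)
    (hK : y * 𝔇.K = 𝔇.K * y) : ∀ c ∈ 𝔇.torus, y * c = c * y := by
  rintro c (⟨j, hj, rfl | rfl⟩ | rfl | rfl)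
  · exact hr j hj
  · exact ((QComm.of_commute (s := s) (hr j hj)).inv_right hs (𝔇.r_ri j hj)
      (𝔇.ri_r j hj)).commute neg_zero
  · exact hK
  · exact ((QComm.of_commute (s := s) hK).inv_right hs 𝔇.K_Ki 𝔇.Ki_K).commute neg_zero

theorem x_K (hs : s ≠ 0) (hK : Odd N → 𝔇.K = 1) (i : Idx N) : ∃ m, QComm s m (𝔇.x i) 𝔇.K := by
  by_cases ho : Odd N
  · exact ⟨0, QComm.of_commute (by rw [hK ho, mul_one, one_mul])⟩
  · exact ⟨_, (𝔇.K_x ho i).symm hs⟩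

theorem r_mem_torus {j : ℤ} (hj : InR N j) : 𝔇.r j ∈ 𝔇.torus := Or.inl ⟨j, hj, Or.inl rfl⟩

theorem torus_subset (i : ℤ) : 𝔇.torus ⊆ 𝔇.upTo i := fun _ ha => Or.inl (Or.inl ha)

theorem V_mem {j : ℤ} (h₁ : -top N ≤ j) (h₂ : j ≤ top N + 1) :
    𝔇.V j ∈ Algebra.adjoin ℂ 𝔇.torus := by
  have key : ∀ m, 0 ≤ m → m ≤ top N → rsq N 𝔇.r m ∈ Algebra.adjoin ℂ 𝔇.torus := by
    intro m h0 h1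
    unfold rsq
    split_ifs with h
    · exact Subalgebra.zero_mem _
    · have := Algebra.subset_adjoin (R := ℂ) (𝔇.r_mem_torus (j := m) ⟨h0, h1, by tauto⟩)
      exact Subalgebra.mul_mem _ this this
  rcases le_or_gt 1 j with h | h
  · rw [𝔇.V_of_pos h]
    exact Subalgebra.smul_mem _ (key _ (by omega) (by omega)) _
  · rw [𝔇.V_of_nonpos (by omega)]
    exact Subalgebra.neg_mem _ (Subalgebra.smul_mem _ (key _ (by omega) (by omega)) _)

/-- The coordinates x^{±i} are removed for i = n, …, 1, then Λ^{±1}. Each time `mem_of_commute` is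
applied with an element g that commutes with the generators to be kept and gives opposite weights to
the two that are removed. -/
theorem mem_adjoin_torus (hs : Generic s) (hN : 3 ≤ N) (hK : Odd N → 𝔇.K = 1) {z : A}
    (hgen : Algebra.adjoin ℂ (𝔇.upTo (top N)) = ⊤) (hz : ∀ y, y * z = z * y) :
    z ∈ Algebra.adjoin ℂ 𝔇.torus := by
  have h0 := hs.ne_zero
  have htd : top N = ((N / 2 : ℕ) : ℤ) := rfl
  have hLr : ∀ j, InR N j → QComm s (-2) 𝔇.Lam (𝔇.r j) := fun j hj => (𝔇.r_lam j hj).symm h0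
  have hLir : ∀ j, InR N j → QComm s 2 𝔇.Lami (𝔇.r j) := fun j hj =>
    (hLr j hj).inv_left h0 𝔇.Lam_Lami 𝔇.Lami_Lam
  have hLiK : 𝔇.Lami * 𝔇.K = 𝔇.K * 𝔇.Lami :=
    ((QComm.of_commute (s := s) 𝔇.K_lam.symm).inv_left h0 𝔇.Lam_Lami 𝔇.Lami_Lam).commute neg_zero
  have hdesc : ∀ d : ℕ, (d : ℤ) ≤ top N → z ∈ Algebra.adjoin ℂ (𝔇.upTo (top N - d)) := by
    intro d
    induction d with
    | zero =>
      intro _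
      rw [Nat.cast_zero, sub_zero, hgen]
      exact Algebra.mem_top
    | succ d ih =>
      intro hd
      rw [Nat.cast_add_one] at hd
      specialize ih (by omega)
      obtain ⟨i, hi⟩ : ∃ i : Idx N, (i : ℤ) = top N - d :=
        ⟨mkIdx (top N - d) (by omega) (by omega) (Or.inl (by omega)), rfl⟩
      rw [← hi] at ih
      rw [show top N - ((d + 1 : ℕ) : ℤ) = (i : ℤ) - 1 by rw [hi, Nat.cast_add_one]; ring]
      have hi1 : 1 ≤ (i : ℤ) := by omega
      have hit := (idx_mem i).2.1
      have hx : ∀ h : Idx N, |(h : ℤ)| = i → ∀ c ∈ 𝔇.upTo (i - 1), ∃ k, QComm s k (𝔇.x h) c := by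
        rintro h hh c ((hc | rfl | hc) | ⟨k, hk0, hk, rfl⟩)
        · exact 𝔇.qComm_torus h0 (fun j hj => ⟨_, 𝔇.x_r h j hj⟩) (𝔇.x_K h0 hK h) c hc
        · exact ⟨_, 𝔇.x_lam h⟩
        · rw [Set.mem_singleton_iff.1 hc]
          exact ⟨_, (𝔇.x_lam h).inv_right h0 𝔇.Lam_Lami 𝔇.Lami_Lam⟩
        · refine ⟨_, 𝔇.x_xExp h0 h k ?_⟩
          intro e
          rw [e, abs_neg] at hh
          omega
      have hni : |((negIdx i : Idx N) : ℤ)| = i := by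
        rw [coe_negIdx, abs_neg, abs_of_pos (by omega)]
      have hii : |(i : ℤ)| = i := abs_of_pos (by omega)
      have hprod : ∀ h : Idx N, 𝔇.x h * 𝔇.x (negIdx h) ∈ Algebra.adjoin ℂ (𝔇.upTo (i - 1)) := by
        intro h
        have := idx_mem h
        refine Algebra.adjoin_mono (𝔇.torus_subset _) ?_
        rw [𝔇.mul_eq hs]
        exact Subalgebra.smul_mem _ (Subalgebra.sub_mem _ (𝔇.V_mem (by omega) (by omega))
          (𝔇.V_mem (by omega) (by omega))) _
      have hprod' := hprod (negIdx i)
      rw [negIdx_negIdx] at hprod'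
      have hsub : 𝔇.upTo i ⊆ 𝔇.upTo (i - 1) ∪ {𝔇.x i, 𝔇.x (negIdx i)} := by
        rintro c (hc | ⟨k, hk0, hk, rfl⟩)
        · exact Or.inl (Or.inl hc)
        · rcases lt_or_eq_of_le hk with h | h
          · exact Or.inl (Or.inr ⟨k, hk0, by omega, rfl⟩)
          · right
            rcases eq_or_eq_neg_of_abs_eq h with h | h
            · exact Or.inl (by rw [idx_ext_iff.2 h])
            · exact Or.inr (by rw [Set.mem_singleton_iff, (idx_ext_iff.2 (h.trans (coe_negIdx i).symm) : k = negIdx i)])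
      -- Here r_{i-1} commutes with x^k for |k| < i but not with x^{±i}, and the factor r_n⁻¹
      -- restores commutation with Λ. For even N and i = 1 there is no r_0, and K takes over.
      obtain ⟨g, gi, hggi, hgc, hgu, hgv⟩ : ∃ g gi : A, g * gi = 1 ∧
          (∀ c ∈ 𝔇.upTo (i - 1), g * c = c * g) ∧ QComm s 2 g (𝔇.x i) ∧
            QComm s (-2) g (𝔇.x (negIdx i)) := by
        by_cases hc : (i : ℤ) = 1 ∧ ¬ Odd N
        · refine ⟨𝔇.K, 𝔇.Ki, 𝔇.K_Ki, ?_, (𝔇.K_x hc.2 i).congr (by rw [hc.1]; rfl),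
            (𝔇.K_x hc.2 (negIdx i)).congr (by rw [coe_negIdx, hc.1]; rfl)⟩
          rintro c ((h | rfl | h) | ⟨k, hk0, hk, rfl⟩)
          · exact 𝔇.commute_torus h0 𝔇.K_r rfl c h
          · exact 𝔇.K_lam
          · rw [Set.mem_singleton_iff.1 h, hLiK]
          · rw [hc.1, sub_self, abs_nonpos_iff] at hk
            exact absurd hk hk0
        · have hR : InR N (i - 1) := ⟨by omega, by omega, by
            by_contra h; exact hc ⟨by omega, by tauto⟩⟩
          have hT := inR_top hN
          have hrx : ∀ h : Idx N, QComm s (-(2 * rExp h (i - 1))) (𝔇.r (i - 1) * 𝔇.ri (top N))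
              (𝔇.x h) := by
            intro h
            have h1 := (𝔇.x_r h _ hR).symm h0
            have h2 := ((𝔇.x_r_top hN h).symm h0).inv_left h0 (𝔇.r_ri _ hT) (𝔇.ri_r _ hT)
            exact (h1.mul_left h0 h2).congr (by ring)
          refine ⟨𝔇.r (i - 1) * 𝔇.ri (top N), 𝔇.r (top N) * 𝔇.ri (i - 1), ?_, ?_,
            (hrx i).congr ?_, (hrx (negIdx i)).congr ?_⟩
          · rw [mul_assoc, ← mul_assoc (𝔇.ri _), 𝔇.ri_r _ hT, one_mul, 𝔇.r_ri _ hR]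
          · rintro c ((h | rfl | h) | ⟨k, hk0, hk, rfl⟩)
            · refine 𝔇.commute_torus h0 (fun j hj => ?_) ?_ c h
              · rw [mul_assoc, (𝔇.ri_comm h0 hT hj).2, ← mul_assoc, 𝔇.r_comm _ _ hR hj, mul_assoc]
              · have h2 := ((QComm.of_commute (s := s) (𝔇.K_r _ hT)).inv_right h0 (𝔇.r_ri _ hT)
                  (𝔇.ri_r _ hT)).commute neg_zero
                rw [mul_assoc, ← h2, ← mul_assoc, ← 𝔇.K_r _ hR, mul_assoc]
            · exact ((𝔇.r_lam _ hR).mul_left h0 (𝔇.ri_lam h0 hT)).commute (by norm_num)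
            · rw [Set.mem_singleton_iff.1 h]
              exact (((𝔇.r_lam _ hR).mul_left h0 (𝔇.ri_lam h0 hT)).inv_right h0 𝔇.Lam_Lami
                𝔇.Lami_Lam).commute (by norm_num)
            · exact (hrx k).commute (by rw [rExp, if_pos hk]; rfl)
          · rw [rExp, if_neg (by omega), if_neg (by omega)]; rfl
          · rw [rExp, if_neg (by omega), coe_negIdx, if_pos (by omega)]; rfl
      exact mem_of_commute hs _ two_ne_zero (hx i hii) (hx _ hni) (hprod i) hprod' hgc hggi hgu hgv
        (Algebra.adjoin_mono hsub ih) (hz g)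
  have h1 := hdesc (N / 2) le_rfl
  rw [← htd, sub_self] at h1
  have h2 : 𝔇.upTo 0 ⊆ 𝔇.torus ∪ {𝔇.Lam, 𝔇.Lami} := by
    rintro c (hc | ⟨k, hk0, hk, rfl⟩)
    · exact hc
    · exact absurd (abs_nonpos_iff.1 hk) hk0
  have hT := inR_top hN
  -- Finally r_n separates Λ and Λ⁻¹ from the radii and K, with which it commutes.
  refine mem_of_commute hs _ two_ne_zero
    (𝔇.qComm_torus h0 (fun j hj => ⟨_, hLr j hj⟩) ⟨0, QComm.of_commute 𝔇.K_lam.symm⟩)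
    (𝔇.qComm_torus h0 (fun j hj => ⟨_, hLir j hj⟩) ⟨0, QComm.of_commute hLiK⟩)
    (by rw [𝔇.Lam_Lami]; exact Subalgebra.one_mem _) (by rw [𝔇.Lami_Lam]; exact Subalgebra.one_mem _)
    (g := 𝔇.r (top N)) (gi := 𝔇.ri (top N)) ?_ (𝔇.r_ri _ hT) (𝔇.r_lam _ hT)
    ((𝔇.r_lam _ hT).inv_right h0 𝔇.Lam_Lami 𝔇.Lami_Lam) (Algebra.adjoin_mono h2 h1) (hz _)
  exact 𝔇.commute_torus h0 (fun j hj => 𝔇.r_comm _ _ hT hj) (𝔇.K_r _ hT).symm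

end QD

end QEuclid

namespace QEuclid

variable {N : ℕ} {s : ℂ}

/-! ## The center of `A_N` -/

theorem adjoin_gen : Algebra.adjoin ℂ (Set.range (gen N s)) = ⊤ := by
  have h : Set.range (gen N s) =
      RingQuot.mkAlgHom ℂ (QRel N s) '' Set.range (FreeAlgebra.ι ℂ : QGen N → _) := by
    rw [← Set.range_comp]
    rfl
  rw [h, ← AlgHom.map_adjoin, FreeAlgebra.adjoin_range_ι, Algebra.map_top, AlgHom.range_eq_top]
  exact RingQuot.mkAlgHom_surjective ℂ _

theorem adjoin_upTo (hN : 3 ≤ N) (hs : Generic s) :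
    Algebra.adjoin ℂ ((qd hN hs).upTo (top N)) = ⊤ := by
  refine top_le_iff.1 (adjoin_gen.symm.le.trans (Algebra.adjoin_mono ?_))
  rintro _ ⟨u, rfl⟩
  cases u with
  | x i =>
    by_cases hi : (i : ℤ) = 0
    · have ho := QD.odd_of_zero hi
      have h0 : InR N 0 := ⟨le_rfl, by omega, Or.inr ho⟩
      exact Or.inl (Or.inl (Or.inl ⟨0, h0, Or.inl ((qd hN hs).x_zero i hi)⟩))
    · exact Or.inr ⟨i, hi, abs_le.2 ⟨(idx_mem i).1, (idx_mem i).2.1⟩, rfl⟩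
  | r j => exact Or.inl (Or.inl (Or.inl ⟨j, inR_iff.2 j.2, Or.inl (rGen_eq (inR_iff.2 j.2)).symm⟩))
  | rInv j =>
    exact Or.inl (Or.inl (Or.inl ⟨j, inR_iff.2 j.2, Or.inr (rInvGen_eq (inR_iff.2 j.2)).symm⟩))
  | lam => exact Or.inl (Or.inr (Or.inl rfl))
  | lamInv => exact Or.inl (Or.inr (Or.inr rfl))
  | K => exact Or.inl (Or.inl (Or.inr (Or.inl rfl)))
  | KInv => exact Or.inl (Or.inl (Or.inr (Or.inr rfl)))

namespace QD

variable {A : Type*} [Ring A] [Algebra ℂ A] (𝔇 : QD N s A)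

open Classical in
/-- The units `r_j`, with `K` in place of `r_0` for even `N`. -/
noncomputable def unit (j : Fin (N / 2 + 1)) : Aˣ :=
  if h : InR N j then ⟨𝔇.r j, 𝔇.ri j, 𝔇.r_ri j h, 𝔇.ri_r j h⟩ else ⟨𝔇.K, 𝔇.Ki, 𝔇.K_Ki, 𝔇.Ki_K⟩

theorem commute_unit (i j : Fin (N / 2 + 1)) : Commute (𝔇.unit i) (𝔇.unit j) := by
  refine Units.ext ?_
  rw [Units.val_mul, Units.val_mul]
  unfold unit
  split_ifs with h1 h2 h2
  · exact 𝔇.r_comm _ _ h1 h2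
  · exact (𝔇.K_r _ h1).symm
  · exact 𝔇.K_r _ h2
  · rfl

/-- The exponents of the monomials in the `r_j` and `K`. -/
abbrev Expo (N : ℕ) : Type := Fin (N / 2 + 1) → Multiplicative ℤ

theorem pairwise_commute : Pairwise fun i j => ∀ x y,
    Commute (zpowersHom Aˣ (𝔇.unit i) x) (zpowersHom Aˣ (𝔇.unit j) y) := fun i j _ _ _ =>
  ((𝔇.commute_unit i j).zpow_left _).zpow_right _

/-- The monomials in the `r_j` and `K`. -/
noncomputable def monomial : Expo N →* A :=
  (Units.coeHom A).comp (MonoidHom.noncommPiCoprod (fun j => zpowersHom Aˣ (𝔇.unit j))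
    𝔇.pairwise_commute)

theorem monomial_mulSingle (j : Fin (N / 2 + 1)) (m : Multiplicative ℤ) :
    𝔇.monomial (Pi.mulSingle j m) = ((𝔇.unit j ^ m.toAdd : Aˣ) : A) := by
  rw [monomial, MonoidHom.comp_apply, MonoidHom.noncommPiCoprod_mulSingle]
  rfl

theorem mem_range_monomial (hK : Odd N → 𝔇.K = 1) {a : A} (ha : a ∈ 𝔇.torus) :
    a ∈ Set.range 𝔇.monomial := by
  have key : ∀ j, ((𝔇.unit j : Aˣ) : A) ∈ Set.range 𝔇.monomial ∧
      (((𝔇.unit j)⁻¹ : Aˣ) : A) ∈ Set.range 𝔇.monomial := fun j =>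
    ⟨⟨Pi.mulSingle j (Multiplicative.ofAdd 1), by rw [monomial_mulSingle]; simp⟩,
      ⟨Pi.mulSingle j (Multiplicative.ofAdd (-1)), by rw [monomial_mulSingle]; simp⟩⟩
  have keyR : ∀ j, InR N j → 𝔇.r j ∈ Set.range 𝔇.monomial ∧ 𝔇.ri j ∈ Set.range 𝔇.monomial := by
    intro j hj
    have h1 := hj.1
    have h2 := hj.2.1
    have hj' : ((⟨j.toNat, by omega⟩ : Fin (N / 2 + 1)) : ℤ) = j := Int.toNat_of_nonneg h1
    have h3 := key ⟨j.toNat, by omega⟩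
    have h4 : InR N ((⟨j.toNat, by omega⟩ : Fin (N / 2 + 1)) : ℤ) := by rw [hj']; exact hj
    rw [unit, dif_pos h4] at h3
    rw [hj'.symm]
    exact h3
  have keyK : 𝔇.K ∈ Set.range 𝔇.monomial ∧ 𝔇.Ki ∈ Set.range 𝔇.monomial := by
    by_cases ho : Odd N
    · have h1 : 𝔇.Ki = 1 := by rw [← 𝔇.K_Ki, hK ho, one_mul]
      rw [hK ho, h1]
      exact ⟨⟨1, map_one _⟩, ⟨1, map_one _⟩⟩
    · have h3 := key 0
      have h4 : ¬ InR N (((0 : Fin (N / 2 + 1)) : ℕ) : ℤ) := fun h => by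
        rcases h.2.2 with h | h
        · exact h rfl
        · exact ho h
      rw [unit, dif_neg h4] at h3
      exact h3
  rcases ha with ⟨j, hj, rfl | rfl⟩ | rfl | rfl
  exacts [(keyR j hj).1, (keyR j hj).2, keyK.1, keyK.2]

theorem mem_span_monomial (hK : Odd N → 𝔇.K = 1) {z : A} (hz : z ∈ Algebra.adjoin ℂ 𝔇.torus) :
    ∃ c : Expo N →₀ ℂ, z = c.sum fun a r => r • 𝔇.monomial a := by
  have : z ∈ Submodule.span ℂ (Set.range 𝔇.monomial) := by
    refine adjoin_le_of_mul_mem _ _ (Submodule.subset_span (Set.mem_range.2 ⟨1, map_one _⟩)) ?_ hz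
    intro g hg y hy
    obtain ⟨a, rfl⟩ := 𝔇.mem_range_monomial hK hg
    induction hy using Submodule.span_induction with
    | zero => rw [mul_zero]; exact Submodule.zero_mem _
    | add a b _ _ ha hb => rw [mul_add]; exact Submodule.add_mem _ ha hb
    | smul r a _ ha => rw [mul_smul_comm]; exact Submodule.smul_mem _ _ ha
    | mem b hb =>
      obtain ⟨b, rfl⟩ := hb
      exact Submodule.subset_span ⟨a * b, map_mul _ _ _⟩
  obtain ⟨c, hc⟩ := Finsupp.mem_span_range_iff_exists_finsupp.1 this
  exact ⟨c, hc.symm⟩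

end QD

open QD

/-- The pairing of an exponent and a point. -/
def pairing (a : Expo N) (t : ℤ → ℤ) : ℤ := ∑ j, (a j).toAdd * t (j : ℕ)

theorem pairing_mul (a b : Expo N) (t : ℤ → ℤ) :
    pairing (a * b) t = pairing a t + pairing b t := by
  simp only [pairing, Pi.mul_apply, toAdd_mul, add_mul, Finset.sum_add_distrib]

theorem pairing_add (a : Expo N) (t v : ℤ → ℤ) :
    pairing a (t + v) = pairing a t + pairing a v := by
  simp only [pairing, Pi.add_apply, mul_add, Finset.sum_add_distrib]

/-- The characters of the lattice of points. -/
noncomputable def chi (hs : s ≠ 0) (a : Expo N) : Multiplicative (ℤ → ℤ) →* ℂ where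
  toFun t := s ^ (2 * pairing a t.toAdd)
  map_one' := by simp [pairing]
  map_mul' t v := by rw [toAdd_mul, pairing_add, mul_add, zpow_add₀ hs]

/-- As `s` is not a root of unity, different exponents give different characters, and distinct
characters are linearly independent. A central element is already a combination of monomials, so the
representation need not be known to be faithful. -/
theorem chi_injective (hs : Generic s) : Function.Injective (chi (N := N) hs.ne_zero) := by
  intro a b h
  ext j
  have h1 : s ^ (2 * pairing a (Pi.single ((j : ℕ) : ℤ) 1)) =
      s ^ (2 * pairing b (Pi.single ((j : ℕ) : ℤ) 1)) :=
    DFunLike.congr_fun h (Multiplicative.ofAdd (Pi.single ((j : ℕ) : ℤ) 1))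
  have h2 : ∀ a : Expo N, pairing a (Pi.single ((j : ℕ) : ℤ) 1) = (a j).toAdd := by
    intro a
    rw [pairing, Finset.sum_eq_single j]
    · simp
    · intro b _ hb
      rw [Pi.single_eq_of_ne, mul_zero]
      exact fun h => hb (Fin.ext (by exact_mod_cast h))
    · simp
  rw [h2, h2] at h1
  by_contra h3
  exact hs.zpow_ne (fun h4 => h3 (by omega)) h1

/-- The representation of the monomials. -/
noncomputable def repMonomial (hs : s ≠ 0) : Expo N →* Module.End ℂ ((ℤ → ℤ) → ℂ) where
  toFun a := wt (fun t => s ^ (2 * pairing a t)) 0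
  map_one' := by
    ext f t
    simp [wt_apply, pairing]
  map_mul' a b := by
    rw [wt_mul]
    refine wt_congr (fun t => ?_) (add_zero _).symm
    rw [pairing_mul, add_zero, mul_add, zpow_add₀ hs]

theorem rep_unit (hN : 3 ≤ N) (hs : Generic s) (j : Fin (N / 2 + 1)) :
    rep hN hs ((qd hN hs).unit j) = wt (fun t => s ^ (2 * t (j : ℕ))) 0 ∧
      rep hN hs (((qd hN hs).unit j)⁻¹ : (QAlg N s)ˣ) = wt (fun t => s ^ (-(2 * t (j : ℕ)))) 0 := by
  by_cases h : InR N j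
  · rw [unit, dif_pos h]
    exact ⟨(congrArg _ (rGen_eq h)).trans ((repQD hs).lift_gen hN hs _ (QGen.r ⟨j, inR_iff.1 h⟩)),
      (congrArg _ (rInvGen_eq h)).trans ((repQD hs).lift_gen hN hs _ (QGen.rInv ⟨j, inR_iff.1 h⟩))⟩
  · rw [unit, dif_neg h]
    have h1 : (((j : ℕ) : ℤ) = 0) ∧ ¬ Odd N := by
      by_contra h2
      exact h ⟨by omega, by omega, by tauto⟩
    refine ⟨((repQD hs).lift_gen hN hs _ QGen.K).trans (wt_congr (fun t => ?_) rfl),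
      ((repQD hs).lift_gen hN hs _ QGen.KInv).trans (wt_congr (fun t => ?_) rfl)⟩ <;>
    rw [if_neg h1.2, h1.1]

theorem rep_monomial (hN : 3 ≤ N) (hs : Generic s) (a : Expo N) :
    rep hN hs ((qd hN hs).monomial a) = wt (fun t => s ^ (2 * pairing a t)) 0 := by
  have h : ((rep hN hs : QAlg N s →ₐ[ℂ] _) : QAlg N s →* _).comp (qd hN hs).monomial =
      repMonomial hs.ne_zero := by
    refine MonoidHom.pi_ext fun j m => ?_
    have h2 : ∀ t : ℤ → ℤ, pairing (Pi.mulSingle j m : Expo N) t = m.toAdd * t (j : ℕ) := by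
      intro t
      rw [pairing, Finset.sum_eq_single j]
      · simp
      · intro b _ hb
        rw [Pi.mulSingle_eq_of_ne hb, toAdd_one, zero_mul]
      · simp
    change rep hN hs ((qd hN hs).monomial (Pi.mulSingle j m)) = wt (fun t => s ^ (2 * pairing _ t)) 0
    rw [monomial_mulSingle]
    simp only [h2]
    have hp : ∀ (e : ℤ) (k : ℕ), (wt (fun t => s ^ (e * t (j : ℕ))) 0) ^ k =
        wt (fun t => s ^ (e * k * t (j : ℕ))) 0 := by
      intro e k
      induction k with
      | zero => ext f t; simp [wt_apply]
      | succ k ih =>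
        rw [pow_succ, ih, wt_mul]
        refine wt_congr (fun t => ?_) (add_zero _)
        rw [add_zero, ← zpow_add₀ hs.ne_zero]
        congr 1
        push_cast
        ring
    have hu := rep_unit hN hs j
    obtain ⟨k, hk | hk⟩ := Int.eq_nat_or_neg m.toAdd
    · rw [hk, zpow_natCast, Units.val_pow_eq_pow_val, map_pow, hu.1, hp]
      simp only [mul_assoc]
    · rw [hk, zpow_neg, zpow_natCast, ← inv_pow, Units.val_pow_eq_pow_val, map_pow, hu.2]
      simp only [← neg_mul]
      rw [hp]
      refine wt_congr (fun t => ?_) rfl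
      congr 1
      ring
  exact DFunLike.congr_fun h a

/-- In the representation a central element is multiplication by a combination of characters.
Commuting with a translation by v of nowhere vanishing weight makes this function invariant under v,
so by independence only exponents orthogonal to v occur. The translations of x^1, …, x^n and Λ form
a triangular system, which leaves the trivial exponent. -/
theorem exists_algebraMap_of_commute (hN : 3 ≤ N) (hs : Generic s) {z : QAlg N s}
    (hz : ∀ y, y * z = z * y) : ∃ c : ℂ, z = algebraMap ℂ _ c := by
  have h0 := hs.ne_zero
  have hK : Odd N → (qd hN hs).K = 1 := fun ho => by
    have h := gen_rel (QRel.K_odd (s := s) ho)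
    rwa [map_one] at h
  obtain ⟨c, hc⟩ := (qd hN hs).mem_span_monomial hK
    ((qd hN hs).mem_adjoin_torus hs hN hK (adjoin_upTo hN hs) hz)
  have hrep : ∀ f t, rep hN hs z f t = (c.sum fun a r => r * s ^ (2 * pairing a t)) * f t := by
    intro f t
    rw [hc, Finsupp.sum, map_sum, LinearMap.sum_apply, Finset.sum_apply, Finsupp.sum,
      Finset.sum_mul]
    refine Finset.sum_congr rfl fun a _ => ?_
    rw [map_smul, rep_monomial, LinearMap.smul_apply, Pi.smul_apply, wt_apply, add_zero, smul_eq_mul,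
      mul_assoc]
  have key : ∀ (y : QAlg N s) (φ : (ℤ → ℤ) → ℂ) (v : ℤ → ℤ), rep hN hs y = wt φ v →
      (∀ t, φ t ≠ 0) → ∀ a, c a ≠ 0 → pairing a v = 0 := by
    intro y φ v hy hφ a ha
    have h1 : ∀ t, (c.sum fun a r => (r * (s ^ (2 * pairing a v) - 1)) * s ^ (2 * pairing a t)) = 0 := by
      intro t
      have h2 := congrFun (LinearMap.congr_fun (congrArg (rep hN hs) (hz y)) 1) t
      rw [map_mul, map_mul, hy, Module.End.mul_apply, Module.End.mul_apply, wt_apply, hrep, hrep,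
        wt_apply] at h2
      change φ t * (_ * (1 : ℂ)) = _ * (φ t * (1 : ℂ)) at h2
      rw [mul_one, mul_one, mul_comm] at h2
      have h3 := mul_right_cancel₀ (hφ t) h2
      rw [← sub_eq_zero, Finsupp.sum, Finsupp.sum, ← Finset.sum_sub_distrib] at h3
      rw [← h3, Finsupp.sum]
      refine Finset.sum_congr rfl fun b _ => ?_
      rw [pairing_add, mul_add, zpow_add₀ h0]
      ring
    have hli := (linearIndependent_monoidHom (Multiplicative (ℤ → ℤ)) ℂ).comp _
      (chi_injective (N := N) hs)
    have h4 := linearIndependent_iff'.1 hli c.support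
      (fun a => c a * (s ^ (2 * pairing a v) - 1)) (by
        ext t
        rw [Finset.sum_apply, Pi.zero_apply, ← h1 t.toAdd]
        rfl) a (Finsupp.mem_support_iff.2 ha)
    rcases mul_eq_zero.1 h4 with h | h
    · exact absurd h ha
    · by_contra h5
      exact hs.zpow_ne_one (m := 2 * pairing a v) (by omega) (sub_eq_zero.1 h)
  have hone : ∀ a, c a ≠ 0 → a = 1 := by
    intro a ha
    have hj : ∀ j : ℕ, ∀ hj : j < N / 2 + 1, (a ⟨j, hj⟩).toAdd = 0 := by
      intro j
      induction j using Nat.strong_induction_on with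
      | _ j ih =>
        intro hj
        -- x^{j+1} translates by -1 at place j and by 0 at later places; at the last place j = n
        -- this role falls to Λ. Earlier places are settled by induction.
        obtain ⟨v, hv, hvj, hv0⟩ : ∃ v, pairing a v = 0 ∧ v j = -1 ∧
            ∀ i : ℕ, j < i → i ≤ N / 2 → v i = 0 := by
          by_cases hn : j < N / 2
          · have hm : (((j : ℤ) + 1 : ℤ) ≠ 0 ∨ Odd N) := Or.inl (by omega)
            refine ⟨repV N (j + 1), key _ _ _ ((repQD hs).lift_gen hN hs _
              (QGen.x (mkIdx ((j : ℤ) + 1) (by omega) (by omega) hm))) ?_ a ha, ?_, ?_⟩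
            · intro t
              change repPhi N s ((j : ℤ) + 1) t ≠ 0
              rw [repPhi, if_pos (by omega)]
              exact zpow_ne_zero _ h0
            · rw [repV, abs_of_nonneg (by omega), if_pos, Int.sign_eq_one_of_pos (by omega)]
              exact ⟨by omega, by by_cases h : j = 0 <;> [right; right] <;> omega⟩
            · intro i hi _
              rw [repV, abs_of_nonneg (by omega), if_neg]
              omega
          · refine ⟨repW N, key _ _ _ ((repQD hs).lift_gen hN hs _ QGen.lam) ?_ a ha, ?_, ?_⟩
            · intro t
              exact one_ne_zero
            · rw [repW, if_pos]
              right
              omega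
            · intro i hi hi'
              omega
        rw [pairing, Finset.sum_eq_single ⟨j, hj⟩, hvj] at hv
        · omega
        · intro b _ hb
          have hb' : (b : ℕ) ≠ j := fun h => hb (Fin.ext h)
          rcases lt_or_gt_of_ne hb' with h | h
          · rw [ih b h b.2, zero_mul]
          · rw [hv0 b h (by omega), mul_zero]
        · simp
    ext j
    exact hj j j.2
  refine ⟨c 1, ?_⟩
  rw [hc, Finsupp.sum, Finset.sum_eq_single 1, map_one (qd hN hs).monomial, Algebra.algebraMap_eq_smul_one]
  · intro b hb h
    exact absurd (hone b (Finsupp.mem_support_iff.1 hb)) h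
  · intro h
    rw [Finsupp.notMem_support_iff.1 h, zero_smul]

end QEuclid

namespace QEuclid

variable {N : ℕ} {s : ℂ}

/-! ## Consequences of the Yang–Baxter equation -/

/-- The trace part is expressed by R̂⁻¹ - R̂ + k. An intertwiner of R̂ and of R̂⁻¹ is therefore one
of P_a. -/
theorem exists_projA_eq (hN : 3 ≤ N) (hs : Generic s) :
    ∃ α β γ : ℂ, projA N s = α • 1 + β • rhat N s + γ • rhatInv N s := by
  have hk := hs.kConst_ne
  have hc := gTrace_ne hN hs
  have h1 : rhatInv N s = rhat N s - kConst s • 1 + kConst s • gg N s := rfl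
  refine ⟨(s ^ 2 + (s ^ 2)⁻¹)⁻¹ * (s ^ 2 + (muConst N s - s ^ 2) * (gTrace N s)⁻¹),
    (s ^ 2 + (s ^ 2)⁻¹)⁻¹ * (-1 - (muConst N s - s ^ 2) * (gTrace N s)⁻¹ * (kConst s)⁻¹),
    (s ^ 2 + (s ^ 2)⁻¹)⁻¹ * ((muConst N s - s ^ 2) * (gTrace N s)⁻¹ * (kConst s)⁻¹), ?_⟩
  rw [projA_eq, projT_eq, h1]
  match_scalars <;> field_simp <;> ring

theorem exists_normConst (N : ℕ) (s : ℂ) : ∃ γ : Idx N → ℂ, NormConst N s γ := by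
  refine ⟨fun a => if (a : ℤ) = 0 then -(s * hConst s)⁻¹ else if (a : ℤ) < 0 then 1
    else if (a : ℤ) = 1 then
      (open Classical in if Odd N then -(s ^ 2 * hConst s ^ 2)⁻¹ else 4 * (s ^ 4 * kConst s ^ 2)⁻¹)
    else -(s ^ 2 * kConst s ^ 2)⁻¹ * omega N s a * omega N s ((a : ℤ) - 1), ?_, ?_, ?_, ?_⟩
  · intro a ha
    rw [if_pos ha]
  · intro ho a ha
    simp [ha, ho, coe_negIdx]
  · intro ho a ha
    simp [ha, ho, coe_negIdx]
  · intro a ha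
    rw [coe_negIdx, if_neg (by omega), if_neg (by omega), if_neg (by omega), if_neg (by omega),
      if_pos (by omega), mul_one]

/-- The matrix identity is inherited from A_N, which is nontrivial by its representation. The
normalization is auxiliary; it only has to exist. -/
theorem rhat_braid (hN : 3 ≤ N) (hs : Generic s) :
    leg12 (rhat N s) * leg23 (rhat N s) * leg12 (rhat N s) =
      leg23 (rhat N s) * leg12 (rhat N s) * leg23 (rhat N s) := by
  have := nontrivial_QAlg hN hs
  obtain ⟨γ, hγ⟩ := exists_normConst N s
  exact (qd hN hs).yangBaxter hγ hs

section

variable {B : Type*} [Ring B] {a b c d : B}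

theorem braid_inv {a' b' : B} (h : a * b * a = b * a * b) (ha : a * a' = 1) (ha' : a' * a = 1)
    (hb : b * b' = 1) (hb' : b' * b = 1) : a' * b' * a' = b' * a' * b' := by
  calc a' * b' * a' = a' * b' * a' * (b * a * b * (b' * a' * b')) := by
        simp only [mul_assoc]
        rw [← mul_assoc b b', hb, one_mul, ← mul_assoc a a', ha, one_mul, hb, mul_one]
    _ = a' * b' * a' * (a * b * a) * (b' * a' * b') := by rw [h, mul_assoc (a' * b' * a')]
    _ = b' * a' * b' := by
        have : a' * b' * a' * (a * b * a) = 1 := by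
          simp only [mul_assoc]
          rw [← mul_assoc a' a, ha', one_mul, ← mul_assoc b' b, hb', one_mul, ha']
        rw [this, one_mul]

end

theorem qrhat_zpow_braid (hN : 3 ≤ N) (hs : Generic s) (δ : ℤˣ) :
    leg12 ((s ^ 2 • rhat N s) ^ (δ : ℤ)) * leg23 ((s ^ 2 • rhat N s) ^ (δ : ℤ)) *
        leg12 ((s ^ 2 • rhat N s) ^ (δ : ℤ)) =
      leg23 ((s ^ 2 • rhat N s) ^ (δ : ℤ)) * leg12 ((s ^ 2 • rhat N s) ^ (δ : ℤ)) *
        leg23 ((s ^ 2 • rhat N s) ^ (δ : ℤ)) := by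
  rcases Int.units_eq_one_or δ with rfl | rfl
  · rw [qrhat_zpow_one]
    simp only [leg12_smul, leg23_smul, smul_mul_assoc, mul_smul_comm, rhat_braid hN hs]
  · have h0 := hs.ne_zero
    rw [qrhat_zpow_neg_one h0]
    have h1 := leg12_mul (rhat N s) (rhatInv N s)
    have h2 := leg12_mul (rhatInv N s) (rhat N s)
    have h3 := leg23_mul (rhat N s) (rhatInv N s)
    have h4 := leg23_mul (rhatInv N s) (rhat N s)
    rw [rhat_mul_rhatInv h0] at h1 h3
    rw [rhatInv_mul_rhat h0] at h2 h4
    rw [leg12_one] at h1 h2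
    rw [leg23_one] at h3 h4
    simp only [leg12_smul, leg23_smul, smul_mul_assoc, mul_smul_comm,
      braid_inv (rhat_braid hN hs) h1.symm h2.symm h3.symm h4.symm]

/-- The antisymmetric projector passes through a product of two flips. -/
theorem projA_braid (hN : 3 ≤ N) (hs : Generic s) (δ : ℤˣ) :
    leg12 (projA N s) * (leg23 ((s ^ 2 • rhat N s) ^ (δ : ℤ)) *
        leg12 ((s ^ 2 • rhat N s) ^ (δ : ℤ))) =
      leg23 ((s ^ 2 • rhat N s) ^ (δ : ℤ)) * leg12 ((s ^ 2 • rhat N s) ^ (δ : ℤ)) *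
        leg23 (projA N s) := by
  have h0 := hs.ne_zero
  set S := (s ^ 2 • rhat N s) ^ (δ : ℤ) with hS
  set W := leg23 S * leg12 S with hW
  -- The braid relation says that W = S₂₃ S₁₂ intertwines S₁₂ and S₂₃. Then it does so for S⁻¹,
  -- hence for P_a, a combination of 1, R̂ and R̂⁻¹.
  have hSW : leg12 S * W = W * leg23 S := by
    rw [hW, ← mul_assoc, qrhat_zpow_braid hN hs]
  have hT := qrhat_zpow_mul (N := N) h0 δ
  have hT' := qrhat_zpow_mul (N := N) h0 (-δ)
  rw [neg_neg] at hT'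
  set T := (s ^ 2 • rhat N s) ^ ((-δ : ℤˣ) : ℤ) with hTdef
  have hTW : leg12 T * W = W * leg23 T := by
    have h1 : leg12 T * leg12 S = 1 := by rw [← leg12_mul, hT', leg12_one]
    have h2 : leg23 S * leg23 T = 1 := by rw [← leg23_mul, hT, leg23_one]
    calc leg12 T * W = leg12 T * (W * leg23 S) * leg23 T := by
          rw [mul_assoc, mul_assoc, h2, mul_one]
      _ = W * leg23 T := by rw [← hSW, ← mul_assoc, h1, one_mul]
  have hR : leg12 (rhat N s) * W = W * leg23 (rhat N s) ∧
      leg12 (rhatInv N s) * W = W * leg23 (rhatInv N s) := by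
    have h2 := pow_ne_zero 2 h0
    have aux : ∀ (c : ℂ) (M : Matrix (Idx N × Idx N) (Idx N × Idx N) ℂ), c ≠ 0 →
        leg12 (c • M) * W = W * leg23 (c • M) → leg12 M * W = W * leg23 M := by
      intro c M hc h
      rw [leg12_smul, leg23_smul, smul_mul_assoc, mul_smul_comm] at h
      exact smul_right_injective _ hc h
    rcases Int.units_eq_one_or δ with rfl | rfl
    · rw [hS, qrhat_zpow_one] at hSW
      rw [hTdef, qrhat_zpow_neg_one h0] at hTW
      exact ⟨aux _ _ h2 hSW, aux _ _ (inv_ne_zero h2) hTW⟩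
    · rw [hS, qrhat_zpow_neg_one h0] at hSW
      rw [hTdef, neg_neg, qrhat_zpow_one] at hTW
      exact ⟨aux _ _ h2 hTW, aux _ _ (inv_ne_zero h2) hSW⟩
  obtain ⟨α, β, γ, h⟩ := exists_projA_eq hN hs
  rw [h]
  simp only [leg12_add, leg23_add, leg12_smul, leg23_smul, leg12_one, leg23_one, add_mul, mul_add,
    smul_mul_assoc, mul_smul_comm, one_mul, mul_one, hR.1, hR.2]

/-! ## Compatibility of flips and metrics -/

section Compat

variable {I : Type*} [Fintype I] [DecidableEq I]

/-- The matrix `S^{am}_{pe}` with the row index `a` and the column index `e`. -/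
def slice (S : Matrix (I × I) (I × I) ℂ) (m p : I) : Matrix I I ℂ :=
  Matrix.of fun a e => S (a, m) (p, e)

/-- The matrix `S^{am}_{pe} h^{ef}` with the row index `(a, p)` and the column index `(m, f)`. -/
def turn (h : Matrix I I ℂ) (S : Matrix (I × I) (I × I) ℂ) : Matrix (I × I) (I × I) ℂ :=
  Matrix.of fun u v => (slice S v.1 u.2 * h) u.1 v.2

/-- The matrix `h ⊗ 1` on pairs of indices. -/
def fstLeg (h : Matrix I I ℂ) : Matrix (I × I) (I × I) ℂ :=
  Matrix.kroneckerMap (· * ·) h (1 : Matrix I I ℂ)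

theorem fstLeg_mul_apply (h : Matrix I I ℂ) (M : Matrix (I × I) (I × I) ℂ) (a p : I) (v : I × I) :
    (fstLeg h * M) (a, p) v = ∑ c, h a c * M (c, p) v := by
  rw [Matrix.mul_apply, Fintype.sum_prod_type]
  refine Finset.sum_congr rfl fun c _ => ?_
  rw [Finset.sum_eq_single p]
  · simp [fstLeg]
  · intro b _ hb
    simp [fstLeg, Matrix.one_apply_ne hb.symm]
  · simp

theorem fstLeg_apply (h : Matrix I I ℂ) (a p c b : I) :
    fstLeg h (a, p) (c, b) = if p = b then h a c else 0 := by
  simp [fstLeg, Matrix.one_apply]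

theorem turn_add (h : Matrix I I ℂ) (S T : Matrix (I × I) (I × I) ℂ) :
    turn h (S + T) = turn h S + turn h T := by
  ext u v
  simp [turn, slice, Matrix.mul_apply, add_mul, Finset.sum_add_distrib]

theorem turn_smul (h : Matrix I I ℂ) (c : ℂ) (S : Matrix (I × I) (I × I) ℂ) :
    turn h (c • S) = c • turn h S := by
  ext u v
  simp [turn, slice, Matrix.mul_apply, mul_assoc, Finset.mul_sum]

/-- A metric `h` and a symmetric flip `S` are compatible up to the factor `κ`. -/
def Compat (κ : ℂ) (h : Matrix I I ℂ) (S : Matrix (I × I) (I × I) ℂ) : Prop :=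
  turn h S * S = κ • fstLeg h

/-- Multiplication by S⁻¹ makes the quadratic condition linear: it compares slices of S with slices
of its inverse. -/
theorem Compat.slice_mul {κ : ℂ} {h : Matrix I I ℂ} {S T : Matrix (I × I) (I × I) ℂ}
    (hS : Compat κ h S) (hST : S * T = 1) (m p : I) :
    slice S m p * h = κ • (h * slice T p m) := by
  have h1 : turn h S = κ • (fstLeg h * T) := by
    rw [← smul_mul_assoc, ← hS, mul_assoc, hST, mul_one]
  ext a f
  have h2 := congrFun (congrFun h1 (a, p)) (m, f)
  rw [Matrix.smul_apply, fstLeg_mul_apply] at h2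
  exact h2

end Compat

theorem fstLeg_gMat (hs : s ≠ 0) : fstLeg (gMat N s) * fstLeg (gMat N s) = 1 := by
  unfold fstLeg
  rw [← Matrix.mul_kronecker_mul, gMat_mul_gMat hs, one_mul, Matrix.one_kronecker_one]

/-- Up to the factor g ⊗ 1, turning a leg with the metric interchanges 1 and g g, and by crossing it
sends R̂ to R̂⁻¹. The span of the three matrices is preserved, so compatibility becomes an identity
within this span. -/
theorem turn_one (hs : s ≠ 0) :
    turn (gMat N s) (1 : Matrix (Idx N × Idx N) (Idx N × Idx N) ℂ) = fstLeg (gMat N s) * gg N s := by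
  ext ⟨a, p⟩ ⟨m, f⟩
  have h : ∑ c, gMat N s a c * gMat N s c p = (1 : Matrix (Idx N) (Idx N) ℂ) a p := by
    rw [← gMat_mul_gMat hs, Matrix.mul_apply]
  rw [fstLeg_mul_apply]
  simp only [gg, Matrix.of_apply, ← mul_assoc, ← Finset.sum_mul, h, turn, slice, Matrix.mul_apply]
  rw [Finset.sum_eq_single m]
  · by_cases hap : a = p <;> simp [hap, Matrix.one_apply]
  · intro b _ hb
    rw [Matrix.one_apply_ne, zero_mul]
    exact fun h => hb (congrArg Prod.snd h).symm
  · simp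

theorem turn_gg (hs : s ≠ 0) : turn (gMat N s) (gg N s) = fstLeg (gMat N s) := by
  ext ⟨a, p⟩ ⟨m, f⟩
  have h : ∑ c, gMat N s p c * gMat N s c f = (1 : Matrix (Idx N) (Idx N) ℂ) p f := by
    rw [← gMat_mul_gMat hs, Matrix.mul_apply]
  rw [fstLeg_apply]
  simp only [turn, slice, gg, Matrix.of_apply, Matrix.mul_apply, mul_assoc, ← Finset.mul_sum, h]
  by_cases hpf : p = f <;> simp [hpf, Matrix.one_apply]

theorem turn_rhat (hs : s ≠ 0) :
    turn (gMat N s) (rhat N s) = fstLeg (gMat N s) * rhatInv N s := by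
  ext ⟨a, p⟩ ⟨m, f⟩
  rw [fstLeg_mul_apply, Finset.sum_eq_single (negIdx a), rhatInv_symm, ← rhat_crossing hs]
  · simp only [turn, slice, Matrix.of_apply, Matrix.mul_apply]
    rw [Finset.sum_eq_single (negIdx f)]
    · intro b _ hb
      rw [gMat_apply, if_neg, mul_zero]
      intro h
      exact hb (by rw [h, negIdx_negIdx])
    · simp
  · intro b _ hb
    rw [gMat_apply, if_neg hb, zero_mul]
  · simp

/-- The three matrices `x R̂ + y + z g g` for which the compatibility has to be checked. -/
theorem compat_iff (hs : s ≠ 0) (κ x y z : ℂ) :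
    Compat κ (gMat N s) (x • rhat N s + y • 1 + z • gg N s) ↔
      (x * y + x * z) • rhat N s + (x ^ 2 - kConst s * x * y + y * z - κ) • 1 +
        (kConst s * x * y + x * z * (muConst N s)⁻¹ + x * y * muConst N s + y ^ 2 +
          y * z * gTrace N s + z ^ 2) • gg N s = 0 := by
  have hμ := muConst_ne (N := N) hs
  have h1 : rhatInv N s * gg N s = (muConst N s)⁻¹ • gg N s := by
    have h2 : (muConst N s)⁻¹ • (rhatInv N s * (rhat N s * gg N s)) = (muConst N s)⁻¹ • gg N s := by
      rw [← mul_assoc, rhatInv_mul_rhat hs, one_mul]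
    rwa [rhat_mul_gg hs, mul_smul_comm, smul_smul, inv_mul_cancel₀ hμ, one_smul] at h2
  rw [Compat, turn_add, turn_add, turn_smul, turn_smul, turn_smul, turn_one hs, turn_gg hs,
    turn_rhat hs]
  have h3 : x • (fstLeg (gMat N s) * rhatInv N s) + y • (fstLeg (gMat N s) * gg N s) +
      z • fstLeg (gMat N s) =
        fstLeg (gMat N s) * (x • rhatInv N s + y • gg N s + z • 1) := by
    simp only [mul_add, mul_smul_comm, mul_one]
  have h4 : (x • rhatInv N s + y • gg N s + z • (1 : Matrix (Idx N × Idx N) (Idx N × Idx N) ℂ)) *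
      (x • rhat N s + y • 1 + z • gg N s) - κ • 1 =
      (x * y + x * z) • rhat N s + (x ^ 2 - kConst s * x * y + y * z - κ) • 1 +
        (kConst s * x * y + x * z * (muConst N s)⁻¹ + x * y * muConst N s + y ^ 2 +
          y * z * gTrace N s + z ^ 2) • gg N s := by
    simp only [mul_add, add_mul, smul_mul_assoc, mul_smul_comm, mul_one, one_mul, h1,
      rhatInv_mul_rhat hs, gg_mul_rhat hs, gg_mul_gg, smul_smul]
    have h5 : rhatInv N s = rhat N s - kConst s • 1 + kConst s • gg N s := rfl
    rw [h5]
    match_scalars <;> ring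
  rw [h3, ← h4, sub_eq_zero, mul_assoc]
  constructor
  · intro h
    have h5 := congrArg (fstLeg (gMat N s) * ·) h
    simp only [← mul_assoc, mul_smul_comm, fstLeg_gMat hs, one_mul] at h5
    exact h5
  · intro h
    rw [h, mul_smul_comm, mul_one]

theorem rhatInv_eq_add (N : ℕ) (s : ℂ) (c : ℂ) : c • rhatInv N s =
    c • rhat N s + (-kConst s * c) • 1 + (kConst s * c) • gg N s := by
  rw [rhatInv]
  module

/-- The two flips are compatible with the metric. -/
theorem compat_qrhat_zpow (hN : 3 ≤ N) (hs : Generic s) (δ : ℤˣ) :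
    Compat (s ^ (4 * (δ : ℤ))) (gMat N s) ((s ^ 2 • rhat N s) ^ (δ : ℤ)) := by
  have h0 := hs.ne_zero
  have h4 : s ^ (4 : ℤ) = s ^ 4 := by norm_cast
  rcases Int.units_eq_one_or δ with rfl | rfl
  · have h := (compat_iff (N := N) h0 (s ^ 4) (s ^ 2) 0 0).2
    rw [zero_smul, zero_smul, add_zero, add_zero] at h
    rw [qrhat_zpow_one, Units.val_one, mul_one, h4]
    refine h ?_
    match_scalars <;> ring
  · rw [qrhat_zpow_neg_one h0, rhatInv_eq_add, compat_iff h0, Units.val_neg, Units.val_one,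
      mul_neg_one, zpow_neg, h4]
    have hk := k_mul_gTrace (N := N) (by omega) h0
    -- The coefficient of g g for the flip v R̂⁻¹ with v = q⁻¹; it vanishes by the value of the
    -- trace c.
    have e : ∀ k μ μi c v : ℂ, k * c = k + μi - μ → k * v * (-k * v) + v * (k * v) * μi +
        v * (-k * v) * μ + (-k * v) ^ 2 + -k * v * (k * v) * c + (k * v) ^ 2 = 0 := by
      intro k μ μi c v h
      linear_combination (-k * v ^ 2) * h

    rw [e _ _ _ _ _ hk, zero_smul, add_zero]
    match_scalars
    · ring
    · field_simp
      ring

end QEuclid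

namespace QEuclid

variable {N : ℕ} {s : ℂ}

/-! ## Uniqueness of the metric and of the flips -/

/-- R̂ conserves the sum of the indices. This reduces products with slices to single entries. -/
theorem rhat_eq_zero {a b c d : Idx N} (h : (a : ℤ) + b ≠ c + d) : rhat N s (a, b) (c, d) = 0 := by
  rw [rhat_apply s a b c d _ _ _ _ rfl rfl rfl rfl]
  repeat rw [if_neg (by omega)]
  simp

theorem rhat_swap (a b : Idx N) : rhat N s (a, b) (b, a) =
    if (a : ℤ) = b ∧ (a : ℤ) ≠ 0 then s ^ 2
      else if (a : ℤ) = -b ∧ (a : ℤ) ≠ 0 then (s ^ 2)⁻¹ else 1 := by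
  rw [rhat_apply s a b b a _ _ _ _ rfl rfl rfl rfl, if_neg (c := (a : ℤ) < b ∧ _) (by omega),
    if_neg (c := (a : ℤ) < a ∧ _) (by omega)]
  split_ifs <;> first | omega | ring

theorem rhat_diag {a b : Idx N} (h : (a : ℤ) < b) (h' : (b : ℤ) ≠ -a) :
    rhat N s (a, b) (a, b) = kConst s := by
  have hne : a ≠ b := fun e => by rw [e] at h; exact lt_irrefl _ h
  rw [rhat_apply_ne s a b a b h', if_neg (fun e => hne e.1), if_pos ⟨rfl, rfl⟩, if_pos h, zero_add]

theorem exists_between (hN : 3 ≤ N) : ∃ b : Idx N, -top N < (b : ℤ) ∧ (b : ℤ) < top N := by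
  have htd : top N = ((N / 2 : ℕ) : ℤ) := rfl
  by_cases ho : Odd N
  · exact ⟨mkIdx 0 (by omega) (by omega) (Or.inr ho), by change -top N < 0; omega, by change 0 < top N; omega⟩
  · have : 4 ≤ N := by
      rcases Nat.lt_or_ge N 4 with h | h
      · have : N = 3 := by omega
        exact absurd (by rw [this]; decide) ho
      · exact h
    exact ⟨mkIdx 1 (by omega) (by omega) (Or.inl one_ne_zero), by change -top N < 1; omega, by change 1 < top N; omega⟩

/-- A matrix that intertwines the slices of the braid matrix up to a factor is a scalar. -/
theorem eq_smul_one_of_slice (hN : 3 ≤ N) (hs : Generic s) (X : Matrix (Idx N) (Idx N) ℂ) (κ : ℂ)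
    (h : ∀ m p, slice (rhat N s) m p * X = κ • (X * slice (rhat N s) m p)) :
    ∃ c : ℂ, X = c • 1 := by
  have h0 := hs.ne_zero
  have h2 := pow_ne_zero 2 h0
  have htd : top N = ((N / 2 : ℕ) : ℤ) := rfl
  have key : ∀ a b f u e v : Idx N, (v : ℤ) + b = f + u → (a : ℤ) + b = f + e →
      rhat N s (a, b) (f, e) * X e u = κ * (X a v * rhat N s (v, b) (f, u)) := by
    intro a b f u e v hv he
    have h1 := congrFun (congrFun (h b f) a) u
    rw [Matrix.smul_apply, Matrix.mul_apply, Matrix.mul_apply, Finset.sum_eq_single e,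
      Finset.sum_eq_single v] at h1
    · exact h1
    · intro w _ hw
      have : rhat N s (w, b) (f, u) = 0 := rhat_eq_zero fun h3 => hw (idx_ext_iff.2 (by omega))
      rw [slice, Matrix.of_apply, this, mul_zero]
    · simp
    · intro w _ hw
      have : rhat N s (a, b) (f, w) = 0 := rhat_eq_zero fun h3 => hw (idx_ext_iff.2 (by omega))
      rw [slice, Matrix.of_apply, this, zero_mul]
    · simp
  -- If X_{au} ≠ 0, the exchange entries of R̂ for a and for u are proportional with the same factor
  -- for all b. The values q, q⁻¹ and 1 at b = ±a, ±u exclude this for a ≠ u.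
  have swap : ∀ a u, X a u ≠ 0 → ∀ b, rhat N s (a, b) (b, a) = κ * rhat N s (u, b) (b, u) := by
    intro a u hX b
    have h1 := key a b b u a u (add_comm _ _) (add_comm _ _)
    refine mul_right_cancel₀ hX (h1.trans (by ring))
  have hq : s ^ 2 ≠ (s ^ 2)⁻¹ := sub_ne_zero.1 hs.kConst_ne
  have hq1 : s ^ 2 ≠ 1 := hs.pow_ne 2 (by norm_num)
  have hq8 : s ^ 8 ≠ 1 := hs.pow_ne 8 (by norm_num)
  have off : ∀ a u, a ≠ u → X a u = 0 := by
    intro a u hau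
    by_contra hX
    have h1 := swap a u hX
    rw [Ne, idx_ext_iff] at hau
    have e1 := h1 a
    have e2 := h1 (negIdx a)
    have e3 := h1 u
    have e4 := h1 (negIdx u)
    simp only [rhat_swap, coe_negIdx, neg_neg, true_and] at e1 e2 e3 e4
    by_cases ha : (a : ℤ) = 0
    · rw [if_neg (by omega), if_neg (by omega), if_pos (by omega)] at e3
      rw [if_neg (by omega), if_neg (by omega), if_neg (by omega), if_pos (by omega)] at e4
      apply hq
      field_simp at e3 e4 ⊢
      linear_combination s ^ 2 * e4 - e3
    · by_cases hu : (a : ℤ) = -u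
      · rw [if_pos (by omega), if_neg (by omega), if_pos (by omega)] at e1
        rw [if_neg (by omega), if_pos (by omega), if_pos (by omega)] at e2
        apply hq8
        field_simp at e1 e2
        linear_combination s ^ 4 * e1 - e2
      · rw [if_pos (by omega), if_neg (by omega), if_neg (by omega)] at e1
        rw [if_neg (by omega), if_pos (by omega), if_neg (by omega), if_neg (by omega)] at e2
        exact hq (e1.trans e2.symm)
  by_cases hX : X = 0
  · exact ⟨0, by rw [hX, zero_smul]⟩
  · have hκ : κ = 1 := by
      obtain ⟨a, ha⟩ : ∃ a, X a a ≠ 0 := by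
        by_contra! h1
        exact hX (Matrix.ext fun a u => by
          by_cases hau : a = u
          · rw [← hau]; exact h1 a
          · exact off a u hau)
      have h1 := swap a a ha a
      have h3 : rhat N s (a, a) (a, a) ≠ 0 := by
        rw [rhat_swap]
        split_ifs
        · exact h2
        · exact inv_ne_zero h2
        · exact one_ne_zero
      exact mul_right_cancel₀ h3 (by rw [← h1, one_mul])
    -- Diagonal entries are compared through the entry k of R̂ at (a, b), (a, b) with a < b. This
    -- does not apply to the opposite pair (-n, n), which is joined through an index in between.
    have link : ∀ a b : Idx N, (a : ℤ) < b → (b : ℤ) ≠ -a → X a a = X b b := by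
      intro a b hab hne
      have h1 := key a b a b b a rfl rfl
      rw [rhat_diag hab hne, hκ, one_mul, mul_comm] at h1
      exact (mul_right_cancel₀ hs.kConst_ne h1).symm
    obtain ⟨m, hm1, hm2⟩ := exists_between hN
    obtain ⟨t, ht⟩ : ∃ t : Idx N, (t : ℤ) = top N :=
      ⟨mkIdx (top N) (by omega) le_rfl (Or.inl (by omega)), rfl⟩
    refine ⟨X t t, Matrix.ext fun a u => ?_⟩
    rw [Matrix.smul_apply, smul_eq_mul]
    by_cases hau : a = u
    · subst hau
      rw [Matrix.one_apply_eq, mul_one]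
      have ha := idx_mem a
      by_cases h3 : (a : ℤ) = top N
      · rw [idx_ext_iff.2 (h3.trans ht.symm)]
      · by_cases h4 : (a : ℤ) = -top N
        · rw [link a m (by omega) (by omega), link m t (by omega) (by omega)]
        · exact link a t (by omega) (by omega)
    · rw [off a u hau, Matrix.one_apply_ne hau, mul_zero]

/-- A metric that is compatible with one of the two flips is a multiple of `g`. -/
theorem eq_smul_gMat_of_compat (hN : 3 ≤ N) (hs : Generic s) (δ : ℤˣ)
    (h : Matrix (Idx N) (Idx N) ℂ) (κ : ℂ) (hh : Compat κ h ((s ^ 2 • rhat N s) ^ (δ : ℤ))) :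
    ∃ c : ℂ, h = c • gMat N s := by
  have h0 := hs.ne_zero
  have hgg := gMat_mul_gMat (N := N) h0
  have hT := qrhat_zpow_mul (N := N) h0 δ
  have h1 := (compat_qrhat_zpow hN hs δ).slice_mul hT
  have h2 := hh.slice_mul hT
  set S := (s ^ 2 • rhat N s) ^ (δ : ℤ) with hS
  set g := gMat N s
  set κ₀ := s ^ (4 * (δ : ℤ))
  have hκ : κ₀ ≠ 0 := zpow_ne_zero _ h0
  -- Both h and g relate the slices of S to those of S⁻¹. Eliminating the latter shows that h g
  -- commutes with the slices of S up to a factor.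
  have h3 : ∀ m p, slice S m p * (h * g) = (κ * κ₀⁻¹) • (h * g * slice S m p) := by
    intro m p
    have h4 : slice S m p = κ₀ • (g * slice ((s ^ 2 • rhat N s) ^ ((-δ : ℤˣ) : ℤ)) p m * g) := by
      rw [← smul_mul_assoc, ← h1, mul_assoc, hgg, mul_one]
    calc slice S m p * (h * g) =
          κ • (h * (g * g) * slice ((s ^ 2 • rhat N s) ^ ((-δ : ℤˣ) : ℤ)) p m * g) := by
          rw [← mul_assoc, h2, hgg, mul_one, smul_mul_assoc]
      _ = (κ * κ₀⁻¹) • (h * g * slice S m p) := by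
          conv_rhs => rw [h4]
          rw [mul_smul_comm, smul_smul, inv_mul_cancel_right₀ hκ]
          simp only [mul_assoc]
  have h4 : ∃ c : ℂ, h * g = c • 1 := by
    have hsl : ∀ (c : ℂ) (M : Matrix (Idx N × Idx N) (Idx N × Idx N) ℂ) m p,
        slice (c • M) m p = c • slice M m p := fun _ _ _ _ => rfl
    have h5 := pow_ne_zero 2 h0
    rcases Int.units_eq_one_or δ with rfl | rfl
    · rw [hS, qrhat_zpow_one] at h3
      refine eq_smul_one_of_slice hN hs _ (κ * κ₀⁻¹) fun m p => ?_
      have h6 := h3 m p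
      rw [hsl, smul_mul_assoc, mul_smul_comm, smul_comm] at h6
      exact smul_right_injective _ h5 h6
    · rw [hS, qrhat_zpow_neg_one h0] at h3
      -- For δ = -1 the slices of R̂⁻¹ are reflected slices of the braid matrix at `s⁻¹`, so the
      -- same rigidity statement applies.
      have h7 : ∀ m p, slice (rhat N s⁻¹) m p =
          (slice (rhatInv N s) (negIdx m) (negIdx p)).submatrix (negEquiv N) (negEquiv N) := by
        intro m p
        ext a e
        have := rhat_flip (N := N) h0 (negIdx a) (negIdx m) (negIdx p) (negIdx e)
        rw [negIdx_negIdx, negIdx_negIdx, negIdx_negIdx, negIdx_negIdx] at this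
        exact this
      obtain ⟨c, hc⟩ := eq_smul_one_of_slice hN hs.inv ((h * g).submatrix (negEquiv N) (negEquiv N))
        (κ * κ₀⁻¹) fun m p => by
          have h6 := h3 (negIdx m) (negIdx p)
          rw [hsl, smul_mul_assoc, mul_smul_comm, smul_comm] at h6
          have h8 := smul_right_injective _ (inv_ne_zero h5) h6
          rw [h7, Matrix.submatrix_mul_equiv, Matrix.submatrix_mul_equiv, h8, Matrix.submatrix_smul]
          rfl
      refine ⟨c, Matrix.ext fun a u => ?_⟩
      have h9 := congrFun (congrFun hc (negIdx a)) (negIdx u)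
      rw [Matrix.submatrix_apply] at h9
      change (h * g) (negIdx (negIdx a)) (negIdx (negIdx u)) = _ at h9
      rw [negIdx_negIdx, negIdx_negIdx] at h9
      rw [h9, Matrix.smul_apply, Matrix.smul_apply, Matrix.one_apply, Matrix.one_apply]
      simp only [negIdx_inj]
  obtain ⟨c, hc⟩ := h4
  refine ⟨c, ?_⟩
  calc h = h * g * g := by rw [mul_assoc, hgg, mul_one]
    _ = c • g := by rw [hc, smul_mul_assoc, one_mul]

/-- Linear independence of the three intertwiners. -/
theorem eq_zero_of_rhat_gg (hN : 3 ≤ N) (hs : Generic s) {α β γ : ℂ}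
    (h : α • rhat N s + β • 1 + γ • gg N s = 0) : α = 0 ∧ β = 0 ∧ γ = 0 := by
  have htd : top N = ((N / 2 : ℕ) : ℤ) := rfl
  obtain ⟨m, hm1, hm2⟩ := exists_between hN
  obtain ⟨t, ht⟩ : ∃ t : Idx N, (t : ℤ) = top N :=
    ⟨mkIdx (top N) (by omega) le_rfl (Or.inl (by omega)), rfl⟩
  have hmt : m ≠ t := fun e => by rw [e] at hm2; omega
  have hg : gMat N s m t = 0 := by
    rw [gMat_apply, if_neg]
    intro e
    rw [e, coe_negIdx] at ht
    omega
  have e : ∀ a b c d : Idx N, α * rhat N s (a, b) (c, d) +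
      β * (if a = c ∧ b = d then 1 else 0) + γ * (gMat N s a b * gMat N s c d) = 0 := by
    intro a b c d
    have := congrFun (congrFun h (a, b)) (c, d)
    simp only [Matrix.add_apply, Matrix.smul_apply, smul_eq_mul, Matrix.one_apply, Prod.mk.injEq, gg,
      Matrix.of_apply, Matrix.zero_apply] at this
    exact this
  have e1 := e m t t m
  rw [hg, rhat_swap, if_neg (by omega), if_neg (by omega), if_neg (fun h => hmt h.1)] at e1
  have hα : α = 0 := by linear_combination e1
  have e2 := e m t m t
  rw [hg, hα, if_pos ⟨rfl, rfl⟩] at e2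
  have hβ : β = 0 := by linear_combination e2
  have e3 := e t (negIdx t) t (negIdx t)
  rw [hα, hβ, zero_mul, zero_mul, zero_add, zero_add, gMat_neg] at e3
  have hz := zpow_ne_zero (-twoRho N t) hs.ne_zero
  exact ⟨hα, hβ, (mul_eq_zero.1 e3).resolve_right (mul_ne_zero hz hz)⟩

/-- The flips that are compatible with `g` up to a factor. -/
theorem eq_qrhat_zpow_of_compat (hN : 3 ≤ N) (hs : Generic s) {Cs Ct κ : ℂ} (hCs : Cs ≠ -1)
    (h : Compat κ (gMat N s) (Cs • projS N s - projA N s + Ct • projT N s)) :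
    ∃ δ : ℤˣ, Cs • projS N s - projA N s + Ct • projT N s = (s ^ 2 • rhat N s) ^ (δ : ℤ) ∧
      κ = s ^ (4 * (δ : ℤ)) := by
  have h0 := hs.ne_zero
  have h2 := pow_ne_zero 2 h0
  have h4 : s ^ (4 : ℤ) = s ^ 4 := by norm_cast
  have hw := sq_add_ne hs
  have hc := gTrace_ne hN hs
  -- The coordinates of the flip in the basis R̂, 1, g g, read off from its eigenvalues C_s, -1,
  -- C_t.
  obtain ⟨x, hx⟩ : ∃ x, x = (Cs + 1) * (s ^ 2 + (s ^ 2)⁻¹)⁻¹ := ⟨_, rfl⟩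
  obtain ⟨y, hy⟩ : ∃ y, y = x * (s ^ 2)⁻¹ - 1 := ⟨_, rfl⟩
  obtain ⟨z, hz⟩ : ∃ z, z = (Ct - y - x * muConst N s) * (gTrace N s)⁻¹ := ⟨_, rfl⟩
  have hx0 : x ≠ 0 := by
    rw [hx]
    exact mul_ne_zero (fun e => hCs (by linear_combination e)) (inv_ne_zero hw)
  have hCs' : Cs = x * s ^ 2 + y := by
    have : x * (s ^ 2 + (s ^ 2)⁻¹) = Cs + 1 := by rw [hx, mul_assoc, inv_mul_cancel₀ hw, mul_one]
    rw [hy]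
    linear_combination -this
  have hCt' : Ct = x * muConst N s + y + z * gTrace N s := by
    rw [hz, mul_assoc, inv_mul_cancel₀ hc]
    ring
  have hS : Cs • projS N s - projA N s + Ct • projT N s =
      x • rhat N s + y • 1 + z • gg N s := by
    have h1 : (1 : Matrix (Idx N × Idx N) (Idx N × Idx N) ℂ) = projS N s + projA N s + projT N s := by
      rw [projS]; abel
    rw [h1, gg_eq hN hs, rhat_eq hs, hCs', hCt']
    have : (x * (s ^ 2)⁻¹ - y) = 1 := by rw [hy]; ring
    match_scalars
    · ring
    · linear_combination this
    · ring
  rw [hS, compat_iff h0] at h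
  obtain ⟨e1, e2, e3⟩ := eq_zero_of_rhat_gg hN hs h
  have hzy : z = -y := by
    have : x * (y + z) = 0 := by linear_combination e1
    linear_combination (mul_eq_zero.1 this).resolve_left hx0
  have hk := k_mul_gTrace (N := N) (by omega) h0
  -- With z = -y and the value of the trace, the coefficient of g g is 2 minus the trace, times y (k
  -- x + y). The roots y = 0 and y = -k x belong to q R̂ and its inverse.
  have e4 : y * (kConst s * x + y) = 0 := by
    have h5 : (2 - gTrace N s) * (y * (kConst s * x + y)) = 0 := by
      rw [hzy] at e3
      linear_combination e3 - x * y * hk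
    exact (mul_eq_zero.1 h5).resolve_left (sub_ne_zero.2 (gTrace_ne_two hN hs).symm)
  rw [hS]
  rcases mul_eq_zero.1 e4 with h5 | h5
  · have hx1 : x = s ^ 2 := by
      rw [h5] at hy
      field_simp at hy
      linear_combination -hy
    refine ⟨1, ?_, ?_⟩
    · rw [qrhat_zpow_one, hzy, h5, hx1, neg_zero, zero_smul, zero_smul, add_zero, add_zero]
    · rw [Units.val_one, mul_one, h4]
      rw [h5, hx1] at e2
      linear_combination -e2
  · have hy1 : y = -kConst s * x := by linear_combination h5
    have hx1 : x = (s ^ 2)⁻¹ := by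
      rw [hy1, kConst] at hy
      exact eq_inv_of_mul_eq_one_left (by linear_combination -hy)
    refine ⟨-1, ?_, ?_⟩
    · rw [qrhat_zpow_neg_one h0, rhatInv_eq_add, hzy, hy1, hx1]
      congr 2
      ring
    · rw [Units.val_neg, Units.val_one, mul_neg_one, zpow_neg, h4]
      rw [hzy, hy1] at e2
      have : κ = x ^ 2 := by linear_combination -e2
      rw [this, hx1]
      ring

end QEuclid

namespace QEuclid

/-! ## Bimodule maps of forms -/

section Forms

variable {I A : Type} [Fintype I] [DecidableEq I] [Ring A] [Algebra ℂ A]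

/-- The flip with the matrix `S`. -/
def flipMap (S : Matrix (I × I) (I × I) ℂ) : Form2 I A → Form2 I A :=
  fun ζ c d => ∑ a, ∑ b, S (a, b) (c, d) • ζ a b

/-- The bilinear map with the components `h`. -/
def metricMap (h : Matrix I I ℂ) : Form2 I A → A := fun ζ => ∑ a, ∑ b, h a b • ζ a b

theorem tens_frame (a b c d : I) :
    tens (frame A a) (frame A b) c d = if a = c ∧ b = d then 1 else 0 := by
  by_cases h1 : a = c <;> by_cases h2 : b = d <;> simp [tens, frame, h1, h2, eq_comm]

theorem eq_sum_tens_frame (ζ : Form2 I A) :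
    ζ = ∑ a, ∑ b, ζ a b • tens (frame A a) (frame A b) := by
  ext c d
  simp only [Finset.sum_apply, Pi.smul_apply, tens_frame, smul_eq_mul]
  rw [Finset.sum_eq_single c, Finset.sum_eq_single d]
  · simp
  · intro b _ hb; simp [hb]
  · simp
  · intro a _ ha; simp [ha]
  · simp

theorem IsBimoduleMap.eq_sum {M : Type} [AddCommGroup M] [Module A M] [Module Aᵐᵒᵖ M]
    {φ : Form2 I A → M} (hφ : IsBimoduleMap A φ) (ζ : Form2 I A) :
    φ ζ = ∑ a, ∑ b, ζ a b • φ (tens (frame A a) (frame A b)) := by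
  let ψ : Form2 I A →ₗ[A] M := ⟨⟨φ, hφ.map_add⟩, hφ.map_left⟩
  have h : ψ ζ = ∑ a, ∑ b, ζ a b • ψ (tens (frame A a) (frame A b)) := by
    conv_lhs => rw [eq_sum_tens_frame ζ]
    simp only [map_sum, map_smul]
  exact h

theorem isBimoduleMap_metricMap (h : Matrix I I ℂ) :
    IsBimoduleMap A (metricMap h : Form2 I A → A) where
  map_add u v := by simp [metricMap, Finset.sum_add_distrib]
  map_left f u := by simp [metricMap, Finset.mul_sum]
  map_right f u := by simp [metricMap, Finset.sum_mul]

theorem metricMap_frame (h : Matrix I I ℂ) (a b : I) :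
    metricMap h (tens (frame A a) (frame A b)) = algebraMap ℂ A (h a b) := by
  simp only [metricMap, tens_frame]
  rw [Finset.sum_eq_single a, Finset.sum_eq_single b]
  · rw [if_pos ⟨rfl, rfl⟩, Algebra.algebraMap_eq_smul_one]
  · intro c _ hc; simp [hc.symm]
  · simp
  · intro c _ hc; simp [hc.symm]
  · simp

theorem IsBimoduleMap.eq_metricMap {φ : Form2 I A → A} (hφ : IsBimoduleMap A φ) (h : Matrix I I ℂ)
    (hh : ∀ a b, φ (tens (frame A a) (frame A b)) = algebraMap ℂ A (h a b)) : φ = metricMap h := by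
  ext ζ
  rw [hφ.eq_sum]
  simp only [hh, metricMap, smul_eq_mul, Algebra.smul_def, Algebra.commutes]

/-- The tensor θ^a ⊗ θ^b commutes with the algebra, so its image is central. -/
theorem IsBimoduleMap.commute_frame {φ : Form2 I A → A} (hφ : IsBimoduleMap A φ) (a b : I) (f : A) :
    f * φ (tens (frame A a) (frame A b)) = φ (tens (frame A a) (frame A b)) * f := by
  have h1 := hφ.map_left f (tens (frame A a) (frame A b))
  have h2 := hφ.map_right f (tens (frame A a) (frame A b))
  have h3 : f • tens (frame A a) (frame A b) = MulOpposite.op f • tens (frame A a) (frame A b) := by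
    ext c d
    simp only [Pi.smul_apply, tens_frame, smul_eq_mul, MulOpposite.smul_eq_mul_unop, MulOpposite.unop_op]
    split_ifs <;> simp
  rw [h3, h2] at h1
  exact h1.symm

theorem isFlipWith_flipMap (S : Matrix (I × I) (I × I) ℂ) :
    IsFlipWith S (flipMap S : Form2 I A → Form2 I A) := by
  refine ⟨⟨fun u v => ?_, fun f u => ?_, fun f u => ?_⟩, fun a b => ?_⟩
  · ext c d
    simp [flipMap, Finset.sum_add_distrib]
  · ext c d
    simp [flipMap, Finset.mul_sum]
  · ext c d
    simp [flipMap, Finset.sum_mul]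
  · ext c d
    simp only [flipMap, tens_frame, Finset.sum_apply, Pi.smul_apply]
    rw [Finset.sum_eq_single a, Finset.sum_eq_single b, Finset.sum_eq_single c,
      Finset.sum_eq_single d]
    · simp
    · intro e _ he; simp [he]
    · simp
    · intro e _ he; simp [he]
    · simp
    · intro e _ he; simp [he.symm]
    · simp
    · intro e _ he; simp [he.symm]
    · simp

theorem IsFlipWith.eq_flipMap {S : Matrix (I × I) (I × I) ℂ} {σ : Form2 I A → Form2 I A}
    (h : IsFlipWith S σ) : σ = flipMap S := by
  ext ζ : 1
  rw [h.1.eq_sum, (isFlipWith_flipMap S).1.eq_sum]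
  simp only [h.2, (isFlipWith_flipMap S).2]

theorem flipMap_flipMap (S T : Matrix (I × I) (I × I) ℂ) (ζ : Form2 I A) :
    flipMap T (flipMap S ζ) = flipMap (S * T) ζ := by
  ext c d
  simp only [flipMap, Matrix.mul_apply, Fintype.sum_prod_type, Finset.sum_smul, Finset.smul_sum,
    smul_smul]
  rw [sum_sum_sum_sum_comm]
  simp only [mul_comm]

theorem flipMap_add (S T : Matrix (I × I) (I × I) ℂ) (ζ : Form2 I A) :
    flipMap (S + T) ζ = flipMap S ζ + flipMap T ζ := by
  ext c d
  simp [flipMap, add_smul, Finset.sum_add_distrib]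

theorem flipMap_neg (S : Matrix (I × I) (I × I) ℂ) (ζ : Form2 I A) :
    flipMap (-S) ζ = -flipMap S ζ := by
  ext c d
  simp [flipMap]

theorem flipMap_map_add (S : Matrix (I × I) (I × I) ℂ) (ζ ζ' : Form2 I A) :
    flipMap S (ζ + ζ') = flipMap S ζ + flipMap S ζ' := (isFlipWith_flipMap S).1.map_add _ _

theorem flipMap_map_neg (S : Matrix (I × I) (I × I) ℂ) (ζ : Form2 I A) :
    flipMap S (-ζ) = -flipMap S ζ := by
  ext c d
  simp [flipMap]

theorem flipMap_map_left (S : Matrix (I × I) (I × I) ℂ) (f : A) (ζ : Form2 I A) :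
    flipMap S (f • ζ) = f • flipMap S ζ := (isFlipWith_flipMap S).1.map_left _ _

theorem flipMap_map_right (S : Matrix (I × I) (I × I) ℂ) (f : A) (ζ : Form2 I A) :
    flipMap S (MulOpposite.op f • ζ) = MulOpposite.op f • flipMap S ζ :=
  (isFlipWith_flipMap S).1.map_right _ _

/-! ### Action on triple tensor products -/

/-- The action of a matrix on triples of indices. -/
def tripleMap (M : Matrix (I × I × I) (I × I × I) ℂ) (ζ : Form3 I A) : Form3 I A :=
  fun i j k => ∑ v, M (i, j, k) v • ζ v.1 v.2.1 v.2.2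

theorem tripleMap_mul (M M' : Matrix (I × I × I) (I × I × I) ℂ) (ζ : Form3 I A) :
    tripleMap (M * M') ζ = tripleMap M (tripleMap M' ζ) := by
  ext i j k
  simp only [tripleMap, Matrix.mul_apply, Finset.sum_smul, Finset.smul_sum, smul_smul]
  exact Finset.sum_comm

theorem act12_flipMap {S : Matrix (I × I) (I × I) ℂ} (hS : ∀ u v, S u v = S v u) (ζ : Form3 I A) :
    act12 (flipMap S) ζ = tripleMap (leg12 S) ζ := by
  ext i j k
  rw [tripleMap, leg12_sum S (fun v => ζ v.1 v.2.1 v.2.2)]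
  simp only [act12, flipMap, hS (_, _) (i, j)]

theorem act23_flipMap {S : Matrix (I × I) (I × I) ℂ} (hS : ∀ u v, S u v = S v u) (ζ : Form3 I A) :
    act23 (flipMap S) ζ = tripleMap (leg23 S) ζ := by
  ext i j k
  rw [tripleMap, leg23_sum S (fun v => ζ v.1 v.2.1 v.2.2)]
  simp only [act23, flipMap, hS (_, _) (j, k)]

/-- A flip acts on components by the transposed matrix; the symmetry of S allows S itself to be
written. -/
theorem contract_act_act {S : Matrix (I × I) (I × I) ℂ} (hS : ∀ u v, S u v = S v u)
    (h : Matrix I I ℂ) (ζ : Form3 I A) (p : I) :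
    contract23 (metricMap h) (act12 (flipMap S) (act23 (flipMap S) ζ)) p =
      ∑ a, ∑ c, ∑ b, (turn h S * S) (a, p) (c, b) • ζ a c b := by
  have h1 : ∀ X : Form3 I A, contract23 (metricMap h) (act12 (flipMap S) X) p =
      ∑ a, ∑ m, ∑ f, turn h S (a, p) (m, f) • X a m f := by
    intro X
    simp only [contract23, metricMap, act12, flipMap, turn, slice, Matrix.of_apply, Matrix.mul_apply,
      Finset.smul_sum, Finset.sum_smul, smul_smul]
    rw [sum_sum_sum_sum_comm]
    refine Finset.sum_congr rfl fun a _ => Finset.sum_congr rfl fun m _ => ?_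
    rw [Finset.sum_comm]
    simp only [mul_comm]
  rw [h1]
  refine Finset.sum_congr rfl fun a _ => ?_
  simp only [act23, flipMap, Matrix.mul_apply, Fintype.sum_prod_type, Finset.smul_sum,
    Finset.sum_smul, smul_smul, hS (_, _) (_, _)]
  rw [sum_sum_sum_sum_comm]
  simp only [hS (_, _) (_, _)]

theorem contract_act_act_of_compat {S : Matrix (I × I) (I × I) ℂ} (hS : ∀ u v, S u v = S v u)
    {h : Matrix I I ℂ} {κ : ℂ} (hc : Compat κ h S) (ζ : Form3 I A) (p : I) :
    contract23 (metricMap h) (act12 (flipMap S) (act23 (flipMap S) ζ)) p =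
      κ • metricMap h fun a c => ζ a c p := by
  rw [contract_act_act hS, hc, metricMap, Finset.smul_sum]
  refine Finset.sum_congr rfl fun a _ => ?_
  rw [Finset.smul_sum]
  refine Finset.sum_congr rfl fun c _ => ?_
  rw [Finset.sum_eq_single p]
  · rw [Matrix.smul_apply, fstLeg_apply, if_pos rfl, smul_smul, smul_eq_mul]
  · intro b _ hb
    rw [Matrix.smul_apply, fstLeg_apply, if_neg hb.symm, smul_zero, zero_smul]
  · simp

theorem compatibleUpTo_of_compat {S : Matrix (I × I) (I × I) ℂ} (hS : ∀ u v, S u v = S v u)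
    {h : Matrix I I ℂ} {κ : ℂ} (hc : Compat κ h S) :
    CompatibleUpTo κ (metricMap h : Form2 I A → A) (flipMap S) := by
  intro ξ η ζ
  ext p
  rw [contract_act_act_of_compat hS hc]
  simp only [metricMap, tensR, tens, Pi.smul_apply, smul_eq_mul, Finset.sum_mul, smul_mul_assoc]

theorem compat_of_compatibleUpTo [Nontrivial A] {S : Matrix (I × I) (I × I) ℂ}
    (hS : ∀ u v, S u v = S v u) {h : Matrix I I ℂ} {κ : ℂ}
    (hc : CompatibleUpTo κ (metricMap h : Form2 I A → A) (flipMap S)) : Compat κ h S := by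
  ext ⟨a, p⟩ ⟨c, b⟩
  have h1 := congrFun (hc (frame A a) (frame A c) (frame A b)) p
  rw [contract_act_act hS, metricMap_frame] at h1
  rw [Finset.sum_eq_single a, Finset.sum_eq_single c, Finset.sum_eq_single b] at h1
  · rw [Matrix.smul_apply, fstLeg_apply]
    refine FaithfulSMul.algebraMap_injective ℂ A ?_
    rw [Algebra.algebraMap_eq_smul_one]
    refine Eq.trans ?_ (h1.trans ?_)
    · simp [tensR, tens, frame]
    · by_cases hp : p = b
      · simp [hp, frame, Algebra.smul_def]
      · simp [hp, frame]
  all_goals simp +contextual [tensR, tens, frame, Pi.single_apply]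

/-! ### Covariant derivatives -/

variable (lam : I → A) (S : Matrix (I × I) (I × I) ℂ)

theorem tens_diff_add (f : A) (η : Form I A) :
    -tens (dirac lam) (f • η) = tens (diff lam f) η + f • (-tens (dirac lam) η) := by
  ext a b
  simp only [tens, dirac, diff, Pi.neg_apply, Pi.add_apply, Pi.smul_apply, smul_eq_mul]
  noncomm_ring

/-- The differential is inner, df = -[θ, f]; moving f across θ supplies the derivative term in
either Leibniz rule. -/
theorem isCovDeriv_covDeriv : IsCovDeriv lam (flipMap S) (covDeriv lam (flipMap S)) where
  map_add ξ η := by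
    have h1 : tens (dirac lam) (ξ + η) = tens (dirac lam) ξ + tens (dirac lam) η := by
      ext a b; simp [tens, mul_add]
    have h2 : tens (ξ + η) (dirac lam) = tens ξ (dirac lam) + tens η (dirac lam) := by
      ext a b; simp [tens, add_mul]
    rw [covDeriv, h1, h2, flipMap_map_add, covDeriv, covDeriv]
    abel
  left_leibniz f ξ := by
    have h1 : tens (f • ξ) (dirac lam) = f • tens ξ (dirac lam) := by
      ext a b; simp [tens, mul_assoc]
    rw [covDeriv, tens_diff_add, h1, flipMap_map_left, covDeriv, smul_add, add_assoc]
  right_leibniz f ξ := by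
    have h1 : tens (dirac lam) (MulOpposite.op f • ξ) = MulOpposite.op f • tens (dirac lam) ξ := by
      ext a b; simp [tens, mul_assoc]
    have h2 : tens (MulOpposite.op f • ξ) (dirac lam) =
        tens ξ (diff lam f) + MulOpposite.op f • tens ξ (dirac lam) := by
      ext a b
      simp only [tens, dirac, diff, Pi.add_apply, Pi.smul_apply, MulOpposite.smul_eq_mul_unop, MulOpposite.unop_op]
      noncomm_ring
    rw [covDeriv, h1, h2, flipMap_map_add, flipMap_map_right, covDeriv, smul_add, smul_neg]
    abel

/-- The extension of the covariant derivative to `Ω¹ ⊗ Ω¹`. -/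
def secondCovDeriv (ζ : Form2 I A) : Form3 I A :=
  -tensL (dirac lam) ζ + act12 (flipMap S) (act23 (flipMap S) (tensR ζ (dirac lam)))

theorem act12_add (X Y : Form3 I A) :
    act12 (flipMap S) (X + Y) = act12 (flipMap S) X + act12 (flipMap S) Y := by
  ext a b c
  simp [act12, flipMap, Finset.sum_add_distrib]

theorem act23_add (X Y : Form3 I A) :
    act23 (flipMap S) (X + Y) = act23 (flipMap S) X + act23 (flipMap S) Y := by
  ext a b c
  simp [act23, flipMap, Finset.sum_add_distrib]

theorem act12_neg (X : Form3 I A) : act12 (flipMap S) (-X) = -act12 (flipMap S) X := by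
  ext a b c
  simp [act12, flipMap]

theorem act23_neg (X : Form3 I A) : act23 (flipMap S) (-X) = -act23 (flipMap S) X := by
  ext a b c
  simp [act23, flipMap]

theorem tensR_flipMap (ζ : Form2 I A) (η : Form I A) :
    tensR (flipMap S ζ) η = act12 (flipMap S) (tensR ζ η) := by
  ext a b c
  simp [tensR, act12, flipMap, Finset.sum_mul]

theorem tensL_flipMap (ξ : Form I A) (ζ : Form2 I A) :
    tensL ξ (flipMap S ζ) = act23 (flipMap S) (tensL ξ ζ) := by
  ext a b c
  simp [tensL, act23, flipMap, Finset.mul_sum]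

theorem tensL_tens (ξ η ζ : Form I A) : tensL ξ (tens η ζ) = tensR (tens ξ η) ζ := by
  ext a b c
  simp [tensL, tensR, tens, mul_assoc]

theorem tensR_add (ζ ζ' : Form2 I A) (η : Form I A) :
    tensR (ζ + ζ') η = tensR ζ η + tensR ζ' η := by
  ext a b c
  simp [tensR, add_mul]

theorem tensL_add (ξ : Form I A) (ζ ζ' : Form2 I A) :
    tensL ξ (ζ + ζ') = tensL ξ ζ + tensL ξ ζ' := by
  ext a b c
  simp [tensL, mul_add]

theorem tensR_neg (ζ : Form2 I A) (η : Form I A) : tensR (-ζ) η = -tensR ζ η := by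
  ext a b c
  simp [tensR]

theorem tensL_neg (ξ : Form I A) (ζ : Form2 I A) : tensL ξ (-ζ) = -tensL ξ ζ := by
  ext a b c
  simp [tensL]

/-- In Dξ ⊗ η + σ₁₂(ξ ⊗ Dη) the two terms σ₁₂(ξ ⊗ θ ⊗ η) cancel, and what remains depends only on ξ
⊗ η. -/
theorem isSecondCovDeriv_secondCovDeriv :
    IsSecondCovDeriv (flipMap S) (covDeriv lam (flipMap S)) (secondCovDeriv lam S) where
  map_add u v := by
    rw [secondCovDeriv, tensL_add, tensR_add, act23_add, act12_add, secondCovDeriv, secondCovDeriv]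
    abel
  map_tens ξ η := by
    rw [secondCovDeriv, covDeriv, covDeriv, tensR_add, tensL_add, tensR_neg, tensL_neg, act12_add,
      act12_neg, tensR_flipMap, tensL_flipMap, tensL_tens, tensL_tens, tensL_tens]
    abel

theorem IsSecondCovDeriv.eq {σ : Form2 I A → Form2 I A} {D : Form I A → Form2 I A}
    {D₂ D₂' : Form2 I A → Form3 I A} (h : IsSecondCovDeriv σ D D₂) (h' : IsSecondCovDeriv σ D D₂') :
    D₂ = D₂' := by
  ext ζ : 1
  let F : Form2 I A →+ Form3 I A := AddMonoidHom.mk' D₂ h.map_add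
  let F' : Form2 I A →+ Form3 I A := AddMonoidHom.mk' D₂' h'.map_add
  have h1 : ζ = ∑ b, tens (fun a => ζ a b) (frame A b) := by
    ext a c
    simp [Finset.sum_apply, tens, frame, Pi.single_apply]
  change F ζ = F' ζ
  rw [h1, map_sum, map_sum]
  refine Finset.sum_congr rfl fun b _ => ?_
  change D₂ _ = D₂' _
  rw [h.map_tens, h'.map_tens]

/-- The covariant derivative of the metric. -/
theorem contract_secondCovDeriv (hS : ∀ u v, S u v = S v u) {h : Matrix I I ℂ} {κ : ℂ}
    (hc : Compat κ h S) (ζ : Form2 I A) :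
    contract23 (metricMap h) (secondCovDeriv lam S ζ) =
      diff lam (metricMap h ζ) + (κ - 1) • (metricMap h ζ • dirac lam) := by
  ext p
  have h1 : contract23 (metricMap h) (secondCovDeriv lam S ζ) p =
      contract23 (metricMap h) (-tensL (dirac lam) ζ) p +
        contract23 (metricMap h) (act12 (flipMap S) (act23 (flipMap S) (tensR ζ (dirac lam)))) p :=
    (isBimoduleMap_metricMap h).map_add _ _
  have h2 : contract23 (metricMap h) (-tensL (dirac lam) ζ) p = lam p * metricMap h ζ := by
    simp [contract23, metricMap, tensL, dirac, Finset.mul_sum]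
  have h3 : metricMap h (fun a c => tensR ζ (dirac lam) a c p) = metricMap h ζ * dirac lam p := by
    simp [metricMap, tensR, Finset.sum_mul]
  -- The two flips contribute κ g(ζ) θ. For κ = 1 this would complete λ g(ζ) to the commutator
  -- d(g(ζ)); the excess is the term with κ - 1.
  rw [h1, h2, contract_act_act_of_compat hS hc, h3]
  change _ = (lam p * metricMap h ζ - metricMap h ζ * lam p) + (κ - 1) • (metricMap h ζ * dirac lam p)
  rw [sub_smul, one_smul, dirac, mul_neg, smul_neg]
  abel

end Forms

end QEuclid

namespace QEuclid

variable {N : ℕ} {s : ℂ}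

/-! ## The calculus -/

section Calculus

theorem sc_add {I : Type*} [Fintype I] [DecidableEq I] {A : Type*} [Ring A] [Algebra ℂ A]
    (M M' : Matrix I I ℂ) : sc A (M + M') = sc A M + sc A M' := map_add _ _ _

theorem sc_one {I : Type*} [Fintype I] [DecidableEq I] {A : Type*} [Ring A] [Algebra ℂ A] :
    sc A (1 : Matrix I I ℂ) = 1 := map_one _

theorem sc_sub {I : Type*} [Fintype I] [DecidableEq I] {A : Type*} [Ring A] [Algebra ℂ A]
    (M M' : Matrix I I ℂ) : sc A (M - M') = sc A M - sc A M' := map_sub _ _ _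

variable {A : Type} [Ring A] [Algebra ℂ A] {ε : ℤˣ} {x l : Idx N → A} {L Li rr : A}

theorem sum_gMat_mul_gMat (hs : s ≠ 0) (a b : Idx N) :
    ∑ c, gMat N s a c * gMat N s c b = if a = b then 1 else 0 := by
  rw [← Matrix.one_apply, ← gMat_mul_gMat hs, Matrix.mul_apply]

namespace IsCalculus

variable (h : IsCalculus N s ε x l L Li rr)
include h

theorem com_Li (i a : Idx N) : com x l i a * Li = Li * com x l i a := by
  calc com x l i a * Li = Li * (L * com x l i a) * Li := by rw [← mul_assoc, h.Li_L, one_mul]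
    _ = Li * com x l i a := by rw [← h.com_L, mul_assoc, mul_assoc, h.L_Li, mul_one]

theorem com_LiLi (i a : Idx N) : com x l i a * (Li * Li) = Li * Li * com x l i a := by
  rw [← mul_assoc, h.com_Li, mul_assoc, h.com_Li, ← mul_assoc]

theorem LiLi_LL : Li * Li * (L * L) = 1 := by
  rw [mul_assoc, ← mul_assoc Li L, h.Li_L, one_mul, h.Li_L]

/-- The inverse of the matrix of the commutators. -/
theorem sum_com_dual (hs : s ≠ 0) (i j : Idx N) :
    ∑ a, com x l i a * ((Li * Li) * ∑ b, ∑ k, (gMat N s a b * gMat N s k j) • com x l k b) =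
      if i = j then 1 else 0 := by
  have h1 : ∀ a, com x l i a *
      ((Li * Li) * ∑ b, ∑ k, (gMat N s a b * gMat N s k j) • com x l k b) =
        (Li * Li) * ∑ k, ∑ b, gMat N s k j • gMat N s a b • (com x l i a * com x l k b) := by
    intro a
    rw [← mul_assoc, h.com_LiLi, mul_assoc, Finset.sum_comm]
    simp only [Finset.mul_sum, mul_smul_comm, smul_smul, mul_comm (gMat N s a _)]
  simp only [h1, ← Finset.mul_sum]
  rw [Finset.sum_comm]
  simp only [← Finset.smul_sum, h.sum_lower]
  simp only [smul_smul]
  rw [← Finset.sum_smul]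
  simp only [mul_comm (gMat N s _ j), sum_gMat_mul_gMat hs]
  rw [mul_smul_comm, h.LiLi_LL]
  split_ifs <;> simp

theorem sum_dual_com (hs : s ≠ 0) (a b : Idx N) :
    ∑ j, ((Li * Li) * ∑ c, ∑ k, (gMat N s a c * gMat N s k j) • com x l k c) * com x l j b =
      if a = b then 1 else 0 := by
  have h1 : ∀ j, ((Li * Li) * ∑ c, ∑ k, (gMat N s a c * gMat N s k j) • com x l k c) * com x l j b =
      (Li * Li) * ∑ c, ∑ k, gMat N s a c • gMat N s k j • (com x l k c * com x l j b) := by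
    intro j
    rw [mul_assoc]
    simp only [Finset.sum_mul, smul_mul_assoc, smul_smul]
  simp only [h1, ← Finset.mul_sum]
  rw [Finset.sum_comm]
  have h2 : ∀ c, ∑ j, ∑ k, gMat N s a c • gMat N s k j • (com x l k c * com x l j b) =
      (gMat N s a c * gMat N s c b) • (L * L) := by
    intro c
    rw [Finset.sum_comm]
    simp only [← Finset.smul_sum, h.sum_upper]
    rw [smul_smul]
  simp only [h2, ← Finset.sum_smul, sum_gMat_mul_gMat hs]
  rw [mul_smul_comm, h.LiLi_LL]
  split_ifs <;> simp

/-- The differentials of the coordinates are a left basis. -/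
theorem existsUnique_sum (hs : s ≠ 0) (ω : Form (Idx N) A) :
    ∃! f : Idx N → A, ω = ∑ i, f i • diff l (x i) := by
  refine ⟨fun j => ∑ a, ω a * ((Li * Li) * ∑ b, ∑ k, (gMat N s a b * gMat N s k j) • com x l k b),
    ?_, ?_⟩
  · ext b
    simp only [Finset.sum_apply, Pi.smul_apply, smul_eq_mul, Finset.sum_mul]
    rw [Finset.sum_comm]
    have h1 : ∀ a, ∑ j, ω a * ((Li * Li) * ∑ c, ∑ k, (gMat N s a c * gMat N s k j) • com x l k c) *
        diff l (x j) b = ω a * if a = b then 1 else 0 := by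
      intro a
      rw [← h.sum_dual_com hs, Finset.mul_sum]
      simp only [mul_assoc]
      rfl
    simp only [h1]
    simp
  · rintro f rfl
    ext j
    have h1 : ∀ i, ∑ a, f i * (com x l i a *
        ((Li * Li) * ∑ b, ∑ k, (gMat N s a b * gMat N s k j) • com x l k b)) =
          f i * if i = j then 1 else 0 := by
      intro i
      rw [← h.sum_com_dual hs, Finset.mul_sum]
    simp only [Finset.sum_apply, Pi.smul_apply, smul_eq_mul, Finset.sum_mul]
    rw [Finset.sum_comm]
    have h2 : ∀ i a, f i * diff l (x i) a *
        ((Li * Li) * ∑ b, ∑ k, (gMat N s a b * gMat N s k j) • com x l k b) = f i * (com x l i a *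
        ((Li * Li) * ∑ b, ∑ k, (gMat N s a b * gMat N s k j) • com x l k b)) := fun i a =>
      mul_assoc _ _ _
    simp only [h2, h1]
    simp

theorem frame_eq (hs : s ≠ 0) (a : Idx N) : frame A a =
    (Li * Li) • ∑ b, ∑ j, ∑ k, (gMat N s a b * gMat N s j k) • (com x l j b • diff l (x k)) := by
  ext c
  have h1 := h.sum_dual_com hs a c
  have h2 : frame A a c = if a = c then 1 else 0 := by
    rw [frame, Pi.single_apply]
    simp only [eq_comm]
  rw [h2, ← h1]
  have h3 : ∀ j, ((Li * Li) * ∑ b, ∑ k, (gMat N s a b * gMat N s k j) • com x l k b) *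
      com x l j c = (Li * Li) * ∑ b, ∑ k, (gMat N s a b * gMat N s k j) •
        (com x l k b * com x l j c) := by
    intro j
    rw [mul_assoc]
    simp only [Finset.sum_mul, smul_mul_assoc]
  simp only [h3, ← Finset.mul_sum]
  simp only [Pi.smul_apply, Finset.sum_apply, smul_eq_mul]
  congr 1
  rw [Finset.sum_comm]
  refine Finset.sum_congr rfl fun b _ => ?_
  rw [Finset.sum_comm]
  rfl

/-! ### Commutation of the commutators with the braid matrix -/

theorem rhatInv_com2 (hs : s ≠ 0) :
    sc A (rhatInv N s) * com2 x l = com2 x l * sc A (rhatInv N s) := by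
  calc sc A (rhatInv N s) * com2 x l =
        sc A (rhatInv N s) * (com2 x l * sc A (rhat N s)) * sc A (rhatInv N s) := by
        rw [Matrix.mul_assoc, Matrix.mul_assoc, ← map_mul, rhat_mul_rhatInv hs, map_one,
          Matrix.mul_one]
    _ = _ := by
      rw [← h.rll, ← Matrix.mul_assoc, ← map_mul, rhatInv_mul_rhat hs, map_one, Matrix.one_mul]

theorem projA_com2 (hN : 3 ≤ N) (hs : Generic s) :
    sc A (projA N s) * com2 x l = com2 x l * sc A (projA N s) := by
  obtain ⟨α, β, γ, e⟩ := exists_projA_eq hN hs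
  rw [e, sc_add, sc_add, sc_smul, sc_smul, sc_smul, sc_one]
  simp only [Matrix.add_mul, Matrix.mul_add, Matrix.smul_mul, Matrix.mul_smul, Matrix.one_mul,
    Matrix.mul_one, h.rll, h.rhatInv_com2 hs.ne_zero]

theorem qrhat_zpow_com2 (hs : s ≠ 0) (δ : ℤˣ) :
    sc A ((s ^ 2 • rhat N s) ^ (δ : ℤ)) * com2 x l =
      com2 x l * sc A ((s ^ 2 • rhat N s) ^ (δ : ℤ)) := by
  rcases Int.units_eq_one_or δ with rfl | rfl
  · rw [qrhat_zpow_one, sc_smul, Matrix.smul_mul, Matrix.mul_smul, h.rll]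
  · rw [qrhat_zpow_neg_one hs, sc_smul, Matrix.smul_mul, Matrix.mul_smul, h.rhatInv_com2 hs]

omit h in
theorem flipMap_tens {S : Matrix (Idx N × Idx N) (Idx N × Idx N) ℂ}
    (hS : sc A S * com2 x l = com2 x l * sc A S) (i j : Idx N) :
    flipMap S (tens (diff l (x i)) (diff l (x j))) =
      ∑ k, ∑ m, S (i, j) (k, m) • tens (diff l (x k)) (diff l (x m)) := by
  ext c d
  have h1 := congrFun (congrFun hS (i, j)) (c, d)
  rw [sc_mul_apply, mul_sc_apply, sum_pair, sum_pair] at h1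
  simp only [Finset.sum_apply, Pi.smul_apply]
  exact h1.symm

theorem metricMap_tens (i j : Idx N) :
    metricMap (gMat N s) (tens (diff l (x i)) (diff l (x j))) = gMat N s i j • (L * L) :=
  h.sum_lower i j

/-! ### The 2-forms -/

/-- The kernel of the antisymmetric projector consists of relations of the 2-forms. -/
theorem mem_symForms (hN : 3 ≤ N) (hs : Generic s) {ζ : Form2 (Idx N) A}
    (hζ : flipMap (projA N s) ζ = 0) :
    ζ ∈ symForms (projS N s) (projT N s) fun i => diff l (x i) := by
  have h0 := hs.ne_zero
  -- The form is expanded in the ξ^i ⊗ ξ^j one factor at a time. As P_s + P_t commutes with e e, it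
  -- acts on these products by the same matrix as on the frame.
  choose G hG _ using fun a => h.existsUnique_sum h0 (ζ a)
  choose F hF _ using fun j => h.existsUnique_sum h0 fun a => G a j
  have h1 : ζ = ∑ i, ∑ j, F j i • tens (diff l (x i)) (diff l (x j)) := by
    ext a b
    rw [hG a]
    simp only [Finset.sum_apply, Pi.smul_apply, smul_eq_mul]
    rw [Finset.sum_comm]
    refine Finset.sum_congr rfl fun j _ => ?_
    rw [congrFun (hF j) a]
    simp only [Finset.sum_apply, Pi.smul_apply, smul_eq_mul, Finset.sum_mul, tens, mul_assoc]
  have h2 : ζ = flipMap (projS N s + projT N s) ζ := by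
    have h3 : (1 : Matrix (Idx N × Idx N) (Idx N × Idx N) ℂ) = projS N s + projT N s + projA N s := by
      rw [projS]; abel
    have h4 : flipMap (1 : Matrix (Idx N × Idx N) (Idx N × Idx N) ℂ) ζ = ζ := by
      ext c d
      rw [flipMap, Finset.sum_eq_single c, Finset.sum_eq_single d]
      · simp
      · intro b _ hb; simp [hb]
      · simp
      · intro b _ hb; simp [hb]
      · simp
    rw [h3, flipMap_add, hζ, add_zero] at h4
    exact h4.symm
  have h5 : sc A (projS N s + projT N s) * com2 x l = com2 x l * sc A (projS N s + projT N s) := by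
    have h6 : projS N s + projT N s = 1 - projA N s := by rw [projS]; abel
    rw [h6, sc_sub, sc_one, Matrix.sub_mul, Matrix.mul_sub, Matrix.one_mul, Matrix.mul_one,
      h.projA_com2 hN hs]
  have h6 : flipMap (projS N s + projT N s) ζ = ∑ i, ∑ j, F j i •
      flipMap (projS N s + projT N s) (tens (diff l (x i)) (diff l (x j))) := by
    let T : Form2 (Idx N) A →ₗ[A] Form2 (Idx N) A :=
      ⟨⟨flipMap (projS N s + projT N s), flipMap_map_add _⟩, flipMap_map_left _⟩
    have h7 : T ζ = ∑ i, ∑ j, F j i • T (tens (diff l (x i)) (diff l (x j))) := by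
      conv_lhs => rw [h1]
      simp only [map_sum, map_smul]
    exact h7
  rw [h2, h6]
  refine Submodule.sum_mem _ fun i _ => Submodule.sum_mem _ fun j _ => Submodule.smul_mem _ _ ?_
  rw [flipMap_tens h5]
  simp only [Matrix.add_apply, add_smul, Finset.sum_add_distrib]
  refine Submodule.add_mem _ (Submodule.subset_span ⟨_, Or.inl rfl, i, j, 1, ?_⟩)
    (Submodule.subset_span ⟨_, Or.inr rfl, i, j, 1, ?_⟩) <;> rw [MulOpposite.op_one, one_smul]

/-- This is P_a(θ ⊗ θ) = 0, with coefficients on both sides. -/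
theorem flipMap_projA_l_l (f g : A) :
    flipMap (projA N s) (fun a b => f * (l a * l b) * g) = 0 := by
  ext c d
  have h1 := h.l_l c d
  have h2 : flipMap (projA N s) (fun a b => f * (l a * l b) * g) c d =
      f * (∑ a, ∑ b, projA N s (c, d) (a, b) • (l a * l b)) * g := by
    simp only [flipMap, Finset.mul_sum, Finset.sum_mul, mul_smul_comm, smul_mul_assoc,
      projA_symm (_, _) (c, d)]
  rw [h2, h1, mul_zero, zero_mul]
  rfl

theorem mkQ_flip_add (hN : 3 ≤ N) (hs : Generic s) (δ : ℤˣ) (ζ : Form2 (Idx N) A) :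
    (symForms (projS N s) (projT N s) fun i => diff l (x i)).mkQ
      (flipMap ((s ^ 2 • rhat N s) ^ (δ : ℤ)) ζ + ζ) = 0 := by
  rw [Submodule.mkQ_apply, Submodule.Quotient.mk_eq_zero]
  refine h.mem_symForms hN hs ?_
  rw [flipMap_map_add, flipMap_flipMap, qrhat_zpow_mul_projA hN hs, flipMap_neg, neg_add_cancel]

/-- Under P_a the flip is -1, so D(df) becomes -(θ ⊗ df + df ⊗ θ). There the terms λ f λ cancel, and
f λ λ and λ λ f are killed by P_a. -/
theorem covDeriv_diff_mem (hN : 3 ≤ N) (hs : Generic s) (δ : ℤˣ) (f : A) :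
    covDeriv l (flipMap ((s ^ 2 • rhat N s) ^ (δ : ℤ))) (diff l f) ∈
      symForms (projS N s) (projT N s) fun i => diff l (x i) := by
  refine h.mem_symForms hN hs ?_
  rw [covDeriv, flipMap_map_add, flipMap_flipMap, qrhat_zpow_mul_projA hN hs, flipMap_neg,
    flipMap_map_neg, ← neg_add, ← flipMap_map_add, neg_eq_zero]
  have h1 : tens (QEuclid.dirac l) (diff l f) + tens (diff l f) (QEuclid.dirac l) =
      (fun a b => f * (l a * l b) * 1) + -(fun a b => 1 * (l a * l b) * f) := by
    ext a b
    simp only [tens, QEuclid.dirac, diff, Pi.add_apply, Pi.neg_apply]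
    noncomm_ring
  rw [h1, flipMap_map_add, flipMap_map_neg, h.flipMap_projA_l_l, h.flipMap_projA_l_l, neg_zero,
    add_zero]

theorem isExteriorDiff (hN : 3 ≤ N) (hs : Generic s) (δ : ℤˣ) :
    IsExteriorDiff l (symForms (projS N s) (projT N s) fun i => diff l (x i)) fun ξ =>
      (symForms (projS N s) (projT N s) fun i => diff l (x i)).mkQ
        (covDeriv l (flipMap ((s ^ 2 • rhat N s) ^ (δ : ℤ))) ξ) where
  map_add ξ η := by rw [(isCovDeriv_covDeriv l _).map_add, map_add]
  leibniz f η := by rw [(isCovDeriv_covDeriv l _).left_leibniz, map_add, map_smul]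
  d_d f := by
    rw [Submodule.mkQ_apply, Submodule.Quotient.mk_eq_zero]
    exact h.covDeriv_diff_mem hN hs δ f

/-- The exact forms ξ^i are a left basis, so additivity, the Leibniz rule and d² = 0 determine d. -/
theorem exteriorDiff_eq (hs : s ≠ 0) {J : Submodule A (Form2 (Idx N) A)}
    {d d' : Form (Idx N) A → Form2 (Idx N) A ⧸ J} (hd : IsExteriorDiff l J d)
    (hd' : IsExteriorDiff l J d') : d = d' := by
  ext ξ : 1
  obtain ⟨f, rfl, -⟩ := h.existsUnique_sum hs ξ
  let F := AddMonoidHom.mk' d hd.map_add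
  let F' := AddMonoidHom.mk' d' hd'.map_add
  change F _ = F' _
  rw [map_sum, map_sum]
  refine Finset.sum_congr rfl fun i _ => ?_
  change d _ = d' _
  rw [hd.leibniz, hd'.leibniz, hd.d_d, hd'.d_d]

/-- A tensor with g = 1 would force θ = 0. Then all commutators vanish, against the orthogonality
relation with its invertible right side. -/
theorem not_forall_contract [Nontrivial A] (hN : 3 ≤ N) (hs : s ≠ 0) {κ : ℂ} (hκ : κ ≠ 1) :
    ¬ ∀ ζ : Form2 (Idx N) A, (κ - 1) • (metricMap (gMat N s) ζ • QEuclid.dirac l) = 0 := by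
  intro h1
  have htd : top N = ((N / 2 : ℕ) : ℤ) := rfl
  let t : Idx N := mkIdx (top N) (by omega) le_rfl (Or.inl (by omega))
  have h2 : ∀ a, l a = 0 := by
    intro a
    have h3 := congrFun (h1 ((s ^ twoRho N t) • tens (frame A t) (frame A (negIdx t)))) a
    have h4 : metricMap (gMat N s) ((s ^ twoRho N t) • tens (frame A t) (frame A (negIdx t))) =
        (1 : A) := by
      have h5 : metricMap (gMat N s) ((s ^ twoRho N t) • tens (frame A t) (frame A (negIdx t))) =
          (s ^ twoRho N t) • metricMap (gMat N s) (tens (frame A t) (frame A (negIdx t))) := by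
        simp only [metricMap, Pi.smul_apply, Finset.smul_sum, smul_smul, mul_comm]
      rw [h5, metricMap_frame, gMat_neg, Algebra.algebraMap_eq_smul_one, smul_smul,
        ← zpow_add₀ hs, add_neg_cancel, zpow_zero, one_smul]
    rw [h4, one_smul] at h3
    have h6 : (κ - 1) • l a = 0 := by
      have : (κ - 1) • -l a = 0 := h3
      rwa [smul_neg, neg_eq_zero] at this
    have h7 : (κ - 1) • l a = (κ - 1) • 0 := by rw [h6, smul_zero]
    exact smul_right_injective A (sub_ne_zero.2 hκ) h7
  have h8 := h.sum_lower t (negIdx t)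
  simp only [com, h2, zero_mul, mul_zero, sub_zero, smul_zero, Finset.sum_const_zero] at h8
  have h9 : L * L = 0 := by
    have h10 : gMat N s t (negIdx t) • (L * L) = gMat N s t (negIdx t) • (0 : A) := by
      rw [← h8, smul_zero]
    refine smul_right_injective A ?_ h10
    rw [gMat_neg]
    exact zpow_ne_zero _ hs
  have h10 := h.LiLi_LL
  rw [h9, mul_zero] at h10
  exact zero_ne_one h10

/-- Vanishing curvature. -/
theorem wedge12_secondCovDeriv (hN : 3 ≤ N) (hs : Generic s) (δ : ℤˣ) (ξ : Form (Idx N) A) :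
    wedge12 (symForms (projS N s) (projT N s) fun i => diff l (x i))
      (secondCovDeriv l ((s ^ 2 • rhat N s) ^ (δ : ℤ))
        (covDeriv l (flipMap ((s ^ 2 • rhat N s) ^ (δ : ℤ))) ξ)) = 0 := by
  have hbr := projA_braid hN hs δ
  have hSP := qrhat_zpow_mul_projA hN hs δ
  have hsym := qrhat_zpow_symm (N := N) hs.ne_zero δ
  set S := (s ^ 2 • rhat N s) ^ (δ : ℤ)
  set P := projA N s
  have hP : ∀ u v, P u v = P v u := projA_symm
  have key : act12 (flipMap P) (secondCovDeriv l S (covDeriv l (flipMap S) ξ)) = 0 := by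
    -- P_a kills θ ⊗ θ ⊗ ξ, and the two middle terms cancel because P_a S = -P_a. In the last term
    -- P_a passes through S₂₃ S₁₂ by the braid relation and meets θ ⊗ θ in ξ ⊗ θ ⊗ θ.
    have e1 : secondCovDeriv l S (covDeriv l (flipMap S) ξ) =
        tensR (tens (QEuclid.dirac l) (QEuclid.dirac l)) ξ
          + -act23 (flipMap S) (tensR (tens (QEuclid.dirac l) ξ) (QEuclid.dirac l))
          + -act12 (flipMap S) (act23 (flipMap S) (tensR (tens (QEuclid.dirac l) ξ) (QEuclid.dirac l)))
          + act12 (flipMap S) (act23 (flipMap S) (act12 (flipMap S)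
            (tensR (tens ξ (QEuclid.dirac l)) (QEuclid.dirac l)))) := by
      rw [secondCovDeriv, covDeriv, tensL_add, tensL_neg, tensL_flipMap, tensR_add, tensR_neg,
        tensR_flipMap, act23_add, act12_add, act23_neg, act12_neg, tensL_tens, tensL_tens]
      abel
    have e2 : ∀ X : Form3 (Idx N) A, act12 (flipMap P) (act12 (flipMap S) X) =
        -act12 (flipMap P) X := by
      intro X
      ext a b c
      change flipMap P (flipMap S fun a' b' => X a' b' c) a b = -flipMap P (fun a' b' => X a' b' c) a b
      rw [flipMap_flipMap, hSP, flipMap_neg]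
      rfl
    have e3 : act12 (flipMap P) (tensR (tens (QEuclid.dirac l) (QEuclid.dirac l)) ξ) = 0 := by
      ext a b c
      have h1 := congrFun (congrFun (h.flipMap_projA_l_l 1 (ξ c)) a) b
      refine Eq.trans ?_ h1
      simp only [act12, tensR, tens, QEuclid.dirac, neg_mul_neg, one_mul]
      rfl
    have e4 : act12 (flipMap P) (act23 (flipMap S) (act12 (flipMap S)
        (tensR (tens ξ (QEuclid.dirac l)) (QEuclid.dirac l)))) = 0 := by
      have e5 : act23 (flipMap P) (tensR (tens ξ (QEuclid.dirac l)) (QEuclid.dirac l)) = 0 := by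
        ext a b c
        have h1 := congrFun (congrFun (h.flipMap_projA_l_l (ξ a) 1) b) c
        refine Eq.trans ?_ h1
        rw [act23]
        congr 1
        ext a' b'
        simp only [tensR, tens, QEuclid.dirac, mul_neg, neg_mul, neg_neg, mul_one, mul_assoc]
      rw [act12_flipMap hP, act23_flipMap hsym, act12_flipMap hsym, ← tripleMap_mul, ← tripleMap_mul,
        mul_assoc, hbr, tripleMap_mul, ← act23_flipMap hP, e5]
      ext a b c
      simp [tripleMap]
    rw [e1, act12_add, act12_add, act12_add, act12_neg, act12_neg, e2, e2, e3, e4]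
    abel
  funext c
  change Submodule.mkQ _ _ = 0
  rw [Submodule.mkQ_apply, Submodule.Quotient.mk_eq_zero]
  refine h.mem_symForms hN hs ?_
  ext a b
  exact congrFun (congrFun (congrFun key a) b) c

end IsCalculus

end Calculus

end QEuclid

/-! ### Proof of the theorem -/

namespace QEuclid

variable {N : ℕ} {s : ℂ}

theorem metricMap_tens_frame {A : Type} [Ring A] [Algebra ℂ A] (ξ : Form (Idx N) A) (a : Idx N) :
    metricMap (gMat N s) (tens ξ (frame A (negIdx a))) = gMat N s a (negIdx a) • ξ a := by
  rw [metricMap, Finset.sum_eq_single a, Finset.sum_eq_single (negIdx a)]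
  · simp [tens, frame]
  · intro b _ hb; simp [tens, frame, hb]
  · simp
  · intro c _ hc
    rw [Finset.sum_eq_zero]
    intro b _
    by_cases hb : b = negIdx a
    · rw [gMat_apply, if_neg, zero_smul]
      rw [hb, negIdx_inj]
      exact hc.symm
    · simp [tens, frame, hb]
  · simp

theorem metricMap_frame_tens {A : Type} [Ring A] [Algebra ℂ A] (η : Form (Idx N) A) (a : Idx N) :
    metricMap (gMat N s) (tens (frame A (negIdx a)) η) = gMat N s (negIdx a) a • η a := by
  rw [metricMap, Finset.sum_eq_single (negIdx a), Finset.sum_eq_single a]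
  · simp [tens, frame]
  · intro b _ hb
    rw [gMat_apply, if_neg, zero_smul]
    rwa [negIdx_negIdx]
  · simp
  · intro c _ hc
    rw [Finset.sum_eq_zero]
    intro b _
    simp [tens, frame, hc]
  · simp

theorem projectors_symm (Cs Ct : ℂ) (u v : Idx N × Idx N) :
    (Cs • projS N s - projA N s + Ct • projT N s) u v =
      (Cs • projS N s - projA N s + Ct • projT N s) v u := by
  have h1 := projA_symm (s := s) u v
  have h2 : projT N s u v = projT N s v u := by
    rw [projT, Matrix.of_apply, Matrix.of_apply, mul_comm (gMat N s u.1 u.2)]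
  have h3 : (1 : Matrix (Idx N × Idx N) (Idx N × Idx N) ℂ) u v = (1 : Matrix _ _ ℂ) v u := by
    simp only [Matrix.one_apply, eq_comm]
  simp only [projS, Matrix.add_apply, Matrix.sub_apply, Matrix.smul_apply, h1, h2, h3]

end QEuclid

open QEuclid in
theorem mainTheorem6 (N : ℕ) (hN : 3 ≤ N) (s : ℂ) (hs₀ : s ≠ 0)
    (hs : ∀ m : ℕ, 0 < m → s ^ m ≠ 1) (ε : ℤˣ) (γ : Idx N → ℂ)
    (hγ : IsNormalization N s ε γ) :
    -- The frame bimodule is the bimodule of 1-forms of the covariant calculus labelled by `ε`.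
    (∀ i j : Idx N, xGen N s i • xi N s ε γ j =
      ∑ k, ∑ l, ((s ^ 2 • rhat N s) ^ (ε : ℤ)) (i, j) (k, l) •
        (MulOpposite.op (xGen N s l) • xi N s ε γ k)) ∧
    (∀ i : Idx N, MulOpposite.op (lamGen N s) • xi N s ε γ i = lamGen N s • xi N s ε γ i) ∧
    (∀ ω : Form (Idx N) (QAlg N s), ∃! f : Idx N → QAlg N s, ω = ∑ i, f i • xi N s ε γ i) ∧
    (∀ a : Idx N, frame (QAlg N s) a =
      (lamPow N s (-ε) * lamPow N s (-ε)) • ∑ b, ∑ j, ∑ l, (gMat N s a b * gMat N s j l) •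
        (⁅lamElt N s ε γ b, xGen N s j⁆ • xi N s ε γ l)) ∧
    -- The Dirac operator.
    (dirac (lamElt N s ε γ) =
      (((ε : ℤ) : ℂ) * omega N s ((N / 2 : ℕ) : ℤ) * s ^ ((ε : ℤ) * (N : ℤ)) * (kConst s)⁻¹) •
        ((rInvGen N s ((N / 2 : ℕ) : ℤ) * rInvGen N s ((N / 2 : ℕ) : ℤ)) •
          ∑ i, ∑ j, gMat N s i j • (xGen N s i • xi N s ε γ j))) ∧
    -- Every bilinear map on 1-forms has constant components in the frame.
    (∀ g' : Form2 (Idx N) (QAlg N s) → QAlg N s, IsBimoduleMap (QAlg N s) g' →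
      ∀ a b, ∃ c : ℂ, g' (tens (frame _ a) (frame _ b)) = algebraMap ℂ (QAlg N s) c) ∧
    -- The metric.
    ∃ g : Form2 (Idx N) (QAlg N s) → QAlg N s,
      IsMetric g ∧
      (∀ a b, g (tens (frame _ a) (frame _ b)) = algebraMap ℂ (QAlg N s) (gMat N s a b)) ∧
      (∀ g' : Form2 (Idx N) (QAlg N s) → QAlg N s, IsBimoduleMap (QAlg N s) g' →
        (∀ a b, g' (tens (frame _ a) (frame _ b)) = algebraMap ℂ (QAlg N s) (gMat N s a b)) →
        g' = g) ∧
      (∀ i j, g (tens (xi N s ε γ i) (xi N s ε γ j)) =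
        gMat N s i j • (lamPow N s ε * lamPow N s ε)) ∧
      -- The flips `C_s P_s - P_a + C_t P_t` with `C_s ≠ -1` that are compatible with the metric
      -- up to a factor are the two flips below.
      (∀ Cs Ct κ : ℂ, Cs ≠ -1 → ∀ σ : Form2 (Idx N) (QAlg N s) → Form2 (Idx N) (QAlg N s),
        IsFlipWith (Cs • projS N s - projA N s + Ct • projT N s) σ → CompatibleUpTo κ g σ →
        ∃ δ : ℤˣ, Cs • projS N s - projA N s + Ct • projT N s = (s ^ 2 • rhat N s) ^ (δ : ℤ) ∧
          κ = s ^ (4 * (δ : ℤ))) ∧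
      -- The two flips `S = (q R̂)^δ`, `δ = ± 1`, and their covariant derivatives.
      ∀ δ : ℤˣ, ∃ σ : Form2 (Idx N) (QAlg N s) → Form2 (Idx N) (QAlg N s),
        IsFlipWith ((s ^ 2 • rhat N s) ^ (δ : ℤ)) σ ∧
        ((s ^ 2 • rhat N s) ^ (δ : ℤ) = s ^ (4 * (δ : ℤ)) • projS N s - projA N s
          + s ^ ((4 - 2 * (N : ℤ)) * (δ : ℤ)) • projT N s) ∧
        (∀ ζ : Form3 (Idx N) (QAlg N s),
          act12 σ (act23 σ (act12 σ ζ)) = act23 σ (act12 σ (act23 σ ζ))) ∧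
        (∀ ζ, (rel2 N s ε γ).mkQ (σ ζ + ζ) = 0) ∧
        (∀ i j, σ (tens (xi N s ε γ i) (xi N s ε γ j)) =
          ∑ h, ∑ k, ((s ^ 2 • rhat N s) ^ (δ : ℤ)) (i, j) (h, k) •
            tens (xi N s ε γ h) (xi N s ε γ k)) ∧
        IsCovDeriv (lamElt N s ε γ) σ (covDeriv (lamElt N s ε γ) σ) ∧
        -- Vanishing torsion.
        (∃! d₁ : Form (Idx N) (QAlg N s) → Form2 (Idx N) (QAlg N s) ⧸ rel2 N s ε γ,
          IsExteriorDiff (lamElt N s ε γ) (rel2 N s ε γ) d₁) ∧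
        (∀ d₁ : Form (Idx N) (QAlg N s) → Form2 (Idx N) (QAlg N s) ⧸ rel2 N s ε γ,
          IsExteriorDiff (lamElt N s ε γ) (rel2 N s ε γ) d₁ →
          ∀ ξ, d₁ ξ - (rel2 N s ε γ).mkQ (covDeriv (lamElt N s ε γ) σ ξ) = 0) ∧
        -- Compatibility with the metric up to the factor `q^{2δ}`, and uniqueness of the metric.
        CompatibleUpTo (s ^ (4 * (δ : ℤ))) g σ ∧
        (∀ (g' : Form2 (Idx N) (QAlg N s) → QAlg N s) (κ : ℂ), IsBimoduleMap (QAlg N s) g' →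
          CompatibleUpTo κ g' σ → ∃ c : ℂ, ∀ ζ, g' ζ = c • g ζ) ∧
        -- The covariant derivative of the metric, and vanishing curvature.
        (∃! D₂ : Form2 (Idx N) (QAlg N s) → Form3 (Idx N) (QAlg N s),
          IsSecondCovDeriv σ (covDeriv (lamElt N s ε γ) σ) D₂) ∧
        ∀ D₂ : Form2 (Idx N) (QAlg N s) → Form3 (Idx N) (QAlg N s),
          IsSecondCovDeriv σ (covDeriv (lamElt N s ε γ) σ) D₂ →
          (∀ ζ, contract23 g (D₂ ζ) = diff (lamElt N s ε γ) (g ζ)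
            + (s ^ (4 * (δ : ℤ)) - 1) • (g ζ • dirac (lamElt N s ε γ))) ∧
          (¬ ∀ ζ, contract23 g (D₂ ζ) = diff (lamElt N s ε γ) (g ζ)) ∧
          (∀ ξ, wedge12 (rel2 N s ε γ) (D₂ (covDeriv (lamElt N s ε γ) σ ξ)) = 0) := by
  have hg : Generic s := ⟨hs₀, hs⟩
  have hnt := nontrivial_QAlg hN hg
  have H := isCalculus_lamElt hN hg ε hγ
  have hflip : ∀ (S : Matrix (Idx N × Idx N) (Idx N × Idx N) ℂ)
      (σ : Form2 (Idx N) (QAlg N s) → Form2 (Idx N) (QAlg N s)), IsFlipWith S σ → σ = flipMap S :=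
    fun S σ h => h.eq_flipMap
  have hcomp : ∀ g' : Form2 (Idx N) (QAlg N s) → QAlg N s, IsBimoduleMap (QAlg N s) g' →
      ∀ a b, ∃ c : ℂ, g' (tens (frame _ a) (frame _ b)) = algebraMap ℂ (QAlg N s) c :=
    fun g' hg' a b => exists_algebraMap_of_commute hN hg fun f => hg'.commute_frame a b f
  refine ⟨fun i j => ?_, fun i => ?_, H.existsUnique_sum hs₀, H.frame_eq hs₀, ?_, hcomp,
    metricMap (gMat N s), ?_, metricMap_frame _, fun g' hg' h => hg'.eq_metricMap _ h,
    H.metricMap_tens, fun Cs Ct κ hCs σ hσ hc => ?_, fun δ => ?_⟩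
  · ext a
    simp only [Finset.sum_apply, Pi.smul_apply]
    exact H.x_com i j a
  · ext a
    rcases Int.units_eq_one_or ε with rfl | rfl
    · have h := H.com_L i a
      rw [lamPow_one] at h
      exact h
    · have h := H.com_Li i a
      rw [neg_neg, lamPow_one] at h
      exact h
  · ext a
    simp only [Finset.sum_apply, Pi.smul_apply]
    exact H.dirac a
  -- Non-degeneracy is tested on the frame elements θ^{-a}, which pick out single components.
  · refine ⟨isBimoduleMap_metricMap _, fun ξ hξ => ?_, fun η hη => ?_⟩
    · ext a
      have h := hξ (frame _ (negIdx a))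
      rw [metricMap_tens_frame, gMat_neg] at h
      exact smul_right_injective _ (zpow_ne_zero _ hs₀) (h.trans (smul_zero _).symm)
    · ext a
      have h := hη (frame _ (negIdx a))
      rw [metricMap_frame_tens, gMat_neg'] at h
      exact smul_right_injective _ (zpow_ne_zero _ hs₀) (h.trans (smul_zero _).symm)
  · rw [hflip _ _ hσ] at hc
    refine eq_qrhat_zpow_of_compat hN hg hCs (compat_of_compatibleUpTo (fun u v => ?_) hc)
    exact projectors_symm Cs Ct u v
  · have hsym := qrhat_zpow_symm (N := N) hs₀ δ
    have hcpt := compat_qrhat_zpow hN hg δ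
    have hκ : s ^ (4 * (δ : ℤ)) ≠ 1 := hg.zpow_ne_one (by
      rcases Int.units_eq_one_or δ with rfl | rfl <;> decide)
    have hd := H.isExteriorDiff hN hg δ
    have hD₂ := isSecondCovDeriv_secondCovDeriv (lamElt N s ε γ) ((s ^ 2 • rhat N s) ^ (δ : ℤ))
    refine ⟨flipMap ((s ^ 2 • rhat N s) ^ (δ : ℤ)), isFlipWith_flipMap _, qrhat_zpow_eq hN hg δ,
      fun ζ => ?_, H.mkQ_flip_add hN hg δ, IsCalculus.flipMap_tens (H.qrhat_zpow_com2 hs₀ δ),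
      isCovDeriv_covDeriv _ _, ⟨_, hd, fun d₁ hd₁ => H.exteriorDiff_eq hs₀ hd₁ hd⟩,
      fun d₁ hd₁ ξ => ?_, compatibleUpTo_of_compat hsym hcpt, fun g' κ hg' hc => ?_,
      ⟨_, hD₂, fun D₂ h => h.eq hD₂⟩, fun D₂ h => ?_⟩
    · simp only [act12_flipMap hsym, act23_flipMap hsym, ← tripleMap_mul, ← mul_assoc,
        qrhat_zpow_braid hN hg]
    · rw [H.exteriorDiff_eq hs₀ hd₁ hd]
      exact sub_self _
    -- Since the center is ℂ, g' is given by a complex matrix, and the claim becomes one about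
    -- matrices.
    · choose h hh using hcomp g' hg'
      have h1 := hg'.eq_metricMap (Matrix.of h) hh
      rw [h1] at hc
      obtain ⟨c, h2⟩ := eq_smul_gMat_of_compat hN hg δ _ κ (compat_of_compatibleUpTo hsym hc)
      refine ⟨c, fun ζ => ?_⟩
      rw [h1, h2]
      simp only [metricMap, Matrix.smul_apply, Finset.smul_sum, smul_smul, smul_eq_mul]
    · rw [h.eq hD₂]
      refine ⟨fun ζ => contract_secondCovDeriv _ _ hsym hcpt ζ, fun h1 => ?_,
        H.wedge12_secondCovDeriv hN hg δ⟩
      refine H.not_forall_contract hN hs₀ hκ fun ζ => ?_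
      have h2 := contract_secondCovDeriv (lamElt N s ε γ) _ hsym hcpt ζ
      rw [h1] at h2
      exact left_eq_add.1 h2
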